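/- **Notation.** Let $p$ be a prime, $\Delta$ a finite set, $\mathbf C_p$ the completion of an algebraic closure of $\mathbf Q_p$, and $|\cdot|_p$ its absolute value, $|p|_p=p^{-1}$. Fix a compatible system $1=\zeta_0,\zeta_1,\zeta_2,\dots$ ($\zeta_{n+1}^p=\zeta_n$, $\zeta_1\ne 1$) of $p$-power roots of unity in $\mathbf C_p$. Inequalities between vectors are componentwise, and $x^{i}=\prod_{\alpha\in\Delta}x_\alpha^{i_\alpha}$ for $i\in\mathbf Z^\Delta$. *Laurent series.* $\mathcal R_\Delta$ is the union over $\rho\in(0,1)^\Delta$ of the rings of Laurent series $\sum_{i\in\mathbf Z^\Delta}a_iX^i$, $a_i\in\mathbf Q_p$, converging on $\{x\in\mathbf C_p^\Delta:\rho_\alpha<|x_\alpha|_p<1\ \forall\alpha\}$. Put $|\sum a_iX^i|_\sigma=\sup_i|a_i|_p\,\sigma^i$ for $\sigma\in(0,1)^\Delta$, and $$\mathcal O^\dagger_{\mathcal E_\Delta}=\{f\in\mathcal R_\Delta:\ \limsup_{\sigma\to 1}|f|_\sigma\le 1\}.$$ $\mathcal O_{\mathcal E_\Delta}$ is the $p$-adic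 completion of $\mathbf Z_p[[X_\alpha:\alpha\in\Delta]][1/\prod_\alpha X_\alpha]$. *One variable.* Let $\mathbf C_p^\flat$ be the tilt of $\mathbf C_p$, with valuation $v(x)=v_p(x^{(0)})$, $\tilde{\mathbf A}=W(\mathbf C_p^\flat)$, $\varepsilon=(1,\zeta_1,\zeta_2,\dots)\in\mathbf C_p^\flat$ and $u=[\varepsilon]-1$. Let $\mathbf A_{\mathbf Q_p}$ be the $p$-adic closure of $\mathbf Z_p((u))$ in $\tilde{\mathbf A}$. For $r>0$ and $x=\sum_{k\ge0}p^k[x_k]$ put $V(x,r)=\inf_k\bigl(k+\frac{p-1}{pr}v(x_k)\bigr)$, let $\tilde{\mathbf A}^{\dagger,r}=\{x: V(x,r)\ge 0,\ v(x_k)+\frac{pr}{p-1}k\to+\infty\}$, $\mathbf A^{\dagger,r}_{\mathbf Q_p}=\mathbf A_{\mathbf Q_p}\cap\tilde{\mathbf A}^{\dagger,r}$ and $\mathbf B^{\dagger,r}_{\mathbf Q_p}=\mathbf A^{\dagger,r}_{\mathbf Q_p}[1/p]$. Let $\mathbf B^{\dagger,r}_{\mathrm{rig},\mathbf Q_p}$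 be the completion of $\mathbf B^{\dagger,r}_{\mathbf Q_p}$ for the family $V(\cdot,[r,s])=\inf_{t\in[r,s]}V(\cdot,t)$, $s\ge r$. *Several variables.* For $r\in(0,\infty)^\Delta$ let $\mathbf A^{\dagger,r}_{\mathbf Q_p,\Delta}$ be the completion of $\bigotimes_{\mathbf Z_p}\mathbf A^{\dagger,r_\alpha}_{\mathbf Q_p}$ for the tensor product of the norms $p^{-V(\cdot,r_\alpha)}$, and let $\mathbf B^{\dagger,r}_{\mathrm{rig},\mathbf Q_p,\Delta}$ be the completed tensor product over $\mathbf Q_p$ of the Fréchet algebras $\mathbf B^{\dagger,r_\alpha}_{\mathrm{rig},\mathbf Q_p}$. Let $\varpi_\alpha$ be $u$ in the $\alpha$-th factor and $\varpi=\prod_\alpha\varpi_\alpha$. Put $$\mathbf A^{\dagger}_{\mathbf Q_p,\Delta}=\bigcup_{r>0}\mathbf A^{\dagger,r}_{\mathbf Q_p,\Delta}[1/\varpi],\qquad \mathbf B^\dagger_{\mathrm{rig},\mathbf Q_p,\Delta}=\bigcup_{r>0}\mathbf B^{\dagger,r}_{\mathrm{rig},\mathbf Q_p,\Delta}$$ (direct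 limits), and let $\mathbf A_{\mathbf Q_p,\Delta}$ be the $p$-adic completion of $\mathbf A^\dagger_{\mathbf Q_p,\Delta}$. **Proposition.** 1. There is a ring isomorphism $\Phi:\mathcal R_\Delta\to\mathbf B^\dagger_{\mathrm{rig},\mathbf Q_p,\Delta}$ with $\Phi(\sum_i a_iX^i)=\sum_i a_i\prod_\alpha\varpi_\alpha^{i_\alpha}$. More precisely, if all $r_\alpha>1$, then the $\varpi_\alpha$ are units of $\mathbf B^{\dagger,r}_{\mathrm{rig},\mathbf Q_p,\Delta}$, and for every $f=\sum_i a_iX^i$ converging on $\{\rho_\alpha<|x_\alpha|_p<1\ \forall\alpha\}$ with all $0<\rho_\alpha<p^{-1/r_\alpha}$ the sum converges in that ring. 2. The inclusions $\mathbf A^{\dagger,r_\alpha}_{\mathbf Q_p}\subset\mathbf B^{\dagger,r_\alpha}_{\mathrm{rig},\mathbf Q_p}$ induce continuous ring homomorphisms $\mathbf A^{\dagger,r}_{\mathbf Q_p,\Delta}\to\mathbf B^{\dagger,r}_{\mathrm{rig},\mathbf Q_p,\Delta}$, $\bigotimes x_\alpha\mapsto\bigotimes x_\alpha$, and these induce an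 injective ring homomorphism $\iota:\mathbf A^\dagger_{\mathbf Q_p,\Delta}\to\mathbf B^\dagger_{\mathrm{rig},\mathbf Q_p,\Delta}$. 3. Under the identification $\Phi$ one has $\mathcal O^\dagger_{\mathcal E_\Delta}=\mathbf A^\dagger_{\mathbf Q_p,\Delta}$, that is, $\Phi(\mathcal O^\dagger_{\mathcal E_\Delta})=\iota(\mathbf A^\dagger_{\mathbf Q_p,\Delta})$. 4. Under the same identification $\mathcal O_{\mathcal E_\Delta}=\mathbf A_{\mathbf Q_p,\Delta}$: there is a ring isomorphism $\Psi:\mathcal O_{\mathcal E_\Delta}\to\mathbf A_{\mathbf Q_p,\Delta}$ that is compatible with $\Phi$, in the sense that every $g\in\mathbf Z_p[[X_\alpha:\alpha\in\Delta]]$, viewed in $\mathcal R_\Delta$, satisfies $\Phi(g)=\iota(a)$ for some $a\in\mathbf A^\dagger_{\mathbf Q_p,\Delta}$, and $\Psi(g)$ is the image of $a$. -/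

import Mathlib

set_option linter.unusedSectionVars false

open Filter Topology

namespace MultiRobba

section LaurentSeries

variable (p : ℕ) [Fact p.Prime] (Δ : Type*) [Fintype Δ]

/-- Two-sided families of coefficients `a_i ∈ ℚ_p`, `i ∈ ℤ^Δ`: formal sums `∑ a_i X^i`. -/
abbrev Coeffs := (Δ → ℤ) → ℚ_[p]

variable {p Δ}

/-- The term `a_i x^i` of the series at a point `x ∈ ℂ_p^Δ`. -/
noncomputable def term (a : Coeffs p Δ) (x : Δ → ℂ_[p]) (i : Δ → ℤ) : ℂ_[p] :=
  algebraMap ℚ_[p] ℂ_[p] (a i) * ∏ α, x α ^ i α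

/-- `∑ a_i X^i` converges on the open polyannulus
`{x ∈ ℂ_p^Δ : ρ_α < |x_α| < 1 for all α}`. -/
def ConvergesOn (ρ : Δ → ℝ) (a : Coeffs p Δ) : Prop :=
  ∀ x : Δ → ℂ_[p], (∀ α, ρ α < ‖x α‖ ∧ ‖x α‖ < 1) → Summable (term a x)

/-- Multiplication of Laurent series: `c_n = ∑_i a_i b_{n-i}`. -/
noncomputable def conv {k : Type*} [NormedField k] (a b : (Δ → ℤ) → k) (n : Δ → ℤ) : k :=
  ∑' i, a i * b (n - i)

section Aux

variable {k : Type*} [NormedField k] [CompleteSpace k] [IsUltrametricDist k]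

lemma summable_iff_norm {ι : Type*} (f : ι → k) :
    Summable f ↔ Tendsto (fun i => ‖f i‖) cofinite (𝓝 0) := by
  rw [NonarchimedeanAddGroup.summable_iff_tendsto_cofinite_zero, tendsto_zero_iff_norm_tendsto_zero]

lemma nonarchimedeanRing : NonarchimedeanRing k where
  is_nonarchimedean := NonarchimedeanAddGroup.is_nonarchimedean

lemma conv_summable_pair {a b : (Δ → ℤ) → k} (ha : Summable a) (hb : Summable b) :
    Summable (fun q : (Δ → ℤ) × (Δ → ℤ) => a q.2 * b (q.1 - q.2)) := by
  have : NonarchimedeanRing k := nonarchimedeanRing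
  have h := ha.mul_of_nonarchimedean hb
  refine h.comp_injective (i := fun q : (Δ → ℤ) × (Δ → ℤ) => (q.2, q.1 - q.2)) ?_
  rintro ⟨n, i⟩ ⟨n', i'⟩ h
  simp only [Prod.mk.injEq] at h
  obtain ⟨rfl, h⟩ := h
  simpa using h

lemma conv_summable_fiber {a b : (Δ → ℤ) → k} (ha : Summable a) (hb : Summable b) (n : Δ → ℤ) :
    Summable (fun i => a i * b (n - i)) :=
  (conv_summable_pair ha hb).prod_factor n

lemma conv_summable {a b : (Δ → ℤ) → k} (ha : Summable a) (hb : Summable b) :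
    Summable (conv a b) := (conv_summable_pair ha hb).prod

lemma conv_comm (a b : (Δ → ℤ) → k) : conv a b = conv b a := by
  funext n
  unfold conv
  rw [← (Equiv.subLeft n).tsum_eq]
  simp [mul_comm]

lemma conv_assoc' {a b c : (Δ → ℤ) → k} (ha : Summable a) (hb : Summable b) (hc : Summable c) :
    conv (conv a b) c = conv a (conv b c) := by
  funext n
  have : NonarchimedeanRing k := nonarchimedeanRing
  have h3 := ha.mul_of_nonarchimedean (hb.mul_of_nonarchimedean hc)
  have hs : Summable (Function.uncurry fun j i : Δ → ℤ => a i * b (j - i) * c (n - j)) := by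
    have := h3.comp_injective
      (i := fun q : (Δ → ℤ) × (Δ → ℤ) => (q.2, (q.1 - q.2, n - q.1))) (by
        rintro ⟨n, i⟩ ⟨n', i'⟩ h
        simp only [Prod.mk.injEq] at h
        obtain ⟨rfl, h, -⟩ := h
        simpa using h)
    refine this.congr fun q => ?_
    simp [Function.uncurry, mul_assoc]
  calc conv (conv a b) c n = ∑' j, ∑' i, a i * b (j - i) * c (n - j) := by
        unfold conv; simp only [tsum_mul_right]
    _ = ∑' i, ∑' j, a i * b (j - i) * c (n - j) := hs.tsum_comm.symm
    _ = conv a (conv b c) n := by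
        unfold conv
        refine tsum_congr fun i => ?_
        rw [← tsum_mul_left, ← (Equiv.addRight i).tsum_eq]
        refine tsum_congr fun j => ?_
        simp [mul_assoc, sub_sub, add_comm]

end Aux

lemma summable_cast {ι : Type*} (f : ι → ℚ_[p]) :
    Summable (fun i => algebraMap ℚ_[p] ℂ_[p] (f i)) ↔ Summable f := by
  rw [summable_iff_norm, summable_iff_norm]; simp

lemma exists_norm_mem {r : ℝ} (h1 : r < 1) :
    ∃ z : ℂ_[p], r < ‖z‖ ∧ ‖z‖ < 1 := by
  have hp : (1 : ℝ) < p := by exact_mod_cast (Fact.out : p.Prime).one_lt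
  obtain ⟨n, hn⟩ := exists_pow_lt_of_lt_one (inv_pos.2 (zero_lt_one.trans hp)) h1
  have hn0 : 0 < n := by
    rcases Nat.eq_zero_or_pos n with rfl | h
    · rw [pow_zero] at hn
      exact absurd hn (not_lt.2 (inv_le_one_of_one_le₀ hp.le))
    · exact h
  obtain ⟨z, hz⟩ := IsAlgClosed.exists_pow_nat_eq (algebraMap ℚ_[p] ℂ_[p] p) hn0
  have hz' : ‖z‖ ^ n = (p : ℝ)⁻¹ := by
    rw [← norm_pow, hz, norm_algebraMap']
    exact Padic.norm_p
  refine ⟨z, ?_, ?_⟩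
  · by_contra h
    exact absurd (pow_le_pow_left₀ (norm_nonneg z) (not_lt.1 h) n) (by rw [hz']; exact not_le.2 hn)
  · by_contra h
    have := one_le_pow₀ (not_lt.1 h) (n := n)
    rw [hz'] at this
    exact absurd this (not_le.2 (inv_lt_one_of_one_lt₀ hp))

lemma exists_point {ρ : Δ → ℝ} (hρ : ∀ α, 0 < ρ α ∧ ρ α < 1) :
    ∃ x : Δ → ℂ_[p], (∀ α, ρ α < ‖x α‖ ∧ ‖x α‖ < 1) := by
  choose x hx using fun α => exists_norm_mem (p := p) (hρ α).2
  exact ⟨x, hx⟩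

lemma term_conv {a b : Coeffs p Δ} {x : Δ → ℂ_[p]} (hx : ∀ α, x α ≠ 0)
    (ha : Summable (term a x)) (hb : Summable (term b x)) :
    term (conv a b) x = conv (term a x) (term b x) := by
  funext n
  have hprod : ∀ i : Δ → ℤ, (∏ α, x α ^ i α) * ∏ α, x α ^ (n - i) α = ∏ α, x α ^ n α := by
    intro i
    rw [← Finset.prod_mul_distrib]
    refine Finset.prod_congr rfl fun α _ => ?_
    rw [← zpow_add₀ (hx α)]; simp
  have hne : (∏ α, x α ^ n α) ≠ 0 := Finset.prod_ne_zero_iff.2 fun α _ => zpow_ne_zero _ (hx α)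
  have key : ∀ i, term a x i * term b x (n - i) =
      algebraMap ℚ_[p] ℂ_[p] (a i * b (n - i)) * ∏ α, x α ^ n α := by
    intro i
    rw [← hprod i]; simp only [term, map_mul]; ring
  have hs : Summable fun i => a i * b (n - i) := by
    rw [← summable_cast]
    have := (conv_summable_fiber ha hb n).mul_right (∏ α, x α ^ n α)⁻¹
    refine this.congr fun i => ?_
    rw [key, mul_assoc, mul_inv_cancel₀ hne, mul_one]
  have hc : Continuous (algebraMap ℚ_[p] ℂ_[p]) := continuous_algebraMap _ _
  unfold conv
  simp only [key, tsum_mul_right]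
  simp only [term]
  rw [hs.map_tsum (algebraMap ℚ_[p] ℂ_[p]) hc]

lemma term_injective {a b : Coeffs p Δ} {x : Δ → ℂ_[p]} (hx : ∀ α, x α ≠ 0)
    (h : term a x = term b x) : a = b := by
  funext n
  have hne : (∏ α, x α ^ n α) ≠ 0 := Finset.prod_ne_zero_iff.2 fun α _ => zpow_ne_zero _ (hx α)
  have := congrFun h n
  exact (algebraMap ℚ_[p] ℂ_[p]).injective (mul_right_cancel₀ hne this)

lemma ConvergesOn.mono {ρ ρ' : Δ → ℝ} {a : Coeffs p Δ} (h : ConvergesOn ρ a)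
    (hρ : ∀ α, ρ α ≤ ρ' α) : ConvergesOn ρ' a :=
  fun x hx => h x fun α => ⟨(hρ α).trans_lt (hx α).1, (hx α).2⟩

lemma ConvergesOn.conv {ρ : Δ → ℝ} (hρ : ∀ α, 0 < ρ α) {a b : Coeffs p Δ}
    (ha : ConvergesOn ρ a) (hb : ConvergesOn ρ b) : ConvergesOn ρ (conv a b) := by
  intro x hx
  rw [term_conv (fun α => norm_pos_iff.1 ((hρ α).trans (hx α).1)) (ha x hx) (hb x hx)]
  exact conv_summable (ha x hx) (hb x hx)

lemma ConvergesOn.add {ρ : Δ → ℝ} {a b : Coeffs p Δ}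
    (ha : ConvergesOn ρ a) (hb : ConvergesOn ρ b) : ConvergesOn ρ (a + b) := by
  intro x hx
  refine ((ha x hx).add (hb x hx)).congr fun i => ?_
  simp [term, add_mul]

lemma ConvergesOn.neg {ρ : Δ → ℝ} {a : Coeffs p Δ}
    (ha : ConvergesOn ρ a) : ConvergesOn ρ (-a) := by
  intro x hx
  refine (ha x hx).neg.congr fun i => ?_
  simp [term]

lemma ConvergesOn.zero {ρ : Δ → ℝ} : ConvergesOn ρ (0 : Coeffs p Δ) := by
  intro x hx
  refine summable_zero.congr fun i => ?_
  simp [term]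

open Classical in
/-- The constant series `1`. -/
noncomputable def oneCoeffs : Coeffs p Δ := fun i => if i = 0 then 1 else 0

lemma ConvergesOn.one {ρ : Δ → ℝ} : ConvergesOn ρ (oneCoeffs : Coeffs p Δ) := by
  intro x hx
  refine summable_of_ne_finset_zero (s := {0}) fun i hi => ?_
  simp [term, oneCoeffs, Finset.mem_singleton.not.1 hi]

lemma one_conv (a : Coeffs p Δ) : conv oneCoeffs a = a := by
  funext n
  unfold conv
  rw [tsum_eq_single 0]
  · simp [oneCoeffs]
  · intro i hi; simp [oneCoeffs, hi]

lemma conv_add' {ρ : Δ → ℝ} (hρ : ∀ α, 0 < ρ α ∧ ρ α < 1) {a b c : Coeffs p Δ}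
    (ha : ConvergesOn ρ a) (hb : ConvergesOn ρ b) (hc : ConvergesOn ρ c) :
    conv a (b + c) = conv a b + conv a c := by
  obtain ⟨x, hx⟩ := exists_point (p := p) hρ
  have hx0 : ∀ α, x α ≠ 0 := fun α => norm_pos_iff.1 ((hρ α).1.trans (hx α).1)
  have hadd : ∀ u v : Coeffs p Δ, term (u + v) x = term u x + term v x := by
    intro u v; funext i; simp [term, add_mul]
  refine term_injective hx0 ?_
  rw [term_conv hx0 (ha x hx) (hb.add hc x hx), hadd, hadd, term_conv hx0 (ha x hx) (hb x hx),
    term_conv hx0 (ha x hx) (hc x hx)]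
  funext n
  simp only [conv, Pi.add_apply, mul_add]
  exact (conv_summable_fiber (ha x hx) (hb x hx) n).tsum_add
    (conv_summable_fiber (ha x hx) (hc x hx) n)

lemma conv_assoc {ρ : Δ → ℝ} (hρ : ∀ α, 0 < ρ α ∧ ρ α < 1) {a b c : Coeffs p Δ}
    (ha : ConvergesOn ρ a) (hb : ConvergesOn ρ b) (hc : ConvergesOn ρ c) :
    conv (conv a b) c = conv a (conv b c) := by
  obtain ⟨x, hx⟩ := exists_point (p := p) hρ
  have hx0 : ∀ α, x α ≠ 0 := fun α => norm_pos_iff.1 ((hρ α).1.trans (hx α).1)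
  have hρ' := fun α => (hρ α).1
  refine term_injective hx0 ?_
  rw [term_conv hx0 (ha.conv hρ' hb x hx) (hc x hx), term_conv hx0 (ha x hx) (hb x hx),
    term_conv hx0 (ha x hx) (hb.conv hρ' hc x hx), term_conv hx0 (hb x hx) (hc x hx)]
  exact conv_assoc' (ha x hx) (hb x hx) (hc x hx)

variable (p Δ)

/-- The multivariable Robba ring `R_Δ`: the union over `ρ ∈ (0,1)^Δ` of the rings of Laurent series
over `ℚ_p` that converge on the open polyannulus with radii `ρ` and `1`. -/
def Robba : Type _ :=
  {a : Coeffs p Δ // ∃ ρ : Δ → ℝ, (∀ α, 0 < ρ α ∧ ρ α < 1) ∧ ConvergesOn ρ a}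

variable {p Δ}

namespace Robba

/-- The coefficients of an element of the Robba ring. -/
def coeff (f : Robba p Δ) : Coeffs p Δ := f.1

lemma common (f g : Robba p Δ) : ∃ ρ : Δ → ℝ, (∀ α, 0 < ρ α ∧ ρ α < 1) ∧
    ConvergesOn ρ f.1 ∧ ConvergesOn ρ g.1 := by
  obtain ⟨ρ, h, hf⟩ := f.2
  obtain ⟨ρ', h', hg⟩ := g.2
  exact ⟨fun α => max (ρ α) (ρ' α), fun α => ⟨(h α).1.trans_le (le_max_left _ _),
    max_lt (h α).2 (h' α).2⟩, hf.mono fun α => le_max_left _ _, hg.mono fun α => le_max_right _ _⟩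

lemma common₃ (f g k : Robba p Δ) : ∃ ρ : Δ → ℝ, (∀ α, 0 < ρ α ∧ ρ α < 1) ∧
    ConvergesOn ρ f.1 ∧ ConvergesOn ρ g.1 ∧ ConvergesOn ρ k.1 := by
  obtain ⟨ρ, h, hf, hg⟩ := common f g
  obtain ⟨ρ', h', hk⟩ := k.2
  exact ⟨fun α => max (ρ α) (ρ' α), fun α => ⟨(h α).1.trans_le (le_max_left _ _),
    max_lt (h α).2 (h' α).2⟩, hf.mono fun α => le_max_left _ _, hg.mono fun α => le_max_left _ _,
    hk.mono fun α => le_max_right _ _⟩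

lemma half : ∀ _ : Δ, (0 : ℝ) < 1 / 2 ∧ (1 / 2 : ℝ) < 1 := fun _ => by norm_num

noncomputable instance : Zero (Robba p Δ) := ⟨⟨0, _, half, ConvergesOn.zero⟩⟩
noncomputable instance : One (Robba p Δ) := ⟨⟨oneCoeffs, _, half, ConvergesOn.one⟩⟩
noncomputable instance : Add (Robba p Δ) :=
  ⟨fun f g => ⟨f.1 + g.1, let ⟨ρ, h, hf, hg⟩ := common f g; ⟨ρ, h, hf.add hg⟩⟩⟩
noncomputable instance : Neg (Robba p Δ) :=
  ⟨fun f => ⟨-f.1, let ⟨ρ, h, hf⟩ := f.2; ⟨ρ, h, hf.neg⟩⟩⟩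
noncomputable instance : Mul (Robba p Δ) :=
  ⟨fun f g => ⟨conv f.1 g.1,
    let ⟨ρ, h, hf, hg⟩ := common f g; ⟨ρ, h, hf.conv (fun α => (h α).1) hg⟩⟩⟩

noncomputable instance : CommRing (Robba p Δ) where
  add_assoc f g k := Subtype.ext (add_assoc f.1 g.1 k.1)
  zero_add f := Subtype.ext (zero_add f.1)
  add_zero f := Subtype.ext (add_zero f.1)
  add_comm f g := Subtype.ext (add_comm f.1 g.1)
  neg_add_cancel f := Subtype.ext (neg_add_cancel f.1)
  mul_comm f g := Subtype.ext (conv_comm f.1 g.1)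
  one_mul f := Subtype.ext (one_conv f.1)
  mul_one f := Subtype.ext ((conv_comm f.1 oneCoeffs).trans (one_conv f.1))
  zero_mul f := Subtype.ext (by
    change conv 0 f.1 = 0
    funext n; simp [conv])
  mul_zero f := Subtype.ext (by
    change conv f.1 0 = 0
    funext n; simp [conv])
  mul_assoc f g k := by
    obtain ⟨ρ, h, hf, hg, hk⟩ := common₃ f g k
    exact Subtype.ext (conv_assoc h hf hg hk)
  left_distrib f g k := by
    obtain ⟨ρ, h, hf, hg, hk⟩ := common₃ f g k
    exact Subtype.ext (conv_add' h hf hg hk)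
  right_distrib f g k := by
    obtain ⟨ρ, h, hf, hg, hk⟩ := common₃ f g k
    refine Subtype.ext ?_
    change conv (f.1 + g.1) k.1 = conv f.1 k.1 + conv g.1 k.1
    rw [conv_comm, conv_add' h hk hf hg, conv_comm k.1, conv_comm k.1]
  nsmul := nsmulRec
  zsmul := zsmulRec

/-- `|f|_σ = sup_i |a_i|_p ∏ σ_α ^ i_α`, with values in `[0, ∞]`. -/
noncomputable def gaussNorm (f : Robba p Δ) (σ : Δ → ℝ) : ENNReal :=
  ⨆ i : Δ → ℤ, ENNReal.ofReal (‖f.coeff i‖ * ∏ α, σ α ^ i α)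

variable (p Δ) in
/-- `O_{E_Δ}^†`: the elements of the Robba ring with `limsup_{σ → 1} |f|_σ ≤ 1`, where
`σ` runs over `(0,1)^Δ`. -/
def integralBounded : Set (Robba p Δ) :=
  {f | limsup (fun σ => f.gaussNorm σ) (𝓝[{σ | ∀ α, 0 < σ α ∧ σ α < 1}] (fun _ => 1)) ≤ 1}

end Robba

end LaurentSeries

section Seminorms

/-- The ring `A` endowed with the uniform structure defined by a family of ring seminorms. -/
def WithSeminorms {A : Type*} [CommRing A] {J : Type*} (_q : J → RingSeminorm A) : Type _ := A

namespace WithSeminorms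

variable {A : Type*} [CommRing A] {J : Type*} (q : J → RingSeminorm A)

instance : CommRing (WithSeminorms q) := inferInstanceAs (CommRing A)

instance : UniformSpace (WithSeminorms q) :=
  ⨅ j, ((q j).toSeminormedRing.toPseudoMetricSpace.toUniformSpace : UniformSpace A)

instance : IsUniformAddGroup (WithSeminorms q) := by
  refine isUniformAddGroup_iInf fun j => ?_
  let := (q j).toSeminormedRing
  exact (inferInstance : IsUniformAddGroup A)

lemma topology_eq : (inferInstance : TopologicalSpace (WithSeminorms q)) =
    ⨅ j, ((q j).toSeminormedRing.toPseudoMetricSpace.toUniformSpace.toTopologicalSpace :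
      TopologicalSpace A) :=
  UniformSpace.toTopologicalSpace_iInf

instance : IsTopologicalRing (WithSeminorms q) := by
  have hmul : @ContinuousMul A (⨅ j,
      ((q j).toSeminormedRing.toPseudoMetricSpace.toUniformSpace.toTopologicalSpace :
      TopologicalSpace A)) _ := by
    refine continuousMul_iInf fun j => ?_
    let := (q j).toSeminormedRing
    exact (inferInstance : ContinuousMul A)
  rw [← topology_eq q] at hmul
  have h1 : ContinuousMul (WithSeminorms q) := hmul
  exact { continuous_mul := h1.continuous_mul
          continuous_add := continuous_add
          continuous_neg := continuous_neg }

/-- The underlying element of `A`. -/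
def toRing : WithSeminorms q → A := id

lemma continuous_seminorm (j : J) : UniformContinuous fun a : WithSeminorms q => q j a := by
  have : @UniformContinuous A ℝ ((q j).toSeminormedRing.toPseudoMetricSpace.toUniformSpace) _
      (q j) := by
    let := (q j).toSeminormedRing
    exact uniformContinuous_norm
  exact Filter.Tendsto.mono_left this (iInf_le (fun j =>
    ((q j).toSeminormedRing.toPseudoMetricSpace.toUniformSpace : UniformSpace A)) j)

/-- A ring homomorphism is continuous as soon as every seminorm of the target is bounded by a
continuous function of some seminorm of the source. -/
lemma continuous_of_bound {B : Type*} [CommRing B] {I : Type*} (q' : I → RingSeminorm B)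
    (φ : A →+* B) (h : ∀ i, ∃ j, ∃ β : ℝ, 0 < β ∧ ∀ a, q' i (φ a) ≤ (q j a) ^ β) :
    Continuous (X := WithSeminorms q) (Y := WithSeminorms q') φ := by
  let ψ : WithSeminorms q →+ WithSeminorms q' := φ.toAddMonoidHom
  have key : ContinuousAt ψ 0 := by
    rw [ContinuousAt, map_zero]
    have ht : (𝓝 (0 : WithSeminorms q')) = ⨅ i, @nhds B
        ((q' i).toSeminormedRing.toPseudoMetricSpace.toUniformSpace.toTopologicalSpace) 0 := by
      rw [← nhds_iInf, ← topology_eq q']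
      rfl
    rw [ht]
    refine tendsto_iInf.2 ?_
    intro i
    obtain ⟨j, β, hβ, hb⟩ := h i
    let := (q' i).toSeminormedRing
    change Tendsto (β := B) ψ (𝓝 0) (𝓝 (0 : B))
    refine tendsto_zero_iff_norm_tendsto_zero.2 ?_
    have hq : Tendsto (fun a : WithSeminorms q => (q j a) ^ β) (𝓝 0) (𝓝 0) := by
      have h1 := ((continuous_seminorm q j).continuous.tendsto 0).rpow_const
        (p := β) (Or.inr hβ.le)
      have h2 : q j (0 : A) = 0 := map_zero _
      change Tendsto _ _ (𝓝 ((q j (0 : A)) ^ β)) at h1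
      rwa [h2, Real.zero_rpow hβ.ne'] at h1
    exact squeeze_zero (fun a => norm_nonneg (E := B) _) (fun a => hb a) hq
  exact continuous_of_continuousAt_zero ψ key

end WithSeminorms

variable {A : Type*} [CommRing A] {J : Type*}

/-- The (Hausdorff) completion of `A` for a family of ring seminorms. -/
abbrev Hat (q : J → RingSeminorm A) : Type _ := UniformSpace.Completion (WithSeminorms q)

namespace Hat

variable (q : J → RingSeminorm A)

/-- The canonical map from a ring to its completion. -/
noncomputable def of : A →+* Hat q :=
  (UniformSpace.Completion.coeRingHom : WithSeminorms q →+* Hat q)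

noncomputable instance {K : Type*} [CommRing K] [Algebra K A] : Algebra K (Hat q) :=
  ((of q).comp (algebraMap K A)).toAlgebra

/-- The extension by continuity of the seminorms to the completion. -/
noncomputable def seminorm (j : J) : RingSeminorm (Hat q) where
  toFun := UniformSpace.Completion.extension fun a : WithSeminorms q => q j a
  map_zero' := by
    rw [← UniformSpace.Completion.coe_zero,
      UniformSpace.Completion.extension_coe (WithSeminorms.continuous_seminorm q j)]
    exact map_zero (q j)
  add_le' x y := by
    have hc : Continuous (UniformSpace.Completion.extension fun a : WithSeminorms q => q j a) :=
      UniformSpace.Completion.continuous_extension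
    induction x, y using UniformSpace.Completion.induction_on₂ with
    | hp => exact isClosed_le (by fun_prop) (by fun_prop)
    | ih a b =>
      rw [← UniformSpace.Completion.coe_add]
      simp only [UniformSpace.Completion.extension_coe (WithSeminorms.continuous_seminorm q j)]
      exact map_add_le_add (q j) a b
  neg' x := by
    have hc : Continuous (UniformSpace.Completion.extension fun a : WithSeminorms q => q j a) :=
      UniformSpace.Completion.continuous_extension
    induction x using UniformSpace.Completion.induction_on with
    | hp => exact isClosed_eq (by fun_prop) (by fun_prop)
    | ih a =>
      rw [← UniformSpace.Completion.coe_neg]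
      simp only [UniformSpace.Completion.extension_coe (WithSeminorms.continuous_seminorm q j)]
      exact map_neg_eq_map (q j) a
  mul_le' x y := by
    have hc : Continuous (UniformSpace.Completion.extension fun a : WithSeminorms q => q j a) :=
      UniformSpace.Completion.continuous_extension
    induction x, y using UniformSpace.Completion.induction_on₂ with
    | hp => exact isClosed_le (by fun_prop) (by fun_prop)
    | ih a b =>
      rw [← UniformSpace.Completion.coe_mul]
      simp only [UniformSpace.Completion.extension_coe (WithSeminorms.continuous_seminorm q j)]
      exact map_mul_le_mul (q j) a b

lemma seminorm_of (j : J) (a : A) : seminorm q j (of q a) = q j a :=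
  UniformSpace.Completion.extension_coe (WithSeminorms.continuous_seminorm q j) a

lemma continuous_seminorm (j : J) : Continuous (seminorm q j) :=
  UniformSpace.Completion.continuous_extension

lemma denseRange_of : DenseRange (of q) :=
  UniformSpace.Completion.denseRange_coe (α := WithSeminorms q)

variable {B : Type*} [CommRing B] {I : Type*} {q} {q' : I → RingSeminorm B}

/-- The map induced on completions by a continuous ring homomorphism. -/
noncomputable def map (φ : A →+* B)
    (h : ∀ i, ∃ j, ∃ β : ℝ, 0 < β ∧ ∀ a, q' i (φ a) ≤ (q j a) ^ β) : Hat q →+* Hat q' :=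
  UniformSpace.Completion.mapRingHom (α := WithSeminorms q) (β := WithSeminorms q') φ
    (WithSeminorms.continuous_of_bound q q' φ h)

lemma continuous_map (φ : A →+* B)
    (h : ∀ i, ∃ j, ∃ β : ℝ, 0 < β ∧ ∀ a, q' i (φ a) ≤ (q j a) ^ β) :
    Continuous (map (q := q) (q' := q') φ h) :=
  UniformSpace.Completion.continuous_map

lemma map_of (φ : A →+* B)
    (h : ∀ i, ∃ j, ∃ β : ℝ, 0 < β ∧ ∀ a, q' i (φ a) ≤ (q j a) ^ β) (a : A) :
    map (q := q) (q' := q') φ h (of q a) = of q' (φ a) :=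
  UniformSpace.Completion.mapRingHom_coe (α := WithSeminorms q) (β := WithSeminorms q')
    (WithSeminorms.continuous_of_bound q q' φ h) a

lemma seminorm_map_le (φ : A →+* B)
    (h : ∀ i, ∃ j, ∃ β : ℝ, 0 < β ∧ ∀ a, q' i (φ a) ≤ (q j a) ^ β) (i : I) (j : J)
    (hij : ∀ a, q' i (φ a) ≤ q j a) (x : Hat q) :
    seminorm q' i (map (q := q) φ h x) ≤ seminorm q j x := by
  refine (denseRange_of q).induction_on x
    (isClosed_le ((continuous_seminorm q' i).comp (continuous_map φ h))
      (continuous_seminorm q j)) fun a => ?_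
  rw [map_of, seminorm_of, seminorm_of]
  exact hij a

end Hat

end Seminorms

section Tensor

open scoped TensorProduct

variable {K : Type*} [NormedCommRing K] {Δ : Type*} [Fintype Δ]
  {A : Δ → Type*} [∀ α, CommRing (A α)] [∀ α, Algebra K (A α)]

/-- The subgroup of all finite sums `∑ c_n • (⨂ x_{n,α})` with
`|c_n| ∏ q_α (x_{n,α}) ≤ r` for all `n`. -/
def tensorBall (q : ∀ α, RingSeminorm (A α)) (r : ℝ) : AddSubgroup (⨂[K] α, A α) :=
  AddSubgroup.closure {t | ∃ (c : K) (x : ∀ α, A α),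
    t = c • PiTensorProduct.tprod K x ∧ ‖c‖ * ∏ α, q α (x α) ≤ r}

lemma tensorBall_mono (q : ∀ α, RingSeminorm (A α)) {r s : ℝ} (h : r ≤ s) :
    tensorBall (K := K) q r ≤ tensorBall q s :=
  AddSubgroup.closure_mono fun _ ⟨c, x, ht, hc⟩ => ⟨c, x, ht, hc.trans h⟩

lemma exists_mem_tensorBall (q : ∀ α, RingSeminorm (A α)) (t : ⨂[K] α, A α) :
    ∃ r, 0 ≤ r ∧ t ∈ tensorBall q r := by
  induction t using PiTensorProduct.induction_on with
  | smul_tprod c x =>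
    exact ⟨‖c‖ * ∏ α, q α (x α), mul_nonneg (norm_nonneg _)
      (Finset.prod_nonneg fun α _ => apply_nonneg _ _),
      AddSubgroup.subset_closure ⟨c, x, rfl, le_rfl⟩⟩
  | add x y hx hy =>
    obtain ⟨r, hr, hx⟩ := hx
    obtain ⟨s, _, hy⟩ := hy
    exact ⟨max r s, hr.trans (le_max_left _ _), add_mem
      (tensorBall_mono q (le_max_left _ _) hx) (tensorBall_mono q (le_max_right _ _) hy)⟩

lemma mul_mem_tensorBall (q : ∀ α, RingSeminorm (A α)) {r s : ℝ} (hr : 0 ≤ r)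
    {t u : ⨂[K] α, A α} (ht : t ∈ tensorBall q r) (hu : u ∈ tensorBall q s) :
    t * u ∈ tensorBall q (r * s) := by
  induction ht using AddSubgroup.closure_induction with
  | zero => rw [zero_mul]; exact zero_mem _
  | add x y _ _ hx hy => rw [add_mul]; exact add_mem hx hy
  | neg x _ hx => rw [neg_mul]; exact neg_mem hx
  | mem x hx =>
    obtain ⟨c, x, rfl, hc⟩ := hx
    induction hu using AddSubgroup.closure_induction with
    | zero => rw [mul_zero]; exact zero_mem _
    | add x y _ _ hx hy => rw [mul_add]; exact add_mem hx hy
    | neg x _ hx => rw [mul_neg]; exact neg_mem hx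
    | mem y hy =>
      obtain ⟨d, y, rfl, hd⟩ := hy
      refine AddSubgroup.subset_closure ⟨c * d, x * y, ?_, ?_⟩
      · rw [PiTensorProduct.smul_tprod_mul_smul_tprod]
      · have h0 : ∀ z : ∀ α, A α, 0 ≤ ∏ α, q α (z α) := fun z =>
          Finset.prod_nonneg fun α _ => apply_nonneg _ _
        calc ‖c * d‖ * ∏ α, q α ((x * y) α)
            ≤ (‖c‖ * ‖d‖) * ∏ α, (q α (x α) * q α (y α)) := by
              refine mul_le_mul (norm_mul_le c d) ?_ (h0 _)
                (mul_nonneg (norm_nonneg _) (norm_nonneg _))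
              exact Finset.prod_le_prod (fun α _ => apply_nonneg _ _)
                fun α _ => map_mul_le_mul (q α) _ _
          _ = (‖c‖ * ∏ α, q α (x α)) * (‖d‖ * ∏ α, q α (y α)) := by
              rw [Finset.prod_mul_distrib]; ring
          _ ≤ r * s := mul_le_mul hc hd (mul_nonneg (norm_nonneg _) (h0 _)) hr

/-- The tensor product seminorm: the infimum, over all ways of writing
`t = ∑ c_n • (⨂ x_{n,α})`, of `max_n |c_n| ∏ q_α (x_{n,α})`. -/
noncomputable def tensorSeminorm (q : ∀ α, RingSeminorm (A α)) : RingSeminorm (⨂[K] α, A α) where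
  toFun t := sInf {r | 0 ≤ r ∧ t ∈ tensorBall q r}
  map_zero' := le_antisymm (csInf_le ⟨0, fun _ h => h.1⟩ ⟨le_rfl, zero_mem _⟩)
    (Real.sInf_nonneg fun _ h => h.1)
  add_le' t u := by
    refine le_of_forall_pos_lt_add fun ε hε => ?_
    set a := sInf {r | 0 ≤ r ∧ t ∈ tensorBall q r} with ha
    set b := sInf {r | 0 ≤ r ∧ u ∈ tensorBall q r} with hb
    obtain ⟨r, ⟨hr, ht⟩, hr'⟩ := exists_lt_of_csInf_lt (exists_mem_tensorBall q t)
      (lt_add_of_pos_right a (half_pos hε))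
    obtain ⟨s, ⟨hs, hu⟩, hs'⟩ := exists_lt_of_csInf_lt (exists_mem_tensorBall q u)
      (lt_add_of_pos_right b (half_pos hε))
    have : sInf {r | 0 ≤ r ∧ t + u ∈ tensorBall q r} ≤ r + s :=
      csInf_le ⟨0, fun _ h => h.1⟩ ⟨add_nonneg hr hs, add_mem
        (tensorBall_mono q (le_add_of_nonneg_right hs) ht)
        (tensorBall_mono q (le_add_of_nonneg_left hr) hu)⟩
    refine this.trans_lt ?_
    linarith
  neg' t := by simp only [neg_mem_iff]
  mul_le' t u := by
    have hbd : ∀ t : ⨂[K] α, A α, BddBelow {r | 0 ≤ r ∧ t ∈ tensorBall q r} :=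
      fun t => ⟨0, fun _ h => h.1⟩
    have h0 : ∀ t : ⨂[K] α, A α, 0 ≤ sInf {r | 0 ≤ r ∧ t ∈ tensorBall q r} :=
      fun t => Real.sInf_nonneg fun _ h => h.1
    refine le_of_forall_pos_le_add fun ε hε => ?_
    set a := sInf {r | 0 ≤ r ∧ t ∈ tensorBall q r} with ha
    set b := sInf {r | 0 ≤ r ∧ u ∈ tensorBall q r} with hb
    have hlim : Tendsto (fun δ : ℝ => (a + δ) * (b + δ)) (𝓝[>] 0) (𝓝 ((a + 0) * (b + 0))) :=
      (Continuous.tendsto (by fun_prop) 0).mono_left nhdsWithin_le_nhds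
    rw [add_zero, add_zero] at hlim
    have hle : sInf {r | 0 ≤ r ∧ t * u ∈ tensorBall q r} ≤ a * b := by
      refine ge_of_tendsto hlim ?_
      filter_upwards [self_mem_nhdsWithin] with δ hδ
      obtain ⟨r, ⟨hr, ht⟩, hr'⟩ := exists_lt_of_csInf_lt (exists_mem_tensorBall q t)
        (lt_add_of_pos_right a hδ)
      obtain ⟨s, ⟨hs, hu⟩, hs'⟩ := exists_lt_of_csInf_lt (exists_mem_tensorBall q u)
        (lt_add_of_pos_right b hδ)
      refine (csInf_le (hbd _) ⟨mul_nonneg hr hs, mul_mem_tensorBall q hr ht hu⟩).trans ?_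
      exact mul_le_mul hr'.le hs'.le hs (hr.trans hr'.le)
    linarith

variable {B : Δ → Type*} [∀ α, CommRing (B α)] [∀ α, Algebra K (B α)]

/-- The tensor product of a family of algebra homomorphisms. -/
noncomputable def tensorMap (φ : ∀ α, A α →ₐ[K] B α) : (⨂[K] α, A α) →ₐ[K] ⨂[K] α, B α :=
  PiTensorProduct.liftAlgHom
    ((PiTensorProduct.tprod K).compLinearMap fun α => (φ α).toLinearMap)
    (by
      rw [PiTensorProduct.one_def]
      simp only [MultilinearMap.compLinearMap_apply]
      congr 1
      funext α
      simp)
    (fun x y => by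
      simp only [MultilinearMap.compLinearMap_apply]
      rw [PiTensorProduct.tprod_mul_tprod]
      congr 1
      funext α
      simp)

lemma tensorMap_tprod (φ : ∀ α, A α →ₐ[K] B α) (x : ∀ α, A α) :
    tensorMap φ (PiTensorProduct.tprod K x) = PiTensorProduct.tprod K fun α => φ α (x α) := by
  simp [tensorMap]

lemma tensorSeminorm_map_le {q : ∀ α, RingSeminorm (A α)} {q' : ∀ α, RingSeminorm (B α)}
    (φ : ∀ α, A α →ₐ[K] B α) {β : ℝ} (hβ : 0 < β)
    (h : ∀ (c : K) (x : ∀ α, A α), ‖c‖ * ∏ α, q' α (φ α (x α)) ≤ (‖c‖ * ∏ α, q α (x α)) ^ β)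
    (t : ⨂[K] α, A α) :
    tensorSeminorm (K := K) q' (tensorMap φ t) ≤ (tensorSeminorm (K := K) q t) ^ β := by
  have h0 : ∀ (c : K) (x : ∀ α, A α), 0 ≤ ‖c‖ * ∏ α, q α (x α) := fun c x =>
    mul_nonneg (norm_nonneg _) (Finset.prod_nonneg fun α _ => apply_nonneg _ _)
  have hmem : ∀ r, 0 ≤ r → t ∈ tensorBall q r → tensorMap φ t ∈ tensorBall q' (r ^ β) := by
    intro r hr ht
    induction ht using AddSubgroup.closure_induction with
    | zero => rw [map_zero]; exact zero_mem _
    | add x y _ _ hx hy => rw [map_add]; exact add_mem hx hy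
    | neg x _ hx => rw [map_neg]; exact neg_mem hx
    | mem x hx =>
      obtain ⟨c, x, rfl, hc⟩ := hx
      refine AddSubgroup.subset_closure ⟨c, fun α => φ α (x α), ?_, ?_⟩
      · rw [map_smul, tensorMap_tprod]
      · exact (h c x).trans (Real.rpow_le_rpow (h0 c x) hc hβ.le)
  change sInf {r | 0 ≤ r ∧ tensorMap φ t ∈ tensorBall q' r} ≤
    (sInf {r | 0 ≤ r ∧ t ∈ tensorBall q r}) ^ β
  set a := sInf {r | 0 ≤ r ∧ t ∈ tensorBall q r} with ha
  have ha0 : 0 ≤ a := Real.sInf_nonneg fun _ h => h.1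
  have hlim : Tendsto (fun δ : ℝ => (a + δ) ^ β) (𝓝[>] 0) (𝓝 ((a + 0) ^ β)) := by
    have : Tendsto (fun δ : ℝ => a + δ) (𝓝[>] 0) (𝓝 (a + 0)) :=
      (Continuous.tendsto (by fun_prop) 0).mono_left nhdsWithin_le_nhds
    exact this.rpow_const (Or.inr hβ.le)
  rw [add_zero] at hlim
  refine ge_of_tendsto hlim ?_
  filter_upwards [self_mem_nhdsWithin] with δ hδ
  obtain ⟨r, ⟨hr, ht⟩, hr'⟩ := exists_lt_of_csInf_lt (exists_mem_tensorBall q t)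
    (lt_add_of_pos_right a hδ)
  have hle : sInf {r | 0 ≤ r ∧ tensorMap φ t ∈ tensorBall q' r} ≤ r ^ β :=
    csInf_le ⟨0, fun _ h => h.1⟩ ⟨Real.rpow_nonneg hr _, hmem r hr ht⟩
  exact hle.trans (Real.rpow_le_rpow hr hr'.le hβ.le)

end Tensor

section Witt

open WittVector

variable {p : ℕ} [hp : Fact p.Prime] {k : Type*} [Field k] [CharP k p] [PerfectRing k p]

/-- The coefficients `x_j` in the Teichmüller expansion `x = ∑ p^j [x_j]`. -/
noncomputable def teichCoeff (x : WittVector p k) (j : ℕ) : k :=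
  ((frobeniusEquiv k p).symm ^ j) (x.coeff j)

lemma teichCoeff_pow (x : WittVector p k) (j : ℕ) : teichCoeff x j ^ p ^ j = x.coeff j := by
  have h : ∀ (j : ℕ) (a : k), (((frobeniusEquiv k p).symm ^ j) a) ^ p ^ j = a := by
    intro j
    induction j with
    | zero => intro a; simp
    | succ j ih =>
      intro a
      rw [pow_succ' (frobeniusEquiv k p).symm, pow_succ, pow_mul]
      rw [RingAut.mul_apply, ← map_pow, ih]
      exact frobeniusEquiv_symm_pow_p k p a
  exact h j _

lemma teichCoeff_eq_iff {x : WittVector p k} {j : ℕ} {a : k} :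
    teichCoeff x j = a ↔ x.coeff j = a ^ p ^ j := by
  rw [← teichCoeff_pow]
  constructor
  · rintro rfl; rfl
  · intro h
    have := iterateFrobenius_inj k p j (a₁ := teichCoeff x j) (a₂ := a)
    simp only [iterateFrobenius_def] at this
    exact this h

lemma coeff_eq_of_dvd {x y : WittVector p k} {n : ℕ} (h : (p : WittVector p k) ^ n ∣ x - y)
    {j : ℕ} (hj : j < n) : x.coeff j = y.coeff j := by
  rw [← Ideal.mem_span_singleton, mem_span_p_pow_iff_le_coeff_eq_zero,
      ← le_coeff_eq_iff_le_sub_coeff_eq_zero] at h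
  exact h j hj

lemma dvd_of_coeff_eq {x y : WittVector p k} {n : ℕ} (h : ∀ j < n, x.coeff j = y.coeff j) :
    (p : WittVector p k) ^ n ∣ x - y := by
  rw [← Ideal.mem_span_singleton, mem_span_p_pow_iff_le_coeff_eq_zero,
      ← le_coeff_eq_iff_le_sub_coeff_eq_zero]
  exact h

lemma teichCoeff_eq_of_dvd {x y : WittVector p k} {n : ℕ} (h : (p : WittVector p k) ^ n ∣ x - y)
    {j : ℕ} (hj : j < n) : teichCoeff x j = teichCoeff y j := by
  simp only [teichCoeff, coeff_eq_of_dvd h hj]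

lemma dvd_teichSum (x : WittVector p k) (n : ℕ) : (p : WittVector p k) ^ (n + 1) ∣
    x - ∑ i ∈ Finset.Iic n, teichmuller p (teichCoeff x i) * p ^ i :=
  dvd_sub_sum_teichmuller_iterateFrobeniusEquiv_coeff x n

lemma teichCoeff_single (a : k) (i j : ℕ) :
    teichCoeff (teichmuller p a * (p : WittVector p k) ^ i) j = if j = i then a else 0 := by
  rw [teichCoeff_eq_iff]
  split_ifs with h
  · subst h; exact teichmuller_mul_pow_coeff _ _
  · rw [zero_pow (pow_pos hp.out.pos _).ne']; exact teichmuller_mul_pow_coeff_of_ne _ h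

lemma teichCoeff_sum (a : ℕ → k) {n j : ℕ} (hj : j ≤ n) :
    teichCoeff (∑ i ∈ Finset.Iic n, teichmuller p (a i) * (p : WittVector p k) ^ i) j = a j := by
  rw [teichCoeff_eq_iff, sum_coeff_eq_coeff_sum]
  · rw [Finset.sum_eq_single j]
    · exact teichmuller_mul_pow_coeff _ _
    · intro b _ hb
      exact teichmuller_mul_pow_coeff_of_ne _ hb.symm
    · intro h; exact absurd (Finset.mem_Iic.2 hj) h
  · refine fun n ↦ ⟨fun ⟨b, _, hb⟩ ⟨c, _, hc⟩ ↦ Subtype.ext ?_⟩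
    change b = c
    rw [← Not.imp_symm (teichmuller_mul_pow_coeff_of_ne _) hb]
    exact Not.imp_symm (teichmuller_mul_pow_coeff_of_ne _) hc

lemma teichCoeff_teichmuller_mul (c : k) (x : WittVector p k) (j : ℕ) :
    teichCoeff (teichmuller p c * x) j = c * teichCoeff x j := by
  have h := (dvd_teichSum x j).mul_left (teichmuller p c)
  rw [mul_sub, Finset.mul_sum] at h
  simp only [← mul_assoc, ← map_mul] at h
  rw [teichCoeff_eq_of_dvd h (Nat.lt_succ_self j)]
  exact teichCoeff_sum (fun i => c * teichCoeff x i) le_rfl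

lemma teichCoeff_zero (j : ℕ) : teichCoeff (0 : WittVector p k) j = 0 := by
  simp [teichCoeff]

lemma teichCoeff_mul_p_zero (x : WittVector p k) : teichCoeff (x * (p : WittVector p k)) 0 = 0 := by
  simp [teichCoeff, mul_charP_coeff_zero]

lemma teichCoeff_mul_p_succ (x : WittVector p k) (j : ℕ) :
    teichCoeff (x * (p : WittVector p k)) (j + 1) = teichCoeff x j := by
  rw [teichCoeff_eq_iff, mul_charP_coeff_succ, pow_succ, pow_mul, teichCoeff_pow]

variable (v : Valuation k NNReal)

lemma val_teichCoeff_le_one {x : WittVector p k} {j : ℕ} :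
    v (teichCoeff x j) ≤ 1 ↔ v (x.coeff j) ≤ 1 := by
  rw [← teichCoeff_pow, map_pow]
  exact (pow_le_one_iff_of_nonneg (zero_le) (pow_pos hp.out.pos j).ne').symm

/-- A Witt vector with integral coefficients up to `n` comes from the valuation ring modulo
`p^(n+1)`. -/
lemma exists_integer {x : WittVector p k} {n : ℕ} (h : ∀ j ≤ n, v (x.coeff j) ≤ 1) :
    ∃ y : WittVector p v.integer,
      (p : WittVector p k) ^ (n + 1) ∣ x - WittVector.map v.integer.subtype y := by
  classical
  refine ⟨WittVector.mk p fun j => if hj : j ≤ n then ⟨x.coeff j, h j hj⟩ else 0, ?_⟩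
  refine dvd_of_coeff_eq fun j hj => ?_
  rw [WittVector.map_coeff]
  simp [Nat.lt_succ_iff.1 hj]

lemma val_map_integer (y : WittVector p v.integer) (j : ℕ) :
    v ((WittVector.map v.integer.subtype y).coeff j) ≤ 1 := by
  rw [WittVector.map_coeff]
  exact (y.coeff j).2

variable (p) in
/-- The group of all `x = ∑ p^j [x_j]` with `|x_j| ≤ B` for `j ≤ n`. -/
def bounded (B : NNReal) (n : ℕ) : AddSubgroup (WittVector p k) :=
  have key : ∀ x y : WittVector p k, (∀ j ≤ n, v (teichCoeff x j) ≤ B) →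
      (∀ j ≤ n, v (teichCoeff y j) ≤ B) → ∀ j ≤ n, v (teichCoeff (x - y) j) ≤ B := by
    intro x y hx hy
    classical
    obtain ⟨w, hwB, hwx, hwy⟩ : ∃ w : k, v w ≤ B ∧ (∀ j ≤ n, v (teichCoeff x j) ≤ v w) ∧
        (∀ j ≤ n, v (teichCoeff y j) ≤ v w) := by
      let S : Finset k := (Finset.Iic n).image (teichCoeff x) ∪ (Finset.Iic n).image (teichCoeff y)
      have hS : S.Nonempty := ⟨teichCoeff x 0, Finset.mem_union_left _
        (Finset.mem_image_of_mem _ (Finset.mem_Iic.2 (Nat.zero_le n)))⟩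
      obtain ⟨w, hw, hmax⟩ := S.exists_max_image v hS
      refine ⟨w, ?_, fun j hj => hmax _ (Finset.mem_union_left _
        (Finset.mem_image_of_mem _ (Finset.mem_Iic.2 hj))), fun j hj => hmax _
        (Finset.mem_union_right _ (Finset.mem_image_of_mem _ (Finset.mem_Iic.2 hj)))⟩
      rcases Finset.mem_union.1 hw with h | h
      · obtain ⟨j, hj, rfl⟩ := Finset.mem_image.1 h
        exact hx j (Finset.mem_Iic.1 hj)
      · obtain ⟨j, hj, rfl⟩ := Finset.mem_image.1 h
        exact hy j (Finset.mem_Iic.1 hj)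
    intro j hj
    refine le_trans ?_ hwB
    rcases eq_or_ne w 0 with rfl | hw
    · have hx0 : (p : WittVector p k) ^ (n + 1) ∣ x - 0 := dvd_of_coeff_eq fun i hi => by
        have : teichCoeff x i = 0 := by simpa using hwx i (Nat.lt_succ_iff.1 hi)
        rw [teichCoeff_eq_iff.1 this, zero_pow (pow_pos hp.out.pos i).ne', zero_coeff]
      have hy0 : (p : WittVector p k) ^ (n + 1) ∣ y - 0 := dvd_of_coeff_eq fun i hi => by
        have : teichCoeff y i = 0 := by simpa using hwy i (Nat.lt_succ_iff.1 hi)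
        rw [teichCoeff_eq_iff.1 this, zero_pow (pow_pos hp.out.pos i).ne', zero_coeff]
      have := dvd_sub hx0 hy0
      rw [sub_zero, sub_zero, ← sub_zero (x - y)] at this
      rw [teichCoeff_eq_of_dvd this (Nat.lt_succ_iff.2 hj), teichCoeff_zero]
    · have hv : v w ≠ 0 := (Valuation.ne_zero_iff v).2 hw
      have int : ∀ z : WittVector p k, (∀ j ≤ n, v (teichCoeff z j) ≤ v w) →
          ∀ j ≤ n, v ((teichmuller p w⁻¹ * z).coeff j) ≤ 1 := by
        intro z hz j hj
        rw [← val_teichCoeff_le_one, teichCoeff_teichmuller_mul, map_mul, map_inv₀]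
        rw [inv_mul_le_iff₀ (pos_iff_ne_zero.2 hv), mul_one]
        exact hz j hj
      obtain ⟨x', hx'⟩ := exists_integer v (int x hwx)
      obtain ⟨y', hy'⟩ := exists_integer v (int y hwy)
      have h := dvd_sub hx' hy'
      rw [sub_sub_sub_comm, ← map_sub, ← mul_sub] at h
      have h1 : v (teichCoeff (teichmuller p w⁻¹ * (x - y)) j) ≤ 1 := by
        rw [val_teichCoeff_le_one, coeff_eq_of_dvd h (Nat.lt_succ_iff.2 hj)]
        exact val_map_integer v _ j
      rw [teichCoeff_teichmuller_mul, map_mul, map_inv₀,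
        inv_mul_le_iff₀ (pos_iff_ne_zero.2 hv), mul_one] at h1
      exact h1
  have h0 : ∀ j ≤ n, v (teichCoeff (0 : WittVector p k) j) ≤ B := fun j _ => by
    rw [teichCoeff_zero, map_zero]; exact zero_le
  { carrier := {x | ∀ j ≤ n, v (teichCoeff x j) ≤ B}
    zero_mem' := h0
    neg_mem' := fun {x} hx => by
      have := key 0 x h0 hx
      rwa [zero_sub] at this
    add_mem' := fun {x y} hx hy => by
      have hn := key 0 y h0 hy
      rw [zero_sub] at hn
      have := key x (-y) hx hn
      rwa [sub_neg_eq_add] at this }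

lemma mem_bounded {B : NNReal} {n : ℕ} {x : WittVector p k} :
    x ∈ bounded p v B n ↔ ∀ j ≤ n, v (teichCoeff x j) ≤ B := Iff.rfl

lemma val_teichCoeff_add (x y : WittVector p k) (m : ℕ) : ∃ i l, i + l = m ∧
    v (teichCoeff (x + y) m) ≤ max (v (teichCoeff x i)) (v (teichCoeff y i)) := by
  obtain ⟨i, hi, hmax⟩ := (Finset.Iic m).exists_max_image
    (fun i => max (v (teichCoeff x i)) (v (teichCoeff y i))) ⟨0, Finset.mem_Iic.2 (Nat.zero_le m)⟩
  refine ⟨i, m - i, Nat.add_sub_cancel' (Finset.mem_Iic.1 hi), ?_⟩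
  have hx : x ∈ bounded p v (max (v (teichCoeff x i)) (v (teichCoeff y i))) m := fun j hj =>
    (le_max_left _ _).trans (hmax j (Finset.mem_Iic.2 hj))
  have hy : y ∈ bounded p v (max (v (teichCoeff x i)) (v (teichCoeff y i))) m := fun j hj =>
    (le_max_right _ _).trans (hmax j (Finset.mem_Iic.2 hj))
  exact add_mem hx hy m le_rfl

lemma val_teichCoeff_neg (x : WittVector p k) (m : ℕ) : ∃ i l, i + l = m ∧
    v (teichCoeff (-x) m) ≤ v (teichCoeff x i) := by
  obtain ⟨i, hi, hmax⟩ := (Finset.Iic m).exists_max_image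
    (fun i => v (teichCoeff x i)) ⟨0, Finset.mem_Iic.2 (Nat.zero_le m)⟩
  refine ⟨i, m - i, Nat.add_sub_cancel' (Finset.mem_Iic.1 hi), ?_⟩
  have hx : x ∈ bounded p v (v (teichCoeff x i)) m := fun j hj => hmax j (Finset.mem_Iic.2 hj)
  exact neg_mem hx m le_rfl

lemma val_teichCoeff_mul (x y : WittVector p k) (m : ℕ) : ∃ i j l, i + j + l = m ∧
    v (teichCoeff (x * y) m) ≤ v (teichCoeff x i) * v (teichCoeff y j) := by
  classical
  let S : Finset (ℕ × ℕ) := (Finset.Iic m ×ˢ Finset.Iic m).filter fun q => q.1 + q.2 ≤ m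
  obtain ⟨⟨i, j⟩, hij, hmax⟩ := S.exists_max_image
    (fun q => v (teichCoeff x q.1) * v (teichCoeff y q.2)) ⟨(0, 0), by simp [S]⟩
  have hij' : i + j ≤ m := (Finset.mem_filter.1 hij).2
  refine ⟨i, j, m - (i + j), Nat.add_sub_cancel' hij', ?_⟩
  set B := v (teichCoeff x i) * v (teichCoeff y j) with hB
  have hmem : ∀ q ∈ Finset.Iic m ×ˢ Finset.Iic m,
      teichmuller p (teichCoeff x q.1) * (p : WittVector p k) ^ q.1 *
        (teichmuller p (teichCoeff y q.2) * (p : WittVector p k) ^ q.2) ∈ bounded p v B m := by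
    intro q hq
    rw [mul_mul_mul_comm, ← map_mul, ← pow_add]
    intro l hl
    rw [teichCoeff_single]
    split_ifs with h
    · rw [map_mul]
      exact hmax q (Finset.mem_filter.2 ⟨hq, h ▸ hl⟩)
    · rw [map_zero]; exact zero_le
  have hsum := sum_mem hmem
  rw [Finset.sum_product] at hsum
  dsimp only at hsum
  rw [← Finset.sum_mul_sum] at hsum
  have hd : (p : WittVector p k) ^ (m + 1) ∣ x * y -
      (∑ i ∈ Finset.Iic m, teichmuller p (teichCoeff x i) * (p : WittVector p k) ^ i) *
      (∑ i ∈ Finset.Iic m, teichmuller p (teichCoeff y i) * (p : WittVector p k) ^ i) := by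
    have := dvd_add ((dvd_teichSum y m).mul_left x) ((dvd_teichSum x m).mul_right
      (∑ i ∈ Finset.Iic m, teichmuller p (teichCoeff y i) * (p : WittVector p k) ^ i))
    rwa [mul_sub, sub_mul, sub_add_sub_cancel] at this
  rw [teichCoeff_eq_of_dvd hd (Nat.lt_succ_self m)]
  exact hsum m le_rfl

end Witt

section Overconvergent

open WittVector

variable {p : ℕ} [hp : Fact p.Prime]

/-- `W(R)` is an algebra over `ℤ_p = W(𝔽_p)` for every ring `R` of characteristic `p`. -/
noncomputable instance {R : Type*} [CommRing R] [CharP R p] : Algebra ℤ_[p] (WittVector p R) :=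
  ((WittVector.map (ZMod.castHom dvd_rfl R)).comp
    (WittVector.equiv p).symm.toRingHom).toAlgebra

lemma coeff_algebraMap {R : Type*} [CommRing R] [CharP R p] (c : ℤ_[p]) (j : ℕ) :
    ∃ a : ZMod p, (algebraMap ℤ_[p] (WittVector p R) c).coeff j = ZMod.castHom dvd_rfl R a :=
  ⟨_, WittVector.map_coeff _ _ _⟩

variable {k : Type*} [Field k] [CharP k p] [PerfectRing k p] (v : Valuation k NNReal)

/-- The positive real numbers. -/
abbrev Pos : Type := Set.Ioi (0 : ℝ)

/-- `p^(-j) |x_j|^((p-1)/(p t))` for `x = ∑ p^j [x_j]`. -/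
noncomputable def wittTerm (t : ℝ) (x : WittVector p k) (j : ℕ) : ℝ :=
  ((p : ℝ)⁻¹) ^ j * (v (teichCoeff x j) : ℝ) ^ (((p : ℝ) - 1) / (p * t))

/-- `|x|_t = p^(-V(x,t))`, where `V(x,t) = inf_j (j + (p-1)/(p t) · v(x_j))` for
`x = ∑ p^j [x_j]`. -/
noncomputable def wittNorm (t : ℝ) (x : WittVector p k) : ℝ := ⨆ j, wittTerm v t x j

variable (p) in
lemma p_pos : (0 : ℝ) < p := by exact_mod_cast hp.out.pos

variable (p) in
lemma one_lt_p : (1 : ℝ) < p := by exact_mod_cast hp.out.one_lt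

lemma exponent_pos (t : Pos) : 0 < ((p : ℝ) - 1) / (p * t.1) :=
  div_pos (sub_pos.2 (one_lt_p p)) (mul_pos (p_pos p) t.2)

lemma wittTerm_nonneg (t : ℝ) (x : WittVector p k) (j : ℕ) : 0 ≤ wittTerm v t x j :=
  mul_nonneg (pow_nonneg (inv_nonneg.2 (p_pos p).le) _) (Real.rpow_nonneg NNReal.zero_le_coe _)

lemma wittNorm_nonneg (t : ℝ) (x : WittVector p k) : 0 ≤ wittNorm v t x :=
  Real.iSup_nonneg fun j => wittTerm_nonneg v t x j

lemma wittTerm_le_of_le (t : Pos) {x y : WittVector p k} {m i l : ℕ} (h : i + l = m)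
    (hv : v (teichCoeff y m) ≤ v (teichCoeff x i)) :
    wittTerm v t y m ≤ ((p : ℝ)⁻¹) ^ l * wittTerm v t x i := by
  unfold wittTerm
  rw [← mul_assoc, ← pow_add, add_comm l i, h]
  exact mul_le_mul_of_nonneg_left (Real.rpow_le_rpow NNReal.zero_le_coe hv (exponent_pos t).le)
    (pow_nonneg (inv_nonneg.2 (p_pos p).le) _)

lemma wittTerm_add (t : Pos) (x y : WittVector p k) (m : ℕ) : ∃ i l, i + l = m ∧
    wittTerm v t (x + y) m ≤ ((p : ℝ)⁻¹) ^ l * max (wittTerm v t x i) (wittTerm v t y i) := by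
  obtain ⟨i, l, h, hv⟩ := val_teichCoeff_add v x y m
  refine ⟨i, l, h, ?_⟩
  have h0 : (0 : ℝ) ≤ ((p : ℝ)⁻¹) ^ l := pow_nonneg (inv_nonneg.2 (p_pos p).le) _
  rcases le_max_iff.1 hv with hv | hv
  · exact (wittTerm_le_of_le v t h hv).trans (mul_le_mul_of_nonneg_left (le_max_left _ _) h0)
  · exact (wittTerm_le_of_le v t h hv).trans (mul_le_mul_of_nonneg_left (le_max_right _ _) h0)

lemma wittTerm_neg (t : Pos) (x : WittVector p k) (m : ℕ) : ∃ i l, i + l = m ∧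
    wittTerm v t (-x) m ≤ ((p : ℝ)⁻¹) ^ l * wittTerm v t x i := by
  obtain ⟨i, l, h, hv⟩ := val_teichCoeff_neg v x m
  exact ⟨i, l, h, wittTerm_le_of_le v t h hv⟩

lemma wittTerm_mul (t : Pos) (x y : WittVector p k) (m : ℕ) : ∃ i j l, i + j + l = m ∧
    wittTerm v t (x * y) m ≤ ((p : ℝ)⁻¹) ^ l * (wittTerm v t x i * wittTerm v t y j) := by
  obtain ⟨i, j, l, h, hv⟩ := val_teichCoeff_mul v x y m
  refine ⟨i, j, l, h, ?_⟩
  have h1 := mul_le_mul_of_nonneg_left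
    (Real.rpow_le_rpow NNReal.zero_le_coe (NNReal.coe_le_coe.2 hv) (exponent_pos (p := p) t).le)
    (pow_nonneg (inv_nonneg.2 (p_pos p).le) m)
  refine h1.trans_eq ?_
  unfold wittTerm
  rw [NNReal.coe_mul, Real.mul_rpow NNReal.zero_le_coe NNReal.zero_le_coe, ← h, pow_add, pow_add]
  ring

lemma wittTerm_integral (t : Pos) {x : WittVector p k} (hx : ∀ j, v (x.coeff j) ≤ 1) (j : ℕ) :
    wittTerm v t x j ≤ ((p : ℝ)⁻¹) ^ j := by
  unfold wittTerm
  refine mul_le_of_le_one_right (pow_nonneg (inv_nonneg.2 (p_pos p).le) _) ?_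
  exact Real.rpow_le_one NNReal.zero_le_coe
    (by exact_mod_cast (val_teichCoeff_le_one v).2 (hx j)) (exponent_pos t).le

lemma inv_pow_le_one (l : ℕ) : ((p : ℝ)⁻¹) ^ l ≤ 1 :=
  pow_le_one₀ (inv_nonneg.2 (p_pos p).le) (inv_le_one_of_one_le₀ (one_lt_p p).le)

variable (p) in
lemma tendsto_inv_pow : Tendsto (fun l : ℕ => ((p : ℝ)⁻¹) ^ l) atTop (𝓝 0) :=
  tendsto_pow_atTop_nhds_zero_of_lt_one (inv_nonneg.2 (p_pos p).le)
    (inv_lt_one_of_one_lt₀ (one_lt_p p))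

/-- The condition defining `Ã^{†,r}`: `V(x,r) ≥ 0` and the terms tend to `0`. -/
def IsOverconvergent (r : ℝ) (x : WittVector p k) : Prop :=
  (∀ j, wittTerm v r x j ≤ 1) ∧ Tendsto (wittTerm v r x) atTop (𝓝 0)

lemma isOverconvergent_integral (r : Pos) {x : WittVector p k} (hx : ∀ j, v (x.coeff j) ≤ 1) :
    IsOverconvergent v r x :=
  ⟨fun j => (wittTerm_integral v r hx j).trans (inv_pow_le_one j),
    squeeze_zero (fun j => wittTerm_nonneg v r x j) (wittTerm_integral v r hx) (tendsto_inv_pow p)⟩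

lemma val_cast_le_one (a : ZMod p) : v (ZMod.castHom dvd_rfl k a) ≤ 1 := by
  have : NeZero p := ⟨hp.out.ne_zero⟩
  rw [← ZMod.natCast_zmod_val a, map_natCast]
  induction a.val with
  | zero => simp
  | succ n ih =>
    rw [Nat.cast_succ]
    exact (v.map_add _ _).trans (max_le ih (by simp))

lemma isOverconvergent_algebraMap (r : Pos) (c : ℤ_[p]) :
    IsOverconvergent v r (algebraMap ℤ_[p] (WittVector p k) c) :=
  isOverconvergent_integral v r fun j => by
    obtain ⟨a, ha⟩ := coeff_algebraMap (R := k) c j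
    rw [ha]; exact val_cast_le_one v a

variable (p) in
/-- `Ã^{†,r}`, the ring of all `x = ∑ p^j [x_j]` in `W(k)` with
`V(x,r) ≥ 0` and `v(x_j) + p r/(p-1) · j → ∞`. -/
noncomputable def Atilde (r : Pos) : Subalgebra ℤ_[p] (WittVector p k) where
  carrier := {x | IsOverconvergent v r x}
  algebraMap_mem' := isOverconvergent_algebraMap v r
  add_mem' {x y} hx hy := by
    refine ⟨fun m => ?_, ?_⟩
    · obtain ⟨i, l, -, h⟩ := wittTerm_add v r x y m
      exact h.trans (mul_le_one₀ (inv_pow_le_one l) (le_max_of_le_left (wittTerm_nonneg v r x i))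
        (max_le (hx.1 i) (hy.1 i)))
    · rw [Metric.tendsto_atTop]
      intro ε hε
      have h1 := hx.2.eventually_lt_const hε
      have h2 := hy.2.eventually_lt_const hε
      have h3 := (tendsto_inv_pow p).eventually_lt_const hε
      obtain ⟨N, hN⟩ := eventually_atTop.1 (h1.and (h2.and h3))
      refine ⟨2 * N, fun m hm => ?_⟩
      rw [Real.dist_eq, sub_zero, abs_of_nonneg (wittTerm_nonneg v r _ m)]
      obtain ⟨i, l, hil, h⟩ := wittTerm_add v r x y m
      refine h.trans_lt ?_
      rcases lt_or_ge i N with hi | hi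
      · exact (mul_le_of_le_one_right (pow_nonneg (inv_nonneg.2 (p_pos p).le) l)
          (max_le (hx.1 i) (hy.1 i))).trans_lt (hN l (by omega)).2.2
      · exact (mul_le_of_le_one_left (le_max_of_le_left (wittTerm_nonneg v r x i))
          (inv_pow_le_one l)).trans_lt (max_lt (hN i hi).1 (hN i hi).2.1)
  mul_mem' {x y} hx hy := by
    refine ⟨fun m => ?_, ?_⟩
    · obtain ⟨i, j, l, -, h⟩ := wittTerm_mul v r x y m
      have h0 := mul_nonneg (wittTerm_nonneg v r x i) (wittTerm_nonneg v r y j)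
      exact h.trans (mul_le_one₀ (inv_pow_le_one l) h0
        (mul_le_one₀ (hx.1 i) (wittTerm_nonneg v r y j) (hy.1 j)))
    · rw [Metric.tendsto_atTop]
      intro ε hε
      have h1 := hx.2.eventually_lt_const hε
      have h2 := hy.2.eventually_lt_const hε
      have h3 := (tendsto_inv_pow p).eventually_lt_const hε
      obtain ⟨N, hN⟩ := eventually_atTop.1 (h1.and (h2.and h3))
      refine ⟨3 * N, fun m hm => ?_⟩
      rw [Real.dist_eq, sub_zero, abs_of_nonneg (wittTerm_nonneg v r _ m)]
      obtain ⟨i, j, l, hil, h⟩ := wittTerm_mul v r x y m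
      refine h.trans_lt ?_
      have h0 := mul_nonneg (wittTerm_nonneg v r x i) (wittTerm_nonneg v r y j)
      rcases lt_or_ge i N with hi | hi
      · rcases lt_or_ge j N with hj | hj
        · exact (mul_le_of_le_one_right (pow_nonneg (inv_nonneg.2 (p_pos p).le) l)
            (mul_le_one₀ (hx.1 i) (wittTerm_nonneg v r y j) (hy.1 j))).trans_lt
            (hN l (by omega)).2.2
        · exact (mul_le_of_le_one_left h0 (inv_pow_le_one l)).trans_lt
            ((mul_le_of_le_one_left (wittTerm_nonneg v r y j) (hx.1 i)).trans_lt (hN j hj).2.1)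
      · exact (mul_le_of_le_one_left h0 (inv_pow_le_one l)).trans_lt
          ((mul_le_of_le_one_right (wittTerm_nonneg v r x i) (hy.1 j)).trans_lt (hN i hi).1)

lemma wittTerm_le_rpow {r s : Pos} (h : r ≤ s) (x : WittVector p k) (j : ℕ) :
    wittTerm v s x j ≤ (wittTerm v r x j) ^ (r.1 / s.1) := by
  have hr : 0 < r.1 := r.2
  have hs : 0 < s.1 := s.2
  have hle : r.1 / s.1 ≤ 1 := (div_le_one hs).2 h
  have hp0 := p_pos p
  have hq : (0 : ℝ) < ((p : ℝ)⁻¹) ^ j := pow_pos (inv_pos.2 hp0) _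
  unfold wittTerm
  rw [Real.mul_rpow hq.le (Real.rpow_nonneg NNReal.zero_le_coe _),
    ← Real.rpow_mul NNReal.zero_le_coe]
  have he : ((p : ℝ) - 1) / (p * r.1) * (r.1 / s.1) = ((p : ℝ) - 1) / (p * s.1) := by
    field_simp
  rw [he]
  refine mul_le_mul_of_nonneg_right ?_ (Real.rpow_nonneg NNReal.zero_le_coe _)
  have := Real.rpow_le_rpow_of_exponent_ge hq (inv_pow_le_one (p := p) j) hle
  rwa [Real.rpow_one] at this

lemma Atilde_mono {r s : Pos} (h : r ≤ s) : Atilde p v r ≤ Atilde p v s := by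
  intro x hx
  have h0 : 0 < r.1 / s.1 := div_pos r.2 s.2
  refine ⟨fun j => (wittTerm_le_rpow v h x j).trans
    (Real.rpow_le_one (wittTerm_nonneg v r x j) (hx.1 j) h0.le), ?_⟩
  refine squeeze_zero (fun j => wittTerm_nonneg v s x j) (wittTerm_le_rpow v h x) ?_
  have := hx.2.rpow_const (p := r.1 / s.1) (Or.inr h0.le)
  rwa [Real.zero_rpow h0.ne'] at this

lemma bddAbove_wittTerm {r : Pos} {x : WittVector p k} (hx : x ∈ Atilde p v r) :
    BddAbove (Set.range (wittTerm v r x)) :=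
  ⟨1, by rintro _ ⟨j, rfl⟩; exact hx.1 j⟩

lemma wittTerm_le_wittNorm {r : Pos} {x : WittVector p k} (hx : x ∈ Atilde p v r) (j : ℕ) :
    wittTerm v r x j ≤ wittNorm v r x := le_ciSup (bddAbove_wittTerm v hx) j

lemma wittNorm_le_one {r : Pos} {x : WittVector p k} (hx : x ∈ Atilde p v r) :
    wittNorm v r x ≤ 1 := ciSup_le hx.1

lemma wittNorm_mono {r s : Pos} (h : r ≤ s) {x : WittVector p k} (hx : x ∈ Atilde p v r) :
    wittNorm v s x ≤ wittNorm v r x ^ (r.1 / s.1) :=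
  ciSup_le fun j => (wittTerm_le_rpow v h x j).trans (Real.rpow_le_rpow (wittTerm_nonneg v r x j)
    (wittTerm_le_wittNorm v hx j) (div_pos r.2 s.2).le)

lemma wittNorm_neg_le {r : Pos} {x : WittVector p k} (hx : x ∈ Atilde p v r) :
    wittNorm v r (-x) ≤ wittNorm v r x := ciSup_le fun m => by
  obtain ⟨i, l, -, h⟩ := wittTerm_neg v r x m
  exact h.trans ((mul_le_of_le_one_left (wittTerm_nonneg v r x i) (inv_pow_le_one l)).trans
    (wittTerm_le_wittNorm v hx i))

lemma wittNorm_zero (t : Pos) : wittNorm v t (0 : WittVector p k) = 0 := by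
  have : ∀ j, wittTerm v t (0 : WittVector p k) j = 0 := fun j => by
    simp only [wittTerm, teichCoeff_zero, map_zero, NNReal.coe_zero,
      Real.zero_rpow (exponent_pos (p := p) t).ne', mul_zero]
  simp [wittNorm, this]

lemma wittNorm_add_le {r : Pos} {x y : WittVector p k} (hx : x ∈ Atilde p v r)
    (hy : y ∈ Atilde p v r) : wittNorm v r (x + y) ≤ max (wittNorm v r x) (wittNorm v r y) :=
  ciSup_le fun m => by
    obtain ⟨i, l, -, h⟩ := wittTerm_add v r x y m
    exact h.trans ((mul_le_of_le_one_left (le_max_of_le_left (wittTerm_nonneg v r x i))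
      (inv_pow_le_one l)).trans
      (max_le_max (wittTerm_le_wittNorm v hx i) (wittTerm_le_wittNorm v hy i)))

lemma wittNorm_mul_le {r : Pos} {x y : WittVector p k} (hx : x ∈ Atilde p v r)
    (hy : y ∈ Atilde p v r) : wittNorm v r (x * y) ≤ wittNorm v r x * wittNorm v r y :=
  ciSup_le fun m => by
    obtain ⟨i, j, l, -, h⟩ := wittTerm_mul v r x y m
    have h0 := mul_nonneg (wittTerm_nonneg v r x i) (wittTerm_nonneg v r y j)
    exact h.trans ((mul_le_of_le_one_left h0 (inv_pow_le_one l)).trans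
      (mul_le_mul (wittTerm_le_wittNorm v hx i) (wittTerm_le_wittNorm v hy j)
      (wittTerm_nonneg v r y j) (wittNorm_nonneg v r x)))

lemma wittTerm_mul_p (t : Pos) (x : WittVector p k) (j : ℕ) :
    wittTerm v t (x * (p : WittVector p k)) (j + 1) = (p : ℝ)⁻¹ * wittTerm v t x j := by
  simp only [wittTerm, teichCoeff_mul_p_succ]
  ring

lemma wittNorm_mul_p (t : Pos) (x : WittVector p k) :
    wittNorm v t (x * (p : WittVector p k)) = (p : ℝ)⁻¹ * wittNorm v t x := by
  have hp0 : (0 : ℝ) ≤ (p : ℝ)⁻¹ := inv_nonneg.2 (p_pos p).le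
  have h0 : wittTerm v t (x * (p : WittVector p k)) 0 = 0 := by
    simp only [wittTerm, teichCoeff_mul_p_zero, map_zero, NNReal.coe_zero,
      Real.zero_rpow (exponent_pos (p := p) t).ne', mul_zero]
  unfold wittNorm
  rw [Real.mul_iSup_of_nonneg hp0]
  by_cases hb : BddAbove (Set.range fun j => (p : ℝ)⁻¹ * wittTerm v t x j)
  · apply le_antisymm
    · refine ciSup_le fun j => ?_
      cases j with
      | zero => rw [h0]; exact Real.iSup_nonneg fun j => mul_nonneg hp0 (wittTerm_nonneg v t x j)
      | succ j => rw [wittTerm_mul_p]; exact le_ciSup hb j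
    · refine ciSup_le fun j => ?_
      rw [← wittTerm_mul_p]
      refine le_ciSup (f := wittTerm v t (x * (p : WittVector p k))) ?_ (j + 1)
      obtain ⟨M, hM⟩ := hb
      refine ⟨max M 0, ?_⟩
      rintro _ ⟨j, rfl⟩
      cases j with
      | zero => rw [h0]; exact le_max_right _ _
      | succ j => rw [wittTerm_mul_p]; exact (hM ⟨j, rfl⟩).trans (le_max_left _ _)
  · rw [Real.iSup_of_not_bddAbove hb, Real.iSup_of_not_bddAbove]
    rintro ⟨M, hM⟩
    refine hb ⟨M, ?_⟩
    rintro _ ⟨j, rfl⟩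
    dsimp only
    rw [← wittTerm_mul_p]
    exact hM ⟨j + 1, rfl⟩

/-- The seminorm `|x|_r` on a ring that maps to `Ã^{†,r}`. -/
noncomputable def overconvergentNorm {A : Type*} [CommRing A] (r : Pos)
    (φ : A →+* WittVector p k) (h : ∀ a, φ a ∈ Atilde p v r) : RingSeminorm A where
  toFun a := wittNorm v r (φ a)
  map_zero' := by rw [map_zero, wittNorm_zero]
  add_le' a b := by
    rw [map_add]
    exact (wittNorm_add_le v (h a) (h b)).trans
      (max_le_add_of_nonneg (wittNorm_nonneg v r _) (wittNorm_nonneg v r _))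
  neg' a := by
    rw [map_neg]
    refine le_antisymm (wittNorm_neg_le v (h a)) ?_
    have := wittNorm_neg_le v (neg_mem (h a))
    rwa [neg_neg] at this
  mul_le' a b := by
    rw [map_mul]
    exact wittNorm_mul_le v (h a) (h b)

end Overconvergent

section Tilt

open WittVector

variable (p : ℕ) [hp : Fact p.Prime]

instance : Fact (¬ IsUnit ((p : ℕ) : 𝓞_ℂ_[p])) := ⟨fun h => by
  have h1 := (PadicComplexInt.integers p).one_of_isUnit h
  rw [map_natCast, PadicComplex.valuation_p, one_div, inv_eq_one] at h1
  exact hp.out.one_lt.ne' (by exact_mod_cast h1)⟩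

/-- The ring of integers of the tilt `ℂ_p^♭`, that is, the inverse limit of copies of
`𝓞_{ℂ_p} / p` along the Frobenius. -/
abbrev Oflat : Type := PreTilt 𝓞_ℂ_[p] p

instance : IsDomain (Oflat p) := PreTilt.isDomain ℂ_[p] Valued.v 𝓞_ℂ_[p] (PadicComplexInt.integers p) p

/-- The tilt `ℂ_p^♭`. -/
abbrev Cflat : Type := FractionRing (Oflat p)

instance : PerfectRing (Cflat p) p where
  bijective_frobenius := by
    refine ⟨fun x y h => frobenius_inj (Cflat p) p h, fun x => ?_⟩
    obtain ⟨a, b, hb, rfl⟩ := IsFractionRing.div_surjective (A := Oflat p) x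
    obtain ⟨a', rfl⟩ := (PerfectRing.bijective_frobenius (R := Oflat p) (p := p)).2 a
    obtain ⟨b', rfl⟩ := (PerfectRing.bijective_frobenius (R := Oflat p) (p := p)).2 b
    exact ⟨algebraMap _ _ a' / algebraMap _ _ b', by simp [div_pow]⟩

/-- The absolute value `x ↦ |x^(0)|` on the ring of integers of the tilt. -/
noncomputable def valOflat : Valuation (Oflat p) NNReal :=
  PreTilt.val ℂ_[p] Valued.v 𝓞_ℂ_[p] (PadicComplexInt.integers p) p

lemma nonZeroDivisors_le : nonZeroDivisors (Oflat p) ≤ (valOflat p).supp.primeCompl :=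
  fun _ hx h => nonZeroDivisors.ne_zero hx
    ((PreTilt.map_eq_zero (PadicComplexInt.integers p)).1 h)

/-- The absolute value `x ↦ |x^(0)|` on the tilt, that is, `p^(-v(x))` where
`v(x) = v_p(x^(0))`. -/
noncomputable def valCflat : Valuation (Cflat p) NNReal :=
  (valOflat p).extendToLocalization (nonZeroDivisors_le p) (Cflat p)

lemma valOflat_le_one (x : Oflat p) : valOflat p x ≤ 1 := by
  classical
  change PreTilt.valAux ℂ_[p] Valued.v 𝓞_ℂ_[p] p x ≤ 1
  unfold PreTilt.valAux
  split_ifs with h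
  · refine pow_le_one₀ zero_le ?_
    generalize PreTilt.coeff (Nat.find h) x = y
    unfold ModP.preVal
    split_ifs
    · exact zero_le_one
    · exact (PadicComplexInt.integers p).map_le_one _
  · exact zero_le_one

/-- `Ã = W(ℂ_p^♭)`. -/
abbrev WTilt : Type := WittVector p (Cflat p)

/-- The inclusion of `W(𝓞_{ℂ_p}^♭)` in `Ã = W(ℂ_p^♭)`. -/
noncomputable def inclOflat : WittVector p (Oflat p) →ₐ[ℤ_[p]] WTilt p where
  __ := WittVector.map (algebraMap (Oflat p) (Cflat p))
  commutes' c := by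
    change ((WittVector.map (algebraMap (Oflat p) (Cflat p))).comp
      (WittVector.map (ZMod.castHom dvd_rfl (Oflat p)))) _ =
      WittVector.map (ZMod.castHom dvd_rfl (Cflat p)) _
    ext j
    simp only [RingHom.comp_apply, WittVector.map_coeff]
    exact RingHom.congr_fun (RingHom.ext_zmod ((algebraMap (Oflat p) (Cflat p)).comp
      (ZMod.castHom dvd_rfl (Oflat p))) (ZMod.castHom dvd_rfl (Cflat p))) _

lemma valCflat_inclOflat (x : WittVector p (Oflat p)) (j : ℕ) :
    valCflat p ((inclOflat p x).coeff j) ≤ 1 := by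
  have : (inclOflat p x).coeff j = algebraMap (Oflat p) (Cflat p) (x.coeff j) :=
    WittVector.map_coeff _ _ _
  rw [this]
  exact ((valOflat p).extendToLocalization_apply_map_apply (nonZeroDivisors_le p) (Cflat p)
    (x.coeff j)).trans_le (valOflat_le_one p _)

/-- A compatible system of `p`-power roots of unity `1, ζ_1, ζ_2, …` in `ℂ_p` with `ζ_1 ≠ 1`. -/
structure RootSystem where
  /-- The roots of unity. -/
  root : ℕ → 𝓞_ℂ_[p]
  root_zero : root 0 = 1
  root_succ : ∀ n, root (n + 1) ^ p = root n
  root_one : root 1 ≠ 1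

variable {p} (ζ : RootSystem p)

/-- The element `ε = (1, ζ_1, ζ_2, …)` of the tilt. -/
noncomputable def RootSystem.eps : Oflat p :=
  ⟨fun n => Ideal.Quotient.mk _ (ζ.root n), fun n => by rw [← map_pow, ζ.root_succ]⟩

/-- `u = [ε] - 1` as an element of `W(𝓞_{ℂ_p}^♭)`. -/
noncomputable def RootSystem.uInt : WittVector p (Oflat p) := teichmuller p ζ.eps - 1

/-- `u = [ε] - 1` as an element of `Ã`. -/
noncomputable def RootSystem.u : WTilt p := inclOflat p ζ.uInt

open Polynomial in
/-- `ℤ_p[[u]]`, the ring of the sums `∑ a_i u^i` with `a_i ∈ ℤ_p`. -/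
noncomputable def RootSystem.powerSeries : Subalgebra ℤ_[p] (WittVector p (Oflat p)) where
  carrier := {x | ∃ f : PowerSeries ℤ_[p], ∀ n, ζ.uInt ^ n ∣ x - aeval ζ.uInt (f.trunc n)}
  algebraMap_mem' c := ⟨PowerSeries.C c, fun n => by
    cases n with
    | zero => simp
    | succ n => simp [PowerSeries.trunc_C]⟩
  add_mem' := by
    rintro x y ⟨f, hf⟩ ⟨g, hg⟩
    refine ⟨f + g, fun n => ?_⟩
    rw [map_add, map_add, add_sub_add_comm]
    exact dvd_add (hf n) (hg n)
  mul_mem' := by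
    rintro x y ⟨f, hf⟩ ⟨g, hg⟩
    refine ⟨f * g, fun n => ?_⟩
    have h1 : (X : ℤ_[p][X]) ^ n ∣ f.trunc n * g.trunc n - (f * g).trunc n := by
      rw [X_pow_dvd_iff]
      intro d hd
      rw [coeff_sub, ← PowerSeries.trunc_trunc_mul_trunc, PowerSeries.coeff_trunc, if_pos hd,
        ← Polynomial.coe_mul, Polynomial.coeff_coe, sub_self]
    have h2 := map_dvd (aeval ζ.uInt) h1
    rw [map_pow, aeval_X, map_sub, map_mul] at h2
    have h3 := dvd_add (dvd_add ((hg n).mul_left x)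
      ((hf n).mul_right (aeval ζ.uInt (g.trunc n)))) h2
    rwa [mul_sub, sub_mul, sub_add_sub_cancel, sub_add_sub_cancel] at h3

open Polynomial in
lemma RootSystem.uInt_mem : ζ.uInt ∈ ζ.powerSeries := ⟨PowerSeries.X, fun n => by
  rcases n with _ | _ | n
  · simp
  · refine (dvd_sub ?_ ?_)
    · simp
    · have : (PowerSeries.X : PowerSeries ℤ_[p]).trunc 1 = 0 := by
        ext d
        rw [PowerSeries.coeff_trunc, coeff_zero, PowerSeries.coeff_X]
        split_ifs <;> first | omega | rfl
      rw [zero_add, this, map_zero]; exact dvd_zero _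
  · rw [PowerSeries.trunc_X, aeval_X, sub_self]; exact dvd_zero _⟩

/-- `A_{ℚ_p}`, the closure of `ℤ_p((u)) = ℤ_p[[u]][1/u]` in `Ã` for the `p`-adic topology. -/
noncomputable def RootSystem.AQp : Subalgebra ℤ_[p] (WTilt p) where
  carrier := {y | ∀ n, ∃ m, ∃ x ∈ ζ.powerSeries, (p : WTilt p) ^ n ∣ ζ.u ^ m * y - inclOflat p x}
  algebraMap_mem' c n := ⟨0, algebraMap _ _ c, algebraMap_mem _ c, by simp⟩
  add_mem' := by
    intro y y' hy hy' n
    obtain ⟨m, x, hx, h⟩ := hy n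
    obtain ⟨m', x', hx', h'⟩ := hy' n
    have hu : ζ.uInt ∈ ζ.powerSeries := ζ.uInt_mem
    refine ⟨m + m', ζ.uInt ^ m' * x + ζ.uInt ^ m * x', add_mem (mul_mem (pow_mem hu _) hx)
      (mul_mem (pow_mem hu _) hx'), ?_⟩
    have := dvd_add (h.mul_left (ζ.u ^ m')) (h'.mul_left (ζ.u ^ m))
    convert this using 1
    rw [map_add, map_mul, map_mul, map_pow, map_pow]
    change _ = ζ.u ^ m' * _ + _
    rw [show inclOflat p ζ.uInt = ζ.u from rfl]
    ring
  mul_mem' := by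
    intro y y' hy hy' n
    obtain ⟨m, x, hx, h⟩ := hy n
    obtain ⟨m', x', hx', h'⟩ := hy' n
    refine ⟨m + m', x * x', mul_mem hx hx', ?_⟩
    have := dvd_add (h.mul_right (ζ.u ^ m' * y')) (h'.mul_left (inclOflat p x))
    convert this using 1
    rw [map_mul]
    ring

end Tilt

section OneVariable

open WittVector

variable {p : ℕ} [hp : Fact p.Prime] (ζ : RootSystem p)

/-- `A_{ℚ_p}^{†,r} = A_{ℚ_p} ∩ Ã^{†,r}`. -/
noncomputable def RootSystem.Adag (r : Pos) : Subalgebra ℤ_[p] (WTilt p) :=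
  ζ.AQp ⊓ Atilde p (valCflat p) r

lemma RootSystem.Adag_mono {r s : Pos} (h : r ≤ s) : ζ.Adag r ≤ ζ.Adag s :=
  inf_le_inf_left _ (Atilde_mono _ h)

lemma RootSystem.u_mem (r : Pos) : ζ.u ∈ ζ.Adag r :=
  ⟨fun n => ⟨0, ζ.uInt, ζ.uInt_mem, by simp [RootSystem.u]⟩,
    isOverconvergent_integral _ r fun j => valCflat_inclOflat p _ j⟩

/-- `u` as an element of `A_{ℚ_p}^{†,r}`. -/
noncomputable def RootSystem.uDag (r : Pos) : ζ.Adag r := ⟨ζ.u, ζ.u_mem r⟩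

/-- The norm `|·|_r = p^(-V(·,r))` on `A_{ℚ_p}^{†,r}`. -/
noncomputable def RootSystem.normAdag (r : Pos) : RingSeminorm (ζ.Adag r) :=
  overconvergentNorm (valCflat p) r (ζ.Adag r).subtype fun a => a.2.2

variable (p) in
/-- The field `Ã[1/p]`. -/
abbrev BTilt : Type := FractionRing (WTilt p)

lemma algebraMap_BTilt_injective : Function.Injective (algebraMap (WTilt p) (BTilt p)) :=
  IsFractionRing.injective _ _

lemma natCast_WTilt_ne_zero : (p : WTilt p) ≠ 0 := WittVector.p_nonzero p (Cflat p)

lemma natCast_BTilt_ne_zero : (p : BTilt p) ≠ 0 := by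
  rw [← map_natCast (algebraMap (WTilt p) (BTilt p))]
  exact (map_ne_zero_iff _ algebraMap_BTilt_injective).2 natCast_WTilt_ne_zero

lemma algebraMap_WTilt_injective : Function.Injective (algebraMap ℤ_[p] (WTilt p)) := by
  rw [injective_iff_map_eq_zero]
  intro c hc
  by_contra h0
  rw [PadicInt.unitCoeff_spec h0, map_mul, map_pow, map_natCast] at hc
  have h1 := (PadicInt.unitCoeff h0).isUnit.map (algebraMap ℤ_[p] (WTilt p))
  exact mul_ne_zero h1.ne_zero (pow_ne_zero _ natCast_WTilt_ne_zero) hc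

noncomputable instance : Algebra ℚ_[p] (BTilt p) :=
  (IsFractionRing.lift (A := ℤ_[p]) (K := ℚ_[p])
    (g := (algebraMap (WTilt p) (BTilt p)).comp (algebraMap ℤ_[p] (WTilt p)))
    (algebraMap_BTilt_injective.comp algebraMap_WTilt_injective)).toAlgebra

lemma algebraMap_BTilt_int (c : ℤ_[p]) : algebraMap ℚ_[p] (BTilt p) c =
    algebraMap (WTilt p) (BTilt p) (algebraMap ℤ_[p] (WTilt p) c) :=
  IsFractionRing.lift_algebraMap (A := ℤ_[p]) (K := ℚ_[p])
    (g := (algebraMap (WTilt p) (BTilt p)).comp (algebraMap ℤ_[p] (WTilt p)))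
    (algebraMap_BTilt_injective.comp algebraMap_WTilt_injective) c

lemma exists_pow_mul_int (c : ℚ_[p]) : ∃ (n : ℕ) (d : ℤ_[p]), (d : ℚ_[p]) = (p : ℚ_[p]) ^ n * c := by
  obtain ⟨n, hn⟩ := ((tendsto_inv_pow p).mul_const ‖c‖).eventually_le_const
    (show (0 : ℝ) * ‖c‖ < 1 by rw [zero_mul]; exact one_pos) |>.exists
  refine ⟨n, ⟨(p : ℚ_[p]) ^ n * c, ?_⟩, rfl⟩
  rwa [norm_mul, norm_pow, Padic.norm_p]

/-- `B_{ℚ_p}^{†,r} = A_{ℚ_p}^{†,r}[1/p]`. -/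
noncomputable def RootSystem.Bdag (r : Pos) : Subalgebra ℚ_[p] (BTilt p) where
  carrier := {x | ∃ n : ℕ, ∃ a ∈ ζ.Adag r, algebraMap (WTilt p) (BTilt p) a = (p : BTilt p) ^ n * x}
  algebraMap_mem' c := by
    obtain ⟨n, d, hd⟩ := exists_pow_mul_int c
    refine ⟨n, algebraMap _ _ d, algebraMap_mem _ d, ?_⟩
    rw [← algebraMap_BTilt_int, hd, map_mul, map_pow, map_natCast]
  add_mem' := by
    rintro x y ⟨n, a, ha, hx⟩ ⟨m, b, hb, hy⟩
    refine ⟨n + m, (p : WTilt p) ^ m * a + (p : WTilt p) ^ n * b, add_mem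
      (mul_mem (pow_mem (natCast_mem _ _) _) ha) (mul_mem (pow_mem (natCast_mem _ _) _) hb), ?_⟩
    rw [map_add, map_mul, map_mul, hx, hy, map_pow, map_pow, map_natCast]
    ring
  mul_mem' := by
    rintro x y ⟨n, a, ha, hx⟩ ⟨m, b, hb, hy⟩
    refine ⟨n + m, a * b, mul_mem ha hb, ?_⟩
    rw [map_mul, hx, hy]
    ring

lemma RootSystem.Bdag_mono {r s : Pos} (h : r ≤ s) : ζ.Bdag r ≤ ζ.Bdag s := by
  rintro x ⟨n, a, ha, hx⟩
  exact ⟨n, a, ζ.Adag_mono h ha, hx⟩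

/-- The extension of `|·|_t = p^(-V(·,t))` to `Ã^{†,t}[1/p]`: `|x|_t = p^n |a|_t` if
`p^n x = a` with `a` in `Ã^{†,t}`. -/
noncomputable def normB (t : Pos) (x : BTilt p) : ℝ :=
  sInf {c | ∃ n : ℕ, ∃ a ∈ Atilde p (valCflat p) t,
    algebraMap (WTilt p) (BTilt p) a = (p : BTilt p) ^ n * x ∧
    c = (p : ℝ) ^ n * wittNorm (valCflat p) t a}

lemma wittNorm_pow_mul (t : Pos) (n : ℕ) (a : WTilt p) :
    (p : ℝ) ^ n * wittNorm (valCflat p) t ((p : WTilt p) ^ n * a) = wittNorm (valCflat p) t a := by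
  induction n with
  | zero => simp
  | succ n ih =>
    rw [pow_succ (p : WTilt p), mul_right_comm, wittNorm_mul_p, pow_succ, mul_assoc,
      mul_inv_cancel_left₀ (p_pos p).ne', ih]

lemma normB_eq {t : Pos} {x : BTilt p} {n : ℕ} {a : WTilt p} (ha : a ∈ Atilde p (valCflat p) t)
    (h : algebraMap (WTilt p) (BTilt p) a = (p : BTilt p) ^ n * x) :
    normB t x = (p : ℝ) ^ n * wittNorm (valCflat p) t a := by
  have : {c | ∃ n : ℕ, ∃ a ∈ Atilde p (valCflat p) t,
      algebraMap (WTilt p) (BTilt p) a = (p : BTilt p) ^ n * x ∧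
      c = (p : ℝ) ^ n * wittNorm (valCflat p) t a} =
      {(p : ℝ) ^ n * wittNorm (valCflat p) t a} := by
    ext c
    rw [Set.mem_singleton_iff]
    constructor
    · rintro ⟨m, b, hb, hx, rfl⟩
      have hab : (p : WTilt p) ^ m * a = (p : WTilt p) ^ n * b := by
        apply algebraMap_BTilt_injective
        rw [map_mul, map_mul, map_pow, map_pow, map_natCast, h, hx]
        ring
      rw [← wittNorm_pow_mul t m a, hab, ← wittNorm_pow_mul t n b]
      ring
    · rintro rfl
      exact ⟨n, a, ha, h, rfl⟩
  rw [normB, this, csInf_singleton]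

lemma normB_bdd {r s : Pos} {x : BTilt p} (hx : x ∈ ζ.Bdag r) :
    BddAbove (Set.range fun t : Set.Icc r s => normB t.1 x) := by
  obtain ⟨n, a, ha, h⟩ := hx
  refine ⟨(p : ℝ) ^ n, ?_⟩
  rintro _ ⟨t, rfl⟩
  have hat := Atilde_mono _ t.2.1 ha.2
  dsimp only
  rw [normB_eq hat h]
  exact mul_le_of_le_one_right (pow_nonneg (p_pos p).le n) (wittNorm_le_one _ hat)

lemma normB_nonneg {r t : Pos} (hrt : r ≤ t) {x : BTilt p} (hx : x ∈ ζ.Bdag r) :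
    0 ≤ normB t x := by
  obtain ⟨n, a, ha, h⟩ := hx
  rw [normB_eq (Atilde_mono _ hrt ha.2) h]
  exact mul_nonneg (pow_nonneg (p_pos p).le n) (wittNorm_nonneg _ _ _)

lemma normB_add_le {r t : Pos} (hrt : r ≤ t) {x y : BTilt p} (hx : x ∈ ζ.Bdag r)
    (hy : y ∈ ζ.Bdag r) : normB t (x + y) ≤ normB t x + normB t y := by
  obtain ⟨n, a, ha, h⟩ := hx
  obtain ⟨m, b, hb, h'⟩ := hy
  have hat := Atilde_mono _ hrt ha.2
  have hbt := Atilde_mono _ hrt hb.2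
  have hat' := mul_mem (pow_mem (natCast_mem (Atilde p (valCflat p) t) p) m) hat
  have hbt' := mul_mem (pow_mem (natCast_mem (Atilde p (valCflat p) t) p) n) hbt
  have e1 : algebraMap (WTilt p) (BTilt p) ((p : WTilt p) ^ m * a) =
      (p : BTilt p) ^ (n + m) * x := by
    rw [map_mul, map_pow, map_natCast, h]; ring
  have e2 : algebraMap (WTilt p) (BTilt p) ((p : WTilt p) ^ n * b) =
      (p : BTilt p) ^ (n + m) * y := by
    rw [map_mul, map_pow, map_natCast, h']; ring
  have e3 : algebraMap (WTilt p) (BTilt p) ((p : WTilt p) ^ m * a + (p : WTilt p) ^ n * b) =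
      (p : BTilt p) ^ (n + m) * (x + y) := by
    rw [map_add, e1, e2]; ring
  rw [normB_eq hat' e1, normB_eq hbt' e2, normB_eq (add_mem hat' hbt') e3, ← mul_add]
  exact mul_le_mul_of_nonneg_left ((wittNorm_add_le _ hat' hbt').trans
    (max_le_add_of_nonneg (wittNorm_nonneg _ _ _) (wittNorm_nonneg _ _ _)))
    (pow_nonneg (p_pos p).le _)

lemma normB_mul_le {r t : Pos} (hrt : r ≤ t) {x y : BTilt p} (hx : x ∈ ζ.Bdag r)
    (hy : y ∈ ζ.Bdag r) : normB t (x * y) ≤ normB t x * normB t y := by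
  obtain ⟨n, a, ha, h⟩ := hx
  obtain ⟨m, b, hb, h'⟩ := hy
  have hat := Atilde_mono _ hrt ha.2
  have hbt := Atilde_mono _ hrt hb.2
  have e3 : algebraMap (WTilt p) (BTilt p) (a * b) = (p : BTilt p) ^ (n + m) * (x * y) := by
    rw [map_mul, h, h']; ring
  rw [normB_eq hat h, normB_eq hbt h', normB_eq (mul_mem hat hbt) e3]
  calc (p : ℝ) ^ (n + m) * wittNorm (valCflat p) t (a * b)
      ≤ (p : ℝ) ^ (n + m) * (wittNorm (valCflat p) t a * wittNorm (valCflat p) t b) :=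
        mul_le_mul_of_nonneg_left (wittNorm_mul_le _ hat hbt) (pow_nonneg (p_pos p).le _)
    _ = _ := by ring

lemma normB_neg_le {r t : Pos} (hrt : r ≤ t) {x : BTilt p} (hx : x ∈ ζ.Bdag r) :
    normB t (-x) ≤ normB t x := by
  obtain ⟨n, a, ha, h⟩ := hx
  have hat := Atilde_mono _ hrt ha.2
  have e3 : algebraMap (WTilt p) (BTilt p) (-a) = (p : BTilt p) ^ n * (-x) := by
    rw [map_neg, h]; ring
  rw [normB_eq hat h, normB_eq (neg_mem hat) e3]
  exact mul_le_mul_of_nonneg_left (wittNorm_neg_le _ hat) (pow_nonneg (p_pos p).le _)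

lemma normB_zero (t : Pos) : normB t (0 : BTilt p) = 0 := by
  rw [normB_eq (n := 0) (a := 0) (zero_mem _) (by simp), wittNorm_zero, mul_zero]

/-- The seminorm `sup_{r ≤ t ≤ s} |x|_t = p^(-V(x,[r,s]))` on `B_{ℚ_p}^{†,r}`. -/
noncomputable def RootSystem.normBdag (r : Pos) (s : Set.Ici r) : RingSeminorm (ζ.Bdag r) :=
  have hne : Nonempty (Set.Icc r s.1) := ⟨⟨r, le_rfl, s.2⟩⟩
  have h0 : ∀ x : ζ.Bdag r, 0 ≤ ⨆ t : Set.Icc r s.1, normB t.1 (x : BTilt p) := fun x =>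
    Real.iSup_nonneg fun t => normB_nonneg ζ t.2.1 x.2
  have hneg : ∀ x : ζ.Bdag r, ⨆ t : Set.Icc r s.1, normB t.1 (-(x : BTilt p)) ≤
      ⨆ t : Set.Icc r s.1, normB t.1 (x : BTilt p) := fun x => ciSup_le fun t =>
    (normB_neg_le ζ t.2.1 x.2).trans (le_ciSup (normB_bdd ζ x.2) t)
  { toFun := fun x => ⨆ t : Set.Icc r s.1, normB t.1 (x : BTilt p)
    map_zero' := by simp [normB_zero]
    add_le' := fun x y => ciSup_le fun t => (normB_add_le ζ t.2.1 x.2 y.2).trans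
      (add_le_add (le_ciSup (normB_bdd ζ x.2) t) (le_ciSup (normB_bdd ζ y.2) t))
    neg' := fun x => by
      refine le_antisymm (hneg x) ?_
      have := hneg (-x)
      rwa [NegMemClass.coe_neg, neg_neg] at this
    mul_le' := fun x y => ciSup_le fun t => (normB_mul_le ζ t.2.1 x.2 y.2).trans
      (mul_le_mul (le_ciSup (normB_bdd ζ x.2) t) (le_ciSup (normB_bdd ζ y.2) t)
        (normB_nonneg ζ t.2.1 y.2) (h0 x)) }

/-- `B_{rig,ℚ_p}^{†,r}`, the completion of `B_{ℚ_p}^{†,r}` for the family of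
seminorms `p^(-V(·,[r,s]))`, `s ≥ r`. -/
abbrev RootSystem.Brig (r : Pos) : Type := Hat (ζ.normBdag r)

lemma RootSystem.normBdag_mono {r r' : Pos} (h : r ≤ r') (s : Set.Ici r') (x : ζ.Bdag r) :
    ζ.normBdag r' s (Subalgebra.inclusion (ζ.Bdag_mono h) x) ≤
      ζ.normBdag r ⟨s.1, h.trans s.2⟩ x := by
  have hne : Nonempty (Set.Icc r' s.1) := ⟨⟨r', le_rfl, s.2⟩⟩
  exact ciSup_le fun t => le_ciSup (f := fun t : Set.Icc r s.1 => normB t.1 (x : BTilt p))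
    (normB_bdd ζ x.2) ⟨t.1, h.trans t.2.1, t.2.2⟩

lemma RootSystem.Brig_bound {r r' : Pos} (h : r ≤ r') (i : Set.Ici r') :
    ∃ j, ∃ β : ℝ, 0 < β ∧ ∀ a, ζ.normBdag r' i
      ((Subalgebra.inclusion (ζ.Bdag_mono h)).toRingHom a) ≤ (ζ.normBdag r j a) ^ β :=
  ⟨⟨i.1, h.trans i.2⟩, 1, one_pos, fun a => by
    rw [Real.rpow_one]; exact ζ.normBdag_mono h i a⟩

/-- The map `B_{rig,ℚ_p}^{†,r} → B_{rig,ℚ_p}^{†,r'}` for `r ≤ r'`. -/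
noncomputable def RootSystem.BrigMap {r r' : Pos} (h : r ≤ r') : ζ.Brig r →ₐ[ℚ_[p]] ζ.Brig r' where
  __ := Hat.map (Subalgebra.inclusion (ζ.Bdag_mono h)).toRingHom (ζ.Brig_bound h)
  commutes' c := by
    change Hat.map (Subalgebra.inclusion (ζ.Bdag_mono h)).toRingHom (ζ.Brig_bound h)
      (Hat.of _ (algebraMap _ _ c)) = Hat.of _ (algebraMap _ _ c)
    rw [Hat.map_of]
    rfl

end OneVariable

section MultiVariable

open scoped TensorProduct

variable {p : ℕ} [hp : Fact p.Prime] (ζ : RootSystem p) {Δ : Type*} [Fintype Δ]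

/-- `A_{ℚ_p,Δ}^{†,r}`, the completion of `⨂_{ℤ_p} A_{ℚ_p}^{†,r_α}` for the tensor product of
the norms `|·|_{r_α}`. -/
abbrev RootSystem.AdagLevel (r : Δ → Pos) : Type _ :=
  Hat fun _ : Unit => tensorSeminorm (K := ℤ_[p]) fun α => ζ.normAdag (r α)

/-- The element `ϖ = ∏ ϖ_α = u ⊗ ⋯ ⊗ u` of `A_{ℚ_p,Δ}^{†,r}`. -/
noncomputable def RootSystem.varpi (r : Δ → Pos) : ζ.AdagLevel r :=
  Hat.of _ (PiTensorProduct.tprod ℤ_[p] fun α => ζ.uDag (r α))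

/-- The inclusion `⨂ A_{ℚ_p}^{†,r_α} → ⨂ A_{ℚ_p}^{†,s_α}`. -/
noncomputable def RootSystem.AdagTensorMap {r s : Δ → Pos} (h : r ≤ s) :
    (⨂[ℤ_[p]] α, ζ.Adag (r α)) →ₐ[ℤ_[p]] ⨂[ℤ_[p]] α, ζ.Adag (s α) :=
  tensorMap fun α => Subalgebra.inclusion (ζ.Adag_mono (h α))

lemma RootSystem.Adag_bound {r s : Δ → Pos} (h : r ≤ s) (i : Unit) :
    ∃ j : Unit, ∃ β : ℝ, 0 < β ∧ ∀ a,
      (fun _ : Unit => tensorSeminorm (K := ℤ_[p]) fun α => ζ.normAdag (s α)) i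
        ((ζ.AdagTensorMap h).toRingHom a) ≤
      ((fun _ : Unit => tensorSeminorm (K := ℤ_[p]) fun α => ζ.normAdag (r α)) j a) ^ β := by
  obtain ⟨β, hβ0, hβ1, hβ⟩ : ∃ β : ℝ, 0 < β ∧ β ≤ 1 ∧ ∀ α, β ≤ (r α).1 / (s α).1 := by
    rcases isEmpty_or_nonempty Δ with hΔ | hΔ
    · exact ⟨1, one_pos, le_rfl, fun α => (hΔ.false α).elim⟩
    · obtain ⟨α, hα⟩ := Finite.exists_min fun α => (r α).1 / (s α).1
      exact ⟨_, div_pos (r α).2 (s α).2, (div_le_one (s α).2).2 (h α), hα⟩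
  refine ⟨(), β, hβ0, fun t => tensorSeminorm_map_le _ hβ0 (fun c x => ?_) t⟩
  have h0 : ∀ α, 0 ≤ ζ.normAdag (r α) (x α) := fun α => apply_nonneg _ _
  rw [Real.mul_rpow (norm_nonneg c) (Finset.prod_nonneg fun α _ => h0 α),
    ← Real.finsetProd_rpow _ _ fun α _ => h0 α]
  refine mul_le_mul ?_ ?_ (Finset.prod_nonneg fun α _ => apply_nonneg _ _)
    (Real.rpow_nonneg (norm_nonneg c) _)
  · have := Real.rpow_le_rpow_of_exponent_ge' (norm_nonneg c) (PadicInt.norm_le_one c) hβ0.le hβ1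
    rwa [Real.rpow_one] at this
  · refine Finset.prod_le_prod (fun α _ => apply_nonneg _ _) fun α _ => ?_
    exact (wittNorm_mono _ (h α) (x α).2.2).trans (Real.rpow_le_rpow_of_exponent_ge' (h0 α)
      (wittNorm_le_one _ (x α).2.2) hβ0.le (hβ α))

/-- The map `A_{ℚ_p,Δ}^{†,r} → A_{ℚ_p,Δ}^{†,s}` for `r ≤ s`. -/
noncomputable def RootSystem.AdagLevelMap {r s : Δ → Pos} (h : r ≤ s) :
    ζ.AdagLevel r →+* ζ.AdagLevel s :=
  Hat.map (ζ.AdagTensorMap h).toRingHom (ζ.Adag_bound h)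

lemma RootSystem.AdagLevelMap_varpi {r s : Δ → Pos} (h : r ≤ s) :
    ζ.AdagLevelMap h (ζ.varpi r) = ζ.varpi s := by
  refine (Hat.map_of _ (ζ.Adag_bound h) _).trans ?_
  exact congrArg (Hat.of _) (tensorMap_tprod _ _)

/-- The map `A_{ℚ_p,Δ}^{†,r}[1/ϖ] → A_{ℚ_p,Δ}^{†,s}[1/ϖ]` for `r ≤ s`. -/
noncomputable def RootSystem.AdagAwayMap (r s : Δ → Pos) (h : r ≤ s) :
    Localization.Away (ζ.varpi r) →+* Localization.Away (ζ.varpi s) :=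
  IsLocalization.Away.lift (ζ.varpi r)
    (g := (algebraMap (ζ.AdagLevel s) (Localization.Away (ζ.varpi s))).comp (ζ.AdagLevelMap h)) <| by
    rw [RingHom.comp_apply, ζ.AdagLevelMap_varpi h]
    exact IsLocalization.Away.algebraMap_isUnit _

variable (Δ) in
/-- `A_{ℚ_p,Δ}^† = ⋃_r A_{ℚ_p,Δ}^{†,r}[1/ϖ]`. -/
abbrev RootSystem.AdagDelta : Type _ :=
  Ring.DirectLimit (fun r : Δ → Pos => Localization.Away (ζ.varpi r))
    (fun r s h => ζ.AdagAwayMap r s h)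

/-- The map `A_{ℚ_p,Δ}^{†,r} → A_{ℚ_p,Δ}^†`. -/
noncomputable def RootSystem.toAdagDelta (r : Δ → Pos) : ζ.AdagLevel r →+* ζ.AdagDelta Δ :=
  (Ring.DirectLimit.of (fun r : Δ → Pos => Localization.Away (ζ.varpi r))
    (fun r s h => ζ.AdagAwayMap r s h) r).comp (algebraMap _ _)

variable (Δ) in
/-- `A_{ℚ_p,Δ}`, the `p`-adic completion of `A_{ℚ_p,Δ}^†`. -/
abbrev RootSystem.ADelta : Type _ :=
  AdicCompletion (Ideal.span {(p : ζ.AdagDelta Δ)}) (ζ.AdagDelta Δ)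

/-- `B_{rig,ℚ_p,Δ}^{†,r}`, the completed tensor product over `ℚ_p` of the Fréchet algebras
`B_{rig,ℚ_p}^{†,r_α}`. -/
abbrev RootSystem.BrigLevel (r : Δ → Pos) : Type _ :=
  Hat fun s : ∀ α, Set.Ici (r α) =>
    tensorSeminorm (K := ℚ_[p]) (A := fun α => ζ.Brig (r α))
      fun α => Hat.seminorm (ζ.normBdag (r α)) (s α)

/-- The map `⨂ B_{rig,ℚ_p}^{†,r_α} → ⨂ B_{rig,ℚ_p}^{†,s_α}`. -/
noncomputable def RootSystem.BrigTensorMap {r s : Δ → Pos} (h : r ≤ s) :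
    (⨂[ℚ_[p]] α, ζ.Brig (r α)) →ₐ[ℚ_[p]] ⨂[ℚ_[p]] α, ζ.Brig (s α) :=
  tensorMap fun α => ζ.BrigMap (h α)

lemma RootSystem.BrigTensor_bound {r s : Δ → Pos} (h : r ≤ s) (i : ∀ α, Set.Ici (s α)) :
    ∃ j : ∀ α, Set.Ici (r α), ∃ β : ℝ, 0 < β ∧ ∀ a,
      (tensorSeminorm (K := ℚ_[p]) (A := fun α => ζ.Brig (s α))
        fun α => Hat.seminorm (ζ.normBdag (s α)) (i α)) ((ζ.BrigTensorMap h).toRingHom a) ≤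
      ((tensorSeminorm (K := ℚ_[p]) (A := fun α => ζ.Brig (r α))
        fun α => Hat.seminorm (ζ.normBdag (r α)) (j α)) a) ^ β := by
  refine ⟨fun α => ⟨(i α).1, (h α).trans (i α).2⟩, 1, one_pos, fun t =>
    tensorSeminorm_map_le _ one_pos (fun c x => ?_) t⟩
  rw [Real.rpow_one]
  refine mul_le_mul_of_nonneg_left (Finset.prod_le_prod (fun α _ => apply_nonneg _ _)
    fun α _ => ?_) (norm_nonneg c)
  exact Hat.seminorm_map_le _ (ζ.Brig_bound (h α)) _ _ (ζ.normBdag_mono (h α) (i α)) _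

/-- The map `B_{rig,ℚ_p,Δ}^{†,r} → B_{rig,ℚ_p,Δ}^{†,s}` for `r ≤ s`. -/
noncomputable def RootSystem.BrigLevelMap (r s : Δ → Pos) (h : r ≤ s) :
    ζ.BrigLevel r →+* ζ.BrigLevel s :=
  Hat.map (ζ.BrigTensorMap h).toRingHom (ζ.BrigTensor_bound h)

variable (Δ) in
/-- `B_{rig,ℚ_p,Δ}^† = ⋃_r B_{rig,ℚ_p,Δ}^{†,r}`. -/
abbrev RootSystem.BrigDelta : Type _ :=
  Ring.DirectLimit (fun r : Δ → Pos => ζ.BrigLevel r) (fun r s h => ζ.BrigLevelMap r s h)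

/-- The map `B_{rig,ℚ_p,Δ}^{†,r} → B_{rig,ℚ_p,Δ}^†`. -/
noncomputable def RootSystem.toBrigDelta (r : Δ → Pos) : ζ.BrigLevel r →+* ζ.BrigDelta Δ :=
  Ring.DirectLimit.of (fun r : Δ → Pos => ζ.BrigLevel r) (fun r s h => ζ.BrigLevelMap r s h) r

end MultiVariable

section Comparison

open scoped TensorProduct

variable {p : ℕ} [hp : Fact p.Prime] (ζ : RootSystem p) {Δ : Type*} [Fintype Δ]

/-- The inclusion `A_{ℚ_p}^{†,r} → B_{ℚ_p}^{†,r}` followed by the map to `B_{rig,ℚ_p}^{†,r}`. -/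
noncomputable def RootSystem.AdagToBrig (r : Pos) : ζ.Adag r →+* ζ.Brig r :=
  (Hat.of (ζ.normBdag r)).comp
    (((algebraMap (WTilt p) (BTilt p)).comp (ζ.Adag r).val.toRingHom).codRestrict (ζ.Bdag r)
      fun a => ⟨0, a.1, a.2, by simp⟩)

open Classical in
/-- The element `ϖ_α = 1 ⊗ ⋯ ⊗ u ⊗ ⋯ ⊗ 1` of `B_{rig,ℚ_p,Δ}^{†,r}`. -/
noncomputable def RootSystem.varpiBrig (r : Δ → Pos) (α : Δ) : ζ.BrigLevel r :=
  Hat.of _ (PiTensorProduct.tprod ℚ_[p]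
    (Pi.mulSingle (M := fun α => ζ.Brig (r α)) α (ζ.AdagToBrig (r α) (ζ.uDag (r α)))))

/-- The homomorphism `Φ` sends a Laurent series `∑ a_i X^i` to `∑ a_i ϖ^i`. If all `r_α > 1`, this
sum is taken in `B_{rig,ℚ_p,Δ}^{†,r}` for every series that converges on an open polyannulus
with inner radii `ρ_α < p^(-1/r_α)`. -/
def RootSystem.IsEvaluation (Φ : Robba p Δ →+* ζ.BrigDelta Δ) : Prop :=
  ∀ (r : Δ → Pos), (∀ α, 1 < (r α).1) →
    ∃ w : Δ → (ζ.BrigLevel r)ˣ, (∀ α, (w α : ζ.BrigLevel r) = ζ.varpiBrig r α) ∧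
      ∀ (f : Robba p Δ) (ρ : Δ → ℝ), (∀ α, 0 < ρ α ∧ ρ α < (p : ℝ) ^ (-(1 / (r α).1))) →
        ConvergesOn ρ f.coeff →
        ∃ y : ζ.BrigLevel r,
          HasSum (fun i : Δ → ℤ => algebraMap ℚ_[p] (ζ.BrigLevel r) (f.coeff i) *
            ((∏ α, w α ^ i α : (ζ.BrigLevel r)ˣ) : ζ.BrigLevel r)) y ∧
          Φ f = ζ.toBrigDelta r y

/-- The homomorphism `ι` is induced by the inclusions `A_{ℚ_p}^{†,r_α} → B_{rig,ℚ_p}^{†,r_α}`: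
for every `r` it restricts to the continuous map `A_{ℚ_p,Δ}^{†,r} → B_{rig,ℚ_p,Δ}^{†,r}`
with `⨂ x_α ↦ ⨂ x_α`. -/
def RootSystem.IsTensorInclusion (ι : ζ.AdagDelta Δ →+* ζ.BrigDelta Δ) : Prop :=
  ∀ r : Δ → Pos, ∃ j : ζ.AdagLevel r →+* ζ.BrigLevel r, Continuous j ∧
    (∀ x : ∀ α, ζ.Adag (r α),
      j (Hat.of _ (PiTensorProduct.tprod ℤ_[p] x)) =
        Hat.of _ (PiTensorProduct.tprod ℚ_[p] fun α => ζ.AdagToBrig (r α) (x α))) ∧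
    ∀ y, ι (ζ.toAdagDelta r y) = ζ.toBrigDelta r (j y)

variable (p Δ) in
/-- `ℤ_p[[X_α : α ∈ Δ]][1/∏ X_α]`. -/
abbrev LaurentInt : Type _ :=
  Localization.Away (∏ α, MvPowerSeries.X α : MvPowerSeries Δ ℤ_[p])

variable (p Δ) in
/-- `O_{E_Δ}`, the `p`-adic completion of `ℤ_p[[X_α : α ∈ Δ]][1/∏ X_α]`. -/
abbrev OE : Type _ := AdicCompletion (Ideal.span {(p : LaurentInt p Δ)}) (LaurentInt p Δ)

open Classical in
/-- A power series with coefficients in `ℤ_p` as a two-sided family of coefficients. -/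
noncomputable def powerSeriesCoeffs (g : MvPowerSeries Δ ℤ_[p]) : Coeffs p Δ := fun i =>
  if 0 ≤ i then
    (MvPowerSeries.coeff (Finsupp.equivFunOnFinite.symm fun α => (i α).toNat) g : ℤ_[p])
  else 0

/-- The homomorphism `Ψ` is compatible with `Φ` and `ι`: for a power series
`g ∈ ℤ_p[[X_α : α ∈ Δ]]`, viewed as an element `f` of the Robba ring, `Ψ g` is the image of
the element `a` with `ι a = Φ f`. -/
def RootSystem.IsCompatible (Φ : Robba p Δ →+* ζ.BrigDelta Δ)
    (ι : ζ.AdagDelta Δ →+* ζ.BrigDelta Δ) (Ψ : OE p Δ →+* ζ.ADelta Δ) : Prop :=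
  ∀ g : MvPowerSeries Δ ℤ_[p], ∃ (f : Robba p Δ) (a : ζ.AdagDelta Δ),
    f.coeff = powerSeriesCoeffs g ∧ ι a = Φ f ∧
    Ψ (algebraMap (LaurentInt p Δ) (OE p Δ) (algebraMap _ (LaurentInt p Δ) g)) =
      algebraMap (ζ.AdagDelta Δ) (ζ.ADelta Δ) a

end Comparison

end MultiRobba

/-!
The theorem is about Laurent expansions in `u = [ε] - 1`; both sides of each identification turn out
to be described by the same conditions on the coefficients.

*One variable.* The element `ε - 1` of the tilt has valuation `p / (p - 1)`, so for `t ≥ 1` the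
quotient `u / [ε - 1]` is a unit that is congruent to `1` modulo `p`, and all its powers have norm
at most `1` for the radius `t`, also after truncation modulo powers of `p`
(`RootSystem.quotUnit_zpow_mem`). Hence `u^i` has norm `p^(-i/t)`, and the truncated norm of a
Laurent polynomial in `u` is the maximum of the norms of its terms (`RootSystem.le_of_sum_mem`).
Passing to the limit, every element of `A_{ℚ_p}` has a unique Laurent expansion
(`RootSystem.exists_represents`, `RootSystem.Represents.unique`). For `r > 1`, the terms of the
expansion of an element of `A_{ℚ_p}^{†,r}` tend to zero (`RootSystem.Represents.finite_lt`). Thus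
the powers of `u` are orthogonal topological generators of `B_{rig,ℚ_p}^{†,r}` for all seminorms
(`RootSystem.isOrthogonal_Brig`), and so are the elements `p^m u^n`, with `m` the least exponent for
which the norm is at most `1`, for `A_{ℚ_p}^{†,r}` over `ℤ_p` (`RootSystem.isOrthogonal_Adag`).

*Several variables.* Orthogonality of generators (`IsOrthogonal`) passes to tensor products and to
completions (`IsOrthogonal.tensor`, `IsOrthogonal.hat`). Hence, if all `r_α > 1`, every element of
`B_{rig,ℚ_p,Δ}^{†,r}` has a unique expansion in the monomials `ϖ^i`, and a series in these
monomials converges if its terms tend to zero for all weights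
(`RootSystem.isTopBasis_BrigLevel`). These weights are the suprema of the monomials over polyannuli
with inner radii `p^(-1/r_α)` and outer radii tending to `1`, so the expansion is a Laurent series
in the Robba ring (`RootSystem.levelToRobba`), and conversely every Laurent series that converges on
a slightly larger polyannulus occurs (`RootSystem.exists_hasSum`). In the limit over `r` the
expansion becomes an isomorphism, and `Φ` is its inverse (`RootSystem.evalEquiv`).

*The bounded ring.* The map `ι` (`RootSystem.inclDelta`) preserves Laurent expansions
(`RootSystem.coeffLevel_inclLevel`); as these determine the elements of both sides, it is injective.
The expansions of the elements of `A_{ℚ_p,Δ}^†` are exactly the Laurent series with integral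
coefficients that decay exponentially in the negative directions, outside a translate of the
positive orthant (`HasIntegralDecay`, `RootSystem.hasIntegralDecay_dagToRobba`,
`RootSystem.exists_dagToRobba_eq_of_hasIntegralDecay`). The translation comes from the inversion of
`ϖ`. A bound for `|f|_σ` near `σ = 1` is, coefficient by coefficient, the same kind of decay, and
`limsup |f|_σ ≤ 1` adds the integrality (`Robba.hasIntegralDecay_of_integralBounded`,
`Robba.integralBounded_of_hasIntegralDecay`).

*The completions.* Modulo `p^n`, only the exponents in a translate of the positive orthant remain,
so a series with integral decay becomes a power series after multiplication by a power of `∏ X_α`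
(`exists_powerSeries_sub_coeff_le`). Hence `ℤ_p[[X]][1/∏ X_α]` and `A_{ℚ_p,Δ}^†` have the same
quotients modulo `p^n`, and therefore the same `p`-adic completion (`exists_equiv_adicCompletion`).
-/

namespace MultiRobba

/-! ### Truncated norms on Witt vectors -/

section WittBall

open WittVector

variable {p : ℕ} [hp : Fact p.Prime] {k : Type*} [Field k] [CharP k p] [PerfectRing k p]
  (v : Valuation k NNReal)

/-- The group of all `x = ∑ p^j [x_j]` with `p^(-j) |x_j|^((p-1)/(p t)) ≤ ρ` for `j ≤ n`. -/
def wittBall (t : Pos) (n : ℕ) (ρ : NNReal) : AddSubgroup (WittVector p k) where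
  carrier := {x | ∀ j ≤ n, wittTerm v t x j ≤ ρ}
  zero_mem' j _ := by
    simp only [wittTerm, teichCoeff_zero, map_zero, NNReal.coe_zero,
      Real.zero_rpow (exponent_pos (p := p) t).ne', mul_zero]
    exact ρ.2
  add_mem' {x y} hx hy j hj := by
    obtain ⟨i, l, h, hle⟩ := wittTerm_add v t x y j
    refine hle.trans ((mul_le_of_le_one_left (le_max_of_le_left (wittTerm_nonneg v t x i))
      (inv_pow_le_one l)).trans (max_le (hx i (by omega)) (hy i (by omega))))
  neg_mem' {x} hx j hj := by
    obtain ⟨i, l, h, hle⟩ := wittTerm_neg v t x j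
    exact hle.trans ((mul_le_of_le_one_left (wittTerm_nonneg v t x i)
      (inv_pow_le_one l)).trans (hx i (by omega)))

variable {v} {t : Pos} {n : ℕ} {ρ σ : NNReal}

lemma wittBall_mono (h : ρ ≤ σ) : wittBall (p := p) v t n ρ ≤ wittBall v t n σ :=
  fun _ hx j hj => (hx j hj).trans h

lemma wittBall_anti {m : ℕ} (h : m ≤ n) : wittBall (p := p) v t n ρ ≤ wittBall v t m ρ :=
  fun _ hx j hj => hx j (hj.trans h)

lemma mul_mem_wittBall {x y : WittVector p k} (hx : x ∈ wittBall v t n ρ)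
    (hy : y ∈ wittBall v t n σ) : x * y ∈ wittBall v t n (ρ * σ) := fun j hj => by
  obtain ⟨i, i', l, h, hle⟩ := wittTerm_mul v t x y j
  refine hle.trans ((mul_le_of_le_one_left (mul_nonneg (wittTerm_nonneg v t x i)
    (wittTerm_nonneg v t y i')) (inv_pow_le_one l)).trans ?_)
  rw [NNReal.coe_mul]
  exact mul_le_mul (hx i (by omega)) (hy i' (by omega)) (wittTerm_nonneg v t y i') ρ.2

lemma wittTerm_eq_zero_of_dvd {x : WittVector p k} {m j : ℕ} (h : (p : WittVector p k) ^ m ∣ x)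
    (hj : j < m) : wittTerm v t x j = 0 := by
  have h' : (p : WittVector p k) ^ m ∣ x - 0 := by rwa [sub_zero]
  simp only [wittTerm, teichCoeff_eq_of_dvd h' hj, teichCoeff_zero, map_zero, NNReal.coe_zero,
      Real.zero_rpow (exponent_pos (p := p) t).ne', mul_zero]

lemma mem_wittBall_of_dvd {x : WittVector p k} (h : (p : WittVector p k) ^ (n + 1) ∣ x) :
    x ∈ wittBall v t n ρ := fun j hj => by
  rw [wittTerm_eq_zero_of_dvd h (by omega)]
  exact ρ.2

lemma mem_wittBall_of_integral {x : WittVector p k} (hx : ∀ j, v (x.coeff j) ≤ 1) :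
    x ∈ wittBall v t n 1 := fun j _ =>
  (wittTerm_integral v t hx j).trans (inv_pow_le_one j)

lemma one_mem_wittBall : (1 : WittVector p k) ∈ wittBall v t n 1 :=
  mem_wittBall_of_integral fun j => by
    cases j with
    | zero => simp
    | succ j => simp [WittVector.one_coeff_eq_of_pos]

lemma pow_mem_wittBall {x : WittVector p k} (hx : x ∈ wittBall v t n ρ) (m : ℕ) :
    x ^ m ∈ wittBall v t n (ρ ^ m) := by
  induction m with
  | zero => simpa using one_mem_wittBall
  | succ m ih => rw [pow_succ, pow_succ]; exact mul_mem_wittBall ih hx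

lemma wittTerm_teichmuller_mul (c : k) (x : WittVector p k) (j : ℕ) :
    wittTerm v t (teichmuller p c * x) j =
      (v c : ℝ) ^ (((p : ℝ) - 1) / (p * t.1)) * wittTerm v t x j := by
  unfold wittTerm
  rw [teichCoeff_teichmuller_mul, map_mul, NNReal.coe_mul,
    Real.mul_rpow NNReal.zero_le_coe NNReal.zero_le_coe]
  ring

lemma wittTerm_pow_mul (x : WittVector p k) (m j : ℕ) :
    wittTerm v t ((p : WittVector p k) ^ m * x) (j + m) = ((p : ℝ)⁻¹) ^ m * wittTerm v t x j := by
  induction m with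
  | zero => simp
  | succ m ih =>
    rw [pow_succ, mul_right_comm, ← add_assoc, wittTerm_mul_p, ih, pow_succ]
    ring

lemma wittTerm_pow_mul_le (x : WittVector p k) (m j : ℕ) (hx : ∀ i ≤ j, wittTerm v t x i ≤ ρ) :
    wittTerm v t ((p : WittVector p k) ^ m * x) j ≤ ((p : ℝ)⁻¹) ^ m * ρ := by
  rcases lt_or_ge j m with h | h
  · rw [wittTerm_eq_zero_of_dvd (dvd_mul_right _ _) h]
    exact mul_nonneg (pow_nonneg (inv_nonneg.2 (p_pos p).le) _) ρ.2
  · obtain ⟨j, rfl⟩ := Nat.exists_eq_add_of_le' h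
    rw [wittTerm_pow_mul]
    exact mul_le_mul_of_nonneg_left (hx j (by omega)) (pow_nonneg (inv_nonneg.2 (p_pos p).le) _)

/-- A Witt vector that is congruent to `1` modulo `p` has an inverse, given modulo every power of
`p` by a geometric sum. Hence the inverse of a vector of truncated norm at most `1` is of truncated
norm at most `1`. -/
lemma inv_mem_wittBall {w w' : WittVector p k} (hw : w ∈ wittBall v t n 1)
    (h1 : (p : WittVector p k) ∣ w - 1) (hww : w * w' = 1) : w' ∈ wittBall v t n 1 := by
  have hd : 1 - w ∈ wittBall v t n 1 := sub_mem one_mem_wittBall hw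
  have hs : ∑ i ∈ Finset.range (n + 1), (1 - w) ^ i ∈ wittBall v t n 1 :=
    sum_mem fun i _ => by simpa using pow_mem_wittBall hd i
  have hg := mul_neg_geom_sum (1 - w) (n + 1)
  rw [sub_sub_cancel] at hg
  have he : w' = ∑ i ∈ Finset.range (n + 1), (1 - w) ^ i + (1 - w) ^ (n + 1) * w' := by
    linear_combination -w' * hg + (∑ i ∈ Finset.range (n + 1), (1 - w) ^ i) * hww
  rw [he]
  refine add_mem hs (mem_wittBall_of_dvd (Dvd.dvd.mul_right (pow_dvd_pow_of_dvd ?_ _) _))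
  rw [← neg_sub]
  exact (dvd_neg).2 h1

/-- Comparison of the terms for two radii. -/
lemma wittTerm_eq_rpow (t s : Pos) (x : WittVector p k) (j : ℕ) :
    (p : ℝ) ^ j * wittTerm v s x j = ((p : ℝ) ^ j * wittTerm v t x j) ^ (t.1 / s.1) := by
  have hp0 := (p_pos p).ne'
  have ht : t.1 ≠ 0 := t.2.ne'
  have hs : s.1 ≠ 0 := s.2.ne'
  unfold wittTerm
  rw [← mul_assoc, ← mul_assoc, ← mul_pow, mul_inv_cancel₀ hp0, one_pow, one_mul, one_mul,
    ← Real.rpow_mul NNReal.zero_le_coe]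
  congr 1
  field_simp

end WittBall

/-! ### The absolute value of `ε - 1` -/

section Eps

variable {p : ℕ} [hp : Fact p.Prime] (ζ : RootSystem p)

lemma RootSystem.root_pow (n m : ℕ) : ζ.root (n + m) ^ p ^ m = ζ.root n := by
  induction m with
  | zero => simp
  | succ m ih => rw [← add_assoc, pow_succ', pow_mul, ζ.root_succ, ih]

lemma RootSystem.isPrimitiveRoot : IsPrimitiveRoot (ζ.root 2) (p ^ (1 + 1)) := by
  refine IsPrimitiveRoot.iff_orderOf.2 (orderOf_eq_prime_pow ?_ ?_)
  · rw [pow_one, show 2 = 1 + 1 from rfl, ζ.root_succ]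
    exact ζ.root_one
  · have := ζ.root_pow 0 2
    rw [zero_add, ζ.root_zero] at this
    exact this

/-- The absolute value of `ζ_2 - 1`: the value at `1` of the cyclotomic polynomial of level `p^2`,
which is `p`, is a product of `p (p - 1)` factors of the same absolute value. -/
lemma RootSystem.norm_root_two : (Valued.v ((ζ.root 2 : ℂ_[p]) - 1) : NNReal) ^ (p * (p - 1)) =
    (p : NNReal)⁻¹ := by
  have hprim : IsPrimitiveRoot (ζ.root 2 : ℂ_[p]) (p ^ (1 + 1)) :=
    ζ.isPrimitiveRoot.map_of_injective (f := (PadicComplexInt p).subtype) Subtype.coe_injective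
  have h := Polynomial.eval_one_cyclotomic_prime_pow (R := ℂ_[p]) (p := p) 1
  rw [Polynomial.cyclotomic_eq_prod_X_sub_primitiveRoots hprim, Polynomial.eval_prod] at h
  have h2 := congrArg (Valued.v : Valuation ℂ_[p] NNReal) h
  rw [PadicComplex.valuation_p, map_prod, one_div] at h2
  rw [← h2, Finset.prod_congr rfl (g := fun _ => Valued.v ((ζ.root 2 : ℂ_[p]) - 1)),
    Finset.prod_const, hprim.card_primitiveRoots, Nat.totient_prime_pow_succ hp.out]
  · rw [pow_one]
  · intro μ hμ
    rw [mem_primitiveRoots (pow_pos hp.out.pos _)] at hμ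
    simp only [Polynomial.eval_sub, Polynomial.eval_X, Polynomial.eval_C]
    -- Any two primitive roots are powers of each other, so `1 - a` and `1 - b` divide each other.
    have key : ∀ a b : ℂ_[p], IsPrimitiveRoot a (p ^ (1 + 1)) → IsPrimitiveRoot b (p ^ (1 + 1)) →
        (Valued.v (1 - a) : NNReal) ≤ Valued.v (1 - b) := by
      intro a b ha hb
      obtain ⟨i, -, rfl⟩ := hb.eq_pow_of_pow_eq_one ha.pow_eq_one
      have hb1 : (Valued.v b : NNReal) = 1 := by
        refine (pow_eq_one_iff_of_nonneg zero_le (pow_pos hp.out.pos (1 + 1)).ne').1 ?_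
        rw [← map_pow, hb.pow_eq_one, map_one]
      rw [← mul_neg_geom_sum, map_mul]
      refine mul_le_of_le_one_right zero_le ?_
      refine Valuation.map_sum_le _ fun j _ => ?_
      rw [map_pow, hb1, one_pow]
    rw [Valuation.map_sub_swap _ _ (1 : ℂ_[p])]
    exact le_antisymm (key _ _ hμ hprim) (key _ _ hprim hμ)

/-- The element `ε - 1` of the tilt. -/
noncomputable def RootSystem.epsSubOne : Cflat p := algebraMap (Oflat p) (Cflat p) (ζ.eps - 1)

/-- The valuation of `ε - 1` in the tilt is `p / (p - 1)`. It can be read off from the component of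
index `2`, because `ζ_2 - 1` is nonzero modulo `p`. (For `p = 2`, the component of index `1` is zero
modulo `p`.) -/
lemma RootSystem.valCflat_epsSubOne : valCflat p ζ.epsSubOne ^ (p - 1) = (p : NNReal)⁻¹ ^ p := by
  have hp1 := hp.out.one_lt
  have hN := ζ.norm_root_two
  have hlt : (Valued.v (p : ℂ_[p]) : NNReal) < Valued.v ((ζ.root 2 : ℂ_[p]) - 1) := by
    rw [PadicComplex.valuation_p, one_div]
    by_contra hle
    push Not at hle
    have hp' : (p : NNReal)⁻¹ < 1 := inv_lt_one_of_one_lt₀ (by exact_mod_cast hp1)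
    have h2 : 2 ≤ p * (p - 1) := by
      calc 2 ≤ p * 1 := by omega
        _ ≤ p * (p - 1) := Nat.mul_le_mul_left _ (by omega)
    have := (pow_le_pow_left₀ zero_le hle (p * (p - 1)))
    rw [hN] at this
    have h3 : ((p : NNReal)⁻¹) ^ (p * (p - 1)) ≤ ((p : NNReal)⁻¹) ^ 2 :=
      pow_le_pow_of_le_one zero_le hp'.le h2
    have h4 : ((p : NNReal)⁻¹) ^ 2 < (p : NNReal)⁻¹ := by
      rw [sq]
      exact mul_lt_of_lt_one_left (inv_pos.2 (by exact_mod_cast hp.out.pos)) hp'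
    exact absurd (this.trans (h3)) (not_le.2 h4)
  have hc : PreTilt.coeff 2 (ζ.eps - 1) =
      (Ideal.Quotient.mk _ (ζ.root 2 - 1) : ModP 𝓞_ℂ_[p] p) := by
    rw [map_sub, map_one, map_sub, map_one]
    rfl
  have hne : (Ideal.Quotient.mk _ (ζ.root 2 - 1) : ModP 𝓞_ℂ_[p] p) ≠ 0 := by
    refine (ModP.v_p_lt_val (K := ℂ_[p]) (v := Valued.v) (hv := PadicComplexInt.integers p)).1 ?_
    exact hlt
  have hval : valCflat p ζ.epsSubOne = Valued.v ((ζ.root 2 : ℂ_[p]) - 1) ^ p ^ 2 := by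
    refine ((valOflat p).extendToLocalization_apply_map_apply (nonZeroDivisors_le p) (Cflat p)
      (ζ.eps - 1)).trans ?_
    change PreTilt.valAux ℂ_[p] Valued.v 𝓞_ℂ_[p] p (ζ.eps - 1) = _
    rw [PreTilt.valAux_eq (hv := PadicComplexInt.integers p) (n := 2) (by rw [hc]; exact hne), hc,
      ModP.preVal_mk (hv := PadicComplexInt.integers p) hne]
    rfl
  rw [hval, ← hN, ← pow_mul, ← pow_mul]
  congr 1
  ring

lemma RootSystem.valCflat_epsSubOne_rpow (t : Pos) :
    (valCflat p ζ.epsSubOne : ℝ) ^ (((p : ℝ) - 1) / (p * t.1)) = (p : ℝ) ^ (-(1 / t.1)) := by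
  have h := congrArg (fun x : NNReal => (x : ℝ)) ζ.valCflat_epsSubOne
  simp only [NNReal.coe_pow, NNReal.coe_inv, NNReal.coe_natCast] at h
  have hp0 := p_pos p
  have ht : t.1 ≠ 0 := t.2.ne'
  have h1 : ((p - 1 : ℕ) : ℝ) = (p : ℝ) - 1 := by
    rw [Nat.cast_sub hp.out.one_le, Nat.cast_one]
  calc (valCflat p ζ.epsSubOne : ℝ) ^ (((p : ℝ) - 1) / (p * t.1))
      = ((valCflat p ζ.epsSubOne : ℝ) ^ (p - 1)) ^ (1 / (p * t.1)) := by
        rw [← Real.rpow_natCast, ← Real.rpow_mul NNReal.zero_le_coe, h1]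
        congr 1
        ring
    _ = (p : ℝ) ^ (-(1 / t.1)) := by
        rw [h, ← Real.rpow_natCast, ← Real.rpow_neg_one, ← Real.rpow_mul hp0.le,
          ← Real.rpow_mul hp0.le]
        congr 1
        field_simp

lemma RootSystem.epsSubOne_ne_zero : ζ.epsSubOne ≠ 0 := by
  intro h
  have := ζ.valCflat_epsSubOne
  rw [h, map_zero, zero_pow (Nat.sub_pos_of_lt hp.out.one_lt).ne'] at this
  have hp0 : (0 : NNReal) < (p : NNReal)⁻¹ := inv_pos.2 (by exact_mod_cast hp.out.pos)
  exact (pow_pos hp0 p).ne this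

end Eps


/-! ### Laurent polynomials in `u` -/

section Laurent

open WittVector

variable {p : ℕ} [hp : Fact p.Prime]

variable (p) in
/-- The real number `p^(-1/t)`, which is `|u|_t` for `t ≥ 1`. -/
noncomputable def radius (t : Pos) : NNReal := (p : NNReal) ^ (-(1 / t.1))

lemma radius_pos (t : Pos) : 0 < radius p t := NNReal.rpow_pos (by exact_mod_cast hp.out.pos)

lemma radius_lt_one (t : Pos) : radius p t < 1 :=
  NNReal.rpow_lt_one_of_one_lt_of_neg (by exact_mod_cast hp.out.one_lt)
    (neg_lt_zero.2 (one_div_pos.2 t.2))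

lemma radius_mono {s t : Pos} (h : s ≤ t) : radius p s ≤ radius p t :=
  NNReal.rpow_le_rpow_of_exponent_le (by exact_mod_cast hp.out.one_le)
    (neg_le_neg (one_div_le_one_div_of_le s.2 h))

lemma inv_le_radius {t : Pos} (h : 1 ≤ t.1) : (p : NNReal)⁻¹ ≤ radius p t := by
  rw [← NNReal.rpow_neg_one]
  refine NNReal.rpow_le_rpow_of_exponent_le (by exact_mod_cast hp.out.one_le) (neg_le_neg ?_)
  exact (div_le_one t.2).2 h

lemma radius_rpow (s t : Pos) : radius p s ^ (s.1 / t.1) = radius p t := by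
  have hs : s.1 ≠ 0 := s.2.ne'
  rw [radius, ← NNReal.rpow_mul, radius]
  congr 1
  field_simp

variable (ζ : RootSystem p)

lemma RootSystem.u_coeff_zero : ζ.u.coeff 0 = ζ.epsSubOne := by
  change (inclOflat p (teichmuller p ζ.eps - 1)).coeff 0 = _
  rw [map_sub, map_one]
  have h : inclOflat p (teichmuller p ζ.eps) = teichmuller p (algebraMap _ (Cflat p) ζ.eps) :=
    WittVector.map_teichmuller p (algebraMap (Oflat p) (Cflat p)) ζ.eps
  have hs : ∀ x y : WTilt p, (x - y).coeff 0 = x.coeff 0 - y.coeff 0 := fun x y =>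
    (WittVector.constantCoeff (p := p) (R := Cflat p)).map_sub x y
  rw [h, hs, teichmuller_coeff_zero, one_coeff_zero, RootSystem.epsSubOne, map_sub, map_one]

/-- `u` as a unit of `Ã`. -/
noncomputable def RootSystem.uUnit : (WTilt p)ˣ :=
  (WittVector.isUnit_of_coeff_zero_ne_zero ζ.u
    (by rw [ζ.u_coeff_zero]; exact ζ.epsSubOne_ne_zero)).unit

lemma RootSystem.val_uUnit : (ζ.uUnit : WTilt p) = ζ.u := rfl

/-- The unit `[ε - 1]` of `Ã`. -/
noncomputable def RootSystem.teichUnit : (WTilt p)ˣ :=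
  Units.map (teichmuller p : Cflat p →* WTilt p) (Units.mk0 _ ζ.epsSubOne_ne_zero)

/-- The unit `w = u / [ε - 1]`, which is congruent to `1` modulo `p`. -/
noncomputable def RootSystem.quotUnit : (WTilt p)ˣ := ζ.teichUnit⁻¹ * ζ.uUnit

lemma RootSystem.val_quotUnit :
    (ζ.quotUnit : WTilt p) = teichmuller p ζ.epsSubOne⁻¹ * ζ.u := by
  rw [RootSystem.quotUnit, Units.val_mul, val_uUnit, RootSystem.teichUnit, ← map_inv]
  rfl

lemma RootSystem.uUnit_eq : ζ.uUnit = ζ.teichUnit * ζ.quotUnit := by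
  rw [RootSystem.quotUnit, mul_inv_cancel_left]

lemma RootSystem.quotUnit_coeff_zero : (ζ.quotUnit : WTilt p).coeff 0 = 1 := by
  rw [val_quotUnit, mul_coeff_zero, teichmuller_coeff_zero, u_coeff_zero,
    inv_mul_cancel₀ ζ.epsSubOne_ne_zero]

lemma dvd_quotUnit_sub_one : (p : WTilt p) ∣ (ζ.quotUnit : WTilt p) - 1 := by
  have := dvd_of_coeff_eq (p := p) (x := (ζ.quotUnit : WTilt p)) (y := 1) (n := 1) (fun j hj => by
    obtain rfl : j = 0 := by omega
    rw [ζ.quotUnit_coeff_zero, one_coeff_zero])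
  rwa [pow_one] at this

lemma radius_coe (t : Pos) : (radius p t : ℝ) = (p : ℝ) ^ (-(1 / t.1)) := by
  simp [radius]

variable {t : Pos} {n : ℕ}

lemma RootSystem.u_integral (j : ℕ) : valCflat p (ζ.u.coeff j) ≤ 1 := valCflat_inclOflat p _ j

/-- This is where `t ≥ 1` is needed: the coefficient of index `0` of `u` has norm `p^(-1/t)`, and
the others are integral, so their terms are at most `p⁻¹ ≤ p^(-1/t)`. -/
lemma RootSystem.quotUnit_mem (ht : 1 ≤ t.1) :
    (ζ.quotUnit : WTilt p) ∈ wittBall (valCflat p) t n 1 := by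
  intro j _
  rw [val_quotUnit, wittTerm_teichmuller_mul, map_inv₀, NNReal.coe_inv,
    Real.inv_rpow NNReal.zero_le_coe, ζ.valCflat_epsSubOne_rpow, ← radius_coe]
  have hr : (0 : ℝ) < radius p t := radius_pos t
  rw [inv_mul_le_iff₀ hr, NNReal.coe_one, mul_one]
  cases j with
  | zero =>
    refine le_of_eq ?_
    have : teichCoeff ζ.u 0 = ζ.epsSubOne := by
      rw [teichCoeff_eq_iff, pow_zero, pow_one, ζ.u_coeff_zero]
    rw [wittTerm, this, ζ.valCflat_epsSubOne_rpow, ← radius_coe, pow_zero, one_mul]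
  | succ j =>
    refine (wittTerm_integral _ t ζ.u_integral _).trans ?_
    rw [pow_succ']
    have h1 : ((p : ℝ))⁻¹ ≤ radius p t := by exact_mod_cast inv_le_radius (p := p) ht
    exact (mul_le_of_le_one_right (inv_nonneg.2 (p_pos p).le) (inv_pow_le_one j)).trans h1

lemma zpow_mem_wittBall {x : (WTilt p)ˣ} {ρ : NNReal}
    (hx : (x : WTilt p) ∈ wittBall (valCflat p) t n ρ)
    (hx' : ((x⁻¹ : (WTilt p)ˣ) : WTilt p) ∈ wittBall (valCflat p) t n ρ⁻¹) (i : ℤ) :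
    ((x ^ i : (WTilt p)ˣ) : WTilt p) ∈ wittBall (valCflat p) t n (ρ ^ i) := by
  cases i with
  | ofNat m => simpa using pow_mem_wittBall hx m
  | negSucc m => simpa using pow_mem_wittBall hx' (m + 1)

lemma RootSystem.quotUnit_zpow_mem (ht : 1 ≤ t.1) (i : ℤ) :
    ((ζ.quotUnit ^ i : (WTilt p)ˣ) : WTilt p) ∈ wittBall (valCflat p) t n 1 := by
  have := zpow_mem_wittBall (p := p) (ρ := 1) (ζ.quotUnit_mem (n := n) ht)
    (by rw [inv_one]; exact inv_mem_wittBall (ζ.quotUnit_mem ht) (dvd_quotUnit_sub_one ζ)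
          ζ.quotUnit.mul_inv) i
  rwa [one_zpow] at this

lemma RootSystem.teichUnit_zpow (i : ℤ) :
    ((ζ.teichUnit ^ i : (WTilt p)ˣ) : WTilt p) = teichmuller p (ζ.epsSubOne ^ i) := by
  rw [RootSystem.teichUnit, ← map_zpow, Units.coe_map, Units.val_zpow_eq_zpow_val, Units.val_mk0]

lemma RootSystem.val_zpow (i : ℤ) :
    (valCflat p (ζ.epsSubOne ^ i) : ℝ) ^ (((p : ℝ) - 1) / (p * t.1)) = radius p t ^ i := by
  rw [map_zpow₀, NNReal.coe_zpow, ← Real.rpow_intCast, ← Real.rpow_mul NNReal.zero_le_coe,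
    mul_comm, Real.rpow_mul NNReal.zero_le_coe, ζ.valCflat_epsSubOne_rpow, Real.rpow_intCast,
    radius_coe]

/-- `u^i` has norm at most `p^(-i/t)`, for `t ≥ 1`. -/
lemma RootSystem.u_zpow_mem (ht : 1 ≤ t.1) (i : ℤ) :
    ((ζ.uUnit ^ i : (WTilt p)ˣ) : WTilt p) ∈ wittBall (valCflat p) t n (radius p t ^ i) := by
  intro j hj
  rw [uUnit_eq, mul_zpow, Units.val_mul, teichUnit_zpow, wittTerm_teichmuller_mul, val_zpow]
  exact mul_le_of_le_one_right (zpow_nonneg NNReal.zero_le_coe _) (ζ.quotUnit_zpow_mem ht i j hj)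

lemma norm_eq_zpow_valuation {c : ℤ_[p]} (hc : c ≠ 0) : ‖c‖ = ((p : ℝ)⁻¹) ^ c.valuation := by
  rw [PadicInt.norm_eq_zpow_neg_valuation hc, zpow_neg, zpow_natCast, inv_pow]

lemma algebraMap_eq_pow_mul {c : ℤ_[p]} (hc : c ≠ 0) : algebraMap ℤ_[p] (WTilt p) c =
    (p : WTilt p) ^ c.valuation * algebraMap ℤ_[p] (WTilt p) (PadicInt.unitCoeff hc) := by
  conv_lhs => rw [PadicInt.unitCoeff_spec hc]
  rw [map_mul, map_pow, map_natCast, mul_comm]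

lemma algebraMap_integral (c : ℤ_[p]) (j : ℕ) :
    valCflat p ((algebraMap ℤ_[p] (WTilt p) c).coeff j) ≤ 1 := by
  obtain ⟨a, ha⟩ := coeff_algebraMap (R := Cflat p) c j
  rw [ha]; exact val_cast_le_one _ a

/-- The term `a u^i` of a Laurent series. -/
noncomputable def RootSystem.mono (a : ℤ_[p]) (i : ℤ) : WTilt p :=
  algebraMap ℤ_[p] (WTilt p) a * ((ζ.uUnit ^ i : (WTilt p)ˣ) : WTilt p)

lemma RootSystem.mono_eq {a : ℤ_[p]} (ha : a ≠ 0) (i : ℤ) : ζ.mono a i =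
    (p : WTilt p) ^ a.valuation * ζ.mono (PadicInt.unitCoeff ha) i := by
  rw [mono, algebraMap_eq_pow_mul ha, mul_assoc]
  rfl

lemma RootSystem.mono_add (a b : ℤ_[p]) (i : ℤ) : ζ.mono (a + b) i = ζ.mono a i + ζ.mono b i := by
  simp only [mono, map_add, add_mul]

lemma RootSystem.mono_zero (i : ℤ) : ζ.mono 0 i = 0 := by simp [mono]

lemma RootSystem.mono_sub (a b : ℤ_[p]) (i : ℤ) : ζ.mono (a - b) i = ζ.mono a i - ζ.mono b i := by
  simp only [mono, map_sub, sub_mul]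

lemma RootSystem.mono_mul (c a : ℤ_[p]) (i : ℤ) :
    ζ.mono (c * a) i = algebraMap ℤ_[p] (WTilt p) c * ζ.mono a i := by
  simp only [mono, map_mul, mul_assoc]

lemma RootSystem.mono_mem (ht : 1 ≤ t.1) (a : ℤ_[p]) (i : ℤ) :
    ζ.mono a i ∈ wittBall (valCflat p) t n (‖a‖₊ * radius p t ^ i) := by
  rcases eq_or_ne a 0 with rfl | ha
  · rw [mono_zero]; exact zero_mem _
  rw [mono_eq ζ ha]
  have h1 : ζ.mono (PadicInt.unitCoeff ha) i ∈ wittBall (valCflat p) t n (1 * radius p t ^ i) :=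
    mul_mem_wittBall (mem_wittBall_of_integral (algebraMap_integral _)) (ζ.u_zpow_mem ht i)
  rw [one_mul] at h1
  intro j hj
  refine (wittTerm_pow_mul_le _ _ j fun i hi => h1 i (hi.trans hj)).trans_eq ?_
  rw [NNReal.coe_mul, coe_nnnorm, norm_eq_zpow_valuation ha]

lemma RootSystem.mono_dvd {a : ℤ_[p]} {m : ℕ} (h : (p : ℤ_[p]) ^ m ∣ a) (i : ℤ) :
    (p : WTilt p) ^ m ∣ ζ.mono a i := by
  obtain ⟨b, rfl⟩ := h
  exact ⟨ζ.mono b i, by rw [mono_mul, map_pow, map_natCast]⟩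

lemma dvd_of_lt_valuation {a : ℤ_[p]} {m : ℕ} (h : a ≠ 0 → m ≤ a.valuation) :
    (p : ℤ_[p]) ^ m ∣ a := by
  rcases eq_or_ne a 0 with rfl | ha
  · exact dvd_zero _
  · rw [← Ideal.mem_span_singleton]
    exact (PadicInt.mem_span_pow_iff_le_valuation a ha m).2 (h ha)

/-- The coefficient of index `v_p(a)` of `a u^i` has the size of `a u^i`. -/
lemma RootSystem.wittTerm_mono {a : ℤ_[p]} (ha : a ≠ 0) (i : ℤ) :
    wittTerm (valCflat p) t (ζ.mono a i) a.valuation = ‖a‖ * radius p t ^ i := by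
  rw [mono_eq ζ ha, norm_eq_zpow_valuation ha]
  have := wittTerm_pow_mul (v := valCflat p) (t := t)
    (ζ.mono (PadicInt.unitCoeff ha) i) a.valuation 0
  rw [zero_add] at this
  rw [this, wittTerm, pow_zero, one_mul, ← ζ.val_zpow]
  have hu : ∀ y : (WTilt p)ˣ, (∀ j, valCflat p ((y : WTilt p).coeff j) ≤ 1) →
      (∀ j, valCflat p (((y⁻¹ : (WTilt p)ˣ) : WTilt p).coeff j) ≤ 1) →
      valCflat p ((y : WTilt p).coeff 0) = 1 := by
    intro y h1 h2
    have h3 : valCflat p (((y : WTilt p) * ((y⁻¹ : (WTilt p)ˣ) : WTilt p)).coeff 0) = 1 := by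
      rw [Units.mul_inv, one_coeff_zero, map_one]
    rw [mul_coeff_zero, map_mul] at h3
    refine le_antisymm (h1 0) ?_
    rw [← h3]
    exact mul_le_of_le_one_right zero_le (h2 0)
  have h1 : valCflat p ((algebraMap ℤ_[p] (WTilt p) (PadicInt.unitCoeff ha)).coeff 0) = 1 :=
    hu (Units.map (algebraMap ℤ_[p] (WTilt p)).toMonoidHom (PadicInt.unitCoeff ha))
      (algebraMap_integral _) (by rw [← map_inv]; exact algebraMap_integral _)
  have h2 : (((ζ.uUnit ^ i : (WTilt p)ˣ) : WTilt p)).coeff 0 = ζ.epsSubOne ^ i := by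
    have : Units.map (WittVector.constantCoeff (p := p) (R := Cflat p)).toMonoidHom ζ.uUnit =
      Units.mk0 _ ζ.epsSubOne_ne_zero := Units.ext ζ.u_coeff_zero
    have h4 := congrArg (fun y : (Cflat p)ˣ => ((y ^ i : (Cflat p)ˣ) : Cflat p)) this
    simp only [← map_zpow] at h4
    rw [Units.val_zpow_eq_zpow_val, Units.val_mk0] at h4
    exact h4
  have h0 : teichCoeff (ζ.mono (PadicInt.unitCoeff ha) i) 0 =
      (ζ.mono (PadicInt.unitCoeff ha) i).coeff 0 := by
    rw [teichCoeff_eq_iff, pow_zero, pow_one]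
  rw [h0, mono, mul_coeff_zero, map_mul, h1, one_mul, h2]

/-- The truncated norm of a Laurent polynomial in `u` is the maximum of the norms of its terms.
Among the terms of maximal norm, the one with the largest exponent has the coefficient of the
smallest valuation `v0`; at the level `v0` it dominates all others, so it cannot be cancelled. -/
lemma RootSystem.le_of_sum_mem (ht : 1 ≤ t.1) {F : Finset ℤ} {a : ℤ → ℤ_[p]} {ρ : NNReal}
    (h : ∑ i ∈ F, ζ.mono (a i) i ∈ wittBall (valCflat p) t n ρ) {i : ℤ} (hi : i ∈ F)
    (hv : (a i).valuation ≤ n) : ‖a i‖₊ * radius p t ^ i ≤ ρ := by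
  classical
  by_contra hlt
  push Not at hlt
  have hai : a i ≠ 0 := by rintro h; rw [h] at hlt; simp at hlt
  let S : Finset ℤ := F.filter fun i => a i ≠ 0 ∧ (a i).valuation ≤ n
  obtain ⟨m, hm, hmax⟩ := S.exists_max_image (fun i => ‖a i‖₊ * radius p t ^ i)
    ⟨i, by simp [S, hi, hai, hv]⟩
  let S' : Finset ℤ := S.filter fun i => ‖a i‖₊ * radius p t ^ i = ‖a m‖₊ * radius p t ^ m
  -- Take the largest exponent among the terms of maximal norm.
  obtain ⟨l, hl, hlmax⟩ := S'.exists_max_image id ⟨m, by simp [S', hm]⟩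
  have hlS := (Finset.mem_filter.1 hl).1
  have hlm := (Finset.mem_filter.1 hl).2
  have hlF := (Finset.mem_filter.1 hlS).1
  obtain ⟨hl0, hlv⟩ := (Finset.mem_filter.1 hlS).2
  have hml : ρ < ‖a l‖₊ * radius p t ^ l := hlt.trans_le (by
    rw [hlm]; exact hmax i (by simp [S, hi, hai, hv]))
  set v0 := (a l).valuation with hv0
  -- All other terms are smaller at the level `v0`.
  have hsmall : ∀ j ∈ F.erase l, ∃ τ < ‖a l‖₊ * radius p t ^ l,
      ζ.mono (a j) j ∈ wittBall (valCflat p) t v0 τ := by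
    intro j hj
    obtain ⟨hjl, hjF⟩ := Finset.mem_erase.1 hj
    by_cases hjv : a j ≠ 0 ∧ (a j).valuation ≤ v0
    · have hjS : j ∈ S := by simp [S, hjF, hjv.1, hjv.2.trans hlv]
      refine ⟨_, lt_of_le_of_ne ?_ ?_, ζ.mono_mem ht _ _⟩
      · rw [hlm]; exact hmax j hjS
      · intro he
        have hjS' : j ∈ S' := by simp only [S', Finset.mem_filter]; exact ⟨hjS, he.trans hlm⟩
        have hjl' : j < l := lt_of_le_of_ne (hlmax j hjS') hjl
        have h1 : ‖a l‖₊ ≤ ‖a j‖₊ := by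
          rw [← NNReal.coe_le_coe, coe_nnnorm, coe_nnnorm, norm_eq_zpow_valuation hl0,
            norm_eq_zpow_valuation hjv.1]
          exact pow_le_pow_of_le_one (inv_nonneg.2 (p_pos p).le)
            (inv_le_one_of_one_le₀ (one_lt_p p).le) hjv.2
        have h2 : radius p t ^ l < radius p t ^ j :=
          zpow_lt_zpow_right_of_lt_one₀ (radius_pos t) (radius_lt_one t) hjl'
        have h3 : ‖a l‖₊ * radius p t ^ l < ‖a j‖₊ * radius p t ^ j :=
          mul_lt_mul_of_le_of_lt_of_pos_of_nonneg h1 h2 (by simpa using hl0) zero_le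
        exact h3.ne' he
    · refine ⟨0, zero_le.trans_lt hml, mem_wittBall_of_dvd (ζ.mono_dvd ?_ j)⟩
      refine dvd_of_lt_valuation fun h0 => ?_
      by_contra h5
      exact hjv ⟨h0, by omega⟩
  choose! τ hτ hτm using hsmall
  let T := (F.erase l).sup τ ⊔ ρ
  have hT : T < ‖a l‖₊ * radius p t ^ l := max_lt
    ((Finset.sup_lt_iff (zero_le.trans_lt hml)).2 hτ) hml
  have h1 : ζ.mono (a l) l ∈ wittBall (valCflat p) t v0 T := by
    have h2 : ∑ j ∈ F.erase l, ζ.mono (a j) j ∈ wittBall (valCflat p) t v0 T :=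
      sum_mem fun j hj => wittBall_mono ((Finset.le_sup hj).trans le_sup_left) (hτm j hj)
    have h3 := sub_mem (wittBall_mono (le_sup_right : ρ ≤ T) (wittBall_anti hlv h)) h2
    rwa [← Finset.add_sum_erase F _ hlF, add_sub_cancel_right] at h3
  have h4 := h1 v0 le_rfl
  rw [ζ.wittTerm_mono hl0] at h4
  exact absurd hT (not_lt.2 (by exact_mod_cast h4))

end Laurent


/-! ### Laurent expansions in `A_{ℚ_p}` -/

section Expansion

open WittVector

variable {p : ℕ} [hp : Fact p.Prime] (ζ : RootSystem p)

/-- The number `1` as an element of `Pos`. -/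
def onePos : Pos := ⟨1, Set.mem_Ioi.2 one_pos⟩

lemma onePos_val : onePos.1 = 1 := rfl

lemma one_le_onePos : 1 ≤ onePos.1 := le_rfl

/-- For a fixed truncation, the topology for the radius `1` is at least as fine as that for `t`. -/
lemma exists_wittBall_le (t : Pos) (n : ℕ) {δ : NNReal} (hδ : 0 < δ) : ∃ δ' : NNReal, 0 < δ' ∧
    wittBall (p := p) (valCflat p) onePos n δ' ≤ wittBall (valCflat p) t n δ := by
  have hp0 := p_pos p
  have ht : t.1 ≠ 0 := t.2.ne'
  have hpn : (0 : NNReal) < (p : NNReal) ^ n := pow_pos (by exact_mod_cast hp.out.pos) n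
  refine ⟨δ ^ t.1 / p ^ n, div_pos (NNReal.rpow_pos hδ) hpn, fun x hx j hj => ?_⟩
  have h1 := hx j hj
  have hpj : (1 : ℝ) ≤ (p : ℝ) ^ j := one_le_pow₀ (one_lt_p p).le
  have h0 := wittTerm_nonneg (valCflat p) onePos x j
  have h2 : (p : ℝ) ^ j * wittTerm (valCflat p) onePos x j ≤ (δ : ℝ) ^ t.1 := by
    calc (p : ℝ) ^ j * wittTerm (valCflat p) onePos x j
        ≤ (p : ℝ) ^ n * ((δ ^ t.1 / p ^ n : NNReal) : ℝ) :=
          mul_le_mul (pow_le_pow_right₀ (one_lt_p p).le hj) h1 h0 (pow_nonneg hp0.le n)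
      _ = (δ : ℝ) ^ t.1 := by
          push_cast
          field_simp
  calc wittTerm (valCflat p) t x j ≤ (p : ℝ) ^ j * wittTerm (valCflat p) t x j :=
        le_mul_of_one_le_left (wittTerm_nonneg _ _ _ _) hpj
    _ = ((p : ℝ) ^ j * wittTerm (valCflat p) onePos x j) ^ (1 / t.1) :=
        wittTerm_eq_rpow (v := valCflat p) onePos t x j
    _ ≤ ((δ : ℝ) ^ t.1) ^ (1 / t.1) := Real.rpow_le_rpow
        (mul_nonneg (pow_nonneg hp0.le j) h0) h2 (one_div_nonneg.2 t.2.le)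
    _ = δ := by rw [← Real.rpow_mul NNReal.zero_le_coe, mul_one_div_cancel ht, Real.rpow_one]

/-- The Laurent series `∑ a_i u^i` converges to `x` modulo `p^(n+1)`, for the weak topology of
`Ã`. -/
def RootSystem.RepresentsAt (n : ℕ) (x : WTilt p) (a : ℤ → ℤ_[p]) : Prop :=
  ∀ δ : NNReal, 0 < δ → ∀ᶠ F : Finset ℤ in atTop,
    x - ∑ i ∈ F, ζ.mono (a i) i ∈ wittBall (valCflat p) onePos n δ

/-- The Laurent series `∑ a_i u^i` converges to `x` for the weak topology of `Ã`. -/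
def RootSystem.Represents (x : WTilt p) (a : ℤ → ℤ_[p]) : Prop := ∀ n, ζ.RepresentsAt n x a

variable {ζ} {x y : WTilt p} {a b : ℤ → ℤ_[p]} {n : ℕ} {t : Pos}

lemma RootSystem.RepresentsAt.mem (h : ζ.RepresentsAt n x a) (t : Pos) {δ : NNReal} (hδ : 0 < δ) :
    ∀ᶠ F : Finset ℤ in atTop, x - ∑ i ∈ F, ζ.mono (a i) i ∈ wittBall (valCflat p) t n δ := by
  obtain ⟨δ', hδ', hle⟩ := exists_wittBall_le (p := p) t n hδ
  exact (h δ' hδ').mono fun F hF => hle hF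

lemma RootSystem.RepresentsAt.anti {m : ℕ} (h : ζ.RepresentsAt n x a) (hm : m ≤ n) :
    ζ.RepresentsAt m x a := fun δ hδ => (h δ hδ).mono fun _ hF => wittBall_anti hm hF

lemma RootSystem.RepresentsAt.add (hx : ζ.RepresentsAt n x a) (hy : ζ.RepresentsAt n y b) :
    ζ.RepresentsAt n (x + y) (a + b) := fun δ hδ => by
  filter_upwards [hx δ hδ, hy δ hδ] with F h1 h2
  have := add_mem h1 h2
  rw [sub_add_sub_comm, ← Finset.sum_add_distrib] at this
  simpa only [Pi.add_apply, RootSystem.mono_add] using this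

lemma RootSystem.RepresentsAt.smul (c : ℤ_[p]) (hx : ζ.RepresentsAt n x a) :
    ζ.RepresentsAt n (c • x) (c • a) := fun δ hδ => by
  filter_upwards [hx δ hδ] with F h1
  have := mul_mem_wittBall (mem_wittBall_of_integral (n := n) (t := onePos)
    (algebraMap_integral c)) h1
  rw [one_mul, mul_sub, Finset.mul_sum] at this
  simpa only [Algebra.smul_def c x, Pi.smul_apply, smul_eq_mul, RootSystem.mono_mul] using this

lemma RootSystem.RepresentsAt.sub (hx : ζ.RepresentsAt n x a) (hy : ζ.RepresentsAt n y b) :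
    ζ.RepresentsAt n (x - y) (a - b) := by
  have := hx.add (hy.smul (-1))
  simpa only [neg_smul, one_smul, ← sub_eq_add_neg] using this

lemma RootSystem.RepresentsAt.le (h : ζ.RepresentsAt n x a) (ht : 1 ≤ t.1) {ρ : NNReal}
    (hx : x ∈ wittBall (valCflat p) t n ρ) {i : ℤ} (hv : (a i).valuation ≤ n) :
    ‖a i‖₊ * radius p t ^ i ≤ ρ := by
  refine le_of_forall_pos_le_add fun δ hδ => ?_
  obtain ⟨F, hF, hiF⟩ := ((h.mem t hδ).and (eventually_ge_atTop {i})).exists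
  have h1 := sub_mem (wittBall_mono (le_self_add : ρ ≤ ρ + δ) hx)
    (wittBall_mono (le_add_self : δ ≤ ρ + δ) hF)
  rw [sub_sub_cancel] at h1
  exact ζ.le_of_sum_mem ht h1 (hiF (Finset.mem_singleton_self i)) hv

lemma RootSystem.RepresentsAt.dvd (h : ζ.RepresentsAt n x a) (h' : ζ.RepresentsAt n x b) (i : ℤ) :
    (p : ℤ_[p]) ^ (n + 1) ∣ a i - b i := by
  have h0 := h.sub h'
  rw [sub_self] at h0
  refine dvd_of_lt_valuation fun hne => ?_
  by_contra hlt
  have := h0.le (t := onePos) one_le_onePos (zero_mem (wittBall (valCflat p) onePos n 0)) (i := i)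
    (by change (a i - b i).valuation ≤ n; omega)
  have h1 : 0 < ‖(a - b) i‖₊ * radius p onePos ^ i :=
    mul_pos (nnnorm_pos.2 hne) (zpow_pos (radius_pos _) _)
  exact absurd this (not_le.2 h1)

lemma RootSystem.Represents.unique (h : ζ.Represents x a) (h' : ζ.Represents x b) : a = b := by
  funext i
  rw [← sub_eq_zero]
  by_contra hne
  have h1 := (h (a i - b i).valuation).dvd (h' _) i
  rw [← Ideal.mem_span_singleton, PadicInt.mem_span_pow_iff_le_valuation _ hne] at h1
  omega

lemma RootSystem.Represents.le (h : ζ.Represents x a) (ht : 1 ≤ t.1)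
    (hx : x ∈ Atilde p (valCflat p) t) (i : ℤ) :
    ‖a i‖ * radius p t ^ i ≤ wittNorm (valCflat p) t x := by
  have := (h (a i).valuation).le ht (ρ := ⟨_, wittNorm_nonneg (valCflat p) t x⟩)
    (fun j _ => wittTerm_le_wittNorm _ hx j) le_rfl
  exact_mod_cast this

/-- A tail of a Laurent expansion is bounded by the supremum of its terms. -/
lemma RootSystem.Represents.sub_mem (h : ζ.Represents x a) (ht : 1 ≤ t.1) {F : Finset ℤ}
    {ρ : NNReal} (hρ : 0 < ρ) (hF : ∀ i ∉ F, ‖a i‖₊ * radius p t ^ i ≤ ρ) (n : ℕ) :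
    x - ∑ i ∈ F, ζ.mono (a i) i ∈ wittBall (valCflat p) t n ρ := by
  classical
  obtain ⟨G, hG, hFG⟩ := (((h n).mem t hρ).and (eventually_ge_atTop F)).exists
  have h1 : ∑ i ∈ G \ F, ζ.mono (a i) i ∈ wittBall (valCflat p) t n ρ :=
    sum_mem fun i hi => wittBall_mono (hF i (Finset.mem_sdiff.1 hi).2) (ζ.mono_mem ht _ _)
  have := add_mem hG h1
  rwa [← Finset.sum_sdiff hFG, sub_add_eq_sub_sub_swap, sub_add_cancel] at this

variable (ζ)

open Polynomial in
/-- Modulo `p^(n+1)`, an element of `A_{ℚ_p}` is of the form `u^(-m) f(u)` for a power series `f`.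
-/
lemma RootSystem.exists_representsAt (hx : x ∈ ζ.AQp) (n : ℕ) : ∃ a, ζ.RepresentsAt n x a := by
  obtain ⟨m, z, ⟨f, hf⟩, hd⟩ := hx (n + 1)
  let a : ℤ → ℤ_[p] := fun i => if 0 ≤ i + m then PowerSeries.coeff (i + m).toNat f else 0
  refine ⟨a, fun δ hδ => ?_⟩
  obtain ⟨N, hN⟩ := exists_pow_lt_of_lt_one (x := δ * radius p onePos ^ (m : ℤ))
    (mul_pos hδ (zpow_pos (radius_pos _) _)) (radius_lt_one (p := p) onePos)
  have hN' : radius p onePos ^ ((N : ℤ) - m) ≤ δ := by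
    rw [zpow_sub₀ (radius_pos _).ne', zpow_natCast, div_le_iff₀ (zpow_pos (radius_pos _) _)]
    exact hN.le
  have hsum : ∑ i ∈ Finset.Ico (-(m : ℤ)) (N - m), ζ.mono (a i) i =
      ((ζ.uUnit ^ (-(m : ℤ)) : (WTilt p)ˣ) : WTilt p) *
        inclOflat p (aeval ζ.uInt (f.trunc N)) := by
    have h1 : aeval ζ.uInt (f.trunc N) = ∑ j ∈ Finset.range N,
        algebraMap ℤ_[p] _ (PowerSeries.coeff j f) * ζ.uInt ^ j :=
      PowerSeries.eval₂_trunc_eq_sum_range _ _ _ _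
    rw [h1, map_sum, Finset.mul_sum]
    symm
    refine Finset.sum_nbij' (fun j : ℕ => (j : ℤ) - m) (fun i => (i + m).toNat) ?_ ?_ ?_ ?_ ?_
    · intro j hj
      have := Finset.mem_range.1 hj
      exact Finset.mem_Ico.2 (by omega)
    · intro i hi
      have := Finset.mem_Ico.1 hi
      exact Finset.mem_range.2 (by omega)
    · intro j _
      simp
    · intro i hi
      have := Finset.mem_Ico.1 hi
      omega
    · intro j _
      have h2 : a ((j : ℤ) - m) = PowerSeries.coeff j f := by simp [a]
      rw [h2, map_mul, map_pow, AlgHom.commutes, RootSystem.mono, sub_eq_neg_add, zpow_add,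
        Units.val_mul, zpow_natCast, Units.val_pow_eq_pow_val, ζ.val_uUnit,
        show inclOflat p ζ.uInt = ζ.u from rfl]
      ring
  filter_upwards [eventually_ge_atTop (Finset.Ico (-(m : ℤ)) (N - m))] with F hF
  classical
  rw [← Finset.sum_sdiff hF, ← sub_sub, sub_right_comm]
  refine sub_mem ?_ (sum_mem fun i hi => ?_)
  · obtain ⟨w, hw⟩ := hf N
    obtain ⟨w', hw'⟩ := hd
    have h1 : x - ∑ i ∈ Finset.Ico (-(m : ℤ)) (N - m), ζ.mono (a i) i =
        (p : WTilt p) ^ (n + 1) * (((ζ.uUnit ^ (-(m : ℤ)) : (WTilt p)ˣ) : WTilt p) * w') +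
        ((ζ.uUnit ^ ((N : ℤ) - m) : (WTilt p)ˣ) : WTilt p) * inclOflat p w := by
      have h2 := congrArg (inclOflat p) hw
      rw [map_sub, map_mul, map_pow] at h2
      change _ = ζ.u ^ N * _ at h2
      rw [hsum, sub_eq_add_neg (N : ℤ), zpow_add, Units.val_mul, zpow_natCast,
        Units.val_pow_eq_pow_val, ζ.val_uUnit]
      have h3 : x = ((ζ.uUnit ^ (-(m : ℤ)) : (WTilt p)ˣ) : WTilt p) * (ζ.u ^ m * x) := by
        rw [← ζ.val_uUnit, ← Units.val_pow_eq_pow_val, ← zpow_natCast, ← mul_assoc,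
          ← Units.val_mul, ← zpow_add, neg_add_cancel, zpow_zero, Units.val_one, one_mul]
      rw [h3]
      linear_combination ((ζ.uUnit ^ (-(m : ℤ)) : (WTilt p)ˣ) : WTilt p) * (hw' + h2)
    rw [h1]
    refine add_mem (mem_wittBall_of_dvd (dvd_mul_right _ _)) (wittBall_mono hN' ?_)
    have := mul_mem_wittBall (ζ.u_zpow_mem (n := n) (t := onePos) one_le_onePos ((N : ℤ) - m))
      (mem_wittBall_of_integral (valCflat_inclOflat p w))
    rwa [mul_one] at this
  · obtain ⟨-, hi⟩ := Finset.mem_sdiff.1 hi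
    rcases lt_or_ge i (-(m : ℤ)) with h | h
    · have : a i = 0 := if_neg (by omega)
      rw [this, RootSystem.mono_zero]
      exact zero_mem _
    · have hi' : (N : ℤ) - m ≤ i := by
        by_contra h'
        exact hi (Finset.mem_Ico.2 ⟨h, by omega⟩)
      refine wittBall_mono ?_ (ζ.mono_mem one_le_onePos _ _)
      have h1 : ‖a i‖₊ ≤ 1 := PadicInt.norm_le_one _
      refine (mul_le_of_le_one_left zero_le h1).trans (le_trans ?_ hN')
      exact zpow_le_zpow_right_of_le_one₀ (radius_pos _) (radius_lt_one _).le hi'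

/-- Every element of `A_{ℚ_p}` has a Laurent expansion in `u`. -/
lemma RootSystem.exists_represents (hx : x ∈ ζ.AQp) : ∃ a, ζ.Represents x a := by
  -- The coefficients modulo the powers of `p` are unique, so they converge `p`-adically.
  choose a ha using ζ.exists_representsAt hx
  have hc : ∀ i, ∃ L : ℤ_[p], ∀ n, (p : ℤ_[p]) ^ n ∣ a n i - L := by
    intro i
    have hmem : ∀ (n : ℕ) (c d : ℤ_[p]), (p : ℤ_[p]) ^ n ∣ c - d ↔
        c ≡ d [SMOD (IsLocalRing.maximalIdeal ℤ_[p] ^ n • ⊤ : Submodule ℤ_[p] ℤ_[p])] := by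
      intro n c d
      rw [SModEq.sub_mem, smul_eq_mul, Ideal.mul_top, PadicInt.maximalIdeal_eq_span_p,
        Ideal.span_singleton_pow, Ideal.mem_span_singleton]
    obtain ⟨L, hL⟩ := IsPrecomplete.prec (I := IsLocalRing.maximalIdeal ℤ_[p]) (M := ℤ_[p])
      inferInstance (f := fun n => a n i) (fun {m n} hmn => (hmem _ _ _).1
        ((pow_dvd_pow _ (Nat.le_succ m)).trans ((ha m).dvd ((ha n).anti hmn) i)))
    exact ⟨L, fun n => (hmem _ _ _).2 (hL n)⟩
  choose L hL using hc
  refine ⟨L, fun n δ hδ => ?_⟩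
  filter_upwards [(ha (n + 1)).anti (Nat.le_succ n) δ hδ] with F hF
  have h1 : ∑ i ∈ F, ζ.mono (a (n + 1) i - L i) i ∈ wittBall (valCflat p) onePos n δ :=
    sum_mem fun i _ => mem_wittBall_of_dvd (ζ.mono_dvd (hL i (n + 1)) i)
  have := add_mem hF h1
  simp only [RootSystem.mono_sub, Finset.sum_sub_distrib] at this
  rwa [sub_add_sub_cancel] at this

/-- A single term `a u^i` is its own Laurent expansion. -/
lemma RootSystem.represents_mono (c : ℤ_[p]) (i : ℤ) :
    ζ.Represents (ζ.mono c i) (Pi.single i c) := fun n δ hδ => by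
  filter_upwards [eventually_ge_atTop {i}] with F hF
  rw [Finset.sum_eq_single_of_mem i (hF (Finset.mem_singleton_self i)), Pi.single_eq_same, sub_self]
  · exact zero_mem _
  · intro j _ hj
    rw [Pi.single_eq_of_ne hj, RootSystem.mono_zero]

/-- The terms of the Laurent expansion of an element of `A_{ℚ_p}^{†,r}`, `r > 1`, tend to `0`. The
truncated norms for the radius `1` control the terms with coefficient of a given valuation; since
`r > 1`, this bound improves with the valuation. -/
lemma RootSystem.Represents.finite_lt {r : Pos} (hr : 1 < r.1)
    (hx : x ∈ Atilde p (valCflat p) r) (ha : ζ.Represents x a) {η : ℝ} (hη : 0 < η) :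
    {i | η < ‖a i‖ * (radius p r : ℝ) ^ i}.Finite := by
  have hp0 := p_pos p
  have hp1 := one_lt_p p
  have hr0 : (0 : ℝ) < radius p r := radius_pos r
  have hr1 : (radius p r : ℝ) < 1 := radius_lt_one r
  have hrr : 0 < r.1 := r.2
  have hr' : 0 < r.1 - 1 := sub_pos.2 hr
  obtain ⟨J, hJ⟩ := eventually_atTop.1 (hx.2.eventually_le_const hη)
  -- The valuations of the coefficients in question are bounded.
  obtain ⟨K, hK⟩ : ∃ K : ℕ, ∀ i, η < ‖a i‖ * (radius p r : ℝ) ^ i → (a i).valuation ≤ K := by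
    have hlim : Tendsto (fun k : ℕ => (p : ℝ) ^ (J * (r.1 - 1)) *
        (((p : ℝ) ^ (-(r.1 - 1))) ^ k)) atTop (𝓝 ((p : ℝ) ^ (J * (r.1 - 1)) * 0)) :=
      (tendsto_pow_atTop_nhds_zero_of_lt_one (Real.rpow_nonneg hp0.le _)
        (Real.rpow_lt_one_of_one_lt_of_neg hp1 (neg_lt_zero.2 hr'))).const_mul _
    rw [mul_zero] at hlim
    obtain ⟨K, hK⟩ := eventually_atTop.1 (hlim.eventually_lt_const (Real.rpow_pos_of_pos hη r.1))
    refine ⟨K, fun i hi => ?_⟩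
    by_contra hlt
    push Not at hlt
    set k := (a i).valuation with hk
    have hne : a i ≠ 0 := by rintro h; rw [h] at hi; simp at hi; linarith
    have hKk := hK k hlt.le
    -- For `j < J` the terms of `x` for the radius `r` are bounded by `1`, for `j ≥ J` by `η`; `ρ`
    -- is the resulting bound for the radius `1`.
    set ρ : ℝ := max ((p : ℝ) ^ (J * (r.1 - 1))) ((p : ℝ) ^ (k * (r.1 - 1)) * η ^ r.1) with hρ
    have hmem : x ∈ wittBall (valCflat p) onePos k ⟨ρ, le_max_of_le_left
        (Real.rpow_nonneg hp0.le _)⟩ := by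
      intro j hj
      have h1 := wittTerm_eq_rpow (v := valCflat p) r onePos x j
      have h0 := wittTerm_nonneg (valCflat p) r x j
      have h2 : wittTerm (valCflat p) onePos x j =
          (p : ℝ) ^ (j * (r.1 - 1)) * (wittTerm (valCflat p) r x j) ^ r.1 := by
        have hpj : (0 : ℝ) < (p : ℝ) ^ j := pow_pos hp0 j
        have e : ((p : ℝ) ^ j) ^ r.1 = (p : ℝ) ^ j * (p : ℝ) ^ (j * (r.1 - 1)) := by
          rw [← Real.rpow_natCast, ← Real.rpow_mul hp0.le, ← Real.rpow_add hp0]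
          congr 1; ring
        rw [onePos_val, div_one, Real.mul_rpow hpj.le h0, e, mul_assoc] at h1
        exact mul_left_cancel₀ hpj.ne' h1
      change wittTerm (valCflat p) onePos x j ≤ ρ
      rw [h2]
      rcases lt_or_ge j J with h | h
      · refine le_max_of_le_left ((mul_le_of_le_one_right (Real.rpow_nonneg hp0.le _)
          (Real.rpow_le_one h0 (hx.1 j) hrr.le)).trans ?_)
        refine Real.rpow_le_rpow_of_exponent_le hp1.le (mul_le_mul_of_nonneg_right ?_ hr'.le)
        exact_mod_cast h.le
      · refine le_max_of_le_right (mul_le_mul ?_ (Real.rpow_le_rpow h0 (hJ j h) hrr.le)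
          (Real.rpow_nonneg h0 _) (Real.rpow_nonneg hp0.le _))
        refine Real.rpow_le_rpow_of_exponent_le hp1.le (mul_le_mul_of_nonneg_right ?_ hr'.le)
        exact_mod_cast hj
    have h3 := (ha k).le (t := onePos) one_le_onePos hmem (i := i) le_rfl
    have h3' : ‖a i‖ * (radius p onePos : ℝ) ^ i ≤ ρ := by exact_mod_cast h3
    -- Compare with the term for the radius `r`.
    have h4 : (‖a i‖ * (radius p r : ℝ) ^ i) ^ r.1 =
        (p : ℝ) ^ (-(k * (r.1 - 1))) * (‖a i‖ * (radius p onePos : ℝ) ^ i) := by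
      have e1 : ((radius p r : ℝ) ^ i) ^ r.1 = (radius p onePos : ℝ) ^ i := by
        rw [← Real.rpow_intCast, ← Real.rpow_intCast, ← Real.rpow_mul hr0.le, mul_comm (i : ℝ),
          Real.rpow_mul hr0.le]
        congr 1
        have := radius_rpow (p := p) r onePos
        rw [onePos_val, div_one] at this
        exact_mod_cast this
      have e2 : ‖a i‖ ^ r.1 = (p : ℝ) ^ (-(k * (r.1 - 1))) * ‖a i‖ := by
        rw [norm_eq_zpow_valuation hne, ← hk, ← Real.rpow_natCast, ← Real.rpow_neg_one,
          ← Real.rpow_mul hp0.le, ← Real.rpow_mul hp0.le, ← Real.rpow_add hp0]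
        congr 1; ring
      rw [Real.mul_rpow (norm_nonneg _) (zpow_nonneg hr0.le _), e1, e2, mul_assoc]
    have h5 : η ^ r.1 < (p : ℝ) ^ (-(k * (r.1 - 1))) * ρ := by
      refine (Real.rpow_lt_rpow hη.le hi hrr).trans_le ?_
      rw [h4]
      exact mul_le_mul_of_nonneg_left h3' (Real.rpow_nonneg hp0.le _)
    rw [hρ, mul_max_of_nonneg _ _ (Real.rpow_nonneg hp0.le _), ← mul_assoc,
      ← Real.rpow_add hp0 (-(k * (r.1 - 1))) (k * (r.1 - 1)), neg_add_cancel, Real.rpow_zero,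
      one_mul, lt_max_iff] at h5
    rcases h5 with h5 | h5
    · rw [mul_comm] at hKk
      rw [← Real.rpow_natCast, ← Real.rpow_mul hp0.le,
        show -(r.1 - 1) * (k : ℝ) = -(k * (r.1 - 1)) by ring] at hKk
      exact lt_asymm h5 hKk
    · exact lt_irrefl _ h5
  -- Hence the indices are bounded.
  obtain ⟨N, hN⟩ := exists_pow_lt_of_lt_one hη hr1
  obtain ⟨M, hM⟩ := exists_pow_lt_of_lt_one (pow_pos (inv_pos.2 hp0) K) hr1
  refine (Set.finite_Icc (-(M : ℤ)) N).subset fun i hi => ?_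
  have hi' : η < ‖a i‖ * (radius p r : ℝ) ^ i := hi
  have hne : a i ≠ 0 := by rintro h; rw [h] at hi'; simp at hi'; linarith
  constructor
  · by_contra hlt
    push Not at hlt
    have h1 := (ha.le hr.le hx i).trans (wittNorm_le_one _ hx)
    rw [norm_eq_zpow_valuation hne] at h1
    have h2 : ((p : ℝ)⁻¹) ^ K ≤ ((p : ℝ)⁻¹) ^ (a i).valuation :=
      pow_le_pow_of_le_one (inv_nonneg.2 hp0.le) (inv_le_one_of_one_le₀ hp1.le) (hK i hi')
    have h3 : (radius p r : ℝ) ^ (-(M : ℤ)) ≤ (radius p r : ℝ) ^ i :=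
      zpow_le_zpow_right_of_le_one₀ hr0 hr1.le hlt.le
    have h4 : 1 < ((p : ℝ)⁻¹) ^ K * (radius p r : ℝ) ^ (-(M : ℤ)) := by
      rw [zpow_neg, zpow_natCast, lt_mul_inv_iff₀ (pow_pos hr0 M), one_mul]
      exact hM
    exact absurd (h4.trans_le (mul_le_mul h2 h3 (zpow_nonneg hr0.le _)
      (pow_nonneg (inv_nonneg.2 hp0.le) _))) (not_lt.2 h1)
  · by_contra hlt
    push Not at hlt
    have h1 : (radius p r : ℝ) ^ i ≤ (radius p r : ℝ) ^ (N : ℤ) :=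
      zpow_le_zpow_right_of_le_one₀ hr0 hr1.le hlt.le
    rw [zpow_natCast] at h1
    have h2 := mul_le_of_le_one_left (zpow_nonneg hr0.le i) (PadicInt.norm_le_one (a i))
    linarith

end Expansion


/-! ### Completions for a family of seminorms -/

section HatTopology

variable {A : Type*} [CommRing A] {J : Type*} (q : J → RingSeminorm A)

/-- The neighbourhoods of zero are generated by the balls of the seminorms. -/
lemma WithSeminorms.nhds_zero :
    (𝓝 (0 : WithSeminorms q)) = ⨅ j, comap (fun a : WithSeminorms q => q j a) (𝓝 0) := by
  have ht : (𝓝 (0 : WithSeminorms q)) = ⨅ j, @nhds A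
      ((q j).toSeminormedRing.toPseudoMetricSpace.toUniformSpace.toTopologicalSpace) 0 := by
    rw [← nhds_iInf, ← WithSeminorms.topology_eq q]
    rfl
  rw [ht]
  congr 1
  funext j
  let := (q j).toSeminormedRing
  exact (comap_norm_nhds_zero (E := A)).symm

lemma WithSeminorms.exists_of_mem_nhds {U : Set (WithSeminorms q)} (hU : U ∈ 𝓝 0) :
    ∃ (S : Finset J) (ε : J → ℝ), (∀ j ∈ S, 0 < ε j) ∧
      ∀ a : WithSeminorms q, (∀ j ∈ S, q j a < ε j) → a ∈ U := by
  classical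
  have hb : ∀ j, (comap (fun a : WithSeminorms q => q j a) (𝓝 0)).HasBasis
      (fun ε : ℝ => 0 < ε) fun ε => {a | q j a < ε} := fun j => by
    refine ((nhds_basis_zero_abs_lt ℝ).comap _).congr (fun _ => Iff.rfl) fun ε _ => ?_
    ext a
    exact iff_of_eq (congrArg (· < ε) (abs_of_nonneg (apply_nonneg (q j) (show A from a))))
  rw [WithSeminorms.nhds_zero, (HasBasis.iInf' hb).mem_iff] at hU
  obtain ⟨⟨I, ε⟩, ⟨hI, hε⟩, hU⟩ := hU
  refine ⟨hI.toFinset, ε, fun j hj => hε j (hI.mem_toFinset.1 hj), fun a ha => hU ?_⟩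
  exact Set.mem_iInter₂.2 fun j hj => ha j (hI.mem_toFinset.2 hj)

namespace Hat

lemma exists_of_mem_nhds {U : Set (Hat q)} (hU : U ∈ 𝓝 0) :
    ∃ (S : Finset J) (ε : J → ℝ), (∀ j ∈ S, 0 < ε j) ∧
      ∀ x : Hat q, (∀ j ∈ S, seminorm q j x < ε j) → x ∈ U := by
  obtain ⟨V, hV, hVU⟩ := exists_nhds_zero_half hU
  have hc : Continuous (fun a : WithSeminorms q => (a : Hat q)) :=
    UniformSpace.Completion.continuous_coe _
  have hV' : (fun a : WithSeminorms q => (a : Hat q)) ⁻¹' V ∈ 𝓝 0 :=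
    hc.continuousAt (by rwa [UniformSpace.Completion.coe_zero])
  obtain ⟨S, ε, hε, hS⟩ := WithSeminorms.exists_of_mem_nhds q hV'
  refine ⟨S, ε, hε, fun x hx => ?_⟩
  have h1 : ∀ᶠ y in 𝓝 x, (∀ j ∈ S, seminorm q j y < ε j) ∧ x - y ∈ V := by
    refine Filter.Eventually.and ?_ ?_
    · exact (Filter.eventually_all_finset S).2 fun j hj =>
        (continuous_seminorm q j).continuousAt.eventually_lt_const (hx j hj)
    · have : ContinuousAt (fun y => x - y) x := (continuous_const.sub continuous_id).continuousAt
      exact this (by simpa using hV)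
  obtain ⟨a, ha⟩ := (denseRange_of q).exists_mem_open isOpen_interior
    (Set.nonempty_of_mem (mem_interior_iff_mem_nhds.2 h1))
  have ha' : of q a ∈ {y | (∀ j ∈ S, seminorm q j y < ε j) ∧ x - y ∈ V} := interior_subset ha
  obtain ⟨hy, hyV⟩ := ha'
  have h2 : of q a ∈ V := hS a fun j hj => by
    have := hy j hj
    rwa [seminorm_of] at this
  have := hVU _ h2 _ hyV
  rwa [add_sub_cancel] at this

lemma tendsto_zero_iff {ι : Type*} {l : Filter ι} {f : ι → Hat q} :
    Tendsto f l (𝓝 0) ↔ ∀ j, Tendsto (fun i => seminorm q j (f i)) l (𝓝 0) := by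
  constructor
  · intro h j
    have := ((continuous_seminorm q j).tendsto 0).comp h
    rwa [map_zero] at this
  · intro h U hU
    obtain ⟨S, ε, hε, hS⟩ := exists_of_mem_nhds q hU
    have : ∀ᶠ i in l, ∀ j ∈ S, seminorm q j (f i) < ε j :=
      (Filter.eventually_all_finset S).2 fun j hj => (h j).eventually_lt_const (hε j hj)
    exact this.mono fun i hi => hS _ hi

lemma eq_zero_of_seminorm {x : Hat q} (h : ∀ j, seminorm q j x = 0) : x = 0 := by
  have : Tendsto (fun _ : ℕ => x) atTop (𝓝 0) :=
    (tendsto_zero_iff q).2 fun j => by simp only [h j]; exact tendsto_const_nhds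
  exact tendsto_nhds_unique tendsto_const_nhds this

variable {q}

lemma seminorm_add_le_max {j : J} (hq : ∀ a b, q j (a + b) ≤ max (q j a) (q j b)) (x y : Hat q) :
    seminorm q j (x + y) ≤ max (seminorm q j x) (seminorm q j y) := by
  refine (denseRange_of q).induction_on₂ (p := fun x y => seminorm q j (x + y) ≤
    max (seminorm q j x) (seminorm q j y)) ?_ (fun a b => ?_) x y
  · have := continuous_seminorm q j
    exact isClosed_le (by fun_prop) (by fun_prop)
  · rw [← map_add, seminorm_of, seminorm_of, seminorm_of]
    exact hq a b

lemma nonarchimedeanRing (hq : ∀ j a b, q j (a + b) ≤ max (q j a) (q j b)) :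
    NonarchimedeanRing (Hat q) where
  is_nonarchimedean U hU := by
    obtain ⟨S, ε, hε, hS⟩ := exists_of_mem_nhds q hU
    refine ⟨⟨⟨⟨⟨{x | ∀ j ∈ S, seminorm q j x < ε j}, ?_⟩, ?_⟩, ?_⟩, ?_⟩, fun x hx => hS x hx⟩
    · intro x y hx hy j hj
      exact (seminorm_add_le_max (hq j) x y).trans_lt (max_lt (hx j hj) (hy j hj))
    · intro j hj
      rw [map_zero]; exact hε j hj
    · intro x hx j hj
      rw [map_neg_eq_map]; exact hx j hj
    · have : {x : Hat q | ∀ j ∈ S, seminorm q j x < ε j} =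
          ⋂ j ∈ S, {x | seminorm q j x < ε j} := by ext; simp
      change IsOpen {x : Hat q | ∀ j ∈ S, seminorm q j x < ε j}
      rw [this]
      exact isOpen_biInter_finset fun j _ =>
        isOpen_lt (continuous_seminorm q j) continuous_const

lemma summable_of_tendsto (hq : ∀ j a b, q j (a + b) ≤ max (q j a) (q j b)) {ι : Type*}
    {f : ι → Hat q} (hf : ∀ j, Tendsto (fun i => seminorm q j (f i)) cofinite (𝓝 0)) :
    Summable f := by
  have := nonarchimedeanRing hq
  exact NonarchimedeanAddGroup.summable_of_tendsto_cofinite_zero ((tendsto_zero_iff q).2 hf)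

variable {L : Type*} [NormedAddCommGroup L] [CompleteSpace L]

lemma continuous_of_le {j : J} {w : ℝ} (hw : 0 < w) (φ : WithSeminorms q →+ L)
    (h : ∀ a, ‖φ a‖ * w ≤ q j a) : Continuous φ := by
  refine continuous_of_continuousAt_zero φ ?_
  rw [ContinuousAt, map_zero, tendsto_zero_iff_norm_tendsto_zero]
  have h1 := ((WithSeminorms.continuous_seminorm q j).continuous.tendsto 0).div_const w
  have h2 : q j (0 : A) = 0 := map_zero _
  change Tendsto _ _ (𝓝 (q j (0 : A) / w)) at h1
  rw [h2, zero_div] at h1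
  exact squeeze_zero (fun a => norm_nonneg _) (fun a => (le_div_iff₀ hw).2 (h a)) h1

variable (L) in
/-- A bounded additive map extends to the completion. -/
lemma exists_extension {j : J} {w : ℝ} (hw : 0 < w) (φ : A →+ L)
    (h : ∀ a, ‖φ a‖ * w ≤ q j a) : ∃ ψ : Hat q →+ L, Continuous ψ ∧ ∀ a, ψ (of q a) = φ a := by
  let φ' : WithSeminorms q →+ L := φ
  have hc : Continuous φ' := continuous_of_le hw φ' h
  exact ⟨φ'.extension hc, AddMonoidHom.continuous_extension _ hc,
    fun a => AddMonoidHom.extension_coe _ hc a⟩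

lemma norm_le_of_dense {j : J} {w : ℝ} {φ : Hat q →+ L} (hφ : Continuous φ)
    (h : ∀ a, ‖φ (of q a)‖ * w ≤ q j a) (x : Hat q) : ‖φ x‖ * w ≤ seminorm q j x := by
  refine (denseRange_of q).induction_on x ?_ fun a => ?_
  · have := continuous_seminorm q j
    exact isClosed_le (by fun_prop) (by fun_prop)
  · rw [seminorm_of]; exact h a

lemma exists_seminorm_sub_lt (j : J) (x : Hat q) {ε : ℝ} (hε : 0 < ε) :
    ∃ a, seminorm q j (x - of q a) < ε := by
  have hc : Continuous fun y => seminorm q j (x - y) :=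
    (continuous_seminorm q j).comp (continuous_const.sub continuous_id)
  obtain ⟨a, ha⟩ := (denseRange_of q).exists_mem_open (isOpen_lt hc continuous_const)
    ⟨x, by simpa using hε⟩
  exact ⟨a, ha⟩

lemma algebraMap_eq {K : Type*} [CommRing K] [Algebra K A] (c : K) :
    algebraMap K (Hat q) c = of q (algebraMap K A c) := rfl

lemma smul_of {K : Type*} [CommRing K] [Algebra K A] (c : K) (a : A) :
    c • of q a = of q (c • a) := by
  rw [Algebra.smul_def, Algebra.smul_def, map_mul]
  rfl

end Hat

end HatTopology

/-! ### Tensor products of seminorms -/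

section TensorSeminorm

open scoped TensorProduct

variable {K : Type*} [NormedCommRing K] {Δ : Type*} [Fintype Δ]
  {A : Δ → Type*} [∀ α, CommRing (A α)] [∀ α, Algebra K (A α)] (q : ∀ α, RingSeminorm (A α))

lemma tensorSeminorm_le {t : ⨂[K] α, A α} {r : ℝ} (hr : 0 ≤ r) (ht : t ∈ tensorBall q r) :
    tensorSeminorm q t ≤ r := csInf_le ⟨0, fun _ h => h.1⟩ ⟨hr, ht⟩

lemma mem_tensorBall_of_lt {t : ⨂[K] α, A α} {r : ℝ} (h : tensorSeminorm q t < r) :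
    t ∈ tensorBall q r := by
  obtain ⟨s, ⟨_, hs⟩, hsr⟩ := exists_lt_of_csInf_lt (exists_mem_tensorBall q t) h
  exact tensorBall_mono q hsr.le hs

lemma tensorSeminorm_add_le_max (t u : ⨂[K] α, A α) :
    tensorSeminorm q (t + u) ≤ max (tensorSeminorm q t) (tensorSeminorm q u) := by
  refine le_of_forall_gt fun r hr => ?_
  obtain ⟨s, hs, hsr⟩ := exists_between hr
  refine (tensorSeminorm_le q ?_ (add_mem (mem_tensorBall_of_lt q ((le_max_left _ _).trans_lt hs))
    (mem_tensorBall_of_lt q ((le_max_right _ _).trans_lt hs)))).trans_lt hsr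
  exact (apply_nonneg _ t).trans ((le_max_left _ _).trans hs.le)

lemma tensorSeminorm_smul_tprod_le (c : K) (x : ∀ α, A α) :
    tensorSeminorm q (c • PiTensorProduct.tprod K x) ≤ ‖c‖ * ∏ α, q α (x α) :=
  tensorSeminorm_le q (mul_nonneg (norm_nonneg _) (Finset.prod_nonneg fun _ _ => apply_nonneg _ _))
    (AddSubgroup.subset_closure ⟨c, x, rfl, le_rfl⟩)

lemma tensorSeminorm_smul_le (c : K) (t : ⨂[K] α, A α) :
    tensorSeminorm q (c • t) ≤ ‖c‖ * tensorSeminorm q t := by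
  have hmem : ∀ r, t ∈ tensorBall q r → c • t ∈ tensorBall q (‖c‖ * r) := by
    intro r ht
    induction ht using AddSubgroup.closure_induction with
    | zero => rw [smul_zero]; exact zero_mem _
    | add x y _ _ hx hy => rw [smul_add]; exact add_mem hx hy
    | neg x _ hx => rw [smul_neg]; exact neg_mem hx
    | mem x hx =>
      obtain ⟨d, x, rfl, hd⟩ := hx
      refine AddSubgroup.subset_closure ⟨c * d, x, by rw [smul_smul], ?_⟩
      calc ‖c * d‖ * ∏ α, q α (x α) ≤ (‖c‖ * ‖d‖) * ∏ α, q α (x α) :=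
            mul_le_mul_of_nonneg_right (norm_mul_le c d)
              (Finset.prod_nonneg fun α _ => apply_nonneg _ _)
        _ = ‖c‖ * (‖d‖ * ∏ α, q α (x α)) := by ring
        _ ≤ ‖c‖ * r := mul_le_mul_of_nonneg_left hd (norm_nonneg c)
  have h0 := apply_nonneg (tensorSeminorm q) t
  refine le_of_forall_pos_le_add fun ε hε => ?_
  have hc : 0 < ‖c‖ + 1 := by positivity
  have hlt : tensorSeminorm q t < tensorSeminorm q t + ε / (‖c‖ + 1) :=
    lt_add_of_pos_right _ (div_pos hε hc)
  refine (tensorSeminorm_le q (mul_nonneg (norm_nonneg c) (h0.trans hlt.le))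
    (hmem _ (mem_tensorBall_of_lt q hlt))).trans ?_
  rw [mul_add]
  refine add_le_add le_rfl ?_
  rw [mul_div_assoc', div_le_iff₀ hc]
  nlinarith [norm_nonneg c]

/-- An additive map to an ultrametric group is bounded as soon as it is bounded on pure tensors. -/
lemma norm_le_tensorSeminorm {L : Type*} [SeminormedAddCommGroup L] [IsUltrametricDist L]
    (φ : (⨂[K] α, A α) →+ L) {w : ℝ}
    (h : ∀ (c : K) (x : ∀ α, A α), ‖φ (c • PiTensorProduct.tprod K x)‖ * w ≤ ‖c‖ * ∏ α, q α (x α))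
    (hw : 0 ≤ w) (t : ⨂[K] α, A α) : ‖φ t‖ * w ≤ tensorSeminorm q t := by
  refine le_of_forall_gt fun r hr => ?_
  obtain ⟨s, hs, hsr⟩ := exists_between hr
  refine lt_of_le_of_lt ?_ hsr
  have hs0 : 0 ≤ s := (apply_nonneg _ t).trans hs.le
  have ht := mem_tensorBall_of_lt q hs
  clear hs hr
  induction ht using AddSubgroup.closure_induction with
  | zero => rw [map_zero, norm_zero, zero_mul]; exact hs0
  | add x y _ _ hx hy =>
    rw [map_add]
    refine (mul_le_mul_of_nonneg_right (IsUltrametricDist.norm_add_le_max _ _) hw).trans ?_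
    rw [max_mul_of_nonneg _ _ hw]
    exact max_le hx hy
  | neg x _ hx => rw [map_neg, norm_neg]; exact hx
  | mem x hx =>
    obtain ⟨c, x, rfl, hc⟩ := hx
    exact (h c x).trans hc

/-- If the span of `E_α` is dense in `A_α` for all `α`, then the span of the tensors `⨂ e_α` with
`e_α` in `E_α` is dense in the tensor product. -/
lemma exists_tensorSeminorm_sub_lt (E : ∀ α, Set (A α))
    (hE : ∀ α (x : A α) (ε : ℝ), 0 < ε → ∃ y ∈ Submodule.span K (E α), q α (x - y) < ε)
    (t : ⨂[K] α, A α) {ε : ℝ} (hε : 0 < ε) :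
    ∃ u ∈ Submodule.span K (PiTensorProduct.tprod K '' {x : ∀ α, A α | ∀ α, x α ∈ E α}),
      tensorSeminorm q (t - u) < ε := by
  classical
  set M := Submodule.span K (PiTensorProduct.tprod K '' {x : ∀ α, A α | ∀ α, x α ∈ E α}) with hM
  let C : AddSubgroup (⨂[K] α, A α) :=
    { carrier := {t | ∀ ε : ℝ, 0 < ε → ∃ u ∈ M, tensorSeminorm q (t - u) < ε}
      zero_mem' := fun ε hε => ⟨0, zero_mem _, by simpa using hε⟩
      add_mem' := fun {t t'} ht ht' ε hε => by
        obtain ⟨u, hu, h⟩ := ht ε hε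
        obtain ⟨u', hu', h'⟩ := ht' ε hε
        refine ⟨u + u', add_mem hu hu', ?_⟩
        rw [add_sub_add_comm]
        exact (tensorSeminorm_add_le_max q _ _).trans_lt (max_lt h h')
      neg_mem' := fun {t} ht ε hε => by
        obtain ⟨u, hu, h⟩ := ht ε hε
        refine ⟨-u, neg_mem hu, ?_⟩
        rwa [← neg_add', ← sub_eq_add_neg, map_neg_eq_map] }
  have hCclosed : ∀ t, (∀ ε : ℝ, 0 < ε → ∃ u ∈ C, tensorSeminorm q (t - u) < ε) → t ∈ C := by
    intro t ht ε hε
    obtain ⟨u, hu, h⟩ := ht ε hε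
    obtain ⟨u', hu', h'⟩ := hu ε hε
    refine ⟨u', hu', ?_⟩
    rw [← sub_add_sub_cancel t u u']
    exact (tensorSeminorm_add_le_max q _ _).trans_lt (max_lt h h')
  have hCsmul : ∀ (c : K) t, t ∈ C → c • t ∈ C := by
    intro c t ht ε hε
    have hc : 0 < ‖c‖ + 1 := by positivity
    obtain ⟨u, hu, h⟩ := ht (ε / (‖c‖ + 1)) (div_pos hε hc)
    refine ⟨c • u, M.smul_mem c hu, ?_⟩
    rw [← smul_sub]
    refine (tensorSeminorm_smul_le q c _).trans_lt ?_
    rw [lt_div_iff₀ hc] at h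
    have h0 := apply_nonneg (tensorSeminorm q) (t - u)
    nlinarith
  -- Approximate the factors of a pure tensor one by one.
  have key : ∀ (F : Finset Δ) (x : ∀ α, A α), (∀ α ∉ F, x α ∈ E α) →
      PiTensorProduct.tprod K x ∈ C := by
    intro F
    induction F using Finset.induction_on with
    | empty =>
      intro x hx ε hε
      exact ⟨_, Submodule.subset_span ⟨x, fun α => hx α (Finset.notMem_empty α), rfl⟩,
        by simpa using hε⟩
    | insert β F hβ ih =>
      intro x hx
      let φ : A β →ₗ[K] ⨂[K] α, A α := (PiTensorProduct.tprod K).toLinearMap x β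
      have hφ : ∀ y, φ y = PiTensorProduct.tprod K (Function.update x β y) := fun y => rfl
      have h1 : ∀ y ∈ Submodule.span K (E β), φ y ∈ C := by
        intro y hy
        induction hy using Submodule.span_induction with
        | mem y hy =>
          refine ih _ fun α hα => ?_
          rcases eq_or_ne α β with rfl | hne
          · rwa [Function.update_self]
          · rw [Function.update_of_ne hne]
            exact hx α (by simp [hne, hα])
        | zero => rw [map_zero]; exact zero_mem _
        | add y z _ _ hy hz => rw [map_add]; exact add_mem hy hz
        | smul c y _ hy => rw [map_smul]; exact hCsmul c _ hy
      have h2 : PiTensorProduct.tprod K x = φ (x β) := by rw [hφ, Function.update_eq_self]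
      rw [h2]
      refine hCclosed _ fun ε hε => ?_
      set P := ∏ α ∈ Finset.univ.erase β, q α (x α) with hP
      have hP0 : 0 ≤ P := Finset.prod_nonneg fun α _ => apply_nonneg _ _
      have hc : 0 < ‖(1 : K)‖ * P + 1 := by positivity
      obtain ⟨y, hy, hxy⟩ := hE β (x β) (ε / (‖(1 : K)‖ * P + 1)) (div_pos hε hc)
      refine ⟨φ y, h1 y hy, ?_⟩
      rw [← map_sub, hφ, ← one_smul K (PiTensorProduct.tprod K _)]
      refine (tensorSeminorm_smul_tprod_le q _ _).trans_lt ?_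
      rw [← Finset.mul_prod_erase Finset.univ _ (Finset.mem_univ β), Function.update_self,
        Finset.prod_congr rfl (g := fun α => q α (x α)) (fun α hα => by
          rw [Function.update_of_ne (Finset.ne_of_mem_erase hα)]), ← hP]
      rw [lt_div_iff₀ hc] at hxy
      have h0 := apply_nonneg (q β) (x β - y)
      nlinarith
  have htop : t ∈ C := by
    induction t using PiTensorProduct.induction_on with
    | smul_tprod c x => exact hCsmul c _ (key Finset.univ x fun α hα =>
        absurd (Finset.mem_univ α) hα)
    | add x y hx hy => exact add_mem hx hy
  exact htop ε hε

end TensorSeminorm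

/-! ### Orthogonal generators -/

section Orthogonal

/-- A seminorm `N` on a module `H` over a normed ring together with topological generators `e_i`
that are orthogonal for `N`, as witnessed by bounded coefficient functionals `c_i`. The values of
the functionals lie in a normed group `L`, and only the norm of `c_i (d e_i)` is compared with that
of `d e_i`, so `c_i (e_i)` need not be `1`. -/
structure IsOrthogonal (K : Type*) [NormedCommRing K] {H L I : Type*} [AddCommGroup H] [Module K H]
    [NormedAddCommGroup L] (N : H → ℝ) (e : I → H) (c : I → H →+ L) (w : I → ℝ) : Prop where
  zero : N 0 = 0
  add_le : ∀ x y, N (x + y) ≤ max (N x) (N y)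
  smul_le : ∀ i (d : K), N (d • e i) ≤ ‖c i (d • e i)‖ * w i
  le : ∀ i y, ‖c i y‖ * w i ≤ N y
  ortho : ∀ i j (d : K), i ≠ j → c i (d • e j) = 0
  dense : ∀ y (ε : ℝ), 0 < ε → ∃ d : I →₀ K, N (y - d.sum fun i k => k • e i) < ε

variable {K : Type*} [NormedCommRing K] {H L I : Type*} [AddCommGroup H] [Module K H]
    [NormedAddCommGroup L] {N : H → ℝ} {e : I → H} {c : I → H →+ L} {w : I → ℝ}

lemma IsOrthogonal.coeff_sum (h : IsOrthogonal K N e c w) (d : I →₀ K) (i : I) :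
    c i (d.sum fun i k => k • e i) = c i (d i • e i) := by
  classical
  rw [Finsupp.sum, map_sum, Finset.sum_eq_single i]
  · intro j _ hj; exact h.ortho i j _ hj.symm
  · intro hi; rw [Finsupp.notMem_support_iff.1 hi, zero_smul, map_zero]

/-- The norm of an element is bounded by the supremum of the norms of its terms. -/
lemma IsOrthogonal.le_of_forall (h : IsOrthogonal K N e c w) {ρ : ℝ} (hρ : 0 ≤ ρ) {y : H}
    (hy : ∀ i, ‖c i y‖ * w i ≤ ρ) (hL : ∀ a b : L, ‖a + b‖ ≤ max ‖a‖ ‖b‖) (hw : ∀ i, 0 ≤ w i) :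
    N y ≤ ρ := by
  refine le_of_forall_pos_le_add fun ε hε => ?_
  obtain ⟨d, hd⟩ := h.dense y ε hε
  set P := d.sum fun i k => k • e i with hP
  have hi : ∀ i, ‖c i P‖ * w i ≤ ρ + ε := by
    intro i
    have h1 := h.le i (y - P)
    have h2 : c i P = c i y + -(c i (y - P)) := by rw [map_sub]; abel
    rw [h2]
    refine (mul_le_mul_of_nonneg_right (hL _ _) (hw i)).trans ?_
    rw [max_mul_of_nonneg _ _ (hw i), norm_neg]
    refine max_le ((hy i).trans (by linarith)) (h1.trans (by linarith))
  have hNP : N P ≤ ρ + ε := by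
    have : ∀ S : Finset I, N (∑ i ∈ S, d i • e i) ≤ ρ + ε := by
      classical
      intro S
      induction S using Finset.induction_on with
      | empty => rw [Finset.sum_empty, h.zero]; linarith
      | insert i S hiS ih =>
        rw [Finset.sum_insert hiS]
        refine (h.add_le _ _).trans (max_le ((h.smul_le i _).trans ?_) ih)
        rw [← h.coeff_sum]
        exact hi i
    exact this _
  rw [← sub_add_cancel y P]
  exact (h.add_le _ _).trans (max_le (by linarith) hNP)

/-- The terms of the expansion of an element tend to zero. -/
lemma IsOrthogonal.tendsto (h : IsOrthogonal K N e c w) (hw : ∀ i, 0 ≤ w i) (y : H) :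
    Tendsto (fun i => ‖c i y‖ * w i) cofinite (𝓝 0) := by
  rw [Metric.tendsto_nhds]
  intro ε hε
  obtain ⟨d, hd⟩ := h.dense y ε hε
  refine (d.support.finite_toSet).subset fun i hi => ?_
  by_contra hid
  refine hi ?_
  have h1 : c i (y - d.sum fun i k => k • e i) = c i y := by
    rw [map_sub, h.coeff_sum, Finsupp.notMem_support_iff.1 hid, zero_smul, map_zero, sub_zero]
  change dist (‖c i y‖ * w i) 0 < ε
  rw [Real.dist_eq, sub_zero, abs_of_nonneg (mul_nonneg (norm_nonneg _) (hw i)), ← h1]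
  exact (h.le i _).trans_lt hd

end Orthogonal


/-! ### The overconvergent rings in one variable -/

section OneVariableExpansion

variable {p : ℕ} [hp : Fact p.Prime] (ζ : RootSystem p) {r : Pos}

lemma RootSystem.exists_represents_coe (x : ζ.Adag r) : ∃ a, ζ.Represents (x : WTilt p) a :=
  ζ.exists_represents x.2.1

variable (r) in
/-- The coefficient of `u^n` in the Laurent expansion of an element of `A_{ℚ_p}^{†,r}`. -/
noncomputable def RootSystem.coeffDag (n : ℤ) : ζ.Adag r →ₗ[ℤ_[p]] ℤ_[p] where
  toFun x := (ζ.exists_represents_coe x).choose n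
  map_add' x y := congrFun ((ζ.exists_represents_coe (x + y)).choose_spec.unique fun k =>
    ((ζ.exists_represents_coe x).choose_spec k).add ((ζ.exists_represents_coe y).choose_spec k)) n
  map_smul' c x := congrFun ((ζ.exists_represents_coe (c • x)).choose_spec.unique fun k =>
    ((ζ.exists_represents_coe x).choose_spec k).smul c) n

lemma RootSystem.represents_coeffDag (x : ζ.Adag r) :
    ζ.Represents (x : WTilt p) fun n => ζ.coeffDag r n x :=
  (ζ.exists_represents_coe x).choose_spec

lemma RootSystem.coeffDag_le {t : Pos} (ht : 1 ≤ t.1) (hrt : r ≤ t) (x : ζ.Adag r) (n : ℤ) :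
    ‖ζ.coeffDag r n x‖ * radius p t ^ n ≤ wittNorm (valCflat p) t (x : WTilt p) :=
  (ζ.represents_coeffDag x).le ht (Atilde_mono _ hrt x.2.2) n

lemma RootSystem.wittTerm_mono_le {t : Pos} (ht : 1 ≤ t.1) (a : ℤ_[p]) (i : ℤ) (j : ℕ) :
    wittTerm (valCflat p) t (ζ.mono a i) j ≤ ‖a‖ * radius p t ^ i := by
  have := ζ.mono_mem (n := j) ht a i j le_rfl
  exact_mod_cast this

lemma RootSystem.wittNorm_mono_le {t : Pos} (ht : 1 ≤ t.1) (a : ℤ_[p]) (i : ℤ) :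
    wittNorm (valCflat p) t (ζ.mono a i) ≤ ‖a‖ * radius p t ^ i :=
  ciSup_le fun j => ζ.wittTerm_mono_le ht a i j

lemma RootSystem.mono_mem_AQp (a : ℤ_[p]) (i : ℤ) : ζ.mono a i ∈ ζ.AQp := fun n => by
  refine ⟨(-i).toNat, algebraMap _ _ a * ζ.uInt ^ (i + (-i).toNat).toNat,
    mul_mem (algebraMap_mem _ a) (pow_mem ζ.uInt_mem _), ?_⟩
  have : ζ.u ^ (-i).toNat * ζ.mono a i =
      inclOflat p (algebraMap _ _ a * ζ.uInt ^ (i + (-i).toNat).toNat) := by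
    rw [map_mul, AlgHom.commutes, map_pow, show inclOflat p ζ.uInt = ζ.u from rfl,
      RootSystem.mono, mul_left_comm, ← ζ.val_uUnit, ← Units.val_pow_eq_pow_val,
      ← Units.val_pow_eq_pow_val, ← Units.val_mul, ← zpow_natCast, ← zpow_add, ← zpow_natCast]
    congr 4
    omega
  rw [this, sub_self]
  exact dvd_zero _

/-- For `r > 1`, the terms `a u^i` of norm at most `1` are in `A_{ℚ_p}^{†,r}`. -/
lemma RootSystem.mono_mem_Adag (hr : 1 < r.1) {a : ℤ_[p]} {i : ℤ}
    (h : ‖a‖ * (radius p r : ℝ) ^ i ≤ 1) : ζ.mono a i ∈ ζ.Adag r := by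
  refine ⟨ζ.mono_mem_AQp a i, fun j => (ζ.wittTerm_mono_le hr.le a i j).trans h, ?_⟩
  have hp0 := p_pos p
  have hr0 : 0 < r.1 := r.2
  set C := ‖a‖ * (radius p onePos : ℝ) ^ i with hC
  have hC0 : 0 ≤ C := mul_nonneg (norm_nonneg _) (zpow_nonneg NNReal.zero_le_coe _)
  -- In terms of the norm for the radius `1`, the terms for `r` decay like `b^j`.
  set b : ℝ := (p : ℝ) ^ (1 / r.1 - 1) with hb
  have hb1 : b < 1 := Real.rpow_lt_one_of_one_lt_of_neg (one_lt_p p)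
    (sub_neg.2 ((div_lt_one hr0).2 hr))
  have hlim : Tendsto (fun j : ℕ => C ^ (1 / r.1) * b ^ j) atTop (𝓝 (C ^ (1 / r.1) * 0)) :=
    (tendsto_pow_atTop_nhds_zero_of_lt_one (Real.rpow_nonneg hp0.le _) hb1).const_mul _
  rw [mul_zero] at hlim
  refine squeeze_zero (fun j => wittTerm_nonneg _ _ _ j) (fun j => ?_) hlim
  have h1 := wittTerm_eq_rpow (v := valCflat p) onePos r (ζ.mono a i) j
  have hpj : (0 : ℝ) < (p : ℝ) ^ j := pow_pos hp0 j
  have h2 : (p : ℝ) ^ j * wittTerm (valCflat p) r (ζ.mono a i) j ≤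
      (p : ℝ) ^ j * (C ^ (1 / r.1) * b ^ j) := by
    rw [h1, onePos_val]
    refine (Real.rpow_le_rpow (mul_nonneg hpj.le (wittTerm_nonneg _ _ _ _))
      (mul_le_mul_of_nonneg_left (ζ.wittTerm_mono_le one_le_onePos a i j) hpj.le)
      (one_div_nonneg.2 hr0.le)).trans_eq ?_
    rw [Real.mul_rpow hpj.le hC0, hb, ← Real.rpow_natCast, ← Real.rpow_mul hp0.le,
      ← Real.rpow_natCast, ← Real.rpow_mul hp0.le, mul_left_comm, ← Real.rpow_add hp0, mul_comm]
    congr 2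
    ring
  exact le_of_mul_le_mul_left h2 hpj

lemma RootSystem.coeffDag_mono {a : ℤ_[p]} {i : ℤ} (h : ζ.mono a i ∈ ζ.Adag r) (n : ℤ) :
    ζ.coeffDag r n ⟨ζ.mono a i, h⟩ = Pi.single (M := fun _ => ℤ_[p]) i a n :=
  congrFun ((ζ.represents_coeffDag ⟨ζ.mono a i, h⟩).unique (ζ.represents_mono a i)) n

lemma RootSystem.mono_coeffDag_mem (hr : 1 < r.1) (x : ζ.Adag r) (i : ℤ) :
    ζ.mono (ζ.coeffDag r i x) i ∈ ζ.Adag r :=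
  ζ.mono_mem_Adag hr ((ζ.coeffDag_le hr.le le_rfl x i).trans (wittNorm_le_one _ x.2.2))

lemma zpow_le_zpow_of_nonpos {a b : ℝ} (ha : 0 < a) (hab : a ≤ b) {i : ℤ} (hi : i ≤ 0) :
    b ^ i ≤ a ^ i := by
  have h := zpow_le_zpow_left₀ (neg_nonneg.2 hi) ha.le hab
  rw [zpow_neg, zpow_neg] at h
  exact (inv_le_inv₀ (zpow_pos ha _) (zpow_pos (ha.trans_le hab) _)).1 h

lemma zpow_le_max_zpow {a b c : ℝ} (ha : 0 < a) (hab : a ≤ b) (hbc : b ≤ c) (i : ℤ) :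
    b ^ i ≤ max (a ^ i) (c ^ i) := by
  rcases le_total 0 i with hi | hi
  · exact le_max_of_le_right (zpow_le_zpow_left₀ hi (ha.trans_le hab).le hbc)
  · exact le_max_of_le_left (zpow_le_zpow_of_nonpos ha hab hi)

/-- The partial sums of the Laurent expansion converge, uniformly for radii in a compact interval.
-/
lemma RootSystem.exists_wittNorm_sub_le (hr : 1 < r.1) (x : ζ.Adag r) (s : Pos) {ε : ℝ}
    (hε : 0 < ε) : ∃ F : Finset ℤ, ∀ t : Pos, r ≤ t → t ≤ s →
      wittNorm (valCflat p) t ((x : WTilt p) - ∑ i ∈ F, ζ.mono (ζ.coeffDag r i x) i) ≤ ε := by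
  have hfin := (ζ.represents_coeffDag x).finite_lt ζ hr x.2.2 hε
  have hs0 : (0 : ℝ) < radius p s := radius_pos s
  have hs1 : (radius p s : ℝ) < 1 := radius_lt_one s
  obtain ⟨N, hN⟩ := exists_pow_lt_of_lt_one hε hs1
  -- A negative power of `u` has its largest norm at `r`, and a nonnegative one at `s`.
  refine ⟨hfin.toFinset ∪ Finset.Icc 0 (N : ℤ), fun t hrt hts => ciSup_le fun j => ?_⟩
  have ht : 1 ≤ t.1 := hr.le.trans hrt
  refine (ζ.represents_coeffDag x).sub_mem ht (ρ := ⟨ε, hε.le⟩) hε (fun i hi => ?_) j j le_rfl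
  simp only [Finset.mem_union, not_or, Set.Finite.mem_toFinset, Set.mem_ofPred_eq, not_lt,
    Finset.mem_Icc, not_and, not_le] at hi
  change ‖ζ.coeffDag r i x‖ * (radius p t : ℝ) ^ i ≤ ε
  have h0 := norm_nonneg (ζ.coeffDag r i x)
  have ht0 : (0 : ℝ) < radius p t := radius_pos t
  rcases le_or_gt 0 i with hi0 | hi0
  · refine (mul_le_of_le_one_left (zpow_nonneg ht0.le i) (PadicInt.norm_le_one _)).trans ?_
    refine (zpow_le_zpow_left₀ hi0 ht0.le (radius_mono hts)).trans ?_
    refine (zpow_le_zpow_right_of_le_one₀ hs0 hs1.le (hi.2 hi0).le).trans ?_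
    rw [zpow_natCast]
    exact hN.le
  · exact (mul_le_mul_of_nonneg_left (zpow_le_zpow_of_nonpos (radius_pos r) (radius_mono hrt)
      hi0.le) h0).trans hi.1

lemma exists_inv_pow_mul_le (r : Pos) (n : ℤ) :
    ∃ m : ℕ, ((p : ℝ)⁻¹) ^ m * (radius p r : ℝ) ^ n ≤ 1 := by
  have h := (tendsto_inv_pow p).mul_const ((radius p r : ℝ) ^ n)
  rw [zero_mul] at h
  exact (h.eventually_le_const one_pos).exists

open Classical in
/-- The least `m` such that `p^m u^n` has norm at most `1` for the radius `r`. -/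
noncomputable def minExp (p : ℕ) [Fact p.Prime] (r : Pos) (n : ℤ) : ℕ :=
  Nat.find (exists_inv_pow_mul_le (p := p) r n)

lemma norm_p_pow (m : ℕ) : ‖(p : ℤ_[p]) ^ m‖ = ((p : ℝ)⁻¹) ^ m := by
  rw [norm_pow, PadicInt.norm_p]

/-- The element `p^m u^n` of `A_{ℚ_p}^{†,r}`, with `m` as small as possible. -/
noncomputable def RootSystem.basisDag (hr : 1 < r.1) (n : ℤ) : ζ.Adag r :=
  ⟨ζ.mono ((p : ℤ_[p]) ^ minExp p r n) n, ζ.mono_mem_Adag hr (by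
    classical
    rw [norm_p_pow]; exact Nat.find_spec (exists_inv_pow_mul_le (p := p) r n))⟩

/-- A term `a u^n` of norm at most `1` is a multiple of `p^m u^n` for the least possible `m`. -/
lemma exists_eq_mul_minExp {a : ℤ_[p]} {n : ℤ} (h : ‖a‖ * (radius p r : ℝ) ^ n ≤ 1) :
    ∃ b, a = b * (p : ℤ_[p]) ^ minExp p r n := by
  classical
  obtain ⟨b, hb⟩ := dvd_of_lt_valuation (a := a) (m := minExp p r n) fun ha => by
    rw [norm_eq_zpow_valuation ha] at h
    exact Nat.find_min' (exists_inv_pow_mul_le (p := p) r n) h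
  exact ⟨b, by rw [hb, mul_comm]⟩

lemma RootSystem.coeffDag_basisDag (hr : 1 < r.1) (n i : ℤ) : ζ.coeffDag r n (ζ.basisDag hr i) =
    Pi.single (M := fun _ => ℤ_[p]) i ((p : ℤ_[p]) ^ minExp p r i) n :=
  ζ.coeffDag_mono _ n

lemma RootSystem.normAdag_basisDag_le (hr : 1 < r.1) (n : ℤ) : ζ.normAdag r (ζ.basisDag hr n) ≤
    ‖(p : ℤ_[p]) ^ minExp p r n‖ * radius p r ^ n :=
  ζ.wittNorm_mono_le hr.le _ n

lemma RootSystem.exists_normAdag_sub_lt (hr : 1 < r.1) (x : ζ.Adag r) {ε : ℝ} (hε : 0 < ε) :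
    ∃ y ∈ Submodule.span ℤ_[p] (Set.range (ζ.basisDag hr)), ζ.normAdag r (x - y) < ε := by
  obtain ⟨F, hF⟩ := ζ.exists_wittNorm_sub_le hr x r (half_pos hε)
  refine ⟨∑ i ∈ F, ⟨_, ζ.mono_coeffDag_mem hr x i⟩, Submodule.sum_mem _ fun i _ => ?_, ?_⟩
  · obtain ⟨b, hb⟩ := exists_eq_mul_minExp
      ((ζ.coeffDag_le hr.le le_rfl x i).trans (wittNorm_le_one _ x.2.2))
    have : (⟨_, ζ.mono_coeffDag_mem hr x i⟩ : ζ.Adag r) = b • ζ.basisDag hr i := by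
      refine Subtype.ext ?_
      change ζ.mono _ i = b • ζ.mono _ i
      rw [Algebra.smul_def, ← RootSystem.mono_mul, ← hb]
    rw [this]
    exact Submodule.smul_mem _ _ (Submodule.subset_span ⟨i, rfl⟩)
  · refine lt_of_le_of_lt ?_ (half_lt_self hε)
    refine le_trans (le_of_eq ?_) (hF r le_rfl le_rfl)
    change wittNorm (valCflat p) r ((x - ∑ i ∈ F, ⟨_, ζ.mono_coeffDag_mem hr x i⟩ : ζ.Adag r) :
      WTilt p) = _
    rw [AddSubgroupClass.coe_sub, AddSubmonoidClass.coe_finsetSum]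

/-! ### The ring `B_{ℚ_p}^{†,r}` -/

lemma RootSystem.algebraMap_zpow_mem (hr : 1 < r.1) (n : ℤ) :
    algebraMap (WTilt p) (BTilt p) ((ζ.uUnit ^ n : (WTilt p)ˣ) : WTilt p) ∈ ζ.Bdag r := by
  refine ⟨minExp p r n, (ζ.basisDag hr n : WTilt p), (ζ.basisDag hr n).2, ?_⟩
  change algebraMap (WTilt p) (BTilt p) (ζ.mono _ n) = _
  rw [RootSystem.mono, map_mul, map_pow, map_pow, map_natCast, map_natCast]

/-- `u` as a unit of `B_{ℚ_p}^{†,r}`. -/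
noncomputable def RootSystem.uBdag (hr : 1 < r.1) : (ζ.Bdag r)ˣ where
  val := ⟨_, ζ.algebraMap_zpow_mem hr 1⟩
  inv := ⟨_, ζ.algebraMap_zpow_mem hr (-1)⟩
  val_inv := Subtype.ext (by
    change algebraMap (WTilt p) (BTilt p) _ * algebraMap (WTilt p) (BTilt p) _ = 1
    rw [← map_mul, ← Units.val_mul, ← zpow_add, add_neg_cancel, zpow_zero, Units.val_one, map_one])
  inv_val := Subtype.ext (by
    change algebraMap (WTilt p) (BTilt p) _ * algebraMap (WTilt p) (BTilt p) _ = 1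
    rw [← map_mul, ← Units.val_mul, ← zpow_add, neg_add_cancel, zpow_zero, Units.val_one, map_one])

lemma RootSystem.coe_uBdag_zpow (hr : 1 < r.1) (n : ℤ) :
    (((ζ.uBdag hr ^ n : (ζ.Bdag r)ˣ) : ζ.Bdag r) : BTilt p) =
      algebraMap (WTilt p) (BTilt p) ((ζ.uUnit ^ n : (WTilt p)ˣ) : WTilt p) := by
  have h : Units.map (ζ.Bdag r).val.toRingHom.toMonoidHom (ζ.uBdag hr) =
      Units.map (algebraMap (WTilt p) (BTilt p)).toMonoidHom ζ.uUnit := Units.ext (by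
    change algebraMap (WTilt p) (BTilt p) ((ζ.uUnit ^ (1 : ℤ) : (WTilt p)ˣ) : WTilt p) = _
    rw [zpow_one]
    rfl)
  have h2 := congrArg (fun y : (BTilt p)ˣ => ((y ^ n : (BTilt p)ˣ) : BTilt p)) h
  simp only [← map_zpow] at h2
  exact h2

lemma RootSystem.normBdag_zpow_le (hr : 1 < r.1) (s : Set.Ici r) (n : ℤ) :
    ζ.normBdag r s ((ζ.uBdag hr ^ n : (ζ.Bdag r)ˣ) : ζ.Bdag r) ≤
      max ((radius p r : ℝ) ^ n) ((radius p s.1 : ℝ) ^ n) := by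
  have hne : Nonempty (Set.Icc r s.1) := ⟨⟨r, le_rfl, s.2⟩⟩
  refine ciSup_le fun t => le_trans ?_ (zpow_le_max_zpow (a := (radius p r : ℝ))
    (b := (radius p t.1 : ℝ)) (radius_pos r) (radius_mono t.2.1) (radius_mono t.2.2) n)
  have h1 : algebraMap (WTilt p) (BTilt p) (ζ.basisDag hr n : WTilt p) =
      (p : BTilt p) ^ minExp p r n * ((ζ.uBdag hr ^ n : (ζ.Bdag r)ˣ) : ζ.Bdag r) := by
    rw [ζ.coe_uBdag_zpow]
    change algebraMap (WTilt p) (BTilt p) (ζ.mono _ n) = _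
    rw [RootSystem.mono, map_mul, map_pow, map_pow, map_natCast, map_natCast]
  rw [normB_eq (Atilde_mono _ t.2.1 (ζ.basisDag hr n).2.2) h1]
  refine (mul_le_mul_of_nonneg_left (ζ.wittNorm_mono_le (hr.le.trans t.2.1) _ n)
    (pow_nonneg (p_pos p).le _)).trans_eq ?_
  rw [norm_p_pow, ← mul_assoc, ← mul_pow, mul_inv_cancel₀ (p_pos p).ne', one_pow, one_mul]

lemma RootSystem.exists_Adag (x : ζ.Bdag r) : ∃ (m : ℕ) (a : ζ.Adag r),
    algebraMap (WTilt p) (BTilt p) a = (p : BTilt p) ^ m * x := by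
  obtain ⟨m, a, ha, h⟩ := x.2
  exact ⟨m, ⟨a, ha⟩, h⟩

variable (r) in
/-- The coefficient of `u^n` in the Laurent expansion of `x`, as a function. -/
noncomputable def RootSystem.coeffBdagFun (n : ℤ) (x : ζ.Bdag r) : ℚ_[p] :=
  ((p : ℚ_[p]) ^ (ζ.exists_Adag x).choose)⁻¹ *
    (ζ.coeffDag r n (ζ.exists_Adag x).choose_spec.choose : ℚ_[p])

lemma RootSystem.coeffBdagFun_eq {x : ζ.Bdag r} {m : ℕ} {a : ζ.Adag r}
    (h : algebraMap (WTilt p) (BTilt p) a = (p : BTilt p) ^ m * x) (n : ℤ) :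
    ζ.coeffBdagFun r n x = ((p : ℚ_[p]) ^ m)⁻¹ * (ζ.coeffDag r n a : ℚ_[p]) := by
  have h' := (ζ.exists_Adag x).choose_spec.choose_spec
  unfold RootSystem.coeffBdagFun
  set m' := (ζ.exists_Adag x).choose
  set a' := (ζ.exists_Adag x).choose_spec.choose
  have hab : (p : ℤ_[p]) ^ m • a' = (p : ℤ_[p]) ^ m' • a := by
    refine Subtype.ext (algebraMap_BTilt_injective ?_)
    change algebraMap _ (BTilt p) ((p : ℤ_[p]) ^ m • (a' : WTilt p)) =
      algebraMap _ (BTilt p) ((p : ℤ_[p]) ^ m' • (a : WTilt p))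
    rw [Algebra.smul_def, Algebra.smul_def, map_pow, map_pow, map_natCast, map_mul, map_mul,
      map_pow, map_pow, map_natCast, h, h']
    ring
  have hc := congrArg (fun y => ((ζ.coeffDag r n y : ℤ_[p]) : ℚ_[p])) hab
  simp only [map_smul, smul_eq_mul, PadicInt.coe_mul, PadicInt.coe_pow, PadicInt.coe_natCast] at hc
  have hp0 : (p : ℚ_[p]) ≠ 0 := by exact_mod_cast hp.out.ne_zero
  field_simp
  linear_combination hc

variable (r) in
/-- The coefficient of `u^n` in the Laurent expansion of an element of `B_{ℚ_p}^{†,r}`. -/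
noncomputable def RootSystem.coeffBdag (n : ℤ) : ζ.Bdag r →ₗ[ℚ_[p]] ℚ_[p] where
  toFun := ζ.coeffBdagFun r n
  map_add' x y := by
    obtain ⟨m, a, h⟩ := ζ.exists_Adag x
    obtain ⟨m', a', h'⟩ := ζ.exists_Adag y
    have e : algebraMap (WTilt p) (BTilt p)
        (((p : ℤ_[p]) ^ m' • a + (p : ℤ_[p]) ^ m • a' : ζ.Adag r) : WTilt p) =
        (p : BTilt p) ^ (m + m') * ((x + y : ζ.Bdag r) : BTilt p) := by
      change algebraMap _ (BTilt p) ((p : ℤ_[p]) ^ m' • (a : WTilt p) +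
        (p : ℤ_[p]) ^ m • (a' : WTilt p)) = _ * ((x : BTilt p) + (y : BTilt p))
      rw [Algebra.smul_def, Algebra.smul_def, map_pow, map_pow, map_natCast, map_add, map_mul,
        map_mul, map_pow, map_pow, map_natCast, h, h']
      ring
    rw [ζ.coeffBdagFun_eq e, ζ.coeffBdagFun_eq h, ζ.coeffBdagFun_eq h']
    simp only [map_add, map_smul, smul_eq_mul, PadicInt.coe_add, PadicInt.coe_mul, PadicInt.coe_pow,
      PadicInt.coe_natCast]
    have hp0 : (p : ℚ_[p]) ≠ 0 := by exact_mod_cast hp.out.ne_zero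
    field_simp
    ring
  map_smul' c x := by
    obtain ⟨m, a, h⟩ := ζ.exists_Adag x
    obtain ⟨l, d, hd⟩ := exists_pow_mul_int c
    have e : algebraMap (WTilt p) (BTilt p) ((d • a : ζ.Adag r) : WTilt p) =
        (p : BTilt p) ^ (l + m) * ((c • x : ζ.Bdag r) : BTilt p) := by
      change algebraMap _ (BTilt p) (d • (a : WTilt p)) = _ * (c • (x : BTilt p))
      rw [Algebra.smul_def, Algebra.smul_def, map_mul, h, ← algebraMap_BTilt_int, hd, map_mul,
        map_pow, map_natCast]
      ring
    rw [ζ.coeffBdagFun_eq e, ζ.coeffBdagFun_eq h]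
    simp only [map_smul, smul_eq_mul, PadicInt.coe_mul, hd, RingHom.id_apply]
    have hp0 : (p : ℚ_[p]) ≠ 0 := by exact_mod_cast hp.out.ne_zero
    field_simp
    ring

lemma RootSystem.coeffBdag_eq {x : ζ.Bdag r} {m : ℕ} {a : ζ.Adag r}
    (h : algebraMap (WTilt p) (BTilt p) a = (p : BTilt p) ^ m * x) (n : ℤ) :
    ζ.coeffBdag r n x = ((p : ℚ_[p]) ^ m)⁻¹ * (ζ.coeffDag r n a : ℚ_[p]) :=
  ζ.coeffBdagFun_eq h n

lemma RootSystem.coeffBdag_le {t : Pos} {s : Set.Ici r} (ht : 1 ≤ t.1) (hrt : r ≤ t)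
    (hts : t ≤ s.1) (x : ζ.Bdag r) (n : ℤ) :
    ‖ζ.coeffBdag r n x‖ * radius p t ^ n ≤ ζ.normBdag r s x := by
  obtain ⟨m, a, h⟩ := ζ.exists_Adag x
  refine le_trans ?_ (le_ciSup (f := fun t : Set.Icc r s.1 => normB t.1 (x : BTilt p))
    (normB_bdd ζ x.2) ⟨t, hrt, hts⟩)
  change _ ≤ normB t (x : BTilt p)
  rw [normB_eq (Atilde_mono _ hrt a.2.2) h, ζ.coeffBdag_eq h, norm_mul, norm_inv, norm_pow,
    Padic.norm_p, inv_pow, inv_inv, mul_assoc]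
  exact mul_le_mul_of_nonneg_left (ζ.coeffDag_le ht hrt a n) (pow_nonneg (p_pos p).le m)

lemma RootSystem.coeffBdag_zpow (hr : 1 < r.1) (n i : ℤ) :
    ζ.coeffBdag r n ((ζ.uBdag hr ^ i : (ζ.Bdag r)ˣ) : ζ.Bdag r) =
      Pi.single (M := fun _ => ℚ_[p]) i 1 n := by
  have h1 : algebraMap (WTilt p) (BTilt p) (ζ.basisDag hr i : WTilt p) =
      (p : BTilt p) ^ minExp p r i * ((ζ.uBdag hr ^ i : (ζ.Bdag r)ˣ) : ζ.Bdag r) := by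
    rw [ζ.coe_uBdag_zpow]
    change algebraMap (WTilt p) (BTilt p) (ζ.mono _ i) = _
    rw [RootSystem.mono, map_mul, map_pow, map_pow, map_natCast, map_natCast]
  have hp0 : (p : ℚ_[p]) ≠ 0 := by exact_mod_cast hp.out.ne_zero
  rw [ζ.coeffBdag_eq h1, ζ.coeffDag_basisDag]
  rcases eq_or_ne n i with rfl | hne
  · rw [Pi.single_eq_same, Pi.single_eq_same, PadicInt.coe_pow, PadicInt.coe_natCast,
      inv_mul_cancel₀ (pow_ne_zero _ hp0)]
  · rw [Pi.single_eq_of_ne hne, Pi.single_eq_of_ne hne, PadicInt.coe_zero, mul_zero]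

lemma RootSystem.exists_normBdag_sub_lt (hr : 1 < r.1) (s : Set.Ici r) (x : ζ.Bdag r) {ε : ℝ}
    (hε : 0 < ε) : ∃ y ∈ Submodule.span ℚ_[p]
      (Set.range fun n : ℤ => ((ζ.uBdag hr ^ n : (ζ.Bdag r)ˣ) : ζ.Bdag r)),
      ζ.normBdag r s (x - y) < ε := by
  obtain ⟨m, a, h⟩ := ζ.exists_Adag x
  have hpm : (0 : ℝ) < (p : ℝ) ^ m := pow_pos (p_pos p) m
  obtain ⟨F, hF⟩ := ζ.exists_wittNorm_sub_le hr a s (div_pos (half_pos hε) hpm)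
  refine ⟨∑ i ∈ F, (((p : ℚ_[p]) ^ m)⁻¹ * (ζ.coeffDag r i a : ℚ_[p])) •
    ((ζ.uBdag hr ^ i : (ζ.Bdag r)ˣ) : ζ.Bdag r), Submodule.sum_mem _ fun i _ =>
      Submodule.smul_mem _ _ (Submodule.subset_span ⟨i, rfl⟩), ?_⟩
  have hne : Nonempty (Set.Icc r s.1) := ⟨⟨r, le_rfl, s.2⟩⟩
  refine (ciSup_le fun t => ?_).trans_lt (half_lt_self hε)
  have hmem : (a : WTilt p) - ∑ i ∈ F, ζ.mono (ζ.coeffDag r i a) i ∈ ζ.Adag r :=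
    sub_mem a.2 (sum_mem fun i _ => ζ.mono_coeffDag_mem hr a i)
  have h1 : algebraMap (WTilt p) (BTilt p)
      ((a : WTilt p) - ∑ i ∈ F, ζ.mono (ζ.coeffDag r i a) i) = (p : BTilt p) ^ m *
      ((x - ∑ i ∈ F, (((p : ℚ_[p]) ^ m)⁻¹ * (ζ.coeffDag r i a : ℚ_[p])) •
    ((ζ.uBdag hr ^ i : (ζ.Bdag r)ˣ) : ζ.Bdag r) : ζ.Bdag r) : BTilt p) := by
    have hp0 : (p : BTilt p) ≠ 0 := natCast_BTilt_ne_zero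
    rw [map_sub, h, map_sum, AddSubgroupClass.coe_sub, AddSubmonoidClass.coe_finsetSum, mul_sub,
      Finset.mul_sum]
    congr 1
    refine Finset.sum_congr rfl fun i _ => ?_
    change _ = (p : BTilt p) ^ m * ((((p : ℚ_[p]) ^ m)⁻¹ * (ζ.coeffDag r i a : ℚ_[p])) •
      (((ζ.uBdag hr ^ i : (ζ.Bdag r)ˣ) : ζ.Bdag r) : BTilt p))
    rw [ζ.coe_uBdag_zpow, Algebra.smul_def, map_mul, map_inv₀, map_pow, map_natCast,
      algebraMap_BTilt_int, RootSystem.mono, map_mul]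
    field_simp
  rw [normB_eq (Atilde_mono _ t.2.1 hmem.2) h1]
  have := hF t.1 t.2.1 t.2.2
  rw [le_div_iff₀ hpm] at this
  linarith

/-! ### The ring `B_{rig,ℚ_p}^{†,r}` -/

lemma RootSystem.exists_coeffBrig (hr : 1 < r.1) (n : ℤ) : ∃ ψ : ζ.Brig r →+ ℚ_[p],
    Continuous ψ ∧ ∀ a, ψ (Hat.of (ζ.normBdag r) a) = ζ.coeffBdag r n a :=
  Hat.exists_extension ℚ_[p] (j := (⟨r, Set.self_mem_Ici⟩ : Set.Ici r))
    (w := (radius p r : ℝ) ^ n) (zpow_pos (radius_pos r) n)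
    (ζ.coeffBdag r n).toAddMonoidHom
    fun a => ζ.coeffBdag_le hr.le le_rfl le_rfl a n

/-- The coefficient of `u^n` in the Laurent expansion of an element of `B_{rig,ℚ_p}^{†,r}`. -/
noncomputable def RootSystem.coeffBrig (hr : 1 < r.1) (n : ℤ) : ζ.Brig r →ₗ[ℚ_[p]] ℚ_[p] where
  __ := (ζ.exists_coeffBrig hr n).choose
  map_smul' c x := by
    have hc := (ζ.exists_coeffBrig hr n).choose_spec.1
    have he := (ζ.exists_coeffBrig hr n).choose_spec.2
    change (ζ.exists_coeffBrig hr n).choose (c • x) = c • (ζ.exists_coeffBrig hr n).choose x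
    refine (Hat.denseRange_of (ζ.normBdag r)).induction_on x ?_ fun a => ?_
    · refine isClosed_eq (hc.comp ?_) (hc.const_smul c)
      have : (fun x : ζ.Brig r => c • x) = fun x => algebraMap ℚ_[p] (ζ.Brig r) c * x :=
        funext fun x => Algebra.smul_def c x
      change Continuous (fun x : ζ.Brig r => c • x)
      rw [this]
      exact continuous_const.mul continuous_id
    · rw [Hat.smul_of, he, he, map_smul]

lemma RootSystem.continuous_coeffBrig (hr : 1 < r.1) (n : ℤ) : Continuous (ζ.coeffBrig hr n) :=
  (ζ.exists_coeffBrig hr n).choose_spec.1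

lemma RootSystem.coeffBrig_of (hr : 1 < r.1) (n : ℤ) (a : ζ.Bdag r) :
    ζ.coeffBrig hr n (Hat.of (ζ.normBdag r) a) = ζ.coeffBdag r n a :=
  (ζ.exists_coeffBrig hr n).choose_spec.2 a

lemma RootSystem.coeffBrig_le (hr : 1 < r.1) {t : Pos} {s : Set.Ici r} (hrt : r ≤ t)
    (hts : t ≤ s.1) (x : ζ.Brig r) (n : ℤ) :
    ‖ζ.coeffBrig hr n x‖ * radius p t ^ n ≤ Hat.seminorm (ζ.normBdag r) s x :=
  Hat.norm_le_of_dense (φ := (ζ.coeffBrig hr n).toAddMonoidHom) (ζ.continuous_coeffBrig hr n)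
    (fun a => by
      change ‖ζ.coeffBrig hr n (Hat.of (ζ.normBdag r) a)‖ * _ ≤ _
      rw [ζ.coeffBrig_of]
      exact ζ.coeffBdag_le (hr.le.trans hrt) hrt hts a n) x

/-- `u` as a unit of `B_{rig,ℚ_p}^{†,r}`. -/
noncomputable def RootSystem.uBrig (hr : 1 < r.1) : (ζ.Brig r)ˣ :=
  Units.map (Hat.of (ζ.normBdag r)).toMonoidHom (ζ.uBdag hr)

lemma RootSystem.val_uBrig (hr : 1 < r.1) :
    (ζ.uBrig hr : ζ.Brig r) = ζ.AdagToBrig r (ζ.uDag r) := by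
  refine congrArg (Hat.of (ζ.normBdag r)) (Subtype.ext ?_)
  change algebraMap (WTilt p) (BTilt p) ((ζ.uUnit ^ (1 : ℤ) : (WTilt p)ˣ) : WTilt p) =
    algebraMap (WTilt p) (BTilt p) ζ.u
  rw [zpow_one, ζ.val_uUnit]

lemma RootSystem.val_uBrig_zpow (hr : 1 < r.1) (n : ℤ) :
    ((ζ.uBrig hr ^ n : (ζ.Brig r)ˣ) : ζ.Brig r) =
      Hat.of (ζ.normBdag r) ((ζ.uBdag hr ^ n : (ζ.Bdag r)ˣ) : ζ.Bdag r) := by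
  rw [RootSystem.uBrig, ← map_zpow]
  rfl

lemma RootSystem.coeffBrig_zpow (hr : 1 < r.1) (n i : ℤ) :
    ζ.coeffBrig hr n ((ζ.uBrig hr ^ i : (ζ.Brig r)ˣ) : ζ.Brig r) =
      Pi.single (M := fun _ => ℚ_[p]) i 1 n := by
  rw [ζ.val_uBrig_zpow, ζ.coeffBrig_of, ζ.coeffBdag_zpow]

lemma RootSystem.seminorm_uBrig_zpow_le (hr : 1 < r.1) (s : Set.Ici r) (n : ℤ) :
    Hat.seminorm (ζ.normBdag r) s ((ζ.uBrig hr ^ n : (ζ.Brig r)ˣ) : ζ.Brig r) ≤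
      max ((radius p r : ℝ) ^ n) ((radius p s.1 : ℝ) ^ n) := by
  rw [ζ.val_uBrig_zpow, Hat.seminorm_of]
  exact ζ.normBdag_zpow_le hr s n

lemma RootSystem.exists_seminorm_sub_lt (hr : 1 < r.1) (s : Set.Ici r) (x : ζ.Brig r) {ε : ℝ}
    (hε : 0 < ε) : ∃ y ∈ Submodule.span ℚ_[p]
      (Set.range fun n : ℤ => ((ζ.uBrig hr ^ n : (ζ.Brig r)ˣ) : ζ.Brig r)),
      Hat.seminorm (ζ.normBdag r) s (x - y) < ε := by
  obtain ⟨a, ha⟩ := Hat.exists_seminorm_sub_lt (q := ζ.normBdag r) s x (half_pos hε)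
  obtain ⟨b, hb, hab⟩ := ζ.exists_normBdag_sub_lt hr s a (half_pos hε)
  refine ⟨Hat.of (ζ.normBdag r) b, ?_, ?_⟩
  · clear hab ha
    induction hb using Submodule.span_induction with
    | mem b hb =>
      obtain ⟨n, rfl⟩ := hb
      exact Submodule.subset_span ⟨n, ζ.val_uBrig_zpow hr n⟩
    | zero => rw [(Hat.of (ζ.normBdag r)).map_zero]; exact zero_mem _
    | add y z _ _ hy hz => rw [(Hat.of (ζ.normBdag r)).map_add y z]; exact add_mem hy hz
    | smul c y _ hy => rw [← Hat.smul_of]; exact Submodule.smul_mem _ c hy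
  · rw [← sub_add_sub_cancel x (Hat.of (ζ.normBdag r) a), ← map_sub]
    refine (map_add_le_add _ _ _).trans_lt ?_
    rw [Hat.seminorm_of]
    linarith

/-- The map from `A_{ℚ_p}^{†,r}` to `B_{rig,ℚ_p}^{†,r}` preserves Laurent expansions. -/
lemma RootSystem.coeffBrig_AdagToBrig (hr : 1 < r.1) (n : ℤ) (x : ζ.Adag r) :
    ζ.coeffBrig hr n (ζ.AdagToBrig r x) = (ζ.coeffDag r n x : ℚ_[p]) := by
  refine (ζ.coeffBrig_of hr n _).trans ?_
  rw [ζ.coeffBdag_eq (m := 0) (a := x) (by rw [pow_zero, one_mul]; rfl), pow_zero, inv_one, one_mul]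

end OneVariableExpansion


/-! ### Orthogonal generators of tensor products and completions -/

section OrthogonalConstructions

open scoped TensorProduct

variable {K : Type*} [NormedCommRing K]

section Tensor

variable {Δ : Type*} [Fintype Δ]
  {A : Δ → Type*} [∀ α, CommRing (A α)] [∀ α, Algebra K (A α)] {q : ∀ α, RingSeminorm (A α)}

/-- The tensor product of a family of linear functionals. -/
noncomputable def tensorCoeff (φ : ∀ α, A α →ₗ[K] K) : (⨂[K] α, A α) →ₗ[K] K :=
  PiTensorProduct.lift ((MultilinearMap.mkPiAlgebra K Δ K).compLinearMap φ)

lemma tensorCoeff_tprod (φ : ∀ α, A α →ₗ[K] K) (x : ∀ α, A α) :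
    tensorCoeff φ (PiTensorProduct.tprod K x) = ∏ α, φ α (x α) := by
  simp [tensorCoeff]

/-- Pure tensors of orthogonal generators are orthogonal generators of the tensor product. -/
lemma IsOrthogonal.tensor [NormMulClass K] [NormOneClass K] [IsUltrametricDist K] {I : Type*}
    {e : ∀ α, I → A α} {c : ∀ α, I → A α →ₗ[K] K} {w : Δ → I → ℝ}
    (h : ∀ α, IsOrthogonal K (q α) (e α) (fun n => (c α n).toAddMonoidHom) (w α))
    (hw : ∀ α n, 0 ≤ w α n) :
    IsOrthogonal K (tensorSeminorm (K := K) q)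
      (fun i : Δ → I => PiTensorProduct.tprod K fun α => e α (i α))
      (fun i => (tensorCoeff fun α => c α (i α)).toAddMonoidHom) fun i => ∏ α, w α (i α) where
  zero := map_zero _
  add_le := tensorSeminorm_add_le_max q
  smul_le i d := by
    refine (tensorSeminorm_smul_tprod_le q d _).trans ?_
    change _ ≤ ‖tensorCoeff _ (d • PiTensorProduct.tprod K fun α => e α (i α))‖ * _
    rw [map_smul, tensorCoeff_tprod, smul_eq_mul, norm_mul, norm_prod, mul_assoc,
      ← Finset.prod_mul_distrib]
    refine mul_le_mul_of_nonneg_left (Finset.prod_le_prod (fun α _ => apply_nonneg _ _)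
      fun α _ => ?_) (norm_nonneg d)
    have := (h α).smul_le (i α) 1
    rwa [one_smul] at this
  le i y := norm_le_tensorSeminorm q _ (fun d x => by
    change ‖tensorCoeff _ (d • PiTensorProduct.tprod K x)‖ * _ ≤ _
    rw [map_smul, tensorCoeff_tprod, smul_eq_mul, norm_mul, norm_prod, mul_assoc,
      ← Finset.prod_mul_distrib]
    exact mul_le_mul_of_nonneg_left (Finset.prod_le_prod
      (fun α _ => mul_nonneg (norm_nonneg _) (hw _ _)) fun α _ => (h α).le (i α) (x α))
      (norm_nonneg d)) (Finset.prod_nonneg fun α _ => hw _ _) y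
  ortho i j d hij := by
    obtain ⟨α, hα⟩ := Function.ne_iff.1 hij
    change tensorCoeff _ (d • PiTensorProduct.tprod K fun α => e α (j α)) = 0
    rw [map_smul, tensorCoeff_tprod, Finset.prod_eq_zero (Finset.mem_univ α), smul_zero]
    have := (h α).ortho (i α) (j α) 1 hα
    rwa [one_smul] at this
  dense y ε hε := by
    obtain ⟨u, hu, hyu⟩ := exists_tensorSeminorm_sub_lt q (fun α => Set.range (e α))
      (fun α x ε hε => by
        obtain ⟨d, hd⟩ := (h α).dense x ε hε
        exact ⟨_, (Finsupp.mem_span_range_iff_exists_finsupp).2 ⟨d, rfl⟩, hd⟩) y hε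
    have himg : PiTensorProduct.tprod K '' {x : ∀ α, A α | ∀ α, x α ∈ Set.range (e α)} =
        Set.range fun i : Δ → I => PiTensorProduct.tprod K fun α => e α (i α) := by
      ext t
      constructor
      · rintro ⟨x, hx, rfl⟩
        choose i hi using hx
        exact ⟨i, by simp only [hi]⟩
      · rintro ⟨i, rfl⟩
        exact ⟨_, fun α => ⟨i α, rfl⟩, rfl⟩
    rw [himg] at hu
    obtain ⟨d, rfl⟩ := (Finsupp.mem_span_range_iff_exists_finsupp).1 hu
    exact ⟨d, hyu⟩

end Tensor

section Completion

variable {A : Type*} [CommRing A] [Algebra K A] {J : Type*} {q : J → RingSeminorm A}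
  {L I : Type*} [NormedAddCommGroup L] [CompleteSpace L]

/-- Orthogonal generators of a ring are orthogonal generators of its completion. -/
lemma IsOrthogonal.hat {j : J} {e : I → A} {c : I → A →+ L} {w : I → ℝ} {c' : I → Hat q →+ L}
    (h : IsOrthogonal K (q j) e c w) (hc : ∀ i, Continuous (c' i))
    (hcc : ∀ i a, c' i (Hat.of q a) = c i a) :
    IsOrthogonal K (Hat.seminorm q j) (fun i => Hat.of q (e i)) c' w where
  zero := map_zero _
  add_le := Hat.seminorm_add_le_max h.add_le
  smul_le i d := by
    rw [Hat.smul_of, Hat.seminorm_of, hcc]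
    exact h.smul_le i d
  le i y := Hat.norm_le_of_dense (hc i) (fun a => by rw [hcc]; exact h.le i a) y
  ortho i i' d hi := by
    rw [Hat.smul_of, hcc]
    exact h.ortho i i' d hi
  dense y ε hε := by
    obtain ⟨a, ha⟩ := Hat.exists_seminorm_sub_lt (q := q) j y (half_pos hε)
    obtain ⟨d, hd⟩ := h.dense a _ (half_pos hε)
    refine ⟨d, ?_⟩
    have hsum : (d.sum fun i k => k • Hat.of q (e i)) = Hat.of q (d.sum fun i k => k • e i) := by
      rw [Finsupp.sum, Finsupp.sum, map_sum]
      exact Finset.sum_congr rfl fun i _ => Hat.smul_of _ _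
    rw [hsum, ← sub_add_sub_cancel y (Hat.of q a), ← map_sub]
    refine (Hat.seminorm_add_le_max h.add_le _ _).trans_lt (max_lt (by linarith) ?_)
    rw [Hat.seminorm_of]
    linarith

end Completion

section Expansion

variable {k : Type*} [NormedField k] [CompleteSpace k] [IsUltrametricDist k]
  {A : Type*} [CommRing A] [Algebra k A] {J : Type*} {q : J → RingSeminorm A}
  {I : Type*} {e : I → A} {c : I → Hat q →+ k} {w : J → I → ℝ}

/-- In the completion for the seminorms `q_j`, every element has a unique expansion `∑ a_i e_i`
with `a_i = c_i(x)`, and a series `∑ a_i e_i` converges as soon as `|a_i| w_j(i)` tends to zero for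
all `j`. -/
structure IsTopBasis (q : J → RingSeminorm A) (e : I → A) (c : I → Hat q →+ k)
    (w : J → I → ℝ) : Prop where
  cont : ∀ i, Continuous (c i)
  orth : ∀ j, IsOrthogonal k (Hat.seminorm q j) (fun i => Hat.of q (e i)) c (w j)
  self : ∀ i d, c i (d • Hat.of q (e i)) = d
  nonneg : ∀ j i, 0 ≤ w j i

namespace IsTopBasis

lemma coeff_self (h : IsTopBasis q e c w) (i : I) (d : k) :
    c i (algebraMap k (Hat q) d * Hat.of q (e i)) = d := by
  rw [← Algebra.smul_def]
  exact h.self i d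

lemma coeff_of_ne [Nonempty J] (h : IsTopBasis q e c w) {i i' : I} (hi : i ≠ i') (d : k) :
    c i (algebraMap k (Hat q) d * Hat.of q (e i')) = 0 := by
  rw [← Algebra.smul_def]
  exact (h.orth (Classical.arbitrary J)).ortho i i' d hi

lemma ext (h : IsTopBasis q e c w) {x y : Hat q} (hxy : ∀ i, c i x = c i y) : x = y := by
  refine sub_eq_zero.1 (Hat.eq_zero_of_seminorm q fun j => le_antisymm ?_ (apply_nonneg _ _))
  refine (h.orth j).le_of_forall le_rfl (fun i => ?_)
    (fun a b => IsUltrametricDist.norm_add_le_max a b) (h.nonneg j)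
  rw [map_sub, hxy, sub_self, norm_zero, zero_mul]

lemma summable (h : IsTopBasis q e c w) (hq : ∀ j a b, q j (a + b) ≤ max (q j a) (q j b))
    {f : I → k} (hf : ∀ j, Tendsto (fun i => ‖f i‖ * w j i) cofinite (𝓝 0)) :
    Summable fun i => algebraMap k (Hat q) (f i) * Hat.of q (e i) := by
  refine Hat.summable_of_tendsto hq fun j => ?_
  refine squeeze_zero (fun i => apply_nonneg _ _) (fun i => ?_) (hf j)
  have := (h.orth j).smul_le i (f i)
  rwa [h.self, Algebra.smul_def] at this

lemma coeff_of_hasSum [Nonempty J] (h : IsTopBasis q e c w) {f : I → k} {y : Hat q}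
    (hy : HasSum (fun i => algebraMap k (Hat q) (f i) * Hat.of q (e i)) y) (i : I) :
    c i y = f i := by
  have h1 := hy.map (c i) (h.cont i)
  refine h1.unique ?_
  convert hasSum_single i (f := c i ∘ fun i => algebraMap k (Hat q) (f i) * Hat.of q (e i))
    (fun j hj => ?_) using 1
  · exact (h.coeff_self i (f i)).symm
  · exact h.coeff_of_ne hj.symm (f j)

lemma hasSum [Nonempty J] (h : IsTopBasis q e c w)
    (hq : ∀ j a b, q j (a + b) ≤ max (q j a) (q j b)) (y : Hat q) :
    HasSum (fun i => algebraMap k (Hat q) (c i y) * Hat.of q (e i)) y := by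
  have hs := h.summable hq (f := fun i => c i y) fun j => (h.orth j).tendsto (h.nonneg j) y
  have := h.ext fun i => h.coeff_of_hasSum hs.hasSum i
  have h2 := hs.hasSum
  rwa [this] at h2

/-- If `e` turns sums into products, then the coefficients of a product are given by convolution. -/
lemma coeff_mul [Nonempty J] [AddCommGroup I] (h : IsTopBasis q e c w)
    (he : ∀ i i', e (i + i') = e i * e i')
    (hq : ∀ j a b, q j (a + b) ≤ max (q j a) (q j b)) (x y : Hat q) (n : I) :
    c n (x * y) = ∑' i, c i x * c (n - i) y := by
  classical
  have := Hat.nonarchimedeanRing hq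
  have h1 := (h.hasSum hq x).mul_of_nonarchimedean (h.hasSum hq y)
  have h2 := h1.map (c n) (h.cont n)
  have h3 : ∀ z : I × I, (algebraMap k (Hat q) (c z.1 x) * Hat.of q (e z.1)) *
      (algebraMap k (Hat q) (c z.2 y) * Hat.of q (e z.2)) =
      algebraMap k (Hat q) (c z.1 x * c z.2 y) * Hat.of q (e (z.1 + z.2)) := by
    intro z
    rw [he, map_mul, map_mul]; ring
  have hinj : Function.Injective fun i : I => (i, n - i) := fun i i' hi => (Prod.ext_iff.1 hi).1
  rw [← hinj.hasSum_iff] at h2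
  · refine (HasSum.tsum_eq ?_).symm
    convert h2 using 2 with i
    simp only [Function.comp_apply]
    rw [h3 (i, n - i)]
    simp only [add_sub_cancel]
    exact (h.coeff_self n _).symm
  · intro z hz
    simp only [Function.comp_apply]
    rw [h3]
    refine h.coeff_of_ne (fun hn => hz ⟨z.1, ?_⟩) _
    exact Prod.ext rfl (by simp only [hn, add_sub_cancel_left])

end IsTopBasis

end Expansion

lemma prod_map_mulSingle_zpow {Δ G : Type*} [Fintype Δ] [DecidableEq Δ] {U : Δ → Type*}
    [∀ α, CommGroup (U α)] [CommGroup G] (f : (∀ α, U α) →* G) (x : ∀ α, U α) (i : Δ → ℤ) :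
    ∏ α, f (Pi.mulSingle α (x α)) ^ i α = f fun α => x α ^ i α := by
  rw [← Finset.univ_prod_mulSingle fun α => x α ^ i α, map_prod]
  refine Finset.prod_congr rfl fun α _ => ?_
  rw [← map_zpow, Pi.mulSingle_zpow]

end OrthogonalConstructions

/-! ### Laurent expansions in the rings over a closed polyannulus -/

section BrigLevel

open scoped TensorProduct

variable {p : ℕ} [hp : Fact p.Prime] (ζ : RootSystem p)

lemma RootSystem.normBdag_algebraMap_le {r : Pos} (hr : 1 ≤ r.1) (s : Set.Ici r) (d : ℚ_[p]) :
    ζ.normBdag r s (algebraMap ℚ_[p] (ζ.Bdag r) d) ≤ ‖d‖ := by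
  have hne : Nonempty (Set.Icc r s.1) := ⟨⟨r, le_rfl, s.2⟩⟩
  refine ciSup_le fun t => ?_
  obtain ⟨n, a, ha⟩ := exists_pow_mul_int d
  have h1 : algebraMap (WTilt p) (BTilt p) (algebraMap ℤ_[p] (WTilt p) a) =
      (p : BTilt p) ^ n * ((algebraMap ℚ_[p] (ζ.Bdag r) d : ζ.Bdag r) : BTilt p) := by
    change _ = (p : BTilt p) ^ n * algebraMap ℚ_[p] (BTilt p) d
    rw [← algebraMap_BTilt_int, ha, map_mul, map_pow, map_natCast]
  rw [normB_eq (algebraMap_mem (Atilde p (valCflat p) t.1) a) h1]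
  have h2 := ζ.wittNorm_mono_le (t := t.1) (hr.trans t.2.1) a 0
  rw [zpow_zero, mul_one, RootSystem.mono, zpow_zero, Units.val_one, mul_one] at h2
  refine (mul_le_mul_of_nonneg_left h2 (pow_nonneg (p_pos p).le _)).trans_eq ?_
  rw [PadicInt.norm_def, ha, norm_mul, norm_pow, Padic.norm_p, ← mul_assoc,
    ← mul_pow, mul_inv_cancel₀ (p_pos p).ne', one_pow, one_mul]

/-- The powers of `u` are orthogonal generators of `B_{rig,ℚ_p}^{†,r}` for `r > 1`; the norm of
`u^n` over the radii between `r` and `s` is attained at one of the ends. -/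
lemma RootSystem.isOrthogonal_Brig {r : Pos} (hr : 1 < r.1) (s : Set.Ici r) :
    IsOrthogonal ℚ_[p] (Hat.seminorm (ζ.normBdag r) s)
      (fun n : ℤ => ((ζ.uBrig hr ^ n : (ζ.Brig r)ˣ) : ζ.Brig r))
      (fun n => (ζ.coeffBrig hr n).toAddMonoidHom)
      (fun n => max ((radius p r : ℝ) ^ n) ((radius p s.1 : ℝ) ^ n)) where
  zero := map_zero _
  add_le x y := by
    refine Hat.seminorm_add_le_max (fun a b => ?_) x y
    have hne : Nonempty (Set.Icc r s.1) := ⟨⟨r, le_rfl, s.2⟩⟩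
    refine ciSup_le fun t => ?_
    -- Both elements are brought to the common denominator `p^(m + n)`.
    obtain ⟨m, a', ha⟩ := ζ.exists_Adag a
    obtain ⟨n, b', hb⟩ := ζ.exists_Adag b
    have ha2 : algebraMap (WTilt p) (BTilt p) ((p : WTilt p) ^ n * a') =
      (p : BTilt p) ^ (m + n) * (a : BTilt p) := by
      rw [map_mul, map_pow, map_natCast, ha]; ring
    have hb2 : algebraMap (WTilt p) (BTilt p) ((p : WTilt p) ^ m * b') =
      (p : BTilt p) ^ (m + n) * (b : BTilt p) := by
      rw [map_mul, map_pow, map_natCast, hb]; ring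
    have hma : (p : WTilt p) ^ n * a' ∈ Atilde p (valCflat p) t.1 :=
      mul_mem (pow_mem (natCast_mem _ p) _) (Atilde_mono _ t.2.1 a'.2.2)
    have hmb : (p : WTilt p) ^ m * b' ∈ Atilde p (valCflat p) t.1 :=
      mul_mem (pow_mem (natCast_mem _ p) _) (Atilde_mono _ t.2.1 b'.2.2)
    have e3 : algebraMap (WTilt p) (BTilt p) ((p : WTilt p) ^ n * a' + (p : WTilt p) ^ m * b') =
        (p : BTilt p) ^ (m + n) * ((a + b : ζ.Bdag r) : BTilt p) := by
      rw [map_add, ha2, hb2, Subalgebra.coe_add, mul_add]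
    have h1 : normB t.1 (a : BTilt p) ≤ ζ.normBdag r s a :=
      le_ciSup (f := fun t : Set.Icc r s.1 => normB t.1 (a : BTilt p)) (normB_bdd ζ a.2) t
    have h2 : normB t.1 (b : BTilt p) ≤ ζ.normBdag r s b :=
      le_ciSup (f := fun t : Set.Icc r s.1 => normB t.1 (b : BTilt p)) (normB_bdd ζ b.2) t
    refine le_trans ?_ (max_le_max h1 h2)
    rw [normB_eq (add_mem hma hmb) e3, normB_eq hma ha2, normB_eq hmb hb2,
      ← mul_max_of_nonneg _ _ (pow_nonneg (p_pos p).le _)]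
    exact mul_le_mul_of_nonneg_left (wittNorm_add_le _ hma hmb) (pow_nonneg (p_pos p).le _)
  smul_le n d := by
    change _ ≤ ‖ζ.coeffBrig hr n (d • _)‖ * _
    rw [(ζ.coeffBrig hr n).map_smul, ζ.coeffBrig_zpow, Pi.single_eq_same, smul_eq_mul, mul_one,
      Algebra.smul_def]
    refine (map_mul_le_mul (Hat.seminorm (ζ.normBdag r) s) _ _).trans ?_
    refine mul_le_mul ?_ (ζ.seminorm_uBrig_zpow_le hr s n) (apply_nonneg _ _) (norm_nonneg d)
    rw [Hat.algebraMap_eq, Hat.seminorm_of]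
    exact ζ.normBdag_algebraMap_le hr.le s d
  le n y := by
    change ‖ζ.coeffBrig hr n y‖ * _ ≤ _
    rw [mul_max_of_nonneg _ _ (norm_nonneg _)]
    exact max_le (ζ.coeffBrig_le hr le_rfl s.2 y n) (ζ.coeffBrig_le hr s.2 le_rfl y n)
  ortho n m d hnm := by
    change ζ.coeffBrig hr n (d • _) = 0
    rw [map_smul, ζ.coeffBrig_zpow, Pi.single_eq_of_ne hnm, smul_zero]
  dense y ε hε := by
    obtain ⟨z, hz, h⟩ := ζ.exists_seminorm_sub_lt hr s y hε
    obtain ⟨d, rfl⟩ := (Finsupp.mem_span_range_iff_exists_finsupp).1 hz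
    exact ⟨d, h⟩

variable {Δ : Type*} [Fintype Δ] {r : Δ → Pos}

/-- The norm of `u^i` in `B_{rig,ℚ_p,Δ}^{†,r}` for the radii between `r` and `s`. -/
noncomputable def levelWeight (p : ℕ) [Fact p.Prime] (r s : Δ → Pos) (i : Δ → ℤ) : ℝ :=
  ∏ α, max ((radius p (r α) : ℝ) ^ i α) ((radius p (s α) : ℝ) ^ i α)

lemma levelWeight_pos (r s : Δ → Pos) (i : Δ → ℤ) : 0 < levelWeight p r s i :=
  Finset.prod_pos fun _ _ => lt_max_of_lt_left (zpow_pos (radius_pos _) _)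

variable (r) in
/-- The tensor products of the seminorms for the radii between `r` and `s`. -/
noncomputable abbrev RootSystem.levelSeminorm (s : ∀ α, Set.Ici (r α)) :
    RingSeminorm (⨂[ℚ_[p]] α, ζ.Brig (r α)) :=
  tensorSeminorm fun α => Hat.seminorm (ζ.normBdag (r α)) (s α)

variable (r) in
lemma RootSystem.levelSeminorm_add_le (s : ∀ α, Set.Ici (r α)) (a b : ⨂[ℚ_[p]] α, ζ.Brig (r α)) :
    ζ.levelSeminorm r s (a + b) ≤ max (ζ.levelSeminorm r s a) (ζ.levelSeminorm r s b) :=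
  tensorSeminorm_add_le_max _ a b

lemma RootSystem.isOrthogonal_BrigTensor (hr : ∀ α, 1 < (r α).1) (s : ∀ α, Set.Ici (r α)) :
    IsOrthogonal ℚ_[p] (ζ.levelSeminorm r s)
      (fun i : Δ → ℤ => PiTensorProduct.tprod ℚ_[p] fun α =>
        ((ζ.uBrig (hr α) ^ i α : (ζ.Brig (r α))ˣ) : ζ.Brig (r α)))
      (fun i => (tensorCoeff fun α => ζ.coeffBrig (hr α) (i α)).toAddMonoidHom)
      (levelWeight p r fun α => (s α).1) :=
  IsOrthogonal.tensor (fun α => ζ.isOrthogonal_Brig (hr α) (s α))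
    fun _ _ => le_max_of_le_left (zpow_pos (radius_pos _) _).le

lemma RootSystem.exists_coeffLevel (hr : ∀ α, 1 < (r α).1) (i : Δ → ℤ) :
    ∃ ψ : ζ.BrigLevel r →+ ℚ_[p], Continuous ψ ∧ ∀ a, ψ (Hat.of (ζ.levelSeminorm r) a) =
      tensorCoeff (fun α => ζ.coeffBrig (hr α) (i α)) a :=
  Hat.exists_extension ℚ_[p] (j := fun α => (⟨r α, Set.self_mem_Ici⟩ : Set.Ici (r α)))
    (levelWeight_pos r _ i) (tensorCoeff fun α => ζ.coeffBrig (hr α) (i α)).toAddMonoidHom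
    fun a => (ζ.isOrthogonal_BrigTensor hr _).le i a

/-- The coefficient of `u^i` in the Laurent expansion of an element of
`B_{rig,ℚ_p,Δ}^{†,r}`. -/
noncomputable def RootSystem.coeffLevel (hr : ∀ α, 1 < (r α).1) (i : Δ → ℤ) :
    ζ.BrigLevel r →+ ℚ_[p] := (ζ.exists_coeffLevel hr i).choose

lemma RootSystem.continuous_coeffLevel (hr : ∀ α, 1 < (r α).1) (i : Δ → ℤ) :
    Continuous (ζ.coeffLevel hr i) := (ζ.exists_coeffLevel hr i).choose_spec.1

lemma RootSystem.coeffLevel_of (hr : ∀ α, 1 < (r α).1) (i : Δ → ℤ)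
    (a : ⨂[ℚ_[p]] α, ζ.Brig (r α)) : ζ.coeffLevel hr i (Hat.of (ζ.levelSeminorm r) a) =
      tensorCoeff (fun α => ζ.coeffBrig (hr α) (i α)) a :=
  (ζ.exists_coeffLevel hr i).choose_spec.2 a

/-- The unit of `B_{rig,ℚ_p,Δ}^{†,r}` given by a family of units of the factors. -/
noncomputable def RootSystem.unitsLevel (r : Δ → Pos) :
    (∀ α, (ζ.Brig (r α))ˣ) →* (ζ.BrigLevel r)ˣ :=
  (Units.map ((Hat.of (ζ.levelSeminorm r)).toMonoidHom.comp
    (PiTensorProduct.tprodMonoidHom ℚ_[p]))).comp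
    (MulEquiv.piUnits (M := fun α => ζ.Brig (r α))).symm.toMonoidHom

lemma RootSystem.val_unitsLevel (x : ∀ α, (ζ.Brig (r α))ˣ) :
    (ζ.unitsLevel r x : ζ.BrigLevel r) =
      Hat.of (ζ.levelSeminorm r) (PiTensorProduct.tprod ℚ_[p] fun α => (x α : ζ.Brig (r α))) := rfl

open Classical in
/-- `ϖ_α` as a unit of `B_{rig,ℚ_p,Δ}^{†,r}`. -/
noncomputable def RootSystem.varpiUnit (hr : ∀ α, 1 < (r α).1) (α : Δ) : (ζ.BrigLevel r)ˣ :=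
  ζ.unitsLevel r (Pi.mulSingle α (ζ.uBrig (hr α)))

lemma RootSystem.val_varpiUnit (hr : ∀ α, 1 < (r α).1) (α : Δ) :
    (ζ.varpiUnit hr α : ζ.BrigLevel r) = ζ.varpiBrig r α := by
  classical
  refine (ζ.val_unitsLevel _).trans ?_
  unfold RootSystem.varpiBrig
  congr 2
  funext β
  rcases eq_or_ne β α with rfl | h
  · rw [Pi.mulSingle_eq_same, Pi.mulSingle_eq_same, ζ.val_uBrig]
  · rw [Pi.mulSingle_eq_of_ne h, Pi.mulSingle_eq_of_ne h, Units.val_one]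

/-- The monomial `ϖ^i` of `B_{rig,ℚ_p,Δ}^{†,r}`. -/
noncomputable def RootSystem.varpiMonomial (hr : ∀ α, 1 < (r α).1) (i : Δ → ℤ) :
    (ζ.BrigLevel r)ˣ := ∏ α, ζ.varpiUnit hr α ^ i α

lemma RootSystem.val_varpiMonomial (hr : ∀ α, 1 < (r α).1) (i : Δ → ℤ) :
    (ζ.varpiMonomial hr i : ζ.BrigLevel r) =
      Hat.of (ζ.levelSeminorm r) (PiTensorProduct.tprod ℚ_[p] fun α =>
        ((ζ.uBrig (hr α) ^ i α : (ζ.Brig (r α))ˣ) : ζ.Brig (r α))) := by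
  classical
  exact congrArg Units.val (prod_map_mulSingle_zpow (ζ.unitsLevel r) (fun α => ζ.uBrig (hr α)) i)

/-- The pure tensor `⨂ u^{i_α}`. -/
noncomputable def RootSystem.uTensor (hr : ∀ α, 1 < (r α).1) (i : Δ → ℤ) :
    ⨂[ℚ_[p]] α, ζ.Brig (r α) :=
  PiTensorProduct.tprod ℚ_[p] fun α => ((ζ.uBrig (hr α) ^ i α : (ζ.Brig (r α))ˣ) : ζ.Brig (r α))

lemma RootSystem.uTensor_add (hr : ∀ α, 1 < (r α).1) (i j : Δ → ℤ) :
    ζ.uTensor hr (i + j) = ζ.uTensor hr i * ζ.uTensor hr j := by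
  unfold RootSystem.uTensor
  rw [PiTensorProduct.tprod_mul_tprod]
  congr 1
  funext α
  simp only [Pi.add_apply, Pi.mul_apply, zpow_add, Units.val_mul]

/-- For `r_α > 1`, the monomials `u^i` form a topological basis of `B_{rig,ℚ_p,Δ}^{†,r}`. -/
lemma RootSystem.isTopBasis_BrigLevel (hr : ∀ α, 1 < (r α).1) :
    IsTopBasis (ζ.levelSeminorm r) (ζ.uTensor hr) (ζ.coeffLevel hr)
      fun s => levelWeight p r fun α => (s α).1 where
  cont := ζ.continuous_coeffLevel hr
  orth s := (ζ.isOrthogonal_BrigTensor hr s).hat (ζ.continuous_coeffLevel hr)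
    fun i a => ζ.coeffLevel_of hr i a
  self i d := by
    rw [Hat.smul_of, ζ.coeffLevel_of, LinearMap.map_smul, RootSystem.uTensor, tensorCoeff_tprod,
      Finset.prod_eq_one, smul_eq_mul, mul_one]
    intro α _
    rw [ζ.coeffBrig_zpow, Pi.single_eq_same]
  nonneg _ _ := (levelWeight_pos _ _ _).le

end BrigLevel


/-! ### Convergence on polyannuli -/

section Convergence

variable {p : ℕ} [hp : Fact p.Prime]

/-- The norms of the elements of `ℂ_p` are dense in `[0, 1]`. -/
lemma exists_norm_between {a b : ℝ} (ha : 0 ≤ a) (hab : a < b) (hb : b ≤ 1) :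
    ∃ z : ℂ_[p], a < ‖z‖ ∧ ‖z‖ < b := by
  have hb0 : 0 < b := ha.trans_lt hab
  obtain ⟨w, hw, hw1⟩ := exists_norm_mem (p := p) ((div_lt_one hb0).2 hab)
  have hw0 : 0 < ‖w‖ := (div_nonneg ha hb0.le).trans_lt hw
  obtain ⟨n, hn, hn'⟩ := exists_nat_pow_near_of_lt_one hb0 hb hw0 hw1
  refine ⟨w ^ (n + 1), ?_, by rwa [norm_pow]⟩
  rw [norm_pow, pow_succ]
  calc a < b * ‖w‖ := by rwa [div_lt_iff₀' hb0] at hw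
    _ ≤ ‖w‖ ^ n * ‖w‖ := mul_le_mul_of_nonneg_right hn' hw0.le

variable (p) in
lemma exists_radius_eq {y : ℝ} (h0 : 0 < y) (h1 : y < 1) : ∃ t : Pos, (radius p t : ℝ) = y := by
  have hl : 0 < -Real.logb p y := neg_pos.2 (Real.logb_neg (one_lt_p p) h0 h1)
  refine ⟨⟨(-Real.logb p y)⁻¹, Set.mem_Ioi.2 (inv_pos.2 hl)⟩, ?_⟩
  rw [radius_coe]
  change (p : ℝ) ^ (-(1 / (-Real.logb p y)⁻¹)) = y
  rw [one_div, inv_inv, neg_neg, Real.rpow_logb (p_pos p) (one_lt_p p).ne' h0]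

lemma le_of_radius_lt {s t : Pos} (h : (radius p s : ℝ) < radius p t) : s ≤ t := by
  by_contra hst
  have : (radius p t : ℝ) ≤ radius p s := radius_mono (not_le.1 hst).le
  exact absurd h (not_lt.2 this)

variable {Δ : Type*} [Fintype Δ] {r : Δ → Pos}

/-- Every point of the open polyannulus lies on the outer boundary for suitable radii `s`, and there
the terms are bounded by the weights. -/
lemma convergesOn_of_tendsto {f : Coeffs p Δ}
    (hf : ∀ s, r ≤ s → Tendsto (fun i => ‖f i‖ * levelWeight p r s i) cofinite (𝓝 0)) :
    ConvergesOn (fun α => (radius p (r α) : ℝ)) f := by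
  intro x hx
  have hr0 : ∀ α, (0 : ℝ) < radius p (r α) := fun α => radius_pos _
  choose s hs using fun α => exists_radius_eq p ((hr0 α).trans (hx α).1) (hx α).2
  rw [summable_iff_norm]
  refine squeeze_zero (fun i => norm_nonneg _) (fun i => ?_)
    (hf s fun α => le_of_radius_lt (by rw [hs]; exact (hx α).1))
  rw [term, norm_mul, norm_algebraMap', norm_prod]
  refine mul_le_mul_of_nonneg_left (Finset.prod_le_prod (fun α _ => norm_nonneg _) fun α _ => ?_)
    (norm_nonneg _)
  rw [norm_zpow, hs]
  exact le_max_right _ _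

/-- A Laurent series that converges on a polyannulus with inner radii less than `p^(-1/r_α)` has
terms that tend to zero for all weights between `r` and `s`. -/
lemma ConvergesOn.tendsto {f : Coeffs p Δ} {ρ : Δ → ℝ}
    (hρ : ∀ α, 0 < ρ α ∧ ρ α < radius p (r α)) (hf : ConvergesOn ρ f) {s : Δ → Pos} (hs : r ≤ s) :
    Tendsto (fun i => ‖f i‖ * levelWeight p r s i) cofinite (𝓝 0) := by
  classical
  have hr1 : ∀ t : Pos, (radius p t : ℝ) < 1 := fun t => radius_lt_one t
  have hrs : ∀ α, (radius p (r α) : ℝ) ≤ radius p (s α) := fun α => radius_mono (hs α)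
  choose y hy hy' using fun α => exists_norm_between (p := p) (hρ α).1.le (hρ α).2 (hr1 _).le
  choose z hz hz' using fun α => exists_norm_mem (p := p) (hr1 (s α))
  -- The monomials are bounded by the sum of their values at the corners of a polyannulus.
  have hc : ∀ F : Finset Δ, Tendsto (fun i => ‖term f (F.piecewise y z) i‖) cofinite (𝓝 0) := by
    intro F
    rw [← summable_iff_norm]
    refine hf _ fun α => ?_
    by_cases hα : α ∈ F
    · rw [Finset.piecewise_eq_of_mem _ _ _ hα]
      exact ⟨hy α, (hy' α).trans (hr1 _)⟩
    · rw [Finset.piecewise_eq_of_notMem _ _ _ hα]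
      exact ⟨((hρ α).2.trans_le (hrs α)).trans (hz α), hz' α⟩
  have hsum := tendsto_finsetSum Finset.univ.powerset fun F _ => hc F
  rw [Finset.sum_const_zero] at hsum
  refine squeeze_zero (fun i => mul_nonneg (norm_nonneg _) (levelWeight_pos _ _ _).le)
    (fun i => ?_) hsum
  have h1 : levelWeight p r s i ≤ ∏ α, (‖y α‖ ^ i α + ‖z α‖ ^ i α) := by
    refine Finset.prod_le_prod (fun α _ => le_max_of_le_left (zpow_pos (radius_pos _) _).le)
      fun α _ => ?_
    have h0 : 0 < ‖y α‖ := (hρ α).1.trans (hy α)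
    refine (max_le (zpow_le_max_zpow h0 (hy' α).le ((hrs α).trans (hz α).le) _)
      (zpow_le_max_zpow h0 ((hy' α).le.trans (hrs α)) (hz α).le _)).trans ?_
    exact max_le_add_of_nonneg (zpow_nonneg (norm_nonneg _) _) (zpow_nonneg (norm_nonneg _) _)
  refine (mul_le_mul_of_nonneg_left h1 (norm_nonneg _)).trans_eq ?_
  rw [Finset.prod_add, Finset.mul_sum]
  refine Finset.sum_congr rfl fun F _ => ?_
  rw [term, norm_mul, norm_algebraMap', norm_prod,
    ← Finset.prod_mul_prod_compl F fun α => ‖F.piecewise y z α ^ i α‖]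
  congr 2
  · exact Finset.prod_congr rfl fun α hα => by
      rw [Finset.piecewise_eq_of_mem _ _ _ hα, norm_zpow]
  · rw [Finset.compl_eq_univ_sdiff]
    exact Finset.prod_congr rfl fun α hα => by
      rw [Finset.piecewise_eq_of_notMem _ _ _ (Finset.mem_sdiff.1 hα).2, norm_zpow]

end Convergence

/-! ### The comparison of the Robba rings -/

section Evaluation

open scoped TensorProduct

lemma Hat.map_map {A B C : Type*} [CommRing A] [CommRing B] [CommRing C] {J J' J'' : Type*}
    {q : J → RingSeminorm A} {q' : J' → RingSeminorm B} {q'' : J'' → RingSeminorm C}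
    {φ : A →+* B} {ψ : B →+* C} {χ : A →+* C}
    (hφ : ∀ i, ∃ j, ∃ β : ℝ, 0 < β ∧ ∀ a, q' i (φ a) ≤ (q j a) ^ β)
    (hψ : ∀ i, ∃ j, ∃ β : ℝ, 0 < β ∧ ∀ a, q'' i (ψ a) ≤ (q' j a) ^ β)
    (hχ : ∀ i, ∃ j, ∃ β : ℝ, 0 < β ∧ ∀ a, q'' i (χ a) ≤ (q j a) ^ β)
    (h : ∀ a, ψ (φ a) = χ a) (x : Hat q) :
    map (q' := q'') ψ hψ (map (q' := q') φ hφ x) = map χ hχ x := by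
  refine (denseRange_of q).induction_on x (isClosed_eq ((continuous_map ψ hψ).comp
    (continuous_map φ hφ)) (continuous_map χ hχ)) fun a => ?_
  rw [map_of, map_of, map_of, h]

lemma tensorMap_tensorMap {K : Type*} [NormedCommRing K] {Δ : Type*} [Fintype Δ]
    {A B C : Δ → Type*} [∀ α, CommRing (A α)] [∀ α, Algebra K (A α)] [∀ α, CommRing (B α)]
    [∀ α, Algebra K (B α)] [∀ α, CommRing (C α)] [∀ α, Algebra K (C α)]
    (φ : ∀ α, A α →ₐ[K] B α) (ψ : ∀ α, B α →ₐ[K] C α) (χ : ∀ α, A α →ₐ[K] C α)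
    (h : ∀ α x, ψ α (φ α x) = χ α x) (x : ⨂[K] α, A α) :
    tensorMap ψ (tensorMap φ x) = tensorMap χ x := by
  induction x using PiTensorProduct.induction_on with
  | smul_tprod c x =>
    rw [map_smul, map_smul, map_smul, tensorMap_tprod, tensorMap_tprod, tensorMap_tprod]
    simp only [h]
  | add x y hx hy => rw [map_add, map_add, map_add, hx, hy]

lemma IsTopBasis.coeff_one {k : Type*} [NormedField k] [CompleteSpace k] [IsUltrametricDist k]
    {A : Type*} [CommRing A] [Algebra k A] {J : Type*} [Nonempty J] {q : J → RingSeminorm A}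
    {I : Type*} [Zero I] {e : I → A} {c : I → Hat q →+ k} {w : J → I → ℝ}
    (h : IsTopBasis q e c w) (he : e 0 = 1) [DecidableEq I] (i : I) :
    c i 1 = if i = 0 then 1 else 0 := by
  have h1 : (1 : Hat q) = algebraMap k (Hat q) 1 * Hat.of q (e 0) := by
    rw [he, map_one, map_one, one_mul]
  rw [h1]
  split_ifs with hi
  · rw [hi]; exact h.coeff_self 0 1
  · exact h.coeff_of_ne hi 1

lemma IsTopBasis.coeff_map {k : Type*} [NormedField k] [CompleteSpace k] [IsUltrametricDist k]
    {A B : Type*} [CommRing A] [Algebra k A] [CommRing B] [Algebra k B] {J J' : Type*}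
    [Nonempty J] [Nonempty J'] {q : J → RingSeminorm A} {q' : J' → RingSeminorm B}
    {I : Type*} {e : I → A} {c : I → Hat q →+ k} {w : J → I → ℝ} (h : IsTopBasis q e c w)
    {e' : I → B} {c' : I → Hat q' →+ k} {w' : J' → I → ℝ} (h' : IsTopBasis q' e' c' w')
    (hq : ∀ j a b, q j (a + b) ≤ max (q j a) (q j b)) (φ : A →ₐ[k] B)
    (hφ : ∀ i, ∃ j, ∃ β : ℝ, 0 < β ∧ ∀ a, q' i (φ.toRingHom a) ≤ (q j a) ^ β)
    (he : ∀ i, φ (e i) = e' i) (y : Hat q) (i : I) :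
    c' i (Hat.map φ.toRingHom hφ y) = c i y := by
  have h1 := (h.hasSum hq y).map (Hat.map φ.toRingHom hφ) (Hat.continuous_map _ hφ)
  refine h'.coeff_of_hasSum (f := fun i => c i y) ?_ i
  convert h1 using 2 with j
  rw [Function.comp_apply, map_mul, Hat.map_of, Hat.algebraMap_eq, Hat.algebraMap_eq, Hat.map_of]
  change _ = Hat.of q' (φ (algebraMap k A _)) * Hat.of q' (φ (e j))
  rw [φ.commutes, he]

variable {p : ℕ} [hp : Fact p.Prime] (ζ : RootSystem p)

lemma RootSystem.BrigMap_comp {r s t : Pos} (hrs : r ≤ s) (hst : s ≤ t) (x : ζ.Brig r) :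
    ζ.BrigMap hst (ζ.BrigMap hrs x) = ζ.BrigMap (hrs.trans hst) x :=
  Hat.map_map (ζ.Brig_bound hrs) (ζ.Brig_bound hst) (ζ.Brig_bound (hrs.trans hst)) (fun _ => rfl) x

lemma RootSystem.BrigMap_AdagToBrig {r s : Pos} (hrs : r ≤ s) (x : ζ.Adag r) :
    ζ.BrigMap hrs (ζ.AdagToBrig r x) =
      ζ.AdagToBrig s (Subalgebra.inclusion (ζ.Adag_mono hrs) x) :=
  Hat.map_of _ (ζ.Brig_bound hrs) _

lemma RootSystem.BrigMap_zpow {r s : Pos} (hr : 1 < r.1) (hrs : r ≤ s) (n : ℤ) :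
    ζ.BrigMap hrs ((ζ.uBrig hr ^ n : (ζ.Brig r)ˣ) : ζ.Brig r) =
      ((ζ.uBrig (hr.trans_le hrs) ^ n : (ζ.Brig s)ˣ) : ζ.Brig s) := by
  have h : Units.map (ζ.BrigMap hrs).toRingHom.toMonoidHom (ζ.uBrig hr) =
      ζ.uBrig (hr.trans_le hrs) := Units.ext (by
    refine Eq.trans ?_ (ζ.val_uBrig (hr.trans_le hrs)).symm
    change ζ.BrigMap hrs (ζ.uBrig hr : ζ.Brig r) = _
    rw [ζ.val_uBrig, ζ.BrigMap_AdagToBrig]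
    rfl)
  rw [← h, ← map_zpow]
  rfl

variable {Δ : Type*} [Fintype Δ]

lemma RootSystem.BrigLevelMap_comp {r s t : Δ → Pos} (hrs : r ≤ s) (hst : s ≤ t)
    (x : ζ.BrigLevel r) : ζ.BrigLevelMap s t hst (ζ.BrigLevelMap r s hrs x) =
      ζ.BrigLevelMap r t (hrs.trans hst) x :=
  Hat.map_map (ζ.BrigTensor_bound hrs) (ζ.BrigTensor_bound hst)
    (ζ.BrigTensor_bound (hrs.trans hst))
    (tensorMap_tensorMap _ _ _ fun α => ζ.BrigMap_comp (hrs α) (hst α)) x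

lemma RootSystem.BrigTensorMap_uTensor {r s : Δ → Pos} (hr : ∀ α, 1 < (r α).1)
    (hs : ∀ α, 1 < (s α).1) (h : r ≤ s) (i : Δ → ℤ) :
    ζ.BrigTensorMap h (ζ.uTensor hr i) = ζ.uTensor hs i := by
  refine (tensorMap_tprod _ _).trans ?_
  unfold RootSystem.uTensor
  congr 1
  funext α
  exact ζ.BrigMap_zpow (hr α) (h α) (i α)

/-- The transition maps preserve Laurent expansions. -/
lemma RootSystem.coeffLevel_BrigLevelMap {r s : Δ → Pos} (hr : ∀ α, 1 < (r α).1)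
    (hs : ∀ α, 1 < (s α).1) (h : r ≤ s) (y : ζ.BrigLevel r) (i : Δ → ℤ) :
    ζ.coeffLevel hs i (ζ.BrigLevelMap r s h y) = ζ.coeffLevel hr i y := by
  have : Nonempty (∀ α, Set.Ici (r α)) := ⟨fun α => ⟨r α, Set.self_mem_Ici⟩⟩
  have : Nonempty (∀ α, Set.Ici (s α)) := ⟨fun α => ⟨s α, Set.self_mem_Ici⟩⟩
  exact (ζ.isTopBasis_BrigLevel hr).coeff_map (ζ.isTopBasis_BrigLevel hs)
    (ζ.levelSeminorm_add_le r) (ζ.BrigTensorMap h) (ζ.BrigTensor_bound h)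
    (ζ.BrigTensorMap_uTensor hr hs h) y i

end Evaluation


/-! ### The Laurent expansion of an element of the Robba ring -/

section LaurentExpansion

open scoped TensorProduct

variable {p : ℕ} [hp : Fact p.Prime] (ζ : RootSystem p) {Δ : Type*} [Fintype Δ] {r : Δ → Pos}

lemma radius_mem (r : Δ → Pos) (α : Δ) : (0 : ℝ) < radius p (r α) ∧ (radius p (r α) : ℝ) < 1 :=
  ⟨radius_pos (r α), radius_lt_one (r α)⟩

instance nonempty_levels (r : Δ → Pos) : Nonempty (∀ α, Set.Ici (r α)) :=
  ⟨fun α => ⟨r α, Set.self_mem_Ici⟩⟩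

lemma RootSystem.uTensor_zero (hr : ∀ α, 1 < (r α).1) : ζ.uTensor hr 0 = 1 := by
  unfold RootSystem.uTensor
  rw [PiTensorProduct.one_def]
  congr 1

/-- The Laurent expansion of an element of `B_{rig,ℚ_p,Δ}^{†,r}`. -/
noncomputable def RootSystem.levelToRobba (hr : ∀ α, 1 < (r α).1) :
    ζ.BrigLevel r →+* Robba p Δ where
  toFun y := ⟨fun i => ζ.coeffLevel hr i y, _, radius_mem r, convergesOn_of_tendsto fun s hs =>
    ((ζ.isTopBasis_BrigLevel hr).orth fun α => ⟨s α, hs α⟩).tendsto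
      (fun i => (levelWeight_pos _ _ _).le) y⟩
  map_one' := by
    classical
    refine Subtype.ext (funext fun i => ?_)
    refine ((ζ.isTopBasis_BrigLevel hr).coeff_one (ζ.uTensor_zero hr) i).trans ?_
    change _ = oneCoeffs i
    unfold oneCoeffs
    congr
  map_mul' x y := Subtype.ext (funext fun i =>
    (ζ.isTopBasis_BrigLevel hr).coeff_mul (ζ.uTensor_add hr) (ζ.levelSeminorm_add_le r) x y i)
  map_zero' := Subtype.ext (funext fun i => (ζ.coeffLevel hr i).map_zero)
  map_add' x y := Subtype.ext (funext fun i => (ζ.coeffLevel hr i).map_add x y)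

lemma RootSystem.levelToRobba_injective (hr : ∀ α, 1 < (r α).1) :
    Function.Injective (ζ.levelToRobba hr) := fun _ _ h =>
  (ζ.isTopBasis_BrigLevel hr).ext fun i => congrFun (congrArg Subtype.val h) i

/-- The Laurent expansions are compatible with the transition maps. -/
lemma RootSystem.levelToRobba_map {s : Δ → Pos} (hr : ∀ α, 1 < (r α).1) (hs : ∀ α, 1 < (s α).1)
    (h : r ≤ s) (y : ζ.BrigLevel r) :
    ζ.levelToRobba hs (ζ.BrigLevelMap r s h y) = ζ.levelToRobba hr y :=
  Subtype.ext (funext fun i => ζ.coeffLevel_BrigLevelMap hr hs h y i)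

/-- The evaluation of a Laurent series that converges on a large enough polyannulus. -/
lemma RootSystem.exists_hasSum (hr : ∀ α, 1 < (r α).1) (f : Robba p Δ) {ρ : Δ → ℝ}
    (hρ : ∀ α, 0 < ρ α ∧ ρ α < radius p (r α)) (hf : ConvergesOn ρ f.coeff) :
    ∃ y : ζ.BrigLevel r, HasSum (fun i => algebraMap ℚ_[p] (ζ.BrigLevel r) (f.coeff i) *
      Hat.of (ζ.levelSeminorm r) (ζ.uTensor hr i)) y ∧ ζ.levelToRobba hr y = f := by
  have h := (ζ.isTopBasis_BrigLevel hr).summable (ζ.levelSeminorm_add_le r) (f := f.coeff)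
    fun s => hf.tendsto hρ fun α => (s α).2
  exact ⟨_, h.hasSum, Subtype.ext (funext fun i =>
    (ζ.isTopBasis_BrigLevel hr).coeff_of_hasSum h.hasSum i)⟩

/-- Radii with `r_α > 1` above given ones. -/
noncomputable def enlarge (r : Δ → Pos) : Δ → Pos :=
  fun α => max (r α) ⟨2, Set.mem_Ioi.2 two_pos⟩

lemma le_enlarge (r : Δ → Pos) : r ≤ enlarge r := fun _ => le_max_left _ _

lemma one_lt_enlarge (r : Δ → Pos) (α : Δ) : 1 < (enlarge r α).1 :=
  lt_of_lt_of_le (b := (2 : ℝ)) one_lt_two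
    (le_max_right (r α) (⟨2, Set.mem_Ioi.2 two_pos⟩ : Pos) : (⟨2, _⟩ : Pos) ≤ _)

lemma enlarge_mono {r s : Δ → Pos} (h : r ≤ s) : enlarge r ≤ enlarge s :=
  fun α => max_le_max_right _ (h α)

variable (Δ) in
/-- The Laurent expansion of an element of `B_{rig,ℚ_p,Δ}^†`. -/
noncomputable def RootSystem.toRobba : ζ.BrigDelta Δ →+* Robba p Δ :=
  Ring.DirectLimit.lift (fun r : Δ → Pos => ζ.BrigLevel r) (fun r s h => ζ.BrigLevelMap r s h) _
    (fun r => (ζ.levelToRobba (one_lt_enlarge r)).comp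
      (ζ.BrigLevelMap r (enlarge r) (le_enlarge r))) fun r s h x => by
    change ζ.levelToRobba (one_lt_enlarge s) (ζ.BrigLevelMap s (enlarge s) _
      (ζ.BrigLevelMap r s h x)) = ζ.levelToRobba (one_lt_enlarge r) (ζ.BrigLevelMap r _ _ x)
    rw [ζ.BrigLevelMap_comp, ← ζ.levelToRobba_map (one_lt_enlarge r) (one_lt_enlarge s)
      (enlarge_mono h), ζ.BrigLevelMap_comp]

lemma RootSystem.toRobba_toBrigDelta (hr : ∀ α, 1 < (r α).1) (y : ζ.BrigLevel r) :
    ζ.toRobba Δ (ζ.toBrigDelta r y) = ζ.levelToRobba hr y := by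
  refine (Ring.DirectLimit.lift_of (G := fun r : Δ → Pos => ζ.BrigLevel r)
    (f := fun r s h => ζ.BrigLevelMap r s h) _ _ _ _ _).trans ?_
  exact ζ.levelToRobba_map hr (one_lt_enlarge r) _ y

lemma RootSystem.toBrigDelta_map {s : Δ → Pos} (h : r ≤ s) (y : ζ.BrigLevel r) :
    ζ.toBrigDelta s (ζ.BrigLevelMap r s h y) = ζ.toBrigDelta r y :=
  Ring.DirectLimit.of_f (G := fun r : Δ → Pos => ζ.BrigLevel r)
    (f := fun r s h => ζ.BrigLevelMap r s h) h y

lemma RootSystem.exists_toBrigDelta (z : ζ.BrigDelta Δ) :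
    ∃ (r : Δ → Pos) (_ : ∀ α, 1 < (r α).1) (y : ζ.BrigLevel r), ζ.toBrigDelta r y = z := by
  have : Nonempty (Δ → Pos) := ⟨fun _ => onePos⟩
  obtain ⟨r, y, rfl⟩ := Ring.DirectLimit.exists_of z
  exact ⟨enlarge r, one_lt_enlarge r, _, ζ.toBrigDelta_map (le_enlarge r) y⟩

lemma exists_radii {ρ : Δ → ℝ} (hρ : ∀ α, 0 < ρ α ∧ ρ α < 1) :
    ∃ r : Δ → Pos, (∀ α, 1 < (r α).1) ∧ ∀ α, 0 < ρ α ∧ ρ α < radius p (r α) := by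
  have h1 : (radius p onePos : ℝ) < 1 := radius_lt_one onePos
  choose y hy hy1 using fun α => exists_between (max_lt (hρ α).2 h1)
  choose r hr using fun α => exists_radius_eq p ((hρ α).1.trans
    ((le_max_left _ _).trans_lt (hy α))) (hy1 α)
  refine ⟨r, fun α => ?_, fun α => ⟨(hρ α).1, by rw [hr]; exact (le_max_left _ _).trans_lt (hy α)⟩⟩
  have h2 : (radius p onePos : ℝ) < radius p (r α) := by
    rw [hr]; exact (le_max_right _ _).trans_lt (hy α)
  refine lt_of_le_of_ne (le_of_radius_lt h2) fun he => ?_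
  rw [show r α = onePos from Subtype.ext he.symm] at h2
  exact lt_irrefl _ h2

/-- The Laurent expansion identifies `B_{rig,ℚ_p,Δ}^†` with the Robba ring. -/
lemma RootSystem.toRobba_bijective : Function.Bijective (ζ.toRobba Δ) := by
  constructor
  · refine (injective_iff_map_eq_zero _).2 fun z hz => ?_
    obtain ⟨r, hr, y, rfl⟩ := ζ.exists_toBrigDelta z
    have h1 : ζ.levelToRobba hr y = ζ.levelToRobba hr 0 :=
      (ζ.toRobba_toBrigDelta hr y).symm.trans (hz.trans (ζ.levelToRobba hr).map_zero.symm)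
    exact (congrArg _ (ζ.levelToRobba_injective hr h1)).trans (ζ.toBrigDelta r).map_zero
  · intro f
    obtain ⟨ρ, hρ, hf⟩ := f.2
    obtain ⟨r, hr, hρr⟩ := exists_radii (p := p) hρ
    obtain ⟨y, -, hy⟩ := ζ.exists_hasSum hr f hρr hf
    exact ⟨ζ.toBrigDelta r y, by rw [ζ.toRobba_toBrigDelta hr, hy]⟩

variable (Δ) in
/-- The evaluation of Laurent series at the `ϖ_α`: the inverse of the Laurent expansion. -/
noncomputable def RootSystem.evalEquiv : Robba p Δ ≃+* ζ.BrigDelta Δ :=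
  (RingEquiv.ofBijective (ζ.toRobba Δ) ζ.toRobba_bijective).symm

lemma RootSystem.evalEquiv_toRobba (z : ζ.BrigDelta Δ) : ζ.evalEquiv Δ (ζ.toRobba Δ z) = z :=
  (RingEquiv.ofBijective (ζ.toRobba Δ) ζ.toRobba_bijective).symm_apply_apply z

lemma RootSystem.exists_hasSum_varpi (hr : ∀ α, 1 < (r α).1) (f : Robba p Δ) {ρ : Δ → ℝ}
    (hρ : ∀ α, 0 < ρ α ∧ ρ α < radius p (r α)) (hf : ConvergesOn ρ f.coeff) :
    ∃ y : ζ.BrigLevel r, HasSum (fun i => algebraMap ℚ_[p] (ζ.BrigLevel r) (f.coeff i) *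
      ((∏ α, ζ.varpiUnit hr α ^ i α : (ζ.BrigLevel r)ˣ) : ζ.BrigLevel r)) y ∧
      ζ.evalEquiv Δ f = ζ.toBrigDelta r y := by
  have h := ζ.exists_hasSum hr f hρ hf
  refine h.imp fun y hy => ⟨?_, ?_⟩
  · exact Eq.mp (congrArg (fun g => HasSum g y) (funext fun i =>
      congrArg (algebraMap ℚ_[p] (ζ.BrigLevel r) (f.coeff i) * ·)
        (ζ.val_varpiMonomial hr i).symm)) hy.1
  · refine Eq.trans ?_ (ζ.evalEquiv_toRobba _)
    refine congrArg (ζ.evalEquiv Δ) ?_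
    exact hy.2.symm.trans (ζ.toRobba_toBrigDelta hr y).symm

lemma RootSystem.isEvaluation_evalEquiv : ζ.IsEvaluation (ζ.evalEquiv Δ).toRingHom := fun _ hr =>
  ⟨ζ.varpiUnit hr, ζ.val_varpiUnit hr, fun f _ hρ hf =>
  ζ.exists_hasSum_varpi hr f (fun α => (hρ α).imp_right fun h => h.trans_eq (radius_coe _).symm) hf⟩

end LaurentExpansion


/-! ### The maps from the bounded to the Robba rings -/

section BaseChange

open scoped TensorProduct

lemma Hat.map_comm {A B B' C : Type*} [CommRing A] [CommRing B] [CommRing B'] [CommRing C]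
    {J I I' J' : Type*} {q : J → RingSeminorm A} {q₁ : I → RingSeminorm B}
    {q₂ : I' → RingSeminorm B'} {q' : J' → RingSeminorm C}
    {φ : A →+* B} {ψ : B →+* C} {φ' : A →+* B'} {ψ' : B' →+* C}
    (hφ : ∀ i, ∃ j, ∃ β : ℝ, 0 < β ∧ ∀ a, q₁ i (φ a) ≤ (q j a) ^ β)
    (hψ : ∀ i, ∃ j, ∃ β : ℝ, 0 < β ∧ ∀ a, q' i (ψ a) ≤ (q₁ j a) ^ β)
    (hφ' : ∀ i, ∃ j, ∃ β : ℝ, 0 < β ∧ ∀ a, q₂ i (φ' a) ≤ (q j a) ^ β)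
    (hψ' : ∀ i, ∃ j, ∃ β : ℝ, 0 < β ∧ ∀ a, q' i (ψ' a) ≤ (q₂ j a) ^ β)
    (h : ∀ a, ψ (φ a) = ψ' (φ' a)) (x : Hat q) :
    map (q' := q') ψ hψ (map (q' := q₁) φ hφ x) =
      map (q' := q') ψ' hψ' (map (q' := q₂) φ' hφ' x) := by
  refine (denseRange_of q).induction_on x (isClosed_eq ((continuous_map ψ hψ).comp
    (continuous_map φ hφ)) ((continuous_map ψ' hψ').comp (continuous_map φ' hφ'))) fun a => ?_
  rw [map_of, map_of, map_of, map_of, h]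

variable {K K' : Type*} [NormedCommRing K] [NormedCommRing K'] [Algebra K' K] {Δ : Type*}
  [Fintype Δ] {A B : Δ → Type*} [∀ α, CommRing (A α)] [∀ α, Algebra K' (A α)]
  [∀ α, CommRing (B α)] [∀ α, Algebra K (B α)]

/-- The ring homomorphism on a tensor product over `K'` given by a multiplicative map that is
multilinear along `σ : K' → S`. -/
noncomputable def tensorLift {S : Type*} [CommRing S] (σ : K' →+* S) (f : (∀ α, A α) →* S)
    (hadd : ∀ (_ : DecidableEq Δ) (x : ∀ α, A α) α a b, f (Function.update x α (a + b)) =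
      f (Function.update x α a) + f (Function.update x α b))
    (hsmul : ∀ (_ : DecidableEq Δ) (x : ∀ α, A α) α c a, f (Function.update x α (c • a)) =
      σ c * f (Function.update x α a)) : (⨂[K'] α, A α) →+* S :=
  letI : Algebra K' S := σ.toAlgebra
  (PiTensorProduct.liftAlgHom (R := K') (S := S)
    { toFun := f
      map_update_add' := fun {_} x α a b => hadd _ x α a b
      map_update_smul' := fun {_} x α c a => (hsmul _ x α c a).trans (Algebra.smul_def c _).symm }
    (map_one f) (map_mul f)).toRingHom

lemma tensorLift_smul_tprod {S : Type*} [CommRing S] {σ : K' →+* S} {f : (∀ α, A α) →* S}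
    {hadd : ∀ (_ : DecidableEq Δ) (x : ∀ α, A α) α a b, f (Function.update x α (a + b)) =
      f (Function.update x α a) + f (Function.update x α b)}
    {hsmul : ∀ (_ : DecidableEq Δ) (x : ∀ α, A α) α c a, f (Function.update x α (c • a)) =
      σ c * f (Function.update x α a)} (c : K') (x : ∀ α, A α) :
    tensorLift σ f hadd hsmul (c • PiTensorProduct.tprod K' x) = σ c * f x := by
  let : Algebra K' S := σ.toAlgebra
  refine (map_smul (PiTensorProduct.liftAlgHom (R := K') (S := S) _ _ _) c _).trans ?_
  rw [Algebra.smul_def]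
  exact congrArg (σ c * ·) (PiTensorProduct.lift.tprod _)

lemma tensorProd_update (φ : ∀ α, A α →+* B α) [DecidableEq Δ] (x : ∀ α, A α) (α : Δ) (c : A α) :
    (fun β => φ β (Function.update x α c β)) =
      Function.update (fun β => φ β (x β)) α (φ α c) := by
  funext β
  rcases eq_or_ne β α with rfl | hβ
  · simp
  · simp [hβ]

/-- The homomorphism `⨂_{K'} A_α → ⨂_K B_α` induced by homomorphisms `A_α → B_α` over `K' → K`. -/
noncomputable def tensorBaseMap (φ : ∀ α, A α →+* B α)
    (hφ : ∀ α c, φ α (algebraMap K' (A α) c) = algebraMap K (B α) (algebraMap K' K c)) :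
    (⨂[K'] α, A α) →+* ⨂[K] α, B α :=
  tensorLift ((algebraMap K (⨂[K] α, B α)).comp (algebraMap K' K))
    ((PiTensorProduct.tprodMonoidHom K).comp
      (MonoidHom.pi fun α => (φ α).toMonoidHom.comp (Pi.evalMonoidHom A α)))
    (fun _ x α a b => by
      change PiTensorProduct.tprod K (fun β => φ β (Function.update x α (a + b) β)) =
        PiTensorProduct.tprod K (fun β => φ β (Function.update x α a β)) +
          PiTensorProduct.tprod K fun β => φ β (Function.update x α b β)
      rw [tensorProd_update, tensorProd_update, tensorProd_update, map_add,
        MultilinearMap.map_update_add])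
    (fun _ x α c a => by
      change PiTensorProduct.tprod K (fun β => φ β (Function.update x α (c • a) β)) =
        algebraMap K _ (algebraMap K' K c) *
          PiTensorProduct.tprod K (fun β => φ β (Function.update x α a β))
      rw [tensorProd_update, tensorProd_update, Algebra.smul_def, map_mul, hφ,
        ← Algebra.smul_def, ← Algebra.smul_def, MultilinearMap.map_update_smul])

variable {φ : ∀ α, A α →+* B α}
    {hφ : ∀ α c, φ α (algebraMap K' (A α) c) = algebraMap K (B α) (algebraMap K' K c)}

lemma tensorBaseMap_smul_tprod (c : K') (x : ∀ α, A α) :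
    tensorBaseMap φ hφ (c • PiTensorProduct.tprod K' x) =
      algebraMap K' K c • PiTensorProduct.tprod K fun α => φ α (x α) := by
  rw [tensorBaseMap, tensorLift_smul_tprod, Algebra.smul_def]
  rfl

lemma tensorBaseMap_tprod (x : ∀ α, A α) :
    tensorBaseMap φ hφ (PiTensorProduct.tprod K' x) =
      PiTensorProduct.tprod K fun α => φ α (x α) := by
  have := tensorBaseMap_smul_tprod (hφ := hφ) 1 x
  rwa [one_smul, map_one, one_smul] at this

lemma tensorSeminorm_baseMap_le {q : ∀ α, RingSeminorm (A α)} {q' : ∀ α, RingSeminorm (B α)}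
    {β : ℝ} (hβ : 0 < β)
    (h : ∀ (c : K') (x : ∀ α, A α), ‖algebraMap K' K c‖ * ∏ α, q' α (φ α (x α)) ≤
      (‖c‖ * ∏ α, q α (x α)) ^ β) (t : ⨂[K'] α, A α) :
    tensorSeminorm (K := K) q' (tensorBaseMap φ hφ t) ≤ (tensorSeminorm (K := K') q t) ^ β := by
  have h0 : ∀ (c : K') (x : ∀ α, A α), 0 ≤ ‖c‖ * ∏ α, q α (x α) := fun c x =>
    mul_nonneg (norm_nonneg _) (Finset.prod_nonneg fun α _ => apply_nonneg _ _)
  have hmem : ∀ r, t ∈ tensorBall q r → tensorBaseMap φ hφ t ∈ tensorBall q' (r ^ β) := by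
    intro r ht
    induction ht using AddSubgroup.closure_induction with
    | zero => rw [map_zero]; exact zero_mem _
    | add x y _ _ hx hy => rw [map_add]; exact add_mem hx hy
    | neg x _ hx => rw [map_neg]; exact neg_mem hx
    | mem x hx =>
      obtain ⟨c, x, rfl, hc⟩ := hx
      exact AddSubgroup.subset_closure ⟨_, _, tensorBaseMap_smul_tprod c x,
        (h c x).trans (Real.rpow_le_rpow (h0 c x) hc hβ.le)⟩
  have hn := apply_nonneg (tensorSeminorm (K := K) q') (tensorBaseMap φ hφ t)
  rw [← Real.rpow_inv_le_iff_of_pos hn (apply_nonneg _ _) hβ]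
  refine le_of_forall_gt fun r hr => ?_
  obtain ⟨s, hs, hsr⟩ := exists_between hr
  have hs0 : 0 ≤ s := (apply_nonneg _ t).trans hs.le
  refine lt_of_le_of_lt ?_ hsr
  rw [Real.rpow_inv_le_iff_of_pos hn hs0 hβ]
  exact tensorSeminorm_le q' (Real.rpow_nonneg hs0 _) (hmem s (mem_tensorBall_of_lt q hs))

end BaseChange

section Inclusion

open scoped TensorProduct

variable {p : ℕ} [hp : Fact p.Prime] (ζ : RootSystem p) {Δ : Type*} [Fintype Δ]

lemma RootSystem.AdagToBrig_algebraMap (r : Pos) (c : ℤ_[p]) :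
    ζ.AdagToBrig r (algebraMap ℤ_[p] (ζ.Adag r) c) =
      algebraMap ℚ_[p] (ζ.Brig r) (algebraMap ℤ_[p] ℚ_[p] c) := by
  refine congrArg (Hat.of (ζ.normBdag r)) (Subtype.ext ?_)
  exact (algebraMap_BTilt_int c).symm

lemma RootSystem.seminorm_AdagToBrig_le {r : Pos} (s : Set.Ici r) (x : ζ.Adag r) :
    Hat.seminorm (ζ.normBdag r) s (ζ.AdagToBrig r x) ≤ ζ.normAdag r x ^ (r.1 / s.1.1) := by
  refine (Hat.seminorm_of _ s _).trans_le ?_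
  have hne : Nonempty (Set.Icc r s.1) := ⟨⟨r, le_rfl, s.2⟩⟩
  refine ciSup_le fun t => ?_
  have hx := x.2.2
  have h1 : normB t.1 (algebraMap (WTilt p) (BTilt p) (x : WTilt p)) =
      wittNorm (valCflat p) t.1 (x : WTilt p) := by
    rw [normB_eq (n := 0) (Atilde_mono _ t.2.1 hx) (by rw [pow_zero, one_mul]), pow_zero, one_mul]
  refine h1.trans_le ((wittNorm_mono _ t.2.1 hx).trans ?_)
  refine Real.rpow_le_rpow_of_exponent_ge' (wittNorm_nonneg _ _ _) (wittNorm_le_one _ hx)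
    (div_pos r.2 (r.2.trans_le s.2)).le ?_
  exact div_le_div_of_nonneg_left r.2.le (r.2.trans_le t.2.1) t.2.2

/-- The map `⨂_{ℤ_p} A_{ℚ_p}^{†,r_α} → ⨂_{ℚ_p} B_{rig,ℚ_p}^{†,r_α}`. -/
noncomputable def RootSystem.inclTensor (r : Δ → Pos) :
    (⨂[ℤ_[p]] α, ζ.Adag (r α)) →+* ⨂[ℚ_[p]] α, ζ.Brig (r α) :=
  tensorBaseMap (fun α => ζ.AdagToBrig (r α)) fun α => ζ.AdagToBrig_algebraMap (r α)

variable (Δ) in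
lemma RootSystem.inclTensor_bound (r : Δ → Pos) (s : ∀ α, Set.Ici (r α)) :
    ∃ j : Unit, ∃ β : ℝ, 0 < β ∧ ∀ a, ζ.levelSeminorm r s (ζ.inclTensor r a) ≤
      ((fun _ : Unit => tensorSeminorm (K := ℤ_[p]) fun α => ζ.normAdag (r α)) j a) ^ β := by
  -- The norms for the radii `r` and `s` are compared through powers with exponents `r_α / s_α`; the
  -- smallest of them works for all factors, since the norms are at most `1`.
  obtain ⟨β, hβ0, hβ1, hβ⟩ : ∃ β : ℝ, 0 < β ∧ β ≤ 1 ∧ ∀ α, β ≤ (r α).1 / (s α).1.1 := by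
    have hs : ∀ α, 0 < (s α).1.1 := fun α => (r α).2.trans_le (s α).2
    rcases isEmpty_or_nonempty Δ with hΔ | hΔ
    · exact ⟨1, one_pos, le_rfl, fun α => (hΔ.false α).elim⟩
    · obtain ⟨α, hα⟩ := Finite.exists_min fun α => (r α).1 / (s α).1.1
      exact ⟨_, div_pos (r α).2 (hs α), (div_le_one (hs α)).2 (s α).2, hα⟩
  refine ⟨(), β, hβ0, tensorSeminorm_baseMap_le hβ0 fun c x => ?_⟩
  have h0 : ∀ α, 0 ≤ ζ.normAdag (r α) (x α) := fun α => apply_nonneg _ _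
  rw [Real.mul_rpow (norm_nonneg c) (Finset.prod_nonneg fun α _ => h0 α),
    ← Real.finsetProd_rpow _ _ fun α _ => h0 α]
  refine mul_le_mul ?_ ?_ (Finset.prod_nonneg fun α _ => apply_nonneg _ _)
    (Real.rpow_nonneg (norm_nonneg c) _)
  · have := Real.rpow_le_rpow_of_exponent_ge' (norm_nonneg c) (PadicInt.norm_le_one c) hβ0.le hβ1
    rwa [Real.rpow_one] at this
  · refine Finset.prod_le_prod (fun α _ => apply_nonneg _ _) fun α _ => ?_
    exact (ζ.seminorm_AdagToBrig_le (s α) (x α)).trans (Real.rpow_le_rpow_of_exponent_ge' (h0 α)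
      (wittNorm_le_one _ (x α).2.2) hβ0.le (hβ α))

/-- The map `A_{ℚ_p,Δ}^{†,r} → B_{rig,ℚ_p,Δ}^{†,r}`. -/
noncomputable def RootSystem.inclLevel (r : Δ → Pos) : ζ.AdagLevel r →+* ζ.BrigLevel r :=
  Hat.map (ζ.inclTensor r) (ζ.inclTensor_bound Δ r)

lemma RootSystem.continuous_inclLevel (r : Δ → Pos) : Continuous (ζ.inclLevel r) :=
  Hat.continuous_map _ (ζ.inclTensor_bound Δ r)

/-- The seminorm on `⨂ A_{ℚ_p}^{†,r_α}`, as a family with one member. -/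
noncomputable abbrev RootSystem.dagSeminorm (r : Δ → Pos) (_ : Unit) :
    RingSeminorm (⨂[ℤ_[p]] α, ζ.Adag (r α)) :=
  tensorSeminorm fun α => ζ.normAdag (r α)

lemma RootSystem.inclLevel_of (r : Δ → Pos) (x : ⨂[ℤ_[p]] α, ζ.Adag (r α)) :
    ζ.inclLevel r (Hat.of (ζ.dagSeminorm r) x) =
      Hat.of (ζ.levelSeminorm r) (ζ.inclTensor r x) :=
  Hat.map_of _ (ζ.inclTensor_bound Δ r) x

lemma RootSystem.inclLevel_tprod (r : Δ → Pos) (x : ∀ α, ζ.Adag (r α)) :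
    ζ.inclLevel r (Hat.of (ζ.dagSeminorm r) (PiTensorProduct.tprod ℤ_[p] x)) =
      Hat.of (ζ.levelSeminorm r) (PiTensorProduct.tprod ℚ_[p] fun α => ζ.AdagToBrig (r α) (x α)) :=
  (ζ.inclLevel_of r _).trans (congrArg _ (tensorBaseMap_tprod x))

lemma tensorMap_tensorBaseMap {K K' : Type*} [NormedCommRing K] [NormedCommRing K']
    [Algebra K' K] {A A' B B' : Δ → Type*} [∀ α, CommRing (A α)] [∀ α, Algebra K' (A α)]
    [∀ α, CommRing (A' α)] [∀ α, Algebra K' (A' α)] [∀ α, CommRing (B α)] [∀ α, Algebra K (B α)]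
    [∀ α, CommRing (B' α)] [∀ α, Algebra K (B' α)] {φ : ∀ α, A α →+* B α}
    {hφ : ∀ α c, φ α (algebraMap K' (A α) c) = algebraMap K (B α) (algebraMap K' K c)}
    {φ' : ∀ α, A' α →+* B' α}
    {hφ' : ∀ α c, φ' α (algebraMap K' (A' α) c) = algebraMap K (B' α) (algebraMap K' K c)}
    {ψ : ∀ α, A α →ₐ[K'] A' α} {χ : ∀ α, B α →ₐ[K] B' α}
    (h : ∀ α x, χ α (φ α x) = φ' α (ψ α x)) (x : ⨂[K'] α, A α) :
    tensorMap χ (tensorBaseMap φ hφ x) = tensorBaseMap φ' hφ' (tensorMap ψ x) := by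
  induction x using PiTensorProduct.induction_on with
  | smul_tprod c x =>
    rw [tensorBaseMap_smul_tprod, map_smul, map_smul, tensorMap_tprod, tensorMap_tprod,
      tensorBaseMap_smul_tprod]
    simp only [h]
  | add x y hx hy => rw [map_add, map_add, map_add, map_add, hx, hy]

lemma RootSystem.BrigLevelMap_inclLevel {r s : Δ → Pos} (h : r ≤ s) (y : ζ.AdagLevel r) :
    ζ.BrigLevelMap r s h (ζ.inclLevel r y) = ζ.inclLevel s (ζ.AdagLevelMap h y) :=
  Hat.map_comm (ζ.inclTensor_bound Δ r) (ζ.BrigTensor_bound h) (ζ.Adag_bound h)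
    (ζ.inclTensor_bound Δ s)
    (tensorMap_tensorBaseMap fun α x => ζ.BrigMap_AdagToBrig (h α) x) y

end Inclusion


/-! ### Laurent expansions in the bounded rings -/

section

variable {K : Type*} [NormedCommRing K] {A : Type*} [CommRing A] [Algebra K A] {J : Type*}
  [Nonempty J] {q : J → RingSeminorm A} {L I : Type*} [NormedAddCommGroup L] {e : I → A}
  {c : I → Hat q →+ L} {w : J → I → ℝ}

/-- In a completion with an orthogonal family, a family of coefficients that tends to zero in all
weights is the family of coefficients of an element. -/
lemma IsOrthogonal.exists_coeff_eq
    (h : ∀ j, IsOrthogonal K (Hat.seminorm q j) (fun i => Hat.of q (e i)) c (w j))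
    (hc : ∀ i, Continuous (c i)) (hq : ∀ j a b, q j (a + b) ≤ max (q j a) (q j b)) (d : I → K)
    (hd : ∀ j, Tendsto (fun i => ‖c i (d i • Hat.of q (e i))‖ * w j i) cofinite (𝓝 0)) :
    ∃ y, ∀ i, c i y = c i (d i • Hat.of q (e i)) := by
  have hs : Summable fun i => d i • Hat.of q (e i) := Hat.summable_of_tendsto hq fun j =>
    squeeze_zero (fun i => apply_nonneg _ _) (fun i => (h j).smul_le i (d i)) (hd j)
  refine ⟨∑' i, d i • Hat.of q (e i), fun i => ?_⟩
  refine (hs.hasSum.map (c i) (hc i)).unique (hasSum_single i fun j hj => ?_)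
  exact (h (Classical.arbitrary J)).ortho i j (d j) hj.symm

end

section DagLevel

open scoped TensorProduct

variable {p : ℕ} [hp : Fact p.Prime] (ζ : RootSystem p) {Δ : Type*} [Fintype Δ] {r : Δ → Pos}

/-- The elements `p^m u^n` with the least possible `m` are orthogonal generators of `A_{ℚ_p}^{†,r}`
over `ℤ_p`. The powers of `u` alone do not suffice, as the negative ones have norm greater than `1`.
-/
lemma RootSystem.isOrthogonal_Adag {r : Pos} (hr : 1 < r.1) :
    IsOrthogonal ℤ_[p] (ζ.normAdag r) (ζ.basisDag hr) (fun n => (ζ.coeffDag r n).toAddMonoidHom)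
      (fun n => (radius p r : ℝ) ^ n) where
  zero := map_zero _
  add_le x y := wittNorm_add_le _ x.2.2 y.2.2
  smul_le n d := by
    change _ ≤ ‖ζ.coeffDag r n (d • _)‖ * _
    rw [(ζ.coeffDag r n).map_smul, ζ.coeffDag_basisDag, Pi.single_eq_same, smul_eq_mul, norm_mul,
      Algebra.smul_def, mul_assoc]
    refine (map_mul_le_mul (ζ.normAdag r) _ _).trans ?_
    refine mul_le_mul ?_ (ζ.normAdag_basisDag_le hr n) (apply_nonneg _ _) (norm_nonneg d)
    have h := ζ.wittNorm_mono_le (t := r) hr.le d 0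
    rwa [zpow_zero, mul_one, RootSystem.mono, zpow_zero, Units.val_one, mul_one] at h
  le n y := ζ.coeffDag_le hr.le le_rfl y n
  ortho n m d hnm := by
    change ζ.coeffDag r n (d • _) = 0
    rw [map_smul, ζ.coeffDag_basisDag, Pi.single_eq_of_ne hnm, smul_zero]
  dense y ε hε := by
    obtain ⟨z, hz, h⟩ := ζ.exists_normAdag_sub_lt hr y hε
    obtain ⟨d, rfl⟩ := (Finsupp.mem_span_range_iff_exists_finsupp).1 hz
    exact ⟨d, h⟩

/-- The pure tensor `⨂ p^{m_α} u^{i_α}` in `⨂ A_{ℚ_p}^{†,r_α}`, with the `m_α` as small as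
possible. -/
noncomputable def RootSystem.basisTensor (hr : ∀ α, 1 < (r α).1) (i : Δ → ℤ) :
    ⨂[ℤ_[p]] α, ζ.Adag (r α) :=
  PiTensorProduct.tprod ℤ_[p] fun α => ζ.basisDag (hr α) (i α)

/-- The coefficient functionals on `⨂ A_{ℚ_p}^{†,r_α}`. -/
noncomputable def RootSystem.coeffDagTensor (r : Δ → Pos) (i : Δ → ℤ) :
    (⨂[ℤ_[p]] α, ζ.Adag (r α)) →ₗ[ℤ_[p]] ℤ_[p] :=
  tensorCoeff fun α => ζ.coeffDag (r α) (i α)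

lemma RootSystem.isOrthogonal_AdagTensor (hr : ∀ α, 1 < (r α).1) :
    IsOrthogonal ℤ_[p] (ζ.dagSeminorm r ()) (ζ.basisTensor hr)
      (fun i => (ζ.coeffDagTensor r i).toAddMonoidHom)
      (fun i => ∏ α, (radius p (r α) : ℝ) ^ i α) :=
  IsOrthogonal.tensor (fun α => ζ.isOrthogonal_Adag (hr α))
    fun _ _ => (zpow_pos (radius_pos _) _).le

lemma prod_radius_zpow_pos (r : Δ → Pos) (i : Δ → ℤ) : 0 < ∏ α, (radius p (r α) : ℝ) ^ i α :=
  Finset.prod_pos fun _ _ => zpow_pos (radius_pos _) _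

lemma RootSystem.exists_coeffDagLevel (hr : ∀ α, 1 < (r α).1) (i : Δ → ℤ) :
    ∃ ψ : ζ.AdagLevel r →+ ℤ_[p], Continuous ψ ∧ ∀ a, ψ (Hat.of (ζ.dagSeminorm r) a) =
      ζ.coeffDagTensor r i a :=
  Hat.exists_extension ℤ_[p] (j := ()) (prod_radius_zpow_pos r i)
    (ζ.coeffDagTensor r i).toAddMonoidHom fun a => (ζ.isOrthogonal_AdagTensor hr).le i a

/-- The coefficient of `u^i` in the Laurent expansion of an element of `A_{ℚ_p,Δ}^{†,r}`. -/
noncomputable def RootSystem.coeffDagLevel (hr : ∀ α, 1 < (r α).1) (i : Δ → ℤ) :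
    ζ.AdagLevel r →+ ℤ_[p] := (ζ.exists_coeffDagLevel hr i).choose

lemma RootSystem.continuous_coeffDagLevel (hr : ∀ α, 1 < (r α).1) (i : Δ → ℤ) :
    Continuous (ζ.coeffDagLevel hr i) := (ζ.exists_coeffDagLevel hr i).choose_spec.1

lemma RootSystem.coeffDagLevel_of (hr : ∀ α, 1 < (r α).1) (i : Δ → ℤ)
    (a : ⨂[ℤ_[p]] α, ζ.Adag (r α)) :
    ζ.coeffDagLevel hr i (Hat.of (ζ.dagSeminorm r) a) = ζ.coeffDagTensor r i a :=
  (ζ.exists_coeffDagLevel hr i).choose_spec.2 a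

lemma RootSystem.isOrthogonal_AdagLevel (hr : ∀ α, 1 < (r α).1) :
    IsOrthogonal ℤ_[p] (Hat.seminorm (ζ.dagSeminorm r) ())
      (fun i => Hat.of (ζ.dagSeminorm r) (ζ.basisTensor hr i)) (ζ.coeffDagLevel hr)
      (fun i => ∏ α, (radius p (r α) : ℝ) ^ i α) :=
  (ζ.isOrthogonal_AdagTensor hr).hat (q := ζ.dagSeminorm r) (ζ.continuous_coeffDagLevel hr)
    fun i a => ζ.coeffDagLevel_of hr i a

lemma RootSystem.coeffDagTensor_smul_tprod (i : Δ → ℤ) (c : ℤ_[p]) (x : ∀ α, ζ.Adag (r α)) :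
    ζ.coeffDagTensor r i (c • PiTensorProduct.tprod ℤ_[p] x) =
      c * ∏ α, ζ.coeffDag (r α) (i α) (x α) := by
  rw [map_smul, smul_eq_mul]
  exact congrArg (c * ·) (tensorCoeff_tprod _ _)

lemma RootSystem.coeffBrigTensor_inclTensor (hr : ∀ α, 1 < (r α).1) (i : Δ → ℤ)
    (x : ⨂[ℤ_[p]] α, ζ.Adag (r α)) :
    tensorCoeff (fun α => ζ.coeffBrig (hr α) (i α)) (ζ.inclTensor r x) =
      (ζ.coeffDagTensor r i x : ℚ_[p]) := by
  induction x using PiTensorProduct.induction_on with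
  | smul_tprod c x =>
    rw [ζ.coeffDagTensor_smul_tprod]
    refine (congrArg _ (tensorBaseMap_smul_tprod c x)).trans ?_
    rw [LinearMap.map_smul, tensorCoeff_tprod, smul_eq_mul, PadicInt.coe_mul]
    refine congrArg ((c : ℚ_[p]) * ·) ?_
    simp only [ζ.coeffBrig_AdagToBrig]
    exact (map_prod (PadicInt.Coe.ringHom (p := p)) _ _).symm
  | add x y hx hy =>
    rw [(ζ.inclTensor r).map_add, LinearMap.map_add, LinearMap.map_add, hx, hy, PadicInt.coe_add]

/-- The map from `A_{ℚ_p,Δ}^{†,r}` to `B_{rig,ℚ_p,Δ}^{†,r}` preserves Laurent expansions. -/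
lemma RootSystem.coeffLevel_inclLevel (hr : ∀ α, 1 < (r α).1) (i : Δ → ℤ) (y : ζ.AdagLevel r) :
    ζ.coeffLevel hr i (ζ.inclLevel r y) = (ζ.coeffDagLevel hr i y : ℚ_[p]) := by
  have h1 := (ζ.continuous_coeffLevel hr i).comp (ζ.continuous_inclLevel r)
  have h2 : Continuous fun x : ℤ_[p] => (x : ℚ_[p]) := continuous_subtype_val
  refine (Hat.denseRange_of (ζ.dagSeminorm r)).induction_on y
    (isClosed_eq h1 (h2.comp (ζ.continuous_coeffDagLevel hr i))) fun a => ?_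
  rw [ζ.inclLevel_of, ζ.coeffLevel_of, ζ.coeffDagLevel_of, ζ.coeffBrigTensor_inclTensor]

/-- An element of `A_{ℚ_p,Δ}^{†,r}` is determined by its Laurent expansion. -/
lemma RootSystem.eq_zero_of_coeffDagLevel (hr : ∀ α, 1 < (r α).1) {y : ζ.AdagLevel r}
    (h : ∀ i, ζ.coeffDagLevel hr i y = 0) : y = 0 := by
  refine Hat.eq_zero_of_seminorm (ζ.dagSeminorm r) fun _ => le_antisymm ?_ (apply_nonneg _ _)
  refine (ζ.isOrthogonal_AdagLevel hr).le_of_forall le_rfl (fun i => ?_)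
    (fun a b => PadicInt.nonarchimedean a b) fun i => (prod_radius_zpow_pos r i).le
  rw [h, norm_zero, zero_mul]

lemma RootSystem.inclLevel_injective (hr : ∀ α, 1 < (r α).1) :
    Function.Injective (ζ.inclLevel r) := by
  refine (injective_iff_map_eq_zero _).2 fun y hy => ζ.eq_zero_of_coeffDagLevel hr fun i => ?_
  have h := ζ.coeffLevel_inclLevel hr i y
  rw [hy, (ζ.coeffLevel hr i).map_zero] at h
  exact Subtype.ext h.symm

/-- The coefficients of an element of `A_{ℚ_p,Δ}^{†,r}` decay exponentially in the negative
directions, uniformly in the element. -/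
lemma RootSystem.norm_coeffDagLevel_le (hr : ∀ α, 1 < (r α).1) (i : Δ → ℤ) (y : ζ.AdagLevel r) :
    ‖ζ.coeffDagLevel hr i y‖ ≤ ∏ α, (radius p (r α) : ℝ) ^ (-i α).toNat := by
  have hρ : ∀ α, (0 : ℝ) < radius p (r α) := fun α => radius_pos _
  refine (Hat.denseRange_of (ζ.dagSeminorm r)).induction_on y
    (isClosed_le (ζ.continuous_coeffDagLevel hr i).norm continuous_const) fun a => ?_
  rw [ζ.coeffDagLevel_of]
  induction a using PiTensorProduct.induction_on with
  | smul_tprod c x =>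
    rw [ζ.coeffDagTensor_smul_tprod, norm_mul, norm_prod]
    refine (mul_le_of_le_one_left (Finset.prod_nonneg fun α _ => norm_nonneg _)
      (PadicInt.norm_le_one c)).trans ?_
    refine Finset.prod_le_prod (fun α _ => norm_nonneg _) fun α _ => ?_
    rcases le_total 0 (i α) with hi | hi
    · rw [Int.toNat_eq_zero.2 (neg_nonpos.2 hi), pow_zero]
      exact PadicInt.norm_le_one _
    · have h := (ζ.coeffDag_le (hr α).le le_rfl (x α) (i α)).trans (wittNorm_le_one _ (x α).2.2)
      rwa [← le_div_iff₀ (zpow_pos (hρ α) _), one_div, ← zpow_neg,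
        ← Int.toNat_of_nonneg (neg_nonneg.2 hi), zpow_natCast] at h
  | add x y hx hy =>
    rw [LinearMap.map_add]
    exact (PadicInt.nonarchimedean _ _).trans (max_le hx hy)

lemma exists_int_mul_eq {p : ℕ} [Fact p.Prime] {x : ℚ_[p]} {a : ℤ_[p]} (h : ‖x‖ ≤ ‖a‖) :
    ∃ d : ℤ_[p], ((d * a : ℤ_[p]) : ℚ_[p]) = x := by
  rcases eq_or_ne a 0 with rfl | ha
  · rw [norm_zero] at h
    exact ⟨0, by rw [norm_le_zero_iff.1 h, mul_zero, PadicInt.coe_zero]⟩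
  · have ha' : (a : ℚ_[p]) ≠ 0 := fun h0 => ha (Subtype.ext h0)
    refine ⟨⟨x / a, ?_⟩, ?_⟩
    · rw [norm_div]
      exact div_le_one_of_le₀ h (norm_nonneg _)
    · exact div_mul_cancel₀ x ha'

/-- A family of multiples of the coefficients of the generators is the family of coefficients of an
element as soon as the terms tend to zero. -/
lemma RootSystem.exists_coeffDagLevel_eq (hr : ∀ α, 1 < (r α).1) (d : (Δ → ℤ) → ℤ_[p])
    (hd : Tendsto (fun i : Δ → ℤ => ‖d i * ∏ α, (p : ℤ_[p]) ^ minExp p (r α) (i α)‖ *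
      ∏ α, (radius p (r α) : ℝ) ^ i α) cofinite (𝓝 0)) :
    ∃ y : ζ.AdagLevel r, ∀ i, ζ.coeffDagLevel hr i y =
      d i * ∏ α, (p : ℤ_[p]) ^ minExp p (r α) (i α) := by
  have hcoeff : ∀ i, ζ.coeffDagLevel hr i (d i • Hat.of (ζ.dagSeminorm r) (ζ.basisTensor hr i)) =
      d i * ∏ α, (p : ℤ_[p]) ^ minExp p (r α) (i α) := by
    intro i
    rw [Hat.smul_of, ζ.coeffDagLevel_of]
    refine (ζ.coeffDagTensor_smul_tprod i _ _).trans (congrArg (d i * ·) ?_)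
    exact Finset.prod_congr rfl fun α _ => by rw [ζ.coeffDag_basisDag, Pi.single_eq_same]
  have hex := IsOrthogonal.exists_coeff_eq (fun _ : Unit => ζ.isOrthogonal_AdagLevel hr)
    (ζ.continuous_coeffDagLevel hr) (fun _ a b => (ζ.isOrthogonal_AdagTensor hr).add_le a b) d
    fun _ => (tendsto_congr fun i => by rw [hcoeff]).2 hd
  exact hex.imp fun y hy i => (hy i).trans (hcoeff i)

/-- An element of `B_{rig,ℚ_p,Δ}^{†,r}` comes from `A_{ℚ_p,Δ}^{†,r}` if the terms of its Laurent
expansion do. -/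
lemma RootSystem.exists_inclLevel_eq (hr : ∀ α, 1 < (r α).1) (w : ζ.BrigLevel r)
    (h : ∀ i, ‖ζ.coeffLevel hr i w‖ ≤ ∏ α, ‖(p : ℤ_[p]) ^ minExp p (r α) (i α)‖) :
    ∃ y, ζ.inclLevel r y = w := by
  have h1 := ((ζ.isTopBasis_BrigLevel hr).orth fun α => ⟨r α, Set.self_mem_Ici⟩).tendsto
    (fun i => (levelWeight_pos _ _ _).le) w
  have hb : ∀ i, ∃ d : ℤ_[p],
      ((d * ∏ α, (p : ℤ_[p]) ^ minExp p (r α) (i α) : ℤ_[p]) : ℚ_[p]) = ζ.coeffLevel hr i w :=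
    fun i => exists_int_mul_eq ((h i).trans_eq (norm_prod _ _).symm)
  choose d hd using hb
  have h2 : Tendsto (fun i : Δ → ℤ => ‖d i * ∏ α, (p : ℤ_[p]) ^ minExp p (r α) (i α)‖ *
      ∏ α, (radius p (r α) : ℝ) ^ i α) cofinite (𝓝 0) := by
    refine (tendsto_congr fun i => ?_).1 h1
    rw [PadicInt.norm_def, hd, levelWeight]
    simp only [max_self]
  refine (ζ.exists_coeffDagLevel_eq hr d h2).imp fun y hy =>
    (ζ.isTopBasis_BrigLevel hr).ext fun i => ?_
  exact (ζ.coeffLevel_inclLevel hr i y).trans ((congrArg _ (hy i)).trans (hd i))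

end DagLevel

/-! ### Direct limits of localizations -/

section AwayLimit

variable {ι : Type*} [Preorder ι] {G : ι → Type*} [∀ i, CommRing (G i)] {x : ∀ i, G i}
  {f : ∀ i j, i ≤ j → G i →+* G j}
  {F : ∀ i j, i ≤ j → Localization.Away (x i) →+* Localization.Away (x j)}

/-- The map from `G_i` to the direct limit of the rings `G_i[1/x_i]`. -/
noncomputable def toAwayLimit
    (F : ∀ i j, i ≤ j → Localization.Away (x i) →+* Localization.Away (x j))
    (i : ι) : G i →+* Ring.DirectLimit (fun i => Localization.Away (x i)) (fun i j h => F i j h) :=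
  (Ring.DirectLimit.of (fun i => Localization.Away (x i)) (fun i j h => F i j h) i).comp
    (algebraMap _ _)

lemma toAwayLimit_map (hF : ∀ i j h y, F i j h (algebraMap _ _ y) = algebraMap _ _ (f i j h y))
    {i j : ι} (h : i ≤ j) (y : G i) : toAwayLimit F j (f i j h y) = toAwayLimit F i y := by
  refine Eq.trans ?_ (Ring.DirectLimit.of_f (G := fun i => Localization.Away (x i))
    (f := fun i j h => F i j h) h (algebraMap _ _ y))
  rw [hF]
  rfl

lemma isUnit_toAwayLimit (i : ι) : IsUnit (toAwayLimit F i (x i)) :=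
  (IsLocalization.Away.algebraMap_isUnit (S := Localization.Away (x i)) (x i)).map
    (Ring.DirectLimit.of (fun i => Localization.Away (x i)) (fun i j h => F i j h) i)

lemma toAwayLimit_eq [IsDirectedOrder ι]
    (hF : ∀ i j h y, F i j h (algebraMap _ _ y) = algebraMap _ _ (f i j h y))
    (hx : ∀ i j h, f i j h (x i) = x j) (i j : ι) :
    toAwayLimit F i (x i) = toAwayLimit F j (x j) := by
  obtain ⟨k, hi, hj⟩ := exists_ge_ge i j
  rw [← toAwayLimit_map hF hi, ← toAwayLimit_map hF hj, hx, hx]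

/-- Every element of the limit becomes an element of some `G_i` after multiplication by a power of
`x_i`. -/
lemma exists_toAwayLimit [Nonempty ι] [IsDirectedOrder ι]
    (z : Ring.DirectLimit (fun i => Localization.Away (x i)) (fun i j h => F i j h)) :
    ∃ (i : ι) (n : ℕ) (y : G i), z * toAwayLimit F i (x i) ^ n = toAwayLimit F i y := by
  obtain ⟨i, a, rfl⟩ := Ring.DirectLimit.exists_of z
  obtain ⟨n, y, hy⟩ := IsLocalization.Away.surj (x i) a
  refine ⟨i, n, y, ?_⟩
  refine Eq.trans ?_ (congrArg (Ring.DirectLimit.of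
    (fun i => Localization.Away (x i)) (fun i j h => F i j h) i) hy)
  rw [map_mul, map_pow]
  rfl

variable {T : Type*} [CommRing T] {g : ∀ i, G i →+* T}

/-- The homomorphism from the direct limit of the rings `G_i[1/x_i]` given by compatible
homomorphisms that send `x_i` to units. -/
noncomputable def awayLimitLift
    (hF : ∀ i j h y, F i j h (algebraMap _ _ y) = algebraMap _ _ (f i j h y))
    (hg : ∀ i j h y, g j (f i j h y) = g i y) (hu : ∀ i, IsUnit (g i (x i))) :
    Ring.DirectLimit (fun i => Localization.Away (x i)) (fun i j h => F i j h) →+* T :=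
  Ring.DirectLimit.lift (fun i => Localization.Away (x i)) (fun i j h => F i j h) _
    (fun i => IsLocalization.Away.lift (x i) (hu i)) fun i j h y => by
      refine RingHom.congr_fun (f := (IsLocalization.Away.lift (x j) (hu j)).comp (F i j h)) ?_ y
      refine IsLocalization.ringHom_ext (Submonoid.powers (x i)) (RingHom.ext fun a => ?_)
      rw [RingHom.comp_apply, RingHom.comp_apply, hF, IsLocalization.Away.lift_eq,
        RingHom.comp_apply, IsLocalization.Away.lift_eq, hg]

lemma awayLimitLift_toAwayLimit
    (hF : ∀ i j h y, F i j h (algebraMap _ _ y) = algebraMap _ _ (f i j h y))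
    (hg : ∀ i j h y, g j (f i j h y) = g i y) (hu : ∀ i, IsUnit (g i (x i))) (i : ι) (y : G i) :
    awayLimitLift hF hg hu (toAwayLimit F i y) = g i y :=
  (Ring.DirectLimit.lift_of (G := fun i => Localization.Away (x i))
    (f := fun i j h => F i j h) _ _ _ _ _).trans (IsLocalization.Away.lift_eq (x i) (hu i) y)

lemma awayLimitLift_injective [Nonempty ι] [IsDirectedOrder ι]
    (hF : ∀ i j h y, F i j h (algebraMap _ _ y) = algebraMap _ _ (f i j h y))
    (hg : ∀ i j h y, g j (f i j h y) = g i y) (hu : ∀ i, IsUnit (g i (x i)))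
    (hinj : ∀ i y, g i y = 0 → ∃ j h, f i j h y = 0) :
    Function.Injective (awayLimitLift hF hg hu) := by
  refine (injective_iff_map_eq_zero _).2 fun z hz => ?_
  obtain ⟨i, n, y, hy⟩ := exists_toAwayLimit z
  have h1 : g i y = 0 := by
    rw [← awayLimitLift_toAwayLimit hF hg hu, ← hy, map_mul, hz, zero_mul]
  obtain ⟨j, h, h0⟩ := hinj i y h1
  have h2 : toAwayLimit F i y = 0 := by rw [← toAwayLimit_map hF h, h0, map_zero]
  rw [h2] at hy
  exact (((isUnit_toAwayLimit i).pow n).mul_left_eq_zero).1 hy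

end AwayLimit

/-! ### The inclusion of the bounded ring in the Robba ring -/

section TensorInclusion

open scoped TensorProduct

variable {p : ℕ} [hp : Fact p.Prime] (ζ : RootSystem p) {Δ : Type*} [Fintype Δ] {r : Δ → Pos}

lemma RootSystem.inclLevel_varpi (hr : ∀ α, 1 < (r α).1) :
    ζ.inclLevel r (ζ.varpi r) = Hat.of (ζ.levelSeminorm r) (ζ.uTensor hr 1) := by
  refine (ζ.inclLevel_tprod r _).trans (congrArg (fun x => Hat.of (ζ.levelSeminorm r)
    (PiTensorProduct.tprod ℚ_[p] x)) (funext fun α => ?_))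
  rw [Pi.one_apply, zpow_one, ζ.val_uBrig]

lemma RootSystem.isUnit_inclLevel_varpi (r : Δ → Pos) :
    IsUnit (ζ.toBrigDelta r (ζ.inclLevel r (ζ.varpi r))) := by
  have h1 : ζ.toBrigDelta r (ζ.inclLevel r (ζ.varpi r)) = ζ.toBrigDelta (enlarge r)
      (ζ.varpiMonomial (one_lt_enlarge r) 1 : ζ.BrigLevel (enlarge r)) := by
    refine (ζ.toBrigDelta_map (le_enlarge r) _).symm.trans (congrArg _ ?_)
    refine (ζ.BrigLevelMap_inclLevel (le_enlarge r) _).trans ?_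
    refine (congrArg _ (ζ.AdagLevelMap_varpi (le_enlarge r))).trans ?_
    exact (ζ.inclLevel_varpi (one_lt_enlarge r)).trans (ζ.val_varpiMonomial _ _).symm
  rw [h1]
  exact IsUnit.map (ζ.toBrigDelta (enlarge r)) (Units.isUnit _)

lemma RootSystem.AdagAwayMap_algebraMap (r s : Δ → Pos) (h : r ≤ s) (y : ζ.AdagLevel r) :
    ζ.AdagAwayMap r s h (algebraMap _ _ y) = algebraMap _ _ (ζ.AdagLevelMap h y) :=
  IsLocalization.Away.lift_eq (ζ.varpi r) _ y

lemma RootSystem.toBrigDelta_inclLevel (r s : Δ → Pos) (h : r ≤ s) (y : ζ.AdagLevel r) :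
    ζ.toBrigDelta s (ζ.inclLevel s (ζ.AdagLevelMap h y)) = ζ.toBrigDelta r (ζ.inclLevel r y) :=
  (congrArg _ (ζ.BrigLevelMap_inclLevel h y)).symm.trans (ζ.toBrigDelta_map h _)

variable (Δ) in
/-- The map `A_{ℚ_p,Δ}^† → B_{rig,ℚ_p,Δ}^†`. -/
noncomputable def RootSystem.inclDelta : ζ.AdagDelta Δ →+* ζ.BrigDelta Δ :=
  awayLimitLift (f := fun _ _ h => ζ.AdagLevelMap h)
    (g := fun r => (ζ.toBrigDelta r).comp (ζ.inclLevel r))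
    ζ.AdagAwayMap_algebraMap ζ.toBrigDelta_inclLevel ζ.isUnit_inclLevel_varpi

lemma RootSystem.inclDelta_toAdagDelta (r : Δ → Pos) (y : ζ.AdagLevel r) :
    ζ.inclDelta Δ (ζ.toAdagDelta r y) = ζ.toBrigDelta r (ζ.inclLevel r y) :=
  awayLimitLift_toAwayLimit (f := fun _ _ h => ζ.AdagLevelMap h)
    (g := fun r => (ζ.toBrigDelta r).comp (ζ.inclLevel r))
    ζ.AdagAwayMap_algebraMap ζ.toBrigDelta_inclLevel ζ.isUnit_inclLevel_varpi r y

lemma RootSystem.isTensorInclusion_inclDelta : ζ.IsTensorInclusion (ζ.inclDelta Δ) := fun r =>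
  ⟨ζ.inclLevel r, ζ.continuous_inclLevel r, ζ.inclLevel_tprod r, ζ.inclDelta_toAdagDelta r⟩

lemma RootSystem.toAdagDelta_map {r s : Δ → Pos} (h : r ≤ s) (y : ζ.AdagLevel r) :
    ζ.toAdagDelta s (ζ.AdagLevelMap h y) = ζ.toAdagDelta r y :=
  toAwayLimit_map (f := fun _ _ h => ζ.AdagLevelMap h) ζ.AdagAwayMap_algebraMap h y

variable (Δ) in
/-- The element `ϖ` of `A_{ℚ_p,Δ}^†`. -/
noncomputable def RootSystem.varpiDelta : ζ.AdagDelta Δ :=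
  ζ.toAdagDelta (fun _ => onePos) (ζ.varpi fun _ => onePos)

lemma RootSystem.toAdagDelta_varpi (r : Δ → Pos) :
    ζ.toAdagDelta r (ζ.varpi r) = ζ.varpiDelta Δ :=
  toAwayLimit_eq (f := fun _ _ h => ζ.AdagLevelMap h) ζ.AdagAwayMap_algebraMap
    (fun _ _ h => ζ.AdagLevelMap_varpi h) r _

lemma RootSystem.isUnit_varpiDelta : IsUnit (ζ.varpiDelta Δ) :=
  isUnit_toAwayLimit (F := fun r s h => ζ.AdagAwayMap (Δ := Δ) r s h) _

instance nonempty_radii : Nonempty (Δ → Pos) := ⟨fun _ => onePos⟩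

/-- Every element of `A_{ℚ_p,Δ}^†` becomes an element of some `A_{ℚ_p,Δ}^{†,r}`, with `r_α > 1`,
after multiplication by a power of `ϖ`. -/
lemma RootSystem.exists_mul_varpiDelta_pow (z : ζ.AdagDelta Δ) :
    ∃ (r : Δ → Pos) (_ : ∀ α, 1 < (r α).1) (n : ℕ) (y : ζ.AdagLevel r),
      z * ζ.varpiDelta Δ ^ n = ζ.toAdagDelta r y := by
  obtain ⟨r, n, y, hy⟩ := exists_toAwayLimit z
  refine ⟨enlarge r, one_lt_enlarge r, n, ζ.AdagLevelMap (le_enlarge r) y, ?_⟩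
  refine Eq.trans ?_ (hy.trans (ζ.toAdagDelta_map (le_enlarge r) y).symm)
  exact congrArg (z * · ^ n) (ζ.toAdagDelta_varpi r).symm

lemma RootSystem.toBrigDelta_eq_zero (hr : ∀ α, 1 < (r α).1) {y : ζ.BrigLevel r}
    (h : ζ.toBrigDelta r y = 0) : y = 0 := by
  refine ζ.levelToRobba_injective hr ((ζ.toRobba_toBrigDelta hr y).symm.trans ?_)
  exact (congrArg _ h).trans ((map_zero _).trans (map_zero _).symm)

lemma RootSystem.inclDelta_injective : Function.Injective (ζ.inclDelta Δ) :=
  awayLimitLift_injective (f := fun _ _ h => ζ.AdagLevelMap h)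
    (g := fun r => (ζ.toBrigDelta r).comp (ζ.inclLevel r))
    ζ.AdagAwayMap_algebraMap ζ.toBrigDelta_inclLevel ζ.isUnit_inclLevel_varpi fun r y hy => by
      refine ⟨enlarge r, le_enlarge r, ζ.inclLevel_injective (one_lt_enlarge r) ?_⟩
      refine Eq.trans ?_ (map_zero _).symm
      refine ζ.toBrigDelta_eq_zero (one_lt_enlarge r) ?_
      exact (ζ.toBrigDelta_inclLevel r _ (le_enlarge r) y).trans hy

end TensorInclusion


/-! ### Integral bounded Laurent series -/

section IntegralBounded

variable {p : ℕ} [hp : Fact p.Prime] {Δ : Type*} [Fintype Δ]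

/-- The total size of the negative part of the exponent `i + (N, …, N)`. -/
def negSize (N : ℕ) (i : Δ → ℤ) : ℕ := ∑ α, (-(i α + N)).toNat

/-- The coefficients are integral and, outside an orthant, decay exponentially in the negative
directions. The expansions of the elements of `A_{ℚ_p,Δ}^†` are the Laurent series with this
property, and so are the series `f` with `limsup |f|_σ ≤ 1`. -/
def HasIntegralDecay (f : Coeffs p Δ) : Prop :=
  ∃ (τ : ℝ) (N : ℕ), 0 < τ ∧ τ < 1 ∧ ∀ i, ‖f i‖ ≤ τ ^ negSize N i

lemma negSize_add_le {N M : ℕ} {i : Δ → ℤ} (h : negSize (N + M) i ≠ 0) :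
    negSize (N + M) i + M ≤ negSize N i := by
  classical
  obtain ⟨β, -, hβ⟩ := Finset.exists_ne_zero_of_sum_ne_zero h
  have hβ' : 0 < -(i β + (N + M : ℕ)) := by
    by_contra hc; exact hβ (Int.toNat_eq_zero.2 (not_lt.1 hc))
  unfold negSize
  rw [← Finset.add_sum_erase _ _ (Finset.mem_univ β),
    ← Finset.add_sum_erase _ _ (Finset.mem_univ β)]
  have h1 : ∑ α ∈ Finset.univ.erase β, (-(i α + (N + M : ℕ))).toNat ≤
      ∑ α ∈ Finset.univ.erase β, (-(i α + N)).toNat :=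
    Finset.sum_le_sum fun α _ => by push_cast; omega
  have h2 : (-(i β + (N + M : ℕ))).toNat + M ≤ (-(i β + N)).toNat := by
    push_cast at hβ' ⊢; omega
  linarith

/-- A constant in the bound can be absorbed by enlarging the orthant. -/
lemma hasIntegralDecay_of_le {f : Coeffs p Δ} {τ C : ℝ} {N : ℕ} (h0 : 0 < τ) (h1 : τ < 1)
    (hf : ∀ i, ‖f i‖ ≤ 1) (hC : ∀ i, ‖f i‖ ≤ C * τ ^ negSize N i) : HasIntegralDecay f := by
  -- Enlarging the orthant by `M` in all directions gains a factor `τ ^ M`.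
  obtain ⟨M, hM⟩ : ∃ M : ℕ, C * τ ^ M ≤ 1 := by
    obtain ⟨M, hM⟩ := exists_pow_lt_of_lt_one
      (inv_pos.2 (lt_max_of_lt_right one_pos : 0 < max C 1)) h1
    refine ⟨M, (mul_le_mul_of_nonneg_right (le_max_left C 1) (pow_pos h0 M).le).trans ?_⟩
    rw [← le_inv_mul_iff₀ (lt_max_of_lt_right one_pos), mul_one]
    exact hM.le
  refine ⟨τ, N + M, h0, h1, fun i => ?_⟩
  rcases eq_or_ne (negSize (N + M) i) 0 with h | h
  · rw [h, pow_zero]; exact hf i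
  · have hCp : 0 ≤ C := by
      by_contra hc
      exact absurd ((norm_nonneg _).trans (hC i)) (not_le.2 (mul_neg_of_neg_of_pos (not_le.1 hc)
        (pow_pos h0 _)))
    refine (hC i).trans ((mul_le_mul_of_nonneg_left (pow_le_pow_of_le_one h0.le h1.le
      (negSize_add_le h)) hCp).trans ?_)
    rw [pow_add, mul_left_comm]
    exact mul_le_of_le_one_right (pow_pos h0 _).le hM

lemma exists_lt_one_of_forall_lt {x : Δ → ℝ} (hx : ∀ α, x α < 1) :
    ∃ τ : ℝ, 0 < τ ∧ τ < 1 ∧ ∀ α, x α ≤ τ := by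
  rcases isEmpty_or_nonempty Δ with hΔ | hΔ
  · exact ⟨1 / 2, by norm_num, by norm_num, fun α => hΔ.elim α⟩
  · obtain ⟨β, hβ⟩ := Finite.exists_max x
    exact ⟨max (x β) (1 / 2), lt_max_of_lt_right (by norm_num), max_lt (hx β) (by norm_num),
      fun α => (hβ α).trans (le_max_left _ _)⟩

namespace Robba

lemma norm_coeff_mul_le_of_gaussNorm {f : Robba p Δ} {σ : Δ → ℝ} {c : ℝ} (hc : 0 ≤ c)
    (h : f.gaussNorm σ ≤ ENNReal.ofReal c) (i : Δ → ℤ) : ‖f.coeff i‖ * ∏ α, σ α ^ i α ≤ c := by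
  rw [← ENNReal.ofReal_le_ofReal_iff hc]
  exact (le_iSup (fun i : Δ → ℤ => ENNReal.ofReal (‖f.coeff i‖ * ∏ α, σ α ^ i α)) i).trans h

/-- The condition on the upper limit as a bound for all terms near `(1, …, 1)`. -/
lemma exists_forall_le_of_integralBounded {f : Robba p Δ} (hf : f ∈ integralBounded p Δ) {c : ℝ}
    (hc : 1 < c) : ∃ δ : ℝ, 0 < δ ∧ δ < 1 ∧ ∀ σ : Δ → ℝ, (∀ α, δ < σ α ∧ σ α < 1) →
      ∀ i, ‖f.coeff i‖ * ∏ α, σ α ^ i α ≤ c := by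
  have h1 : limsup (fun σ => f.gaussNorm σ) (𝓝[{σ | ∀ α, 0 < σ α ∧ σ α < 1}] (fun _ => 1)) <
      ENNReal.ofReal c := lt_of_le_of_lt hf (by
    rw [← ENNReal.ofReal_one]
    exact (ENNReal.ofReal_lt_ofReal_iff (one_pos.trans hc)).2 hc)
  have h2 := eventually_lt_of_limsup_lt h1
  obtain ⟨ε, hε, h3⟩ := Metric.mem_nhdsWithin_iff.1 h2
  refine ⟨max (1 - ε) (1 / 2), lt_max_of_lt_right (by norm_num), max_lt (by linarith)
    (by norm_num), fun σ hσ i => ?_⟩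
  refine norm_coeff_mul_le_of_gaussNorm (one_pos.trans hc).le (le_of_lt (h3 ⟨?_, fun α => ⟨?_,
    (hσ α).2⟩⟩)) i
  · rw [Metric.mem_ball, dist_pi_lt_iff hε]
    intro α
    rw [Real.dist_eq, abs_sub_comm, abs_of_pos (sub_pos.2 (hσ α).2)]
    linarith [(le_max_left _ _).trans_lt (hσ α).1]
  · linarith [(le_max_right _ _).trans_lt (hσ α).1]

/-- The bound on the Gauss norms near `(1, …, 1)`, in the limit where the radii of the variables
with nonnegative exponents tend to one. -/
lemma exists_coeff_le_of_integralBounded {f : Robba p Δ} (hf : f ∈ integralBounded p Δ) {c : ℝ}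
    (hc : 1 < c) : ∃ τ : ℝ, 0 < τ ∧ τ < 1 ∧ ∀ i, ‖f.coeff i‖ ≤ c * τ ^ negSize 0 i := by
  obtain ⟨δ, hδ0, hδ1, h⟩ := exists_forall_le_of_integralBounded hf hc
  obtain ⟨τ, hτ, hτ1⟩ := exists_between hδ1
  have hτ0 := hδ0.trans hτ
  refine ⟨τ, hτ0, hτ1, fun i => ?_⟩
  have hcont : Tendsto (fun s : ℝ => ‖f.coeff i‖ * ∏ α, (if i α < 0 then τ else s) ^ i α) (𝓝[<] 1)
      (𝓝 (‖f.coeff i‖ * ∏ α, (if i α < 0 then τ else 1) ^ i α)) := by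
    refine Tendsto.const_mul _ (tendsto_finsetProd _ fun α _ => ?_)
    split_ifs
    · exact tendsto_const_nhds
    · exact ((continuousAt_zpow₀ (1 : ℝ) (i α) (Or.inl one_ne_zero)).tendsto).mono_left
        nhdsWithin_le_nhds
  have hle := le_of_tendsto hcont (b := c) (by
    filter_upwards [Ioo_mem_nhdsLT hδ1] with s hs
    refine h _ (fun α => ?_) i
    split_ifs
    exacts [⟨hτ, hτ1⟩, hs])
  have hprod : ∏ α, (if i α < 0 then τ else 1) ^ i α = (τ ^ negSize 0 i)⁻¹ := by
    rw [negSize, ← Finset.prod_pow_eq_pow_sum, ← Finset.prod_inv_distrib]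
    refine Finset.prod_congr rfl fun α _ => ?_
    split_ifs with hi
    · rw [Nat.cast_zero, add_zero, ← zpow_natCast, Int.toNat_of_nonneg (by omega), ← zpow_neg,
        neg_neg]
    · rw [one_zpow, Int.toNat_eq_zero.2 (by push_cast; omega), pow_zero, inv_one]
  rwa [hprod, ← div_eq_mul_inv, div_le_iff₀ (pow_pos hτ0 _)] at hle

lemma hasIntegralDecay_of_integralBounded {f : Robba p Δ} (hf : f ∈ integralBounded p Δ) :
    HasIntegralDecay f.coeff := by
  obtain ⟨τ, h0, h1, h⟩ := exists_coeff_le_of_integralBounded hf one_lt_two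
  -- The bounds with constants `c > 1` arbitrarily close to `1` show that the coefficients are
  -- integral.
  refine hasIntegralDecay_of_le h0 h1 (fun i => le_of_forall_gt_imp_ge_of_dense fun c hc => ?_) h
  obtain ⟨τ', h0', h1', h'⟩ := exists_coeff_le_of_integralBounded hf hc
  exact (h' i).trans (mul_le_of_le_one_right (one_pos.trans hc).le (pow_le_one₀ h0'.le h1'.le))

lemma integralBounded_of_hasIntegralDecay {f : Robba p Δ} (hf : HasIntegralDecay f.coeff) :
    f ∈ integralBounded p Δ := by
  obtain ⟨τ, N, h0, h1, h⟩ := hf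
  have hlim : Tendsto (fun σ : Δ → ℝ => ENNReal.ofReal (∏ α, (σ α ^ N)⁻¹)) (𝓝 fun _ => 1)
      (𝓝 1) := by
    have h2 : Tendsto (fun σ : Δ → ℝ => ∏ α, (σ α ^ N)⁻¹) (𝓝 fun _ => 1)
        (𝓝 (∏ _α : Δ, ((1 : ℝ) ^ N)⁻¹)) := by
      refine tendsto_finsetProd _ fun α _ => Tendsto.inv₀ (Tendsto.pow ?_ N) (by simp)
      exact (continuous_apply α).tendsto fun _ => (1 : ℝ)
    rw [one_pow, inv_one, Finset.prod_const_one] at h2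
    have h3 := ENNReal.tendsto_ofReal h2
    rwa [ENNReal.ofReal_one] at h3
  change limsup _ _ ≤ (1 : ENNReal)
  refine le_of_forall_gt_imp_ge_of_dense fun c hc => limsup_le_of_le ?_ ?_
  · isBoundedDefault
  · have h4 : ∀ᶠ σ : Δ → ℝ in 𝓝 fun _ => 1, ∀ α, τ < σ α := by
      refine eventually_all.2 fun α => ?_
      exact ((continuous_apply α).tendsto fun _ => (1 : ℝ)).eventually (lt_mem_nhds h1)
    filter_upwards [nhdsWithin_le_nhds (hlim.eventually (gt_mem_nhds hc)),
      nhdsWithin_le_nhds h4, self_mem_nhdsWithin] with σ hσ hτ hmem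
    refine (iSup_le fun i => ENNReal.ofReal_le_ofReal ?_).trans hσ.le
    refine (mul_le_mul_of_nonneg_right (h i) (Finset.prod_nonneg fun α _ =>
      (zpow_pos (hmem α).1 _).le)).trans ?_
    rw [negSize, ← Finset.prod_pow_eq_pow_sum, ← Finset.prod_mul_distrib]
    refine Finset.prod_le_prod (fun α _ => mul_nonneg (pow_nonneg h0.le _)
      (zpow_pos (hmem α).1 _).le) fun α _ => ?_
    have hs := (hmem α).1
    refine (mul_le_mul_of_nonneg_right (pow_le_pow_left₀ h0.le (hτ α).le _)
      (zpow_pos hs _).le).trans ?_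
    rw [← zpow_natCast, ← zpow_natCast, ← zpow_add₀ hs.ne', ← zpow_neg]
    exact zpow_le_zpow_right_of_le_one₀ hs (hmem α).2.le (by omega)

end Robba

end IntegralBounded


/-! ### The image of `A_{ℚ_p,Δ}^†` in the Robba ring -/

section RangeOfInclusion

open scoped TensorProduct

variable {p : ℕ} [hp : Fact p.Prime] (ζ : RootSystem p) {Δ : Type*} [Fintype Δ] {r : Δ → Pos}

namespace Robba

lemma ext_coeff {f g : Robba p Δ} (h : ∀ i, f.coeff i = g.coeff i) : f = g :=
  Subtype.ext (funext h)

lemma coeff_mul (f g : Robba p Δ) (n : Δ → ℤ) :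
    (f * g).coeff n = ∑' i, f.coeff i * g.coeff (n - i) := rfl

/-- Multiplication by a series with the coefficients of `∏ X_α` shifts the exponents. -/
lemma coeff_mul_of_coeff_eq_single {x : Robba p Δ} (h1 : x.coeff 1 = 1)
    (h0 : ∀ i ≠ 1, x.coeff i = 0) (f : Robba p Δ) (i : Δ → ℤ) :
    (f * x).coeff i = f.coeff (i - 1) := by
  rw [coeff_mul, tsum_eq_single (i - 1), sub_sub_cancel, h1, mul_one]
  intro j hj
  rw [h0, mul_zero]
  rintro h
  exact hj (by rw [← h, sub_sub_cancel])

lemma coeff_mul_pow_of_coeff_eq_single {x : Robba p Δ} (h1 : x.coeff 1 = 1)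
    (h0 : ∀ i ≠ 1, x.coeff i = 0) (f : Robba p Δ) (N : ℕ) (i : Δ → ℤ) :
    (f * x ^ N).coeff i = f.coeff (fun α => i α - N) := by
  induction N generalizing i with
  | zero => simp
  | succ N ih =>
    rw [pow_succ, ← mul_assoc, coeff_mul_of_coeff_eq_single h1 h0, ih]
    congr 1
    funext α
    simp only [Pi.sub_apply, Pi.one_apply]
    push_cast; ring

end Robba

variable (Δ) in
/-- The Laurent expansion of an element of `A_{ℚ_p,Δ}^†`. -/
noncomputable def RootSystem.dagToRobba : ζ.AdagDelta Δ →+* Robba p Δ :=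
  (ζ.toRobba Δ).comp (ζ.inclDelta Δ)

lemma RootSystem.dagToRobba_injective : Function.Injective (ζ.dagToRobba Δ) := fun _ _ h =>
  ζ.inclDelta_injective (ζ.toRobba_bijective.1 h)

lemma RootSystem.dagToRobba_toAdagDelta (hr : ∀ α, 1 < (r α).1) (y : ζ.AdagLevel r) :
    ζ.dagToRobba Δ (ζ.toAdagDelta r y) = ζ.levelToRobba hr (ζ.inclLevel r y) :=
  (congrArg (ζ.toRobba Δ) (ζ.inclDelta_toAdagDelta r y)).trans (ζ.toRobba_toBrigDelta hr _)

lemma RootSystem.coeff_dagToRobba_toAdagDelta (hr : ∀ α, 1 < (r α).1) (y : ζ.AdagLevel r)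
    (i : Δ → ℤ) : (ζ.dagToRobba Δ (ζ.toAdagDelta r y)).coeff i = (ζ.coeffDagLevel hr i y : ℚ_[p]) :=
  (congrArg (fun f : Robba p Δ => f.coeff i) (ζ.dagToRobba_toAdagDelta hr y)).trans
    (ζ.coeffLevel_inclLevel hr i y)

lemma IsTopBasis.coeff_self_one {k : Type*} [NormedField k] [CompleteSpace k] [IsUltrametricDist k]
    {A : Type*} [CommRing A] [Algebra k A] {J : Type*} {q : J → RingSeminorm A}
    {I : Type*} {e : I → A} {c : I → Hat q →+ k} {w : J → I → ℝ} [Nonempty J]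
    (h : IsTopBasis q e c w) (i : I) :
    c i (Hat.of q (e i)) = 1 ∧ ∀ j ≠ i, c j (Hat.of q (e i)) = 0 := by
  have h1 := h.coeff_self i 1
  have h2 := fun j (hj : j ≠ i) => h.coeff_of_ne hj 1
  simp only [map_one, one_mul] at h1 h2
  exact ⟨h1, h2⟩

/-- The series `f` is the monomial `∏ X_α`. -/
def Robba.IsProdX (f : Robba p Δ) : Prop := f.coeff 1 = 1 ∧ ∀ i ≠ 1, f.coeff i = 0

lemma RootSystem.isProdX_levelToRobba (hr : ∀ α, 1 < (r α).1) :
    (ζ.levelToRobba hr (Hat.of (ζ.levelSeminorm r) (ζ.uTensor hr 1))).IsProdX :=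
  (ζ.isTopBasis_BrigLevel hr).coeff_self_one 1

lemma RootSystem.dagToRobba_varpiDelta (hr : ∀ α, 1 < (r α).1) :
    ζ.dagToRobba Δ (ζ.varpiDelta Δ) =
      ζ.levelToRobba hr (Hat.of (ζ.levelSeminorm r) (ζ.uTensor hr 1)) :=
  (congrArg (ζ.dagToRobba Δ) (ζ.toAdagDelta_varpi r).symm).trans
    ((ζ.dagToRobba_toAdagDelta hr (ζ.varpi r)).trans (congrArg _ (ζ.inclLevel_varpi hr)))

lemma RootSystem.isProdX_dagToRobba_varpiDelta : (ζ.dagToRobba Δ (ζ.varpiDelta Δ)).IsProdX :=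
  Eq.subst (motive := fun f : Robba p Δ => f.IsProdX)
    (ζ.dagToRobba_varpiDelta (one_lt_enlarge fun _ : Δ => onePos)).symm
    (ζ.isProdX_levelToRobba (one_lt_enlarge fun _ : Δ => onePos))

lemma RootSystem.norm_coeff_dagToRobba_le (hr : ∀ α, 1 < (r α).1) {τ : ℝ}
    (h : ∀ α, (radius p (r α) : ℝ) ≤ τ) (y : ζ.AdagLevel r) (i : Δ → ℤ) :
    ‖(ζ.dagToRobba Δ (ζ.toAdagDelta r y)).coeff i‖ ≤ τ ^ negSize 0 i := by
  refine (congrArg norm (ζ.coeff_dagToRobba_toAdagDelta hr y i)).trans_le ?_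
  refine (ζ.norm_coeffDagLevel_le hr i y).trans ?_
  rw [negSize, ← Finset.prod_pow_eq_pow_sum]
  refine Finset.prod_le_prod (fun α _ => pow_nonneg (radius_pos _).le _) fun α _ => ?_
  rw [Nat.cast_zero, add_zero]
  exact pow_le_pow_left₀ (radius_mem (p := p) r α).1.le (h α) _

lemma RootSystem.exists_forall_norm_coeff_le (z : ζ.AdagDelta Δ) :
    ∃ (N : ℕ) (τ : ℝ), 0 < τ ∧ τ < 1 ∧ ∀ i,
      ‖(ζ.dagToRobba Δ (z * ζ.varpiDelta Δ ^ N)).coeff i‖ ≤ τ ^ negSize 0 i := by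
  refine (ζ.exists_mul_varpiDelta_pow z).elim fun r h => h.elim fun hr h => h.elim fun N h =>
    h.elim fun y hy => ?_
  refine (exists_lt_one_of_forall_lt fun α => (radius_mem (p := p) r α).2).elim fun τ hτ =>
    ⟨N, τ, hτ.1, hτ.2.1, fun i => ?_⟩
  exact (congrArg (fun x => ‖(ζ.dagToRobba Δ x).coeff i‖) hy).trans_le
    (ζ.norm_coeff_dagToRobba_le hr hτ.2.2 y i)

/-- The coefficient of the generator of index `i` is not much smaller than `τ^(-i)`. As `minExp` is
minimal, it is within a factor `p` of the bound, and this factor is compensated by `τ ^ M`. -/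
lemma pow_le_norm_minExp {r : Pos} {τ : ℝ} (h0 : 0 < τ) (h1 : τ < 1) (hτ : τ ≤ radius p r) {M : ℕ}
    (hM : τ ^ M ≤ (p : ℝ)⁻¹) (i : ℤ) : τ ^ (-(i - M)).toNat ≤ ‖(p : ℤ_[p]) ^ minExp p r i‖ := by
  classical
  rw [norm_p_pow]
  rcases Nat.eq_zero_or_pos (minExp p r i) with hm | hm
  · rw [hm, pow_zero]; exact pow_le_one₀ h0.le h1.le
  obtain ⟨m, hm'⟩ := Nat.exists_eq_succ_of_ne_zero hm.ne'
  have h2 := Nat.find_min (exists_inv_pow_mul_le (p := p) r i) (m := m)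
    (by change m < minExp p r i; omega)
  have hrad : (0 : ℝ) < radius p r := radius_pos r
  have hi : i < 0 := by
    by_contra hi
    refine h2 (mul_le_one₀ (pow_le_one₀ (inv_nonneg.2 (p_pos p).le)
      (inv_le_one_of_one_le₀ (by exact_mod_cast hp.out.one_lt.le))) (zpow_pos hrad _).le ?_)
    obtain ⟨n, rfl⟩ := Int.eq_ofNat_of_zero_le (not_lt.1 hi)
    rw [zpow_natCast]
    exact pow_le_one₀ hrad.le (radius_lt_one r).le
  obtain ⟨n, rfl⟩ : ∃ n : ℕ, i = -n := ⟨(-i).toNat, by omega⟩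
  rw [not_le, zpow_neg, ← div_eq_mul_inv, one_lt_div (zpow_pos hrad _), zpow_natCast] at h2
  rw [show (-(-(n : ℤ) - M)).toNat = n + M by omega, hm', pow_add, pow_succ]
  exact mul_le_mul ((pow_le_pow_left₀ h0.le hτ n).trans h2.le) hM (pow_pos h0 _).le
    (pow_nonneg (inv_nonneg.2 (p_pos p).le) _)

lemma exists_radii_le {ρ : Δ → ℝ} (hρ : ∀ α, 0 < ρ α ∧ ρ α < 1) {τ : ℝ} (h1 : τ < 1) :
    ∃ r : Δ → Pos, (∀ α, 1 < (r α).1) ∧ (∀ α, 0 < ρ α ∧ ρ α < radius p (r α)) ∧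
      ∀ α, τ ≤ radius p (r α) := by
  obtain ⟨r, hr, h⟩ := exists_radii (p := p) (ρ := fun α => max (ρ α) τ) fun α =>
    ⟨lt_max_of_lt_left (hρ α).1, max_lt (hρ α).2 h1⟩
  exact ⟨r, hr, fun α => ⟨(hρ α).1, (le_max_left _ _).trans_lt (h α).2⟩,
    fun α => (le_max_right _ _).trans (h α).2.le⟩

lemma RootSystem.exists_inclLevel_eq_of_le (hr : ∀ α, 1 < (r α).1) {τ : ℝ} (h0 : 0 < τ) (h1 : τ < 1)
    {M : ℕ} (hM : τ ^ M ≤ (p : ℝ)⁻¹) (hτr : ∀ α, τ ≤ radius p (r α)) (w : ζ.BrigLevel r)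
    (h : ∀ i, ‖(ζ.levelToRobba hr w).coeff i‖ ≤ τ ^ negSize 0 fun α => i α - M) :
    ∃ y, ζ.inclLevel r y = w := by
  refine ζ.exists_inclLevel_eq hr w fun i => (h i).trans ?_
  rw [negSize, ← Finset.prod_pow_eq_pow_sum]
  refine Finset.prod_le_prod (fun α _ => pow_nonneg h0.le _) fun α _ => ?_
  rw [Nat.cast_zero, add_zero]
  exact pow_le_norm_minExp h0 h1 (hτr α) hM (i α)

/-- Laurent series whose coefficients decay fast enough in the negative directions have their terms
in `A_{ℚ_p,Δ}^{†,r}` for suitable `r`. -/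
lemma RootSystem.exists_dagToRobba_eq {f : Robba p Δ} {τ : ℝ} (h0 : 0 < τ) (h1 : τ < 1) {M : ℕ}
    (hM : τ ^ M ≤ (p : ℝ)⁻¹) (h : ∀ i, ‖f.coeff i‖ ≤ τ ^ negSize 0 fun α => i α - M) :
    ∃ z, ζ.dagToRobba Δ z = f := by
  obtain ⟨ρ, hρ, hconv⟩ := f.2
  obtain ⟨r, hr, hρr, hτr⟩ := exists_radii_le (p := p) hρ h1
  refine (ζ.exists_hasSum hr f hρr hconv).elim fun w hw => ?_
  refine (ζ.exists_inclLevel_eq_of_le hr h0 h1 hM hτr w (hw.2.symm ▸ h)).elim fun y hy => ?_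
  exact ⟨ζ.toAdagDelta r y, (ζ.dagToRobba_toAdagDelta hr y).trans ((congrArg _ hy).trans hw.2)⟩

section Abstract

variable {D : Type*} [CommRing D] {κ : D →+* Robba p Δ} {x : D}

/-- If, after multiplication by a power of `x ↦ ∏ X_α`, every series in the image decays on all
negative exponents, then every series in the image has integral decay. -/
lemma Robba.IsProdX.hasIntegralDecay (hx : (κ x).IsProdX)
    (h : ∀ z, ∃ (N : ℕ) (τ : ℝ), 0 < τ ∧ τ < 1 ∧
      ∀ i, ‖(κ (z * x ^ N)).coeff i‖ ≤ τ ^ negSize 0 i) (z : D) :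
    HasIntegralDecay (κ z).coeff := by
  obtain ⟨N, τ, h0, h1, h⟩ := h z
  refine ⟨τ, N, h0, h1, fun i => ?_⟩
  have h2 := h fun α => i α + N
  rw [map_mul, map_pow, Robba.coeff_mul_pow_of_coeff_eq_single hx.1 hx.2] at h2
  simpa only [negSize, add_sub_cancel_right, Nat.cast_zero, add_zero] using h2

/-- If `x ↦ ∏ X_α` is a unit, then it is enough to reach the series whose coefficients decay outside
the orthant of the exponents `i ≥ M`, where `M` is large. -/
lemma Robba.IsProdX.mem_range (hx : (κ x).IsProdX) (hu : IsUnit x)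
    (h : ∀ f (τ : ℝ) (M : ℕ), 0 < τ → τ < 1 → τ ^ M ≤ (p : ℝ)⁻¹ →
      (∀ i, ‖f.coeff i‖ ≤ τ ^ negSize 0 fun α => i α - M) → ∃ z, κ z = f)
    {f : Robba p Δ} (hf : HasIntegralDecay f.coeff) : ∃ z, κ z = f := by
  obtain ⟨τ, N, h0, h1, hf⟩ := hf
  obtain ⟨M, hM⟩ := exists_pow_lt_of_lt_one (inv_pos.2 (p_pos p)) h1
  -- The exponent `N` moves the orthant to the origin, and `M` leaves room for the bound `hM`.
  obtain ⟨z, hz⟩ := h (f * κ x ^ (N + M)) τ M h0 h1 hM.le fun i => by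
    rw [Robba.coeff_mul_pow_of_coeff_eq_single hx.1 hx.2]
    refine (hf _).trans_eq ?_
    congr 1
    refine Finset.sum_congr rfl fun α _ => ?_
    push_cast
    congr 1
    ring
  have hu := hu.pow (N + M)
  refine ⟨z * (hu.unit⁻¹ : Dˣ), ?_⟩
  refine ((hu.map κ).mul_left_inj).1 ?_
  rw [← map_mul, mul_assoc, IsUnit.val_inv_mul, mul_one, hz, map_pow]

end Abstract

lemma RootSystem.hasIntegralDecay_dagToRobba (z : ζ.AdagDelta Δ) :
    HasIntegralDecay (ζ.dagToRobba Δ z).coeff :=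
  Robba.IsProdX.hasIntegralDecay ζ.isProdX_dagToRobba_varpiDelta ζ.exists_forall_norm_coeff_le z

/-- Every series with integral coefficients that decay in the negative directions is the expansion
of an element of `A_{ℚ_p,Δ}^†`. -/
lemma RootSystem.exists_dagToRobba_eq_of_hasIntegralDecay {f : Robba p Δ}
    (hf : HasIntegralDecay f.coeff) : ∃ z, ζ.dagToRobba Δ z = f :=
  Robba.IsProdX.mem_range ζ.isProdX_dagToRobba_varpiDelta ζ.isUnit_varpiDelta
    (fun _ _ _ h0 h1 hM h => ζ.exists_dagToRobba_eq h0 h1 hM h) hf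

lemma image_eq_range {R B D : Type*} {s : Set R} {Φ : R → B} {j : D → B} {T : B → R}
    (hT : ∀ b, Φ (T b) = b) (h1 : ∀ z, T (j z) ∈ s) (h2 : ∀ f ∈ s, ∃ z, T (j z) = f) :
    Φ '' s = Set.range j := by
  ext b
  constructor
  · rintro ⟨f, hf, rfl⟩
    obtain ⟨z, rfl⟩ := h2 f hf
    exact ⟨z, (hT _).symm⟩
  · rintro ⟨z, rfl⟩
    exact ⟨_, h1 z, hT _⟩

/-- The bounded Laurent series with integral coefficients are the elements of `A_{ℚ_p,Δ}^†`. -/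
lemma RootSystem.evalEquiv_image_integralBounded :
    ζ.evalEquiv Δ '' Robba.integralBounded p Δ = Set.range (ζ.inclDelta Δ) :=
  image_eq_range (T := ζ.toRobba Δ) ζ.evalEquiv_toRobba
    (fun z => Robba.integralBounded_of_hasIntegralDecay (ζ.hasIntegralDecay_dagToRobba z))
    fun _ hf => ζ.exists_dagToRobba_eq_of_hasIntegralDecay
      (Robba.hasIntegralDecay_of_integralBounded hf)

end RangeOfInclusion


/-! ### Completions and quotients -/

section AdicCompletion

variable {A B : Type*} [CommRing A] [CommRing B] {I : Ideal A} {J : Ideal B}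

lemma factorPow_evalₐ (I : Ideal A) {m n : ℕ} (h : m ≤ n) (x : AdicCompletion I A) :
    Ideal.Quotient.factorPow I h (AdicCompletion.evalₐ I n x) = AdicCompletion.evalₐ I m x := by
  induction x using AdicCompletion.induction_on with
  | h f =>
    rw [AdicCompletion.evalₐ_mk, AdicCompletion.evalₐ_mk]
    exact AdicCompletion.Ideal.mk_eq_mk I h f

/-- Compatible isomorphisms of the quotients by the powers of two ideals induce an isomorphism of
the completions. -/
lemma exists_adicCompletion_equiv (e : ∀ n, A ⧸ I ^ n ≃+* B ⧸ J ^ n)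
    (he : ∀ m n (h : m ≤ n) x, Ideal.Quotient.factorPow J h (e n x) =
      e m (Ideal.Quotient.factorPow I h x)) :
    ∃ Ψ : AdicCompletion I A ≃+* AdicCompletion J B,
      ∀ n x, AdicCompletion.evalₐ J n (Ψ x) = e n (AdicCompletion.evalₐ I n x) := by
  have he' : ∀ m n (h : m ≤ n) x, Ideal.Quotient.factorPow I h ((e n).symm x) =
      (e m).symm (Ideal.Quotient.factorPow J h x) := fun m n h x => by
    rw [RingEquiv.eq_symm_apply, ← he, RingEquiv.apply_symm_apply]
  let F : AdicCompletion I A →+* AdicCompletion J B := AdicCompletion.liftRingHom J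
    (fun n => (e n).toRingHom.comp (AdicCompletion.evalₐ I n).toRingHom) fun {m n} h => by
      refine RingHom.ext fun x => (he m n h _).trans ?_
      exact congrArg (e m) (factorPow_evalₐ I h x)
  let G : AdicCompletion J B →+* AdicCompletion I A := AdicCompletion.liftRingHom I
    (fun n => (e n).symm.toRingHom.comp (AdicCompletion.evalₐ J n).toRingHom) fun {m n} h => by
      refine RingHom.ext fun x => (he' m n h _).trans ?_
      exact congrArg (e m).symm (factorPow_evalₐ J h x)
  have hF : ∀ n x, AdicCompletion.evalₐ J n (F x) = e n (AdicCompletion.evalₐ I n x) :=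
    fun n x => AdicCompletion.evalₐ_liftRingHom _ _ _ n x
  have hG : ∀ n x, AdicCompletion.evalₐ I n (G x) = (e n).symm (AdicCompletion.evalₐ J n x) :=
    fun n x => AdicCompletion.evalₐ_liftRingHom _ _ _ n x
  refine ⟨RingEquiv.ofRingHom F G ?_ ?_, hF⟩
  · exact RingHom.ext fun x => AdicCompletion.ext_evalₐ fun n => by
      rw [RingHom.comp_apply, hF, hG, RingEquiv.apply_symm_apply, RingHom.id_apply]
  · exact RingHom.ext fun x => AdicCompletion.ext_evalₐ fun n => by
      rw [RingHom.comp_apply, hG, hF, RingEquiv.symm_apply_apply, RingHom.id_apply]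

/-- A homomorphism that is bijective modulo all powers of an element induces an isomorphism of the
completions. -/
lemma exists_adicCompletion_equiv_of_bijective_mod (θ : A →+* B) {a : A} {b : B}
    (hab : θ a = b) (hsurj : ∀ n y, ∃ x c, y = θ x + b ^ n * c)
    (hinj : ∀ n x c, θ x = b ^ n * c → ∃ d, x = a ^ n * d) :
    ∃ Ψ : AdicCompletion (Ideal.span {a}) A ≃+* AdicCompletion (Ideal.span {b}) B,
      ∀ x, Ψ (algebraMap A _ x) = algebraMap B _ (θ x) := by
  subst hab
  have hle : ∀ n, Ideal.span {a} ^ n ≤ (Ideal.span {θ a} ^ n).comap θ := fun n => by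
    rw [Ideal.span_singleton_pow, Ideal.span_singleton_pow, Ideal.span_singleton_le_iff_mem,
      Ideal.mem_comap, map_pow]
    exact Ideal.mem_span_singleton_self _
  have hbij : ∀ n, Function.Bijective (Ideal.quotientMap (Ideal.span {θ a} ^ n) θ (hle n)) := by
    refine fun n => ⟨Ideal.quotientMap_injective' fun x hx => ?_, fun y => ?_⟩
    · rw [Ideal.mem_comap, Ideal.span_singleton_pow, Ideal.mem_span_singleton] at hx
      rw [Ideal.span_singleton_pow, Ideal.mem_span_singleton]
      obtain ⟨c, hc⟩ := hx
      exact hinj n x c hc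
    · obtain ⟨y, rfl⟩ := Ideal.Quotient.mk_surjective y
      obtain ⟨x, c, rfl⟩ := hsurj n y
      refine ⟨Ideal.Quotient.mk _ x, ?_⟩
      rw [Ideal.quotientMap_mk, Ideal.Quotient.eq, sub_add_cancel_left, neg_mem_iff,
        Ideal.span_singleton_pow]
      exact Ideal.mul_mem_right _ _ (Ideal.mem_span_singleton_self _)
  obtain ⟨Ψ, hΨ⟩ := exists_adicCompletion_equiv (I := Ideal.span {a}) (J := Ideal.span {θ a})
    (fun n => RingEquiv.ofBijective _ (hbij n)) fun m n h x => by
      obtain ⟨x, rfl⟩ := Ideal.Quotient.mk_surjective x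
      rfl
  refine ⟨Ψ, fun x => AdicCompletion.ext_evalₐ fun n => ?_⟩
  rw [hΨ, AdicCompletion.algebraMap_apply, AdicCompletion.algebraMap_apply,
    AdicCompletion.evalₐ_of, AdicCompletion.evalₐ_of]
  rfl

end AdicCompletion


/-! ### Power series in the Robba ring -/

section PowerSeries

variable {p : ℕ} [hp : Fact p.Prime] {Δ : Type*} [Fintype Δ]

/-- The exponents of power series among the exponents of Laurent series. -/
def natExponent (k : Δ →₀ ℕ) : Δ → ℤ := fun α => k α

lemma natExponent_nonneg (k : Δ →₀ ℕ) : 0 ≤ natExponent k := fun α => Int.natCast_nonneg (k α)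

lemma natExponent_injective : Function.Injective (natExponent (Δ := Δ)) := fun _ _ h =>
  Finsupp.ext fun α => Nat.cast_injective (R := ℤ) (congrFun h α)

lemma exists_natExponent {i : Δ → ℤ} (hi : 0 ≤ i) : ∃ k, natExponent k = i :=
  ⟨Finsupp.equivFunOnFinite.symm fun α => (i α).toNat, funext fun α => Int.toNat_of_nonneg (hi α)⟩

lemma powerSeriesCoeffs_natExponent (g : MvPowerSeries Δ ℤ_[p]) (k : Δ →₀ ℕ) :
    powerSeriesCoeffs g (natExponent k) = (MvPowerSeries.coeff k g : ℤ_[p]) := by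
  unfold powerSeriesCoeffs
  rw [if_pos (natExponent_nonneg k)]
  congr 3
  ext α
  simp [natExponent]

lemma powerSeriesCoeffs_of_not_nonneg (g : MvPowerSeries Δ ℤ_[p]) {i : Δ → ℤ} (hi : ¬ 0 ≤ i) :
    powerSeriesCoeffs g i = 0 := by
  unfold powerSeriesCoeffs
  rw [if_neg hi]

lemma ext_nonneg {f g : Coeffs p Δ} (h : ∀ k, f (natExponent k) = g (natExponent k))
    (h' : ∀ i, ¬ 0 ≤ i → f i = g i) : f = g := by
  funext i
  by_cases hi : 0 ≤ i
  · obtain ⟨k, rfl⟩ := exists_natExponent hi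
    exact h k
  · exact h' i hi

lemma norm_powerSeriesCoeffs_le (g : MvPowerSeries Δ ℤ_[p]) (i : Δ → ℤ) :
    ‖powerSeriesCoeffs g i‖ ≤ 1 := by
  by_cases hi : 0 ≤ i
  · obtain ⟨k, rfl⟩ := exists_natExponent hi
    rw [powerSeriesCoeffs_natExponent]
    exact PadicInt.norm_le_one _
  · rw [powerSeriesCoeffs_of_not_nonneg g hi, norm_zero]
    exact zero_le_one

lemma convergesOn_powerSeriesCoeffs (g : MvPowerSeries Δ ℤ_[p]) {ρ : Δ → ℝ} (hρ : ∀ α, 0 < ρ α) :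
    ConvergesOn ρ (powerSeriesCoeffs g) := by
  classical
  intro x hx
  -- All `|x_α|` are at most some `t < 1`, so the terms outside a cube of side `K` are at most
  -- `t^K`.
  obtain ⟨t, ht0, ht1, ht⟩ := exists_lt_one_of_forall_lt fun α => (hx α).2
  rw [summable_iff_norm, Metric.tendsto_nhds]
  intro ε hε
  obtain ⟨K, hK⟩ := exists_pow_lt_of_lt_one hε ht1
  refine (Set.finite_Icc (0 : Δ → ℤ) fun _ => K).subset fun i hi => ?_
  by_contra hmem
  refine hi ?_
  change dist ‖_‖ 0 < ε
  rw [Real.dist_eq, sub_zero, abs_norm, term]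
  by_cases h0 : 0 ≤ i
  · have h1 : ∃ β, (K : ℤ) < i β := by
      by_contra hc
      push Not at hc
      exact hmem ⟨h0, hc⟩
    obtain ⟨β, hβ⟩ := h1
    have hpos : ∀ α, 0 < ‖x α‖ := fun α => (hρ α).trans (hx α).1
    rw [norm_mul, norm_algebraMap', norm_prod]
    refine ((mul_le_of_le_one_left (Finset.prod_nonneg fun α _ => norm_nonneg _)
      (norm_powerSeriesCoeffs_le g i)).trans ?_).trans_lt hK
    rw [← Finset.mul_prod_erase _ _ (Finset.mem_univ β)]
    have h2 : ∀ α, ‖x α ^ i α‖ ≤ 1 := fun α => by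
      rw [norm_zpow]
      exact zpow_le_one₀ (hpos α) (hx α).2.le (h0 α)
    refine (mul_le_of_le_one_right (norm_nonneg _) (Finset.prod_le_one
      (fun α _ => norm_nonneg _) fun α _ => h2 α)).trans ?_
    rw [norm_zpow, ← zpow_natCast]
    exact (zpow_le_zpow_right_of_le_one₀ (hpos β) (hx β).2.le hβ.le).trans
      (zpow_le_zpow_left₀ (Int.natCast_nonneg K) (hpos β).le (ht β))
  · rw [powerSeriesCoeffs_of_not_nonneg g h0, map_zero, zero_mul, norm_zero]
    exact hε

lemma powerSeriesCoeffs_mul (g h : MvPowerSeries Δ ℤ_[p]) :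
    powerSeriesCoeffs (g * h) = conv (powerSeriesCoeffs g) (powerSeriesCoeffs h) := by
  classical
  refine ext_nonneg (fun k => ?_) fun n hn => ?_
  · rw [powerSeriesCoeffs_natExponent, MvPowerSeries.coeff_mul, conv]
    have hinj : Set.InjOn (fun q : (Δ →₀ ℕ) × (Δ →₀ ℕ) => natExponent q.1)
        (Finset.HasAntidiagonal.antidiagonal k : Set ((Δ →₀ ℕ) × (Δ →₀ ℕ))) := by
      intro q hq q' hq' h
      have h1 : q.1 = q'.1 := natExponent_injective h
      have h2 := (Finset.HasAntidiagonal.mem_antidiagonal.1 (Finset.mem_coe.1 hq)).trans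
        (Finset.HasAntidiagonal.mem_antidiagonal.1 (Finset.mem_coe.1 hq')).symm
      rw [h1] at h2
      exact Prod.ext h1 (add_left_cancel h2)
    rw [tsum_eq_sum (s := (Finset.HasAntidiagonal.antidiagonal k).image fun q => natExponent q.1),
      Finset.sum_image hinj]
    · refine (map_sum (PadicInt.Coe.ringHom (p := p)) _ _).trans ?_
      refine Finset.sum_congr rfl fun q hq => ?_
      have h1 : natExponent k - natExponent q.1 = natExponent q.2 := by
        rw [← Finset.HasAntidiagonal.mem_antidiagonal.1 hq]
        funext α
        simp [natExponent]
      rw [h1, powerSeriesCoeffs_natExponent, powerSeriesCoeffs_natExponent]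
      exact map_mul (PadicInt.Coe.ringHom (p := p)) _ _
    · intro i hi
      by_cases h0 : 0 ≤ i
      · rw [powerSeriesCoeffs_of_not_nonneg h, mul_zero]
        intro h1
        obtain ⟨a, rfl⟩ := exists_natExponent h0
        obtain ⟨b, hb⟩ := exists_natExponent h1
        refine hi (Finset.mem_image.2 ⟨(a, b), Finset.HasAntidiagonal.mem_antidiagonal.2 ?_, rfl⟩)
        refine natExponent_injective ?_
        rw [eq_sub_iff_add_eq'] at hb
        rw [← hb]
        funext α
        simp [natExponent]
      · rw [powerSeriesCoeffs_of_not_nonneg g h0, zero_mul]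
  · rw [powerSeriesCoeffs_of_not_nonneg _ hn, conv]
    refine Eq.trans tsum_zero.symm (tsum_congr fun i => ?_)
    by_cases h0 : 0 ≤ i
    · rw [powerSeriesCoeffs_of_not_nonneg h, mul_zero]
      intro h1
      exact hn (h0.trans (sub_nonneg.1 h1))
    · rw [powerSeriesCoeffs_of_not_nonneg g h0, zero_mul]

variable (p Δ) in
/-- Power series with coefficients in `ℤ_p` as elements of the Robba ring. -/
noncomputable def powerSeriesToRobba : MvPowerSeries Δ ℤ_[p] →+* Robba p Δ where
  toFun g := ⟨powerSeriesCoeffs g, _, Robba.half,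
    convergesOn_powerSeriesCoeffs g fun α => (Robba.half α).1⟩
  map_one' := Subtype.ext (by
    classical
    refine ext_nonneg (fun k => ?_) fun i hi => ?_
    · change powerSeriesCoeffs 1 (natExponent k) = oneCoeffs (natExponent k)
      rw [powerSeriesCoeffs_natExponent, MvPowerSeries.coeff_one, oneCoeffs]
      have : natExponent k = 0 ↔ k = 0 :=
        ⟨fun h => natExponent_injective h, fun h => by rw [h]; rfl⟩
      split_ifs <;> simp_all
    · change powerSeriesCoeffs 1 i = oneCoeffs i
      rw [powerSeriesCoeffs_of_not_nonneg _ hi, oneCoeffs, if_neg]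
      rintro rfl
      exact hi le_rfl)
  map_mul' g h := Subtype.ext (powerSeriesCoeffs_mul g h)
  map_zero' := Subtype.ext (by
    refine ext_nonneg (fun k => ?_) fun i hi => powerSeriesCoeffs_of_not_nonneg _ hi
    refine (powerSeriesCoeffs_natExponent _ k).trans ?_
    rw [map_zero]
    rfl)
  map_add' g h := Subtype.ext (by
    refine ext_nonneg (fun k => ?_) fun i hi => ?_
    · change powerSeriesCoeffs (g + h) (natExponent k) =
        powerSeriesCoeffs g (natExponent k) + powerSeriesCoeffs h (natExponent k)
      simp only [powerSeriesCoeffs_natExponent, map_add, PadicInt.coe_add]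
    · change powerSeriesCoeffs (g + h) i = powerSeriesCoeffs g i + powerSeriesCoeffs h i
      simp only [powerSeriesCoeffs_of_not_nonneg _ hi, add_zero])

lemma coeff_powerSeriesToRobba (g : MvPowerSeries Δ ℤ_[p]) :
    (powerSeriesToRobba p Δ g).coeff = powerSeriesCoeffs g := rfl

lemma negSize_eq_zero_iff {i : Δ → ℤ} : negSize 0 i = 0 ↔ 0 ≤ i := by
  simp [negSize, Pi.le_def]

lemma hasIntegralDecay_powerSeriesToRobba (g : MvPowerSeries Δ ℤ_[p]) :
    HasIntegralDecay (powerSeriesToRobba p Δ g).coeff := by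
  refine ⟨1 / 2, 0, by norm_num, by norm_num, fun i => ?_⟩
  rw [coeff_powerSeriesToRobba]
  by_cases hi : 0 ≤ i
  · rw [negSize_eq_zero_iff.2 hi, pow_zero]
    exact norm_powerSeriesCoeffs_le g i
  · rw [powerSeriesCoeffs_of_not_nonneg g hi, norm_zero]
    positivity

lemma isProdX_powerSeriesToRobba :
    (powerSeriesToRobba p Δ (∏ α, MvPowerSeries.X α)).IsProdX := by
  classical
  have hX : (∏ α, MvPowerSeries.X α : MvPowerSeries Δ ℤ_[p]) =
      MvPowerSeries.monomial (∑ α, Finsupp.single α 1) 1 := by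
    simp only [MvPowerSeries.X_def, MvPowerSeries.prod_monomial, Finset.prod_const_one]
  have h1 : natExponent (∑ α : Δ, Finsupp.single α 1) = 1 := by
    funext α
    simp [natExponent, Finsupp.single_apply]
  rw [hX]
  constructor
  · rw [← h1, coeff_powerSeriesToRobba, powerSeriesCoeffs_natExponent,
      MvPowerSeries.coeff_monomial_same, PadicInt.coe_one]
  · intro i hi
    rw [coeff_powerSeriesToRobba]
    by_cases h0 : 0 ≤ i
    · obtain ⟨k, rfl⟩ := exists_natExponent h0
      rw [powerSeriesCoeffs_natExponent, MvPowerSeries.coeff_monomial_ne, PadicInt.coe_zero]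
      rintro rfl
      exact hi h1
    · rw [powerSeriesCoeffs_of_not_nonneg _ h0]

lemma Robba.IsProdX.eq {f g : Robba p Δ} (hf : f.IsProdX) (hg : g.IsProdX) : f = g := by
  refine Robba.ext_coeff fun i => ?_
  rcases eq_or_ne i 1 with rfl | hi
  · rw [hf.1, hg.1]
  · rw [hf.2 i hi, hg.2 i hi]

lemma Robba.coeff_natCast_pow_mul (n : ℕ) (f : Robba p Δ) (i : Δ → ℤ) :
    ((p : Robba p Δ) ^ n * f).coeff i = (p : ℚ_[p]) ^ n * f.coeff i := by
  have h : ∀ (m : ℕ) (g : Robba p Δ), ((m : Robba p Δ) * g).coeff i = (m : ℚ_[p]) * g.coeff i := by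
    intro m g
    induction m with
    | zero => rw [Nat.cast_zero, Nat.cast_zero, zero_mul, zero_mul]; rfl
    | succ m ih =>
      rw [Nat.cast_succ, Nat.cast_succ, add_mul, add_mul, one_mul, one_mul, ← ih]; rfl
  rw [← Nat.cast_pow, h, Nat.cast_pow]

/-- A series with integral decay and coefficients divisible by `p^n` is `p^n` times a series with
integral decay. -/
lemma exists_eq_natCast_pow_mul {f : Robba p Δ} (hf : HasIntegralDecay f.coeff) {n : ℕ}
    (h : ∀ i, ‖f.coeff i‖ ≤ ((p : ℝ)⁻¹) ^ n) :
    ∃ g : Robba p Δ, HasIntegralDecay g.coeff ∧ f = (p : Robba p Δ) ^ n * g := by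
  obtain ⟨ρ, hρ, hconv⟩ := f.2
  have hp0 : (p : ℚ_[p]) ^ n ≠ 0 := pow_ne_zero _ (by exact_mod_cast hp.out.ne_zero)
  have hnorm : ‖((p : ℚ_[p]) ^ n)⁻¹‖ = (p : ℝ) ^ n := by
    rw [norm_inv, norm_pow, Padic.norm_p, inv_pow, inv_inv]
  let g : Robba p Δ := ⟨fun i => ((p : ℚ_[p]) ^ n)⁻¹ * f.coeff i, ρ, hρ, fun x hx =>
    ((hconv x hx).mul_left (algebraMap ℚ_[p] ℂ_[p] ((p : ℚ_[p]) ^ n)⁻¹)).congr fun i => by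
      simp only [term, map_mul, mul_assoc]; rfl⟩
  have hg : ∀ i, g.coeff i = ((p : ℚ_[p]) ^ n)⁻¹ * f.coeff i := fun _ => rfl
  refine ⟨g, ?_, Robba.ext_coeff fun i => ?_⟩
  · obtain ⟨τ, N, h0, h1, hτ⟩ := hf
    refine hasIntegralDecay_of_le (C := (p : ℝ) ^ n) (N := N) h0 h1 (fun i => ?_) fun i => ?_
    · rw [hg, norm_mul, hnorm]
      refine (mul_le_mul_of_nonneg_left (h i) (pow_nonneg (p_pos p).le n)).trans_eq ?_
      rw [← mul_pow, mul_inv_cancel₀ (p_pos p).ne', one_pow]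
    · rw [hg, norm_mul, hnorm]
      exact mul_le_mul_of_nonneg_left (hτ i) (pow_nonneg (p_pos p).le n)
  · rw [Robba.coeff_natCast_pow_mul, hg, mul_inv_cancel_left₀ hp0]

end PowerSeries


/-! ### The comparison of the `p`-adic completions -/

section CompletionComparison

variable {p : ℕ} [hp : Fact p.Prime] {Δ : Type*} [Fintype Δ]

/-- A homomorphism with values in the image of an injective homomorphism lifts. -/
lemma exists_ringHom_lift {P D R : Type*} [CommRing P] [CommRing D] [CommRing R] {κ : D →+* R}
    (hκ : Function.Injective κ) (ψ : P →+* R) (h : ∀ g, ∃ z, κ z = ψ g) :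
    ∃ θ : P →+* D, ∀ g, κ (θ g) = ψ g := by
  choose z hz using h
  exact ⟨{ toFun := z
           map_one' := hκ (by rw [hz, map_one, map_one])
           map_mul' := fun a b => hκ (by rw [hz, map_mul, map_mul, hz, hz])
           map_zero' := hκ (by rw [hz, map_zero, map_zero])
           map_add' := fun a b => hκ (by rw [hz, map_add, map_add, hz, hz]) }, hz⟩

lemma exists_eq_natCast_pow_mul_powerSeries {g : MvPowerSeries Δ ℤ_[p]} {n : ℕ}
    (h : ∀ i, ‖powerSeriesCoeffs g i‖ ≤ ((p : ℝ)⁻¹) ^ n) :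
    ∃ g', g = (p : MvPowerSeries Δ ℤ_[p]) ^ n * g' := by
  have hd : ∀ k, ∃ d : ℤ_[p], MvPowerSeries.coeff k g = (p : ℤ_[p]) ^ n * d := fun k => by
    have h1 := h (natExponent k)
    rw [powerSeriesCoeffs_natExponent, ← PadicInt.norm_def, ← zpow_natCast, inv_zpow',
      PadicInt.norm_le_pow_iff_mem_span_pow, Ideal.mem_span_singleton] at h1
    exact h1
  obtain ⟨g', hg'⟩ : ∃ g' : MvPowerSeries Δ ℤ_[p], ∀ k, MvPowerSeries.coeff k g =
      (p : ℤ_[p]) ^ n * MvPowerSeries.coeff k g' :=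
    ⟨fun k => (hd k).choose, fun k => (hd k).choose_spec⟩
  refine ⟨g', MvPowerSeries.ext fun k => ?_⟩
  rw [hg', ← Nat.cast_pow, ← Nat.cast_pow, ← nsmul_eq_mul, ← nsmul_eq_mul, map_nsmul]

variable {D : Type*} [CommRing D] {κ : D →+* Robba p Δ} {x : D}

lemma exists_eq_natCast_pow_mul_of_range (hκ : Function.Injective κ)
    (hdecay : ∀ z, HasIntegralDecay (κ z).coeff)
    (hrange : ∀ f : Robba p Δ, HasIntegralDecay f.coeff → ∃ z, κ z = f) {y : D} {n : ℕ}
    (h : ∀ i, ‖(κ y).coeff i‖ ≤ ((p : ℝ)⁻¹) ^ n) : ∃ c, y = (p : D) ^ n * c := by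
  obtain ⟨g, hg, hy⟩ := exists_eq_natCast_pow_mul (hdecay y) h
  obtain ⟨c, rfl⟩ := hrange g hg
  exact ⟨c, hκ (by rw [hy, map_mul, map_pow, map_natCast])⟩

lemma norm_coeff_natCast_pow_mul_le {n : ℕ} {f : Robba p Δ} (hf : HasIntegralDecay f.coeff)
    (i : Δ → ℤ) : ‖((p : Robba p Δ) ^ n * f).coeff i‖ ≤ ((p : ℝ)⁻¹) ^ n := by
  obtain ⟨τ, N, h0, h1, h⟩ := hf
  rw [Robba.coeff_natCast_pow_mul, norm_mul, norm_pow, Padic.norm_p]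
  exact mul_le_of_le_one_right (pow_nonneg (inv_nonneg.2 (p_pos p).le) n)
    ((h i).trans (pow_le_one₀ h0.le h1.le))

/-- After multiplication by a power of `∏ X_α`, a series with integral decay is congruent to a power
series modulo `p^n`: the coefficients of `f` are divisible by `p^n` outside an orthant. -/
lemma exists_powerSeries_sub_coeff_le {x : Robba p Δ} (hx : x.IsProdX) {f : Robba p Δ}
    (hf : HasIntegralDecay f.coeff) (n : ℕ) : ∃ (N : ℕ) (g : MvPowerSeries Δ ℤ_[p]),
      ∀ i, ‖(f * x ^ N - powerSeriesToRobba p Δ g).coeff i‖ ≤ ((p : ℝ)⁻¹) ^ n := by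
  obtain ⟨τ, N, h0, h1, h⟩ := hf
  -- Outside the orthant enlarged by `M`, the coefficients are at most `τ ^ M ≤ p^(-n)`.
  obtain ⟨M, hM⟩ := exists_pow_lt_of_lt_one (pow_pos (inv_pos.2 (p_pos p)) n) h1
  have hshift : ∀ i, ‖(f * x ^ (N + M)).coeff i‖ ≤ τ ^ negSize N fun α => i α - (N + M : ℕ) :=
    fun i => by
      rw [Robba.coeff_mul_pow_of_coeff_eq_single hx.1 hx.2]
      exact h _
  refine ⟨N + M, fun k => ⟨(f * x ^ (N + M)).coeff (natExponent k),
    (hshift _).trans (pow_le_one₀ h0.le h1.le)⟩, fun i => ?_⟩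
  set g : MvPowerSeries Δ ℤ_[p] := fun k => ⟨(f * x ^ (N + M)).coeff (natExponent k),
    (hshift _).trans (pow_le_one₀ h0.le h1.le)⟩ with hg
  have hsub : (f * x ^ (N + M) - powerSeriesToRobba p Δ g).coeff i =
      (f * x ^ (N + M)).coeff i - powerSeriesCoeffs g i := by
    rw [sub_eq_add_neg, sub_eq_add_neg]; rfl
  rw [hsub]
  by_cases hi : 0 ≤ i
  · obtain ⟨k, rfl⟩ := exists_natExponent hi
    rw [powerSeriesCoeffs_natExponent]
    have : ((MvPowerSeries.coeff k g : ℤ_[p]) : ℚ_[p]) =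
        (f * x ^ (N + M)).coeff (natExponent k) := rfl
    rw [this, sub_self, norm_zero]
    exact pow_nonneg (inv_nonneg.2 (p_pos p).le) n
  · rw [powerSeriesCoeffs_of_not_nonneg g hi, sub_zero]
    refine (hshift i).trans (le_trans (pow_le_pow_of_le_one h0.le h1.le ?_) hM.le)
    rw [Pi.le_def] at hi
    push Not at hi
    obtain ⟨β, hβ⟩ := hi
    refine le_trans ?_ (Finset.single_le_sum (fun α _ => Nat.zero_le _) (Finset.mem_univ β))
    simp only [Pi.zero_apply] at hβ
    push_cast
    omega

/-- The completion of `ℤ_p[[X]][1/∏ X_α]` agrees with that of the ring of all series with integral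
decay: both rings have the same quotients modulo `p^n`. -/
lemma exists_equiv_adicCompletion (hκ : Function.Injective κ)
    (hdecay : ∀ z, HasIntegralDecay (κ z).coeff)
    (hrange : ∀ f : Robba p Δ, HasIntegralDecay f.coeff → ∃ z, κ z = f)
    (hx : (κ x).IsProdX) (hu : IsUnit x) :
    ∃ Ψ : OE p Δ ≃+* AdicCompletion (Ideal.span {(p : D)}) D, ∀ g : MvPowerSeries Δ ℤ_[p],
      ∃ a : D, κ a = powerSeriesToRobba p Δ g ∧
        Ψ (algebraMap (LaurentInt p Δ) (OE p Δ) (algebraMap _ (LaurentInt p Δ) g)) =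
          algebraMap D _ a := by
  obtain ⟨θ₀, hθ₀⟩ := exists_ringHom_lift hκ (powerSeriesToRobba p Δ) fun g =>
    hrange _ (hasIntegralDecay_powerSeriesToRobba g)
  set X : MvPowerSeries Δ ℤ_[p] := ∏ α, MvPowerSeries.X α with hX
  have hθX : θ₀ X = x := hκ ((hθ₀ X).trans (isProdX_powerSeriesToRobba.eq hx))
  have huX : IsUnit (θ₀ X) := hθX ▸ hu
  let θ : LaurentInt p Δ →+* D := IsLocalization.Away.lift X huX
  have hθ : ∀ g, θ (algebraMap _ _ g) = θ₀ g := IsLocalization.Away.lift_eq X huX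
  have hθp : θ (p : LaurentInt p Δ) = (p : D) := map_natCast θ p
  have huL : IsUnit (algebraMap _ (LaurentInt p Δ) X) :=
    IsLocalization.Away.algebraMap_isUnit (S := LaurentInt p Δ) X
  obtain ⟨Ψ, hΨ⟩ := exists_adicCompletion_equiv_of_bijective_mod θ hθp
    (fun n y => by
      obtain ⟨N, g, h⟩ := exists_powerSeries_sub_coeff_le hx (hdecay y) n
      have h' : ∀ i, ‖(κ (y * x ^ N - θ₀ g)).coeff i‖ ≤ ((p : ℝ)⁻¹) ^ n := by
        rw [map_sub, map_mul, map_pow, hθ₀]; exact h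
      obtain ⟨c, hc⟩ := exists_eq_natCast_pow_mul_of_range hκ hdecay hrange h'
      obtain ⟨v, hv⟩ := huL.pow N
      have hv' : θ (v : LaurentInt p Δ) = x ^ N := by rw [hv, map_pow, hθ, hθX]
      have hvi : θ ((v⁻¹ : (LaurentInt p Δ)ˣ) : LaurentInt p Δ) * x ^ N = 1 := by
        rw [← hv', ← map_mul, Units.inv_mul, map_one]
      refine ⟨algebraMap _ _ g * (v⁻¹ : (LaurentInt p Δ)ˣ),
        c * θ ((v⁻¹ : (LaurentInt p Δ)ˣ) : LaurentInt p Δ), ?_⟩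
      rw [map_mul, hθ]
      linear_combination θ ((v⁻¹ : (LaurentInt p Δ)ˣ) : LaurentInt p Δ) * hc - y * hvi)
    (fun n a c h => by
      obtain ⟨N, g, hg⟩ := IsLocalization.Away.surj X a
      have h1 : θ₀ g = (p : D) ^ n * (c * x ^ N) := by
        rw [← hθ, ← hg, map_mul, map_pow, hθ, hθX, h, mul_assoc]
      have h2 : ∀ i, ‖powerSeriesCoeffs g i‖ ≤ ((p : ℝ)⁻¹) ^ n := fun i => by
        rw [← coeff_powerSeriesToRobba, ← hθ₀, h1, map_mul, map_pow, map_natCast]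
        exact norm_coeff_natCast_pow_mul_le (hdecay _) i
      obtain ⟨g', rfl⟩ := exists_eq_natCast_pow_mul_powerSeries h2
      obtain ⟨v, hv⟩ := huL.pow N
      refine ⟨algebraMap _ _ g' * (v⁻¹ : (LaurentInt p Δ)ˣ), ?_⟩
      rw [← hv, ← Units.eq_mul_inv_iff_mul_eq] at hg
      rw [hg, map_mul, map_pow, map_natCast, mul_assoc])
  exact ⟨Ψ, fun g => ⟨θ₀ g, hθ₀ g, by rw [hΨ, hθ]⟩⟩

/-- The isomorphism of the `p`-adic completions. -/
lemma RootSystem.exists_isCompatible (ζ : RootSystem p) : ∃ Ψ : OE p Δ ≃+* ζ.ADelta Δ,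
    ζ.IsCompatible (ζ.evalEquiv Δ).toRingHom (ζ.inclDelta Δ) Ψ.toRingHom :=
  (exists_equiv_adicCompletion ζ.dagToRobba_injective ζ.hasIntegralDecay_dagToRobba
    (fun _ hf => ζ.exists_dagToRobba_eq_of_hasIntegralDecay hf) ζ.isProdX_dagToRobba_varpiDelta
    ζ.isUnit_varpiDelta).imp fun _ h g => (h g).elim fun a ha =>
      ⟨powerSeriesToRobba p Δ g, a, rfl, (ζ.evalEquiv_toRobba _).symm.trans
        (congrArg (ζ.evalEquiv Δ) ha.1), ha.2⟩

end CompletionComparison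

end MultiRobba

theorem mainTheorem10 (p : ℕ) [Fact p.Prime] (ζ : MultiRobba.RootSystem p)
    (Δ : Type*) [Fintype Δ] :
    ∃ (Φ : MultiRobba.Robba p Δ ≃+* ζ.BrigDelta Δ) (ι : ζ.AdagDelta Δ →+* ζ.BrigDelta Δ)
      (Ψ : MultiRobba.OE p Δ ≃+* ζ.ADelta Δ),
      ζ.IsEvaluation Φ.toRingHom ∧
      ζ.IsTensorInclusion ι ∧
      Function.Injective ι ∧
      Φ '' MultiRobba.Robba.integralBounded p Δ = Set.range ι ∧
      ζ.IsCompatible Φ.toRingHom ι Ψ.toRingHom :=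
  ζ.exists_isCompatible.elim fun Ψ hΨ => ⟨ζ.evalEquiv Δ, ζ.inclDelta Δ, Ψ,
    ζ.isEvaluation_evalEquiv, ζ.isTensorInclusion_inclDelta, ζ.inclDelta_injective,
    ζ.evalEquiv_image_integralBounded, hΨ⟩
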